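/- **Setting.** Let $d\ge 2$, $k\ge 0$, and let $\Omega\subset\mathbb R^d$ be a polygonal/polyhedral domain lying locally on one side of its boundary faces ($\Omega=\operatorname{int}\overline\Omega$), divided into disjoint open parts $\Omega_+,\Omega_-$ with $\overline\Omega=\overline{\Omega}_+\cup\overline{\Omega}_-$, with interface $\Gamma_I=\overline{\Omega}_+\cap\overline{\Omega}_-$. Let $\Gamma_D\neq\emptyset$ and $\Gamma_N$ be disjoint subsets of $\partial\Omega$ with $\partial\Omega=\overline{\Gamma_D}\cup\overline{\Gamma_N}$. Let $\sigma=\sigma_+>0$ on $\Omega_+$ and $\sigma=\sigma_-<0$ on $\Omega_-$ be constants with $0<\sigma_{\min}\le\sigma_+,-\sigma_-\le\sigma_{\max}$. Let $\mathcal T_h$ be a conforming simplicial triangulation of $\Omega$, shape-regular with constant $\rho$ (each $K$ contains a ball of radius $h_K/\rho$, $h_K=\operatorname{diam}K$), $h=\max_K h_K$, with set of faces $\mathcal F_h$. Each element lies in $\Omega_+$ or in $\Omega_-$, $\Gamma_I$ and $\overline{\Gamma_D}$ are unions of faces, and no $K$ has $\partial K\subset\Gamma_I$. Let $\mathcal F_h^D$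 be the set of faces in $\overline{\Gamma_D}$; the remaining faces on $\partial\Omega$ are the Neumann faces. Let $\tau$ be constant on each face, with $\tau=0$ on faces in $\Gamma_I$ and, on faces not in $\Gamma_I$, $\tau>0$ on those of elements in $\Omega_+$ and $\tau<0$ on those of elements in $\Omega_-$; let $|\tau|\le\gamma$. Let $V_h$, $W_h$ be the spaces of vector-valued and scalar functions that are polynomials of degree $\le k$ on each element, and $M_h$ the space of functions on the faces that are polynomials of degree $\le k$ on each face and vanish on $\mathcal F_h^D$. Write $(\cdot,\cdot)_\Omega=\sum_K\int_K$ (gradients of discrete functions are elementwise), $\langle\cdot,\cdot\rangle_{\partial\mathcal T_h}=\sum_K\int_{\partial K}$, $\|\cdot\|_\Omega$ for the $L^2$ norm, $n$ for the outward unit normal of the element, and $\|r\|_{V_h}^2=(\sigma^{-1}r,r)_{\Omega_+}-(\sigma^{-1}r,r)_{\Omega_-}$. For $(r,v)\in H^1(K;\mathbb R^d)\times H^1(K)$, the HDG projection $(\Pi_V r,\Pi_W v)\in\mathcal P_k(K;\mathbb R^d)\times\mathcal P_k(K)$ of the pair is defined by $(\Pi_V r,s)_K=(r,s)_K$ for all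 $s\in\mathcal P_{k-1}(K;\mathbb R^d)$, $(\Pi_W v,s)_K=(v,s)_K$ for all $s\in\mathcal P_{k-1}(K)$, and $\langle\Pi_V r\cdot n+\tau\Pi_W v,\lambda\rangle_F=\langle r\cdot n+\tau v,\lambda\rangle_F$ for all faces $F\subset\partial K$ and $\lambda\in\mathcal P_k(F)$. (So $\Pi_V q,\Pi_W u$ come from the pair $(q,u)$ and $\Pi_V\Phi$ from the pair $(\Phi,\phi)$ below.) Let $f\in L^2(\Omega)$. Let $(q,u)\in H^1(\Omega;\mathbb R^d)\times H^1(\Omega)$ (in particular, any pair in $H^s$, $s\ge1$), with $\bar u$ equal to the trace of $u$ on $\mathcal F_h\setminus\mathcal F_h^D$ and to $0$ on $\mathcal F_h^D$, satisfy for all $(r,v,\bar v)\in V_h\times W_h\times M_h$ $$(\sigma^{-1}q,r)_\Omega+(\nabla u,r)_\Omega-\langle u-\bar u,r\cdot n\rangle_{\partial\mathcal T_h}=0,$$ $$(q,\nabla v)_\Omega-\langle q\cdot n+\tau(u-\bar u),v\rangle_{\partial\mathcal T_h}=(f,v)_\Omega,\qquad \langle q\cdot n+\tau(u-\bar u),\bar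 v\rangle_{\partial\mathcal T_h\setminus\mathcal F_h^D}=0,$$ and let $(q_h,u_h,\bar u_h)\in V_h\times W_h\times M_h$ be a solution of the HDG method, that is, of the same equations with $(q_h,u_h,\bar u_h)$ in place of $(q,u,\bar u)$ (and all of $\partial\mathcal T_h$ in the last one). For $\theta\in L^2(\Omega)$ consider the dual problem $$\sigma^{-1}\Phi+\nabla\phi=0,\quad \nabla\cdot\Phi=\theta\ \text{ in }\Omega,\qquad \phi=0\ \text{ on }\Gamma_D,\qquad \Phi\cdot n=0\ \text{ on }\Gamma_N$$ (when $\overline{\Gamma_D}=\partial\Omega$ this is $\phi=0$ on $\partial\Omega$), with $\phi\in H^1(\Omega)$, and the regularity estimate $$\|\Phi\|_{1,\Omega_+}+\|\Phi\|_{1,\Omega_-}+\|\phi\|_{2,\Omega_+}+\|\phi\|_{2,\Omega_-}\le C_{\rm reg}\|\theta\|_\Omega.\tag{R}$$ **Theorem.** There is a constant $C>0$, depending only on $d,k,\sigma_{\min},\sigma_{\max},\gamma,\rho$ (in particular not on $h$), such that in the above setting: (a) For every $\theta\in L^2(\Omega)$ and every solution $(\Phi,\phi)$ of the dual problem that satisfies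 (R), $$(\Pi_W u-u_h,\theta)_\Omega=(\sigma^{-1}(q-q_h),\Pi_V\Phi-\Phi)_\Omega+(\Pi_V q-q,\nabla(\phi-\phi_h))_\Omega\qquad\text{for all }\phi_h\in W_h.$$ (b) If $k\ge1$ and for every $\theta\in L^2(\Omega)$ the dual problem has a solution satisfying (R), then $$\|\Pi_W u-u_h\|_\Omega\le C\,C_{\rm reg}\,h\,\bigl(\|q-q_h\|_{V_h}+\|q-\Pi_V q\|_\Omega\bigr).$$ -/

import Mathlib

open MeasureTheory Filter Topology
open scoped ContDiff

noncomputable section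

namespace SignHDG

/-- Euclidean space `ℝ^d`. -/
abbrev E (d : ℕ) := EuclideanSpace ℝ (Fin d)

/-- Real polynomials in the `d` coordinates. -/
abbrev Poly (d : ℕ) := MvPolynomial (Fin d) ℝ

variable {d : ℕ}

/-! ### Polynomials as functions -/

/-- The value of a polynomial at a point. -/
def pval (p : Poly d) (x : E d) : ℝ := MvPolynomial.eval (fun i => x i) p

/-- The value of a vector-valued polynomial at a point. -/
def vval (r : Fin d → Poly d) (x : E d) : E d := WithLp.toLp 2 fun i => pval (r i) x

/-- The gradient of a polynomial. -/
def pgrad (p : Poly d) (x : E d) : E d := vval (fun i => MvPolynomial.pderiv i p) x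

/-! ### Sobolev spaces through weak derivatives -/

/-- Test functions on `U`: smooth with compact support in `U`. -/
def IsTest (U : Set (E d)) (ψ : E d → ℝ) : Prop :=
  ContDiff ℝ ∞ ψ ∧ HasCompactSupport ψ ∧ tsupport ψ ⊆ U

/-- The `i`-th partial derivative of a smooth function. -/
def pd (i : Fin d) (ψ : E d → ℝ) (x : E d) : ℝ := fderiv ℝ ψ x (EuclideanSpace.single i 1)

/-- `g` is the weak gradient of `v` on the open set `U`. -/
def HasWeakGrad (U : Set (E d)) (v : E d → ℝ) (g : E d → E d) : Prop :=
  ∀ ψ, IsTest U ψ → ∀ i, ∫ x in U, v x * pd i ψ x = -∫ x in U, g x i * ψ x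

/-- `θ` is the weak divergence of `w` on the open set `U`. -/
def HasWeakDiv (U : Set (E d)) (w : E d → E d) (θ : E d → ℝ) : Prop :=
  ∀ ψ, IsTest U ψ → ∫ x in U, ∑ i, w x i * pd i ψ x = -∫ x in U, θ x * ψ x

/-- `v ∈ H¹(U)`. -/
def MemH1 (U : Set (E d)) (v : E d → ℝ) : Prop :=
  MemLp v 2 (volume.restrict U) ∧
    ∃ g : E d → E d, MemLp g 2 (volume.restrict U) ∧ HasWeakGrad U v g

open Classical in
/-- The weak gradient of `v ∈ H¹(U)` (unique almost everywhere in the open set `U`). -/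
def weakGrad (U : Set (E d)) (v : E d → ℝ) : E d → E d :=
  if h : MemH1 U v then h.2.choose else 0

/-- `v ∈ H²(U)`: `v` and its first weak derivatives are in `H¹(U)`. -/
def MemH2 (U : Set (E d)) (v : E d → ℝ) : Prop :=
  MemH1 U v ∧ ∀ i, MemH1 U (fun x => weakGrad U v x i)

/-- `w ∈ H¹(U; ℝ^d)`. -/
def MemH1Vec (U : Set (E d)) (w : E d → E d) : Prop := ∀ i, MemH1 U (fun x => w x i)

/-- The norm `‖θ‖_U` of `L²(U)`. -/
def normL2 (U : Set (E d)) (θ : E d → ℝ) : ℝ := Real.sqrt (∫ x in U, θ x ^ 2)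

/-- The square of the norm `‖v‖_{1,U}` of `H¹(U)`. -/
def normH1Sq (U : Set (E d)) (v : E d → ℝ) : ℝ :=
  (∫ x in U, v x ^ 2) + ∫ x in U, ‖weakGrad U v x‖ ^ 2

/-- The norm `‖w‖_{1,U}` of `H¹(U; ℝ^d)`. -/
def normH1Vec (U : Set (E d)) (w : E d → E d) : ℝ :=
  Real.sqrt (∑ i, normH1Sq U (fun x => w x i))

/-- The norm `‖v‖_{2,U}` of `H²(U)`. -/
def normH2 (U : Set (E d)) (v : E d → ℝ) : ℝ :=
  Real.sqrt ((∫ x in U, v x ^ 2) + ∑ i, normH1Sq U (fun x => weakGrad U v x i))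

/-! ### Simplices, their faces, and traces

A simplex is given by the finite set of its vertices. -/

/-- The closed simplex with vertex set `K`. -/
def simplex (K : Finset (E d)) : Set (E d) := convexHull ℝ (K : Set (E d))

/-- The faces of codimension one of a `d`-simplex. -/
def facesOf (K : Finset (E d)) : Finset (Finset (E d)) := K.powersetCard d

/-- Lebesgue measure on a `d`-simplex. -/
def cellMeasure (K : Finset (E d)) : Measure (E d) := volume.restrict (simplex K)

/-- Surface measure on a face of codimension one. -/
def faceMeasure (F : Finset (E d)) : Measure (E d) :=
  (Measure.euclideanHausdorffMeasure (d - 1)).restrict (simplex F)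

/-- The barycentre of a simplex. -/
def barycentre (K : Finset (E d)) : E d := (K.card : ℝ)⁻¹ • ∑ x ∈ K, x

/-- The outward unit normal of the `d`-simplex `K` on its face `F`: the component orthogonal to `F`
of the vector from the barycentre of `K` to the barycentre of `F`, normalized. -/
def normal (K F : Finset (E d)) : E d :=
  let w := ((vectorSpan ℝ (F : Set (E d)))ᗮ).starProjection (barycentre F - barycentre K)
  ‖w‖⁻¹ • w

/-- `g` is the trace of `v ∈ H¹(K)` on the boundary of the simplex `K`: there are functions, smooth
up to the boundary, that converge to `v` in `H¹(K)` and whose boundary values converge to `g` in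
`L²(∂K)`. -/
def HasTrace (K : Finset (E d)) (v g : E d → ℝ) : Prop :=
  (∀ F ∈ facesOf K, MemLp g 2 (faceMeasure F)) ∧
  ∃ (G : E d → E d) (ψ : ℕ → E d → ℝ), (∀ n, ContDiff ℝ ∞ (ψ n)) ∧
    MemLp v 2 (cellMeasure K) ∧ MemLp G 2 (cellMeasure K) ∧
    Tendsto (fun n => eLpNorm (fun x => ψ n x - v x) 2 (cellMeasure K)) atTop (𝓝 0) ∧
    Tendsto (fun n => eLpNorm (fun x => gradient (ψ n) x - G x) 2 (cellMeasure K)) atTop (𝓝 0) ∧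
    ∀ F ∈ facesOf K,
      Tendsto (fun n => eLpNorm (fun x => ψ n x - g x) 2 (faceMeasure F)) atTop (𝓝 0)

open Classical in
/-- The trace on `∂K` of a function in `H¹(K)` (unique almost everywhere on each face). -/
def trace (K : Finset (E d)) (v : E d → ℝ) : E d → ℝ :=
  if h : ∃ g, HasTrace K v g then h.choose else 0

/-- The normal trace `w · n_K` on the face `F` of `K` of a field `w ∈ H¹(K; ℝ^d)`. -/
def normalTrace (K F : Finset (E d)) (w : E d → E d) (x : E d) : ℝ :=
  ∑ i, trace K (fun y => w y i) x * normal K F i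

/-- The normal component `r · n_K` on the face `F` of `K` of a polynomial field `r`. -/
def normalVal (K F : Finset (E d)) (r : Fin d → Poly d) (x : E d) : ℝ :=
  inner ℝ (vval r x) (normal K F)

/-! ### The geometry and the triangulation -/

/-- A bounded open set `Ω` (boundedness follows from the triangulation below) that is split into two
open parts `Ωp` and `Ωm`, with the Dirichlet part `ΓD` and the Neumann part `ΓN` of its boundary.
No part of `∂Ω` has `Ω` on both sides (`interior_closure`). -/
structure Config (d : ℕ) where
  Ω : Set (E d)
  Ωp : Set (E d)
  Ωm : Set (E d)
  ΓD : Set (E d)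
  ΓN : Set (E d)
  isOpen_Ω : IsOpen Ω
  nonempty_Ω : Ω.Nonempty
  interior_closure : interior (closure Ω) = Ω
  isOpen_Ωp : IsOpen Ωp
  isOpen_Ωm : IsOpen Ωm
  disjoint_Ω : Ωp ∩ Ωm = ∅
  closure_Ω : closure Ω = closure Ωp ∪ closure Ωm
  ΓD_subset : ΓD ⊆ frontier Ω
  ΓN_subset : ΓN ⊆ frontier Ω
  disjoint_Γ : Disjoint ΓD ΓN
  frontier_Ω : frontier Ω = closure ΓD ∪ closure ΓN
  nonempty_ΓD : ΓD.Nonempty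

/-- The interface. -/
def Config.ΓI (G : Config d) : Set (E d) := closure G.Ωp ∩ closure G.Ωm

open Classical in
/-- The piecewise constant coefficient. -/
def Config.σ (G : Config d) (σp σm : ℝ) (x : E d) : ℝ := if x ∈ G.Ωp then σp else σm

/-- A conforming simplicial triangulation of `Ω`, adapted to the two subdomains, to the interface
and to the Dirichlet boundary; no element has its whole boundary on the interface. -/
structure Triangulation (G : Config d) where
  cx : Geometry.SimplicialComplex ℝ (E d)
  finite_faces : cx.faces.Finite
  space_eq : cx.space = closure G.Ω
  side : ∀ K ∈ cx.faces, K.card = d + 1 →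
    interior (simplex K) ⊆ G.Ωp ∨ interior (simplex K) ⊆ G.Ωm
  interface : G.ΓI = ⋃ F ∈ {F ∈ cx.faces | F.card = d ∧ simplex F ⊆ G.ΓI}, simplex F
  dirichlet : closure G.ΓD = ⋃ F ∈ {F ∈ cx.faces | F.card = d ∧ simplex F ⊆ closure G.ΓD}, simplex F
  not_enclosed : ∀ K ∈ cx.faces, K.card = d + 1 → ∃ F ∈ facesOf K, ¬ simplex F ⊆ G.ΓI

namespace Triangulation

variable {G : Config d} (T : Triangulation G)

/-- The elements of the triangulation. -/
def cells : Finset (Finset (E d)) := {K ∈ T.finite_faces.toFinset | K.card = d + 1}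

/-- The faces of codimension one of the triangulation. -/
def faces : Finset (Finset (E d)) := {F ∈ T.finite_faces.toFinset | F.card = d}

open Classical in
/-- The elements in `Ωp`. -/
def cellsp : Finset (Finset (E d)) := {K ∈ T.cells | interior (simplex K) ⊆ G.Ωp}

open Classical in
/-- The elements in `Ωm`. -/
def cellsm : Finset (Finset (E d)) := {K ∈ T.cells | interior (simplex K) ⊆ G.Ωm}

open Classical in
/-- The Dirichlet faces. -/
def facesD : Finset (Finset (E d)) := {F ∈ T.faces | simplex F ⊆ closure G.ΓD}

open Classical in
/-- The Neumann faces: the faces on `∂Ω` that are not Dirichlet faces. -/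
def facesN : Finset (Finset (E d)) :=
  {F ∈ T.faces | simplex F ⊆ frontier G.Ω ∧ ¬ simplex F ⊆ closure G.ΓD}

/-- The mesh size: the maximum of the diameters of the elements. -/
def h : ℝ := ⨆ K : {K // K ∈ T.cells}, Metric.diam (simplex K.1)

/-- Shape regularity with constant `ρ`: each element `K` contains a ball of radius `h_K / ρ`. -/
def ShapeRegular (ρ : ℝ) : Prop :=
  ∀ K ∈ T.cells, ∃ x, Metric.closedBall x (Metric.diam (simplex K) / ρ) ⊆ simplex K

/-- The sign condition on the stabilization parameter, which has one value on each face. -/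
def TauCondition (τ : Finset (E d) → ℝ) : Prop :=
  (∀ F ∈ T.faces, simplex F ⊆ G.ΓI → τ F = 0) ∧
  (∀ K ∈ T.cellsp, ∀ F ∈ facesOf K, ¬ simplex F ⊆ G.ΓI → 0 < τ F) ∧
  (∀ K ∈ T.cellsm, ∀ F ∈ facesOf K, ¬ simplex F ⊆ G.ΓI → τ F < 0)

/-! ### Discrete spaces -/

/-- `V_h`: vector-valued piecewise polynomials of degree at most `k`. -/
def MemV (k : ℕ) (r : Finset (E d) → Fin d → Poly d) : Prop :=
  ∀ K ∈ T.cells, ∀ i, (r K i).totalDegree ≤ k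

/-- `W_h`: piecewise polynomials of degree at most `k`. -/
def MemW (k : ℕ) (v : Finset (E d) → Poly d) : Prop :=
  ∀ K ∈ T.cells, (v K).totalDegree ≤ k

/-- `M_h`: facewise polynomials of degree at most `k` that vanish on the Dirichlet faces. -/
def MemM (k : ℕ) (m : Finset (E d) → Poly d) : Prop :=
  (∀ F ∈ T.faces, (m F).totalDegree ≤ k) ∧ ∀ F ∈ T.facesD, ∀ x ∈ simplex F, pval (m F) x = 0

/-! ### Elementwise integrals and norms -/

/-- `∑_K ∫_K g_K`. -/
def sumCells (g : Finset (E d) → E d → ℝ) : ℝ := ∑ K ∈ T.cells, ∫ x, g K x ∂cellMeasure K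

/-- `∑_K ∑_{F ⊂ ∂K} ∫_F g_{K,F}`. -/
def sumBdry (g : Finset (E d) → Finset (E d) → E d → ℝ) : ℝ :=
  ∑ K ∈ T.cells, ∑ F ∈ facesOf K, ∫ x, g K F x ∂faceMeasure F

/-- The same sum without the Dirichlet faces. -/
def sumBdryNotD (g : Finset (E d) → Finset (E d) → E d → ℝ) : ℝ :=
  ∑ K ∈ T.cells, ∑ F ∈ facesOf K \ T.facesD, ∫ x, g K F x ∂faceMeasure F

/-- The `L²` norm of a scalar function given on each element. -/
def normCells (v : Finset (E d) → E d → ℝ) : ℝ := Real.sqrt (T.sumCells fun K x => v K x ^ 2)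

/-- The `L²` norm of a vector function given on each element. -/
def normCellsVec (r : Finset (E d) → E d → E d) : ℝ :=
  Real.sqrt (T.sumCells fun K x => ‖r K x‖ ^ 2)

/-- The norm `‖r‖_{V_h}`, whose square is `(σ⁻¹ r, r)` on `Ωp` minus `(σ⁻¹ r, r)` on `Ωm`. -/
def normV (σp σm : ℝ) (r : Finset (E d) → E d → E d) : ℝ :=
  Real.sqrt ((∑ K ∈ T.cellsp, ∫ x, (G.σ σp σm x)⁻¹ * inner ℝ (r K x) (r K x) ∂cellMeasure K)
    - ∑ K ∈ T.cellsm, ∫ x, (G.σ σp σm x)⁻¹ * inner ℝ (r K x) (r K x) ∂cellMeasure K)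

/-! ### The exact problem and the HDG method (with `u_D = 0`, `u_N = 0`) -/

/-- `(q, u)`, with `ubar` the restriction of `u` to the faces (and `0` on the Dirichlet faces),
solves the variational equations satisfied by the exact solution, tested with
`V_h × W_h × M_h`. -/
structure IsExactSolution (k : ℕ) (σp σm : ℝ) (τ : Finset (E d) → ℝ) (f : E d → ℝ)
    (q : E d → E d) (u : E d → ℝ) (ubar : Finset (E d) → E d → ℝ) : Prop where
  memH1_q : MemH1Vec G.Ω q
  memH1_u : MemH1 G.Ω u
  ubar_eq : ∀ K ∈ T.cells, ∀ F ∈ facesOf K, F ∉ T.facesD → ubar F =ᵐ[faceMeasure F] trace K u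
  ubar_D : ∀ F ∈ T.facesD, ubar F =ᵐ[faceMeasure F] 0
  eq1 : ∀ r, T.MemV k r →
    T.sumCells (fun K x => (G.σ σp σm x)⁻¹ * inner ℝ (q x) (vval (r K) x))
      + T.sumCells (fun K x => inner ℝ (weakGrad G.Ω u x) (vval (r K) x))
      - T.sumBdry (fun K F x => (trace K u x - ubar F x) * normalVal K F (r K) x) = 0
  eq2 : ∀ v, T.MemW k v →
    T.sumCells (fun K x => inner ℝ (q x) (pgrad (v K) x))
      - T.sumBdry (fun K F x =>
          (normalTrace K F q x + τ F * (trace K u x - ubar F x)) * pval (v K) x)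
      = T.sumCells (fun K x => f x * pval (v K) x)
  eq3 : ∀ vbar, T.MemM k vbar →
    T.sumBdryNotD (fun K F x =>
      (normalTrace K F q x + τ F * (trace K u x - ubar F x)) * pval (vbar F) x) = 0

/-- `(qh, uh, ubarh) ∈ V_h × W_h × M_h` solves the HDG equations. -/
structure IsHDGSolution (k : ℕ) (σp σm : ℝ) (τ : Finset (E d) → ℝ) (f : E d → ℝ)
    (qh : Finset (E d) → Fin d → Poly d) (uh ubarh : Finset (E d) → Poly d) : Prop where
  mem_qh : T.MemV k qh
  mem_uh : T.MemW k uh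
  mem_ubarh : T.MemM k ubarh
  eq1 : ∀ r, T.MemV k r →
    T.sumCells (fun K x => (G.σ σp σm x)⁻¹ * inner ℝ (vval (qh K) x) (vval (r K) x))
      + T.sumCells (fun K x => inner ℝ (pgrad (uh K) x) (vval (r K) x))
      - T.sumBdry (fun K F x =>
          (pval (uh K) x - pval (ubarh F) x) * normalVal K F (r K) x) = 0
  eq2 : ∀ v, T.MemW k v →
    T.sumCells (fun K x => inner ℝ (vval (qh K) x) (pgrad (v K) x))
      - T.sumBdry (fun K F x =>
          (normalVal K F (qh K) x + τ F * (pval (uh K) x - pval (ubarh F) x)) * pval (v K) x)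
      = T.sumCells (fun K x => f x * pval (v K) x)
  eq3 : ∀ vbar, T.MemM k vbar →
    T.sumBdry (fun K F x =>
      (normalVal K F (qh K) x + τ F * (pval (uh K) x - pval (ubarh F) x))
        * pval (vbar F) x) = 0

/-! ### The dual problem -/

/-- `(Φ, φ)` solves the dual problem with right-hand side `θ`: `σ⁻¹ Φ + ∇φ = 0` and `∇ · Φ = θ` in
`Ω`, `φ = 0` on the Dirichlet boundary, `Φ · n = 0` on the Neumann boundary; `Φ` is in `H¹` of each
subdomain, so that it has a normal trace. -/
structure IsDualSolution (σp σm : ℝ) (θ : E d → ℝ) (Φ : E d → E d) (φ : E d → ℝ) : Prop where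
  memL2_Φ : MemLp Φ 2 (volume.restrict G.Ω)
  memH1_φ : MemH1 G.Ω φ
  memH1_Φp : MemH1Vec G.Ωp Φ
  memH1_Φm : MemH1Vec G.Ωm Φ
  flux : ∀ᵐ x ∂(volume.restrict G.Ω), (G.σ σp σm x)⁻¹ • Φ x + weakGrad G.Ω φ x = 0
  div : HasWeakDiv G.Ω Φ θ
  dirichlet : ∀ K ∈ T.cells, ∀ F ∈ facesOf K, F ∈ T.facesD → trace K φ =ᵐ[faceMeasure F] 0
  neumann : ∀ K ∈ T.cells, ∀ F ∈ facesOf K, F ∈ T.facesN →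
    normalTrace K F Φ =ᵐ[faceMeasure F] 0

end Triangulation

/-- The piecewise `H¹ × H²` regularity estimate with constant `Creg`. -/
def HasRegularity (G : Config d) (Creg : ℝ) (θ : E d → ℝ) (Φ : E d → E d) (φ : E d → ℝ) : Prop :=
  MemH1Vec G.Ωp Φ ∧ MemH1Vec G.Ωm Φ ∧ MemH2 G.Ωp φ ∧ MemH2 G.Ωm φ ∧
    normH1Vec G.Ωp Φ + normH1Vec G.Ωm Φ + normH2 G.Ωp φ + normH2 G.Ωm φ ≤ Creg * normL2 G.Ω θ

/-! ### The HDG projection -/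

/-- `(P, p)` is the HDG projection of `(r, v) ∈ H¹(K; ℝ^d) × H¹(K)`. -/
structure IsProjection (k : ℕ) (τ : Finset (E d) → ℝ) (K : Finset (E d))
    (r : E d → E d) (v : E d → ℝ) (P : Fin d → Poly d) (p : Poly d) : Prop where
  degree_P : ∀ i, (P i).totalDegree ≤ k
  degree_p : p.totalDegree ≤ k
  moment_P : ∀ s : Fin d → Poly d, (∀ i, (s i).totalDegree < k) →
    ∫ x, inner ℝ (vval P x) (vval s x) ∂cellMeasure K
      = ∫ x, inner ℝ (r x) (vval s x) ∂cellMeasure K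
  moment_p : ∀ s : Poly d, s.totalDegree < k →
    ∫ x, pval p x * pval s x ∂cellMeasure K = ∫ x, v x * pval s x ∂cellMeasure K
  face : ∀ F ∈ facesOf K, ∀ l : Poly d, l.totalDegree ≤ k →
    ∫ x, (normalVal K F P x + τ F * pval p x) * pval l x ∂faceMeasure F
      = ∫ x, (normalTrace K F r x + τ F * trace K v x) * pval l x ∂faceMeasure F

open Classical in
/-- The HDG projection `(Π_V (r, v), Π_W (r, v))`, element by element. -/
def proj (k : ℕ) (τ : Finset (E d) → ℝ) (r : E d → E d) (v : E d → ℝ) (K : Finset (E d)) :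
    (Fin d → Poly d) × Poly d :=
  if h : ∃ P : (Fin d → Poly d) × Poly d, IsProjection k τ K r v P.1 P.2 then h.choose else 0

/-- `Π_V`, the vector component of the HDG projection of the pair `(r, v)`. -/
def projV (k : ℕ) (τ : Finset (E d) → ℝ) (r : E d → E d) (v : E d → ℝ) (K : Finset (E d)) :
    Fin d → Poly d := (proj k τ r v K).1

/-- `Π_W`, the scalar component of the HDG projection of the pair `(r, v)`. -/
def projW (k : ℕ) (τ : Finset (E d) → ℝ) (r : E d → E d) (v : E d → ℝ) (K : Finset (E d)) :
    Poly d := (proj k τ r v K).2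

end SignHDG

end

/-! Write e = Π_V q − q_h and ε = Π_W u − u_h in the elements and ê = ū − ū_h on the faces.

Part (a). The exact and the discrete equations are subtracted and integrated by parts on each
element. The moments of the HDG projection allow Π_W u in place of u against div r, which has degree
below k, and Π_V q in place of q against gradients of polynomials. Its face condition turns the
error of the numerical flux into e·n + τ(ε − ê), as far as polynomials of degree k can see it
(`flux_error`). The resulting error equations (`error_eq1`, `error_eq2`, `error_eq3`) are tested
with Π_V Φ, with Π_W φ and with the facewise L² projection of the trace of φ. A fourth relation says
that the normal component of Φ, which does not jump and vanishes on Neumann faces, is orthogonal to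
the facewise projection of ê (`sum_flux_eq_zero`). In the sum of the four all face terms cancel on
each element, and the right-hand side of (a) is what remains (`dual_identity_of_proj`). The function
φ_h is arbitrary because Π_V q − q is orthogonal to its gradient.

Part (b). Take θ = ε in (a) and apply the Cauchy-Schwarz inequality. It remains to bound Φ − Π_V Φ
and ∇(φ − φ_h) by h times the regularity norms. For the second, φ_h is affine on each element, with
the slopes given by the Poincaré inequality; no continuity between elements is required.

For the first, the HDG projection is compared with the L² projections. The differences δ and r lie
in the space `perp` of polynomials of degree k orthogonal to those of lower degree. There the norm
in the element is bounded by the norm on any one face (`exists_cell_le_face`): a member vanishing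
where the coordinate λ is 0 is λ q with q of lower degree, hence ∫ λ q² = 0. Moreover r·n is
orthogonal on ∂K to `perp` (`sum_normal_perp`). Testing the face equations with δ thus eliminates r
and leaves ∑ τ_F ‖δ‖_F². Since τ has one sign on ∂K and is nonzero on some face, this gives both
solvability (`exists_isProjection`) and stability (`exists_correction_le`). Only the largest |τ_F|
enters the estimate, together with τ δ rather than δ alone, so no lower bound on |τ| is needed and
the zeros on the interface do no harm.

The analysis on a simplex is uniform in its shape because everything is expressed by the gradients
of the barycentric coordinates, whose norms are the reciprocal heights, and by the diameter. Shape
regularity bounds their product. Averages over points pulled towards an interior ball show that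
smooth functions are dense in H¹; the divergence theorem then yields traces, integration by parts
and the trace inequality. -/

noncomputable section

namespace SignHDG

/-! ### The norm of `L²` -/

section L2

variable {α V : Type*} [MeasurableSpace α] {μ : Measure α} [NormedAddCommGroup V]

/-- The norm of `L²(μ)`. -/
def l2 (μ : Measure α) (f : α → V) : ℝ := Real.sqrt (∫ x, ‖f x‖ ^ 2 ∂μ)

lemma l2_nonneg (f : α → V) : 0 ≤ l2 μ f := Real.sqrt_nonneg _

lemma l2_sq (f : α → V) : l2 μ f ^ 2 = ∫ x, ‖f x‖ ^ 2 ∂μ :=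
  Real.sq_sqrt (integral_nonneg fun _ => by positivity)

lemma l2_sq_real (f : α → ℝ) : l2 μ f ^ 2 = ∫ x, f x ^ 2 ∂μ := by
  simp [l2_sq]

lemma l2_eq_eLpNorm {f : α → V} (hf : MemLp f 2 μ) : l2 μ f = (eLpNorm f 2 μ).toReal := by
  rw [hf.eLpNorm_eq_integral_rpow_norm (by norm_num) (by norm_num), ENNReal.toReal_ofReal
    (by positivity), l2, Real.sqrt_eq_rpow]
  norm_num

lemma l2_congr_ae {f g : α → V} (h : f =ᵐ[μ] g) : l2 μ f = l2 μ g := by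
  unfold l2
  congr 1
  exact integral_congr_ae (h.mono fun x hx => by simp only [hx])

lemma l2_add_le {f g : α → V} (hf : MemLp f 2 μ) (hg : MemLp g 2 μ) :
    l2 μ (fun x => f x + g x) ≤ l2 μ f + l2 μ g := by
  rw [show (fun x => f x + g x) = f + g from rfl, l2_eq_eLpNorm hf, l2_eq_eLpNorm hg,
    l2_eq_eLpNorm (hf.add hg), ← ENNReal.toReal_add hf.2.ne hg.2.ne]
  exact ENNReal.toReal_mono (ENNReal.add_ne_top.2 ⟨hf.2.ne, hg.2.ne⟩)
    (eLpNorm_add_le hf.1 hg.1 (by norm_num))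

lemma l2_neg (f : α → V) : l2 μ (fun x => -f x) = l2 μ f := by simp [l2]

lemma l2_sub_comm (f g : α → V) : l2 μ (fun x => f x - g x) = l2 μ (fun x => g x - f x) := by
  simp [l2, norm_sub_rev]

lemma l2_sub_le {f g : α → V} (hf : MemLp f 2 μ) (hg : MemLp g 2 μ) :
    l2 μ (fun x => f x - g x) ≤ l2 μ f + l2 μ g := by
  have := l2_add_le hf hg.neg
  simp only [Pi.neg_apply, ← sub_eq_add_neg] at this
  refine this.trans_eq ?_
  congr 1
  exact l2_neg g

lemma l2_const_mul (c : ℝ) (f : α → ℝ) : l2 μ (fun x => c * f x) = |c| * l2 μ f := by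
  unfold l2
  simp only [norm_mul, mul_pow, integral_const_mul]
  rw [Real.sqrt_mul (by positivity), Real.sqrt_sq (norm_nonneg _), Real.norm_eq_abs]

lemma integrable_norm_sq {f : α → V} (hf : MemLp f 2 μ) : Integrable (fun x => ‖f x‖ ^ 2) μ :=
  hf.integrable_norm_pow (by norm_num)

/-- Nothing is asked of `f`: if the square of its norm is not integrable, its integral is 0 by
convention. -/
lemma l2_mono {W : Type*} [NormedAddCommGroup W] {f : α → V} {g : α → W} (hg : MemLp g 2 μ)
    (h : ∀ᵐ x ∂μ, ‖f x‖ ≤ ‖g x‖) : l2 μ f ≤ l2 μ g := by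
  refine Real.sqrt_le_sqrt (integral_mono_of_nonneg ?_ (integrable_norm_sq hg) ?_)
  · exact Eventually.of_forall fun _ => by positivity
  · exact h.mono fun x hx => pow_le_pow_left₀ (norm_nonneg _) hx 2

lemma integrable_mul_of_memLp {f g : α → ℝ} (hf : MemLp f 2 μ) (hg : MemLp g 2 μ) :
    Integrable (fun x => f x * g x) μ := hf.integrable_mul hg

lemma abs_integral_mul_le {f g : α → ℝ} (hf : MemLp f 2 μ) (hg : MemLp g 2 μ) :
    |∫ x, f x * g x ∂μ| ≤ l2 μ f * l2 μ g := by
  have h := abs_real_inner_le_norm (hf.toLp f) (hg.toLp g)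
  rw [L2.inner_def, Lp.norm_toLp, Lp.norm_toLp, ← l2_eq_eLpNorm hf, ← l2_eq_eLpNorm hg] at h
  convert h using 2
  refine integral_congr_ae ?_
  filter_upwards [hf.coeFn_toLp, hg.coeFn_toLp] with x h1 h2
  simp [h1, h2, mul_comm]

lemma tendsto_l2_of_eLpNorm {ψ : ℕ → α → V} {v : α → V} (hψ : ∀ n, MemLp (ψ n) 2 μ)
    (hv : MemLp v 2 μ) (h : Tendsto (fun n => eLpNorm (fun x => ψ n x - v x) 2 μ) atTop (𝓝 0)) :
    Tendsto (fun n => l2 μ (fun x => ψ n x - v x)) atTop (𝓝 0) := by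
  have := (ENNReal.tendsto_toReal ENNReal.zero_ne_top).comp h
  simp only [ENNReal.toReal_zero] at this
  refine this.congr fun n => ?_
  exact (l2_eq_eLpNorm ((hψ n).sub hv)).symm

lemma tendsto_l2 {ψ : ℕ → α → V} {v : α → V} (hψ : ∀ n, MemLp (ψ n) 2 μ)
    (hv : MemLp v 2 μ) (h : Tendsto (fun n => eLpNorm (fun x => ψ n x - v x) 2 μ) atTop (𝓝 0)) :
    Tendsto (fun n => l2 μ (ψ n)) atTop (𝓝 (l2 μ v)) := by
  have h0 := tendsto_l2_of_eLpNorm hψ hv h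
  rw [tendsto_iff_dist_tendsto_zero]
  refine squeeze_zero (fun _ => dist_nonneg) (fun n => ?_) h0
  rw [Real.dist_eq, abs_sub_le_iff]
  constructor
  · have := l2_add_le ((hψ n).sub hv) hv
    simp only [Pi.sub_apply, sub_add_cancel] at this
    have h2 : l2 μ (ψ n - v) = l2 μ (fun x => ψ n x - v x) := rfl
    linarith
  · have := l2_add_le (hv.sub (hψ n)) (hψ n)
    simp only [Pi.sub_apply, sub_add_cancel] at this
    have h2 : l2 μ (v - ψ n) = l2 μ (fun x => v x - ψ n x) := rfl
    rw [l2_sub_comm] at h2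
    linarith

lemma tendsto_integral_mul {ψ : ℕ → α → ℝ} {v g : α → ℝ} (hψ : ∀ n, MemLp (ψ n) 2 μ)
    (hv : MemLp v 2 μ) (hg : MemLp g 2 μ)
    (h : Tendsto (fun n => eLpNorm (fun x => ψ n x - v x) 2 μ) atTop (𝓝 0)) :
    Tendsto (fun n => ∫ x, ψ n x * g x ∂μ) atTop (𝓝 (∫ x, v x * g x ∂μ)) := by
  have h0 := (tendsto_l2_of_eLpNorm hψ hv h).mul_const (l2 μ g)
  rw [zero_mul] at h0
  rw [tendsto_iff_dist_tendsto_zero]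
  refine squeeze_zero (fun _ => dist_nonneg) (fun n => ?_) h0
  rw [Real.dist_eq, ← integral_sub (integrable_mul_of_memLp (hψ n) hg)
    (integrable_mul_of_memLp hv hg)]
  simp only [← sub_mul]
  exact abs_integral_mul_le ((hψ n).sub hv) hg

lemma memLp_coord {m : ℕ} {f : α → E m} (hf : MemLp f 2 μ) (i : Fin m) :
    MemLp (fun x => f x i) 2 μ :=
  (EuclideanSpace.proj i : E m →L[ℝ] ℝ).comp_memLp' hf

lemma memLp_of_coord {m : ℕ} {f : α → E m} (hf : ∀ i, MemLp (fun x => f x i) 2 μ) :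
    MemLp f 2 μ := by
  have h : MemLp (fun x => ∑ i, f x i • EuclideanSpace.single i (1 : ℝ)) 2 μ :=
    memLp_finsetSum _ fun i _ =>
      (ContinuousLinearMap.toSpanSingleton ℝ (EuclideanSpace.single i (1 : ℝ))).comp_memLp' (hf i)
  convert h using 1
  funext x
  ext j
  simp [Finset.sum_apply, Pi.single_apply]

lemma l2_sq_eq_sum {m : ℕ} {f : α → E m} (hf : MemLp f 2 μ) :
    l2 μ f ^ 2 = ∑ i, l2 μ (fun x => f x i) ^ 2 := by
  simp only [l2_sq, EuclideanSpace.norm_sq_eq]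
  exact integral_finsetSum _ fun i _ => integrable_norm_sq (memLp_coord hf i)

variable [InnerProductSpace ℝ V]

lemma integrable_inner_of_memLp {f g : α → V} (hf : MemLp f 2 μ) (hg : MemLp g 2 μ) :
    Integrable (fun x => inner ℝ (f x) (g x)) μ := by
  refine (integrable_mul_of_memLp hf.norm hg.norm).mono (hf.1.inner hg.1) ?_
  refine Eventually.of_forall fun x => ?_
  rw [norm_mul, norm_norm, norm_norm]
  exact norm_inner_le_norm _ _

lemma abs_integral_inner_le {f g : α → V} (hf : MemLp f 2 μ) (hg : MemLp g 2 μ) :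
    |∫ x, inner ℝ (f x) (g x) ∂μ| ≤ l2 μ f * l2 μ g := by
  have h := abs_real_inner_le_norm (hf.toLp f) (hg.toLp g)
  rw [L2.inner_def, Lp.norm_toLp, Lp.norm_toLp, ← l2_eq_eLpNorm hf, ← l2_eq_eLpNorm hg] at h
  convert h using 2
  refine integral_congr_ae ?_
  filter_upwards [hf.coeFn_toLp, hg.coeFn_toLp] with x h1 h2
  simp [h1, h2]

end L2

/-! ### Finite-dimensional linear algebra -/

/-- A functional that vanishes on the radical of a symmetric form is represented by the form. -/
lemma exists_representer {V : Type*} [AddCommGroup V] [Module ℝ V] [FiniteDimensional ℝ V]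
    (B : V →ₗ[ℝ] V →ₗ[ℝ] ℝ) (hB : ∀ x y, B x y = B y x) (L : V →ₗ[ℝ] ℝ)
    (hL : ∀ x, B x x = 0 → L x = 0) : ∃ p, ∀ v, B p v = L v := by
  -- The range of the dual map is the annihilator of ker B, and x in ker B has B x x = 0. Symmetry
  -- and reflexivity then move the representing functional into the first slot of B.
  have h : L ∈ LinearMap.range (LinearMap.dualMap B) := by
    rw [LinearMap.range_dualMap_eq_dualAnnihilator_ker, Submodule.mem_dualAnnihilator]
    intro x hx
    exact hL x (by rw [LinearMap.mem_ker.1 hx]; rfl)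
  obtain ⟨ξ, hξ⟩ := h
  obtain ⟨p, rfl⟩ := (Module.evalEquiv ℝ V).surjective ξ
  refine ⟨p, fun v => ?_⟩
  rw [← hξ, hB]
  rfl

/-- Two linear maps from a finite-dimensional space are comparable if their kernels are. -/
lemma exists_norm_le_of_ker_le {V W W' : Type*} [AddCommGroup V] [Module ℝ V]
    [FiniteDimensional ℝ V] [NormedAddCommGroup W] [NormedSpace ℝ W] [NormedAddCommGroup W']
    [NormedSpace ℝ W'] (S : V →ₗ[ℝ] W) (T : V →ₗ[ℝ] W') (h : ∀ x, S x = 0 → T x = 0) :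
    ∃ C, 0 < C ∧ ∀ v, ‖T v‖ ≤ C * ‖S v‖ := by
  -- T factors through the range of S, and a linear map on this finite-dimensional space is bounded.
  let g : LinearMap.range S →ₗ[ℝ] W' :=
    (LinearMap.ker S).liftQ T (fun x hx => h x hx) ∘ₗ S.quotKerEquivRange.symm.toLinearMap
  have hg : ∀ v, g ⟨S v, v, rfl⟩ = T v := by
    intro v
    have : S.quotKerEquivRange.symm ⟨S v, v, rfl⟩ = (LinearMap.ker S).mkQ v := by
      rw [LinearEquiv.symm_apply_eq]
      rfl
    simp only [g, LinearMap.comp_apply, LinearEquiv.coe_coe, this]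
    exact (LinearMap.ker S).liftQ_apply T v
  let G : LinearMap.range S →L[ℝ] W' := LinearMap.toContinuousLinearMap g
  refine ⟨‖G‖ + 1, by positivity, fun v => ?_⟩
  rw [← hg v]
  calc ‖G ⟨S v, v, rfl⟩‖ ≤ ‖G‖ * ‖S v‖ := G.le_opNorm _
    _ ≤ (‖G‖ + 1) * ‖S v‖ := by gcongr; linarith

/-! ### Simplices with numbered vertices -/

section Cell

variable {n : ℕ} (b : AffineBasis (Fin (n + 2)) ℝ (E (n + 1)))

lemma basis_injective : Function.Injective b := b.ind.injective

/-- The set of vertices. -/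
def vs : Finset (E (n + 1)) := Finset.univ.map ⟨b, basis_injective b⟩

/-- The face opposite to the vertex with number `i`. -/
def fc (i : Fin (n + 2)) : Finset (E (n + 1)) :=
  (Finset.univ.erase i).map ⟨b, basis_injective b⟩

lemma coe_vs : (vs b : Set (E (n + 1))) = Set.range b := by simp [vs]

lemma coe_fc (i : Fin (n + 2)) :
    (fc b i : Set (E (n + 1))) = Set.range (fun j => b (i.succAbove j)) := by
  ext x
  simp only [fc, Finset.coe_map, Finset.coe_erase, Finset.coe_univ, Set.mem_image,
    Set.mem_sdiff, Set.mem_univ, true_and, Set.mem_singleton_iff, Set.mem_range,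
    Function.Embedding.coeFn_mk]
  constructor
  · rintro ⟨j, hj, rfl⟩
    obtain ⟨l, rfl⟩ := Fin.exists_succAbove_eq hj
    exact ⟨l, rfl⟩
  · rintro ⟨l, rfl⟩
    exact ⟨_, Fin.succAbove_ne i l, rfl⟩

lemma fc_subset (i : Fin (n + 2)) : fc b i ⊆ vs b :=
  Finset.map_subset_map.2 (Finset.erase_subset _ _)

lemma card_vs : (vs b).card = n + 2 := by simp [vs]

lemma card_fc (i : Fin (n + 2)) : (fc b i).card = n + 1 := by simp [fc]

lemma fc_mem_facesOf (i : Fin (n + 2)) : fc b i ∈ facesOf (vs b) :=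
  Finset.mem_powersetCard.2 ⟨fc_subset b i, card_fc b i⟩

lemma mem_fc {i j : Fin (n + 2)} : b j ∈ fc b i ↔ j ≠ i := by
  simp [fc, (basis_injective b).eq_iff]

lemma fc_injective : Function.Injective (fc b) := by
  intro i j h
  by_contra hij
  have := (mem_fc b (i := j) (j := i)).2 hij
  rw [← h, mem_fc] at this
  exact this rfl

lemma mem_facesOf_iff {F : Finset (E (n + 1))} : F ∈ facesOf (vs b) ↔ ∃ i, fc b i = F := by
  constructor
  · intro h
    obtain ⟨h1, h2⟩ := Finset.mem_powersetCard.1 h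
    have : ¬ vs b ⊆ F := fun h3 => by
      have := Finset.card_le_card h3
      rw [card_vs] at this
      omega
    obtain ⟨x, hx, hxF⟩ := Finset.not_subset.1 this
    obtain ⟨i, -, rfl⟩ := Finset.mem_map.1 hx
    refine ⟨i, (Finset.eq_of_subset_of_card_le ?_ ?_).symm⟩
    · intro y hy
      obtain ⟨j, -, rfl⟩ := Finset.mem_map.1 (h1 hy)
      refine (mem_fc b).2 ?_
      rintro rfl
      exact hxF hy
    · rw [card_fc, h2]
  · rintro ⟨i, rfl⟩
    exact fc_mem_facesOf b i

lemma facesOf_eq : facesOf (vs b) = Finset.univ.map ⟨fc b, fc_injective b⟩ := by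
  ext F
  simp [mem_facesOf_iff]

lemma sum_facesOf {M : Type*} [AddCommMonoid M] (g : Finset (E (n + 1)) → M) :
    ∑ F ∈ facesOf (vs b), g F = ∑ i, g (fc b i) := by
  simp [facesOf_eq]

/-- Elements are given as unordered vertex sets; a numbering makes them affine bases and gives
access to barycentric coordinates. -/
lemma exists_vs_eq {K : Finset (E (n + 1))} (hK : AffineIndependent ℝ ((↑) : K → E (n + 1)))
    (hc : K.card = n + 2) : ∃ b : AffineBasis (Fin (n + 2)) ℝ (E (n + 1)), vs b = K := by
  let e : Fin (n + 2) ≃ K := (K.equivFinOfCardEq hc).symm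
  have h1 : AffineIndependent ℝ (fun i => (e i : E (n + 1))) := hK.comp_embedding e.toEmbedding
  have h2 : affineSpan ℝ (Set.range fun i => (e i : E (n + 1))) = ⊤ := by
    rw [h1.affineSpan_eq_top_iff_card_eq_finrank_add_one]
    simp
  refine ⟨⟨_, h1, h2⟩, ?_⟩
  apply Finset.coe_injective
  rw [coe_vs]
  ext x
  simp only [Set.mem_range, Finset.mem_coe]
  constructor
  · rintro ⟨i, rfl⟩
    exact (e i).2
  · intro hx
    refine ⟨e.symm ⟨x, hx⟩, ?_⟩
    change (e (e.symm ⟨x, hx⟩) : E (n + 1)) = x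
    simp

/-- The gradient of a barycentric coordinate. -/
def cgrad (i : Fin (n + 2)) : E (n + 1) :=
  (InnerProductSpace.toDual ℝ (E (n + 1))).symm (LinearMap.toContinuousLinearMap (b.coord i).linear)

lemma inner_cgrad (i : Fin (n + 2)) (v : E (n + 1)) :
    inner ℝ (cgrad b i) v = (b.coord i).linear v := by
  rw [cgrad, InnerProductSpace.toDual_symm_apply]
  rfl

lemma coord_eq_add (i : Fin (n + 2)) (x y : E (n + 1)) :
    b.coord i x = b.coord i y + inner ℝ (cgrad b i) (x - y) := by
  rw [inner_cgrad, ← vsub_eq_sub, AffineMap.linearMap_vsub]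
  simp

lemma coord_add (i : Fin (n + 2)) (x v : E (n + 1)) :
    b.coord i (x + v) = b.coord i x + inner ℝ (cgrad b i) v := by
  rw [coord_eq_add b i (x + v) x, add_sub_cancel_left]

lemma inner_cgrad_sub (i j l : Fin (n + 2)) :
    inner ℝ (cgrad b i) (b j - b l) = (if i = j then 1 else 0) - if i = l then 1 else 0 := by
  have := coord_eq_add b i (b j) (b l)
  rw [b.coord_apply, b.coord_apply] at this
  linarith

lemma sum_cgrad_smul (v : E (n + 1)) : ∑ i, inner ℝ (cgrad b i) v • b i = v := by
  have h1 := b.linear_combination_coord_eq_self v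
  have h2 := b.linear_combination_coord_eq_self 0
  rw [← sub_zero v]
  conv_rhs => rw [← h1, ← h2, ← Finset.sum_sub_distrib]
  refine Finset.sum_congr rfl fun i _ => ?_
  rw [← sub_smul, coord_eq_add b i v 0]
  congr 1
  ring

lemma sum_inner_cgrad (v : E (n + 1)) : ∑ i, inner ℝ (cgrad b i) v = 0 := by
  have h1 := b.sum_coord_apply_eq_one v
  have h2 := b.sum_coord_apply_eq_one 0
  have : ∀ i, inner ℝ (cgrad b i) v = b.coord i v - b.coord i 0 := fun i => by
    rw [coord_eq_add b i v 0, sub_zero]; ring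
  simp only [this, Finset.sum_sub_distrib, h1, h2, sub_self]

lemma cgrad_ne_zero (i : Fin (n + 2)) : cgrad b i ≠ 0 := by
  intro h
  obtain ⟨j, hj⟩ := exists_ne i
  have := inner_cgrad_sub b i i j
  rw [h, inner_zero_left] at this
  simp [hj.symm] at this

lemma norm_cgrad_pos (i : Fin (n + 2)) : 0 < ‖cgrad b i‖ := norm_pos_iff.2 (cgrad_ne_zero b i)

lemma simplex_vs : simplex (vs b) = {x | ∀ i, 0 ≤ b.coord i x} := by
  rw [simplex, coe_vs, b.convexHull_eq_nonneg_coord]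

lemma interior_simplex_vs : interior (simplex (vs b)) = {x | ∀ i, 0 < b.coord i x} := by
  rw [simplex, coe_vs, b.interior_convexHull]

lemma simplex_subset_of_subset {F : Finset (E (n + 1))} (h : F ⊆ vs b) {x : E (n + 1)}
    (hx : x ∈ simplex F) {i : Fin (n + 2)} (hi : b i ∉ F) : b.coord i x = 0 := by
  have : simplex F ⊆ (b.coord i) ⁻¹' {0} := by
    refine convexHull_min ?_ ((convex_singleton (0 : ℝ)).affine_preimage _)
    intro y hy
    obtain ⟨j, -, rfl⟩ := Finset.mem_map.1 (h hy)
    refine b.coord_apply_ne ?_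
    rintro rfl
    exact hi hy
  exact this hx

lemma mem_simplex_fc {i : Fin (n + 2)} {x : E (n + 1)} :
    x ∈ simplex (fc b i) ↔ b.coord i x = 0 ∧ ∀ j, 0 ≤ b.coord j x := by
  constructor
  · intro h
    refine ⟨simplex_subset_of_subset b (fc_subset b i) h (by simp [mem_fc]), ?_⟩
    have : x ∈ simplex (vs b) := convexHull_mono (by exact_mod_cast fc_subset b i) h
    rwa [simplex_vs] at this
  · rintro ⟨h0, h⟩
    have h1 := b.linear_combination_coord_eq_self x
    rw [← h1, ← Finset.add_sum_erase _ _ (Finset.mem_univ i), h0, zero_smul, zero_add]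
    refine (convex_convexHull ℝ _).sum_mem (fun j _ => h j) ?_ fun j hj => ?_
    · have := b.sum_coord_apply_eq_one x
      rwa [← Finset.add_sum_erase _ _ (Finset.mem_univ i), h0, zero_add] at this
    · exact subset_convexHull ℝ _ (by exact_mod_cast (mem_fc b).2 (Finset.ne_of_mem_erase hj))

lemma isCompact_simplex {d : ℕ} (K : Finset (E d)) : IsCompact (simplex K) :=
  K.finite_toSet.isCompact_convexHull ℝ

lemma convex_simplex {d : ℕ} (K : Finset (E d)) : Convex ℝ (simplex K) := convex_convexHull ℝ _

lemma measurableSet_simplex {d : ℕ} (K : Finset (E d)) : MeasurableSet (simplex K) :=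
  (isCompact_simplex K).isClosed.measurableSet

lemma simplex_mono {d : ℕ} {F K : Finset (E d)} (h : F ⊆ K) : simplex F ⊆ simplex K :=
  convexHull_mono (by exact_mod_cast h)

lemma coord_barycentre_vs (i : Fin (n + 2)) : b.coord i (barycentre (vs b)) = ((n : ℝ) + 2)⁻¹ := by
  have h : barycentre (vs b) = ∑ j, ((n : ℝ) + 2)⁻¹ • b j := by
    rw [barycentre, card_vs, vs, Finset.sum_map, Finset.smul_sum]
    push_cast
    rfl
  have hw : ∑ _j : Fin (n + 2), ((n : ℝ) + 2)⁻¹ = 1 := by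
    simp
    field_simp
  have := b.coord_apply_combination_of_mem (Finset.mem_univ i) hw
  rwa [Finset.univ.affineCombination_eq_linear_combination _ _ hw, ← h] at this

lemma coord_barycentre_fc (i : Fin (n + 2)) : b.coord i (barycentre (fc b i)) = 0 := by
  refine simplex_subset_of_subset b (fc_subset b i) (F := fc b i) ?_ (by simp [mem_fc])
  rw [barycentre, Finset.smul_sum]
  refine (convex_convexHull ℝ _).sum_mem (fun _ _ => by positivity) ?_ fun x hx =>
    subset_convexHull ℝ _ (by exact_mod_cast hx)
  rw [Finset.sum_const, card_fc]
  simp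
  field_simp

/-- The coordinate i vanishes at all vertices of the face, which gives one inclusion; both spaces
have dimension n. -/
lemma vectorSpan_fc (i : Fin (n + 2)) :
    vectorSpan ℝ (fc b i : Set (E (n + 1))) = (ℝ ∙ cgrad b i)ᗮ := by
  refine Submodule.eq_of_le_of_finrank_eq ?_ ?_
  · rw [vectorSpan_def, Submodule.span_le]
    rintro v ⟨x, hx, y, hy, rfl⟩
    obtain ⟨j, -, rfl⟩ := Finset.mem_map.1 (fc_subset b i hx)
    obtain ⟨l, -, rfl⟩ := Finset.mem_map.1 (fc_subset b i hy)
    rw [SetLike.mem_coe, Submodule.mem_orthogonal_singleton_iff_inner_right]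
    have hj : i ≠ j := ((mem_fc b).1 hx).symm
    have hl : i ≠ l := ((mem_fc b).1 hy).symm
    simpa [hj, hl] using inner_cgrad_sub b i j l
  · have h1 : AffineIndependent ℝ fun j => b (i.succAbove j) :=
      b.ind.comp_embedding i.succAboveEmb
    rw [coe_fc, h1.finrank_vectorSpan (n := n) (by simp)]
    have : Fact (Module.finrank ℝ (E (n + 1)) = n + 1) := ⟨by simp⟩
    rw [Submodule.finrank_orthogonal_span_singleton (n := n) (cgrad_ne_zero b i)]

/-- The orthogonal complement of the face is the line of the gradient, and from the barycentre of
the element to that of the face the coordinate i falls from 1/(n + 2) to 0. Hence the minus sign. -/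
lemma normal_eq (i : Fin (n + 2)) :
    normal (vs b) (fc b i) = -(‖cgrad b i‖⁻¹ • cgrad b i) := by
  have h1 : inner ℝ (cgrad b i) (barycentre (fc b i) - barycentre (vs b)) = -((n : ℝ) + 2)⁻¹ := by
    have := coord_eq_add b i (barycentre (fc b i)) (barycentre (vs b))
    rw [coord_barycentre_vs, coord_barycentre_fc] at this
    linarith
  have hpos := norm_cgrad_pos b i
  have hn : (0 : ℝ) < (n : ℝ) + 2 := by positivity
  have h2 : ((vectorSpan ℝ (fc b i : Set (E (n + 1))))ᗮ).starProjection
      (barycentre (fc b i) - barycentre (vs b))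
      = (-(((n : ℝ) + 2)⁻¹ / ‖cgrad b i‖ ^ 2)) • cgrad b i := by
    have : (vectorSpan ℝ (fc b i : Set (E (n + 1))))ᗮ = ℝ ∙ cgrad b i := by
      rw [vectorSpan_fc, Submodule.orthogonal_orthogonal]
    simp only [this]
    rw [Submodule.starProjection_singleton, h1]
    congr 1
    simp [neg_div]
  simp only [normal]
  rw [h2, norm_smul, smul_smul, norm_neg, ← neg_smul, Real.norm_of_nonneg (by positivity)]
  congr 1
  field_simp

lemma inner_normal (i : Fin (n + 2)) (v : E (n + 1)) :
    inner ℝ v (normal (vs b) (fc b i)) = -(‖cgrad b i‖⁻¹ * inner ℝ (cgrad b i) v) := by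
  rw [normal_eq, inner_neg_right, inner_smul_right, real_inner_comm]

lemma norm_normal (i : Fin (n + 2)) : ‖normal (vs b) (fc b i)‖ = 1 := by
  rw [normal_eq, norm_neg, norm_smul, norm_inv, norm_norm,
    inv_mul_cancel₀ (norm_cgrad_pos b i).ne']

lemma coord_le_one {x : E (n + 1)} (hx : x ∈ simplex (vs b)) (i : Fin (n + 2)) :
    b.coord i x ≤ 1 := by
  rw [simplex_vs] at hx
  rw [← b.sum_coord_apply_eq_one x]
  exact Finset.single_le_sum (f := fun i => b.coord i x) (fun j _ => hx j) (Finset.mem_univ i)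

/-- Moving the centre of the ball by r against the gradient lowers the coordinate by ‖∇λ_i‖ r. It
was at most 1 and must stay nonnegative. This is how shape regularity bounds the heights from below.
-/
lemma norm_cgrad_mul_le {x : E (n + 1)} {r : ℝ} (hr : 0 ≤ r)
    (h : Metric.closedBall x r ⊆ simplex (vs b)) (i : Fin (n + 2)) : ‖cgrad b i‖ * r ≤ 1 := by
  have hpos := norm_cgrad_pos b i
  have h1 : x + (-(r * ‖cgrad b i‖⁻¹)) • cgrad b i ∈ simplex (vs b) := by
    refine h ?_
    rw [Metric.mem_closedBall, dist_eq_norm, add_sub_cancel_left, norm_smul, norm_neg,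
      Real.norm_of_nonneg (by positivity)]
    field_simp
    exact le_rfl
  have h2 := coord_le_one b (h (Metric.mem_closedBall_self hr)) i
  rw [simplex_vs] at h1
  have h3 := h1 i
  rw [coord_add, inner_smul_right, real_inner_self_eq_norm_sq] at h3
  have : r * ‖cgrad b i‖⁻¹ * ‖cgrad b i‖ ^ 2 = ‖cgrad b i‖ * r := by field_simp
  nlinarith

/-- The height over every face is at most the diameter. -/
lemma one_le_norm_cgrad_mul_diam (i : Fin (n + 2)) :
    1 ≤ ‖cgrad b i‖ * Metric.diam (simplex (vs b)) := by
  obtain ⟨j, hj⟩ := exists_ne i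
  have h := inner_cgrad_sub b i i j
  rw [if_pos rfl, if_neg hj.symm, sub_zero] at h
  rw [← h]
  refine (real_inner_le_norm _ _).trans ?_
  gcongr
  rw [← dist_eq_norm]
  have hm : ∀ l, b l ∈ simplex (vs b) := fun l =>
    subset_convexHull ℝ _ (by rw [coe_vs]; exact ⟨l, rfl⟩)
  exact Metric.dist_le_diam_of_mem (isCompact_simplex _).isBounded (hm i) (hm j)

lemma sum_cgrad_smul_sub (v : E (n + 1)) (i : Fin (n + 2)) :
    ∑ j, inner ℝ (cgrad b j) v • (b j - b i) = v := by
  simp only [smul_sub, Finset.sum_sub_distrib, sum_cgrad_smul, ← Finset.sum_smul,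
    sum_inner_cgrad, zero_smul, sub_zero]

/-- A vector is controlled by its normal components. -/
lemma norm_le_sum_cgrad (v : E (n + 1)) (i : Fin (n + 2)) :
    ‖v‖ ≤ Metric.diam (simplex (vs b)) * ∑ j ∈ Finset.univ.erase i, |inner ℝ (cgrad b j) v| := by
  -- The vector is expanded in the edges that issue from vertex i, so its component normal to face i
  -- is not needed.
  conv_lhs => rw [← sum_cgrad_smul_sub b v i, ← Finset.add_sum_erase _ _ (Finset.mem_univ i)]
  rw [sub_self, smul_zero, zero_add, Finset.mul_sum]
  refine (norm_sum_le _ _).trans (Finset.sum_le_sum fun j _ => ?_)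
  rw [norm_smul, Real.norm_eq_abs, mul_comm]
  gcongr
  rw [← dist_eq_norm]
  have hm : ∀ l, b l ∈ simplex (vs b) := fun l =>
    subset_convexHull ℝ _ (by rw [coe_vs]; exact ⟨l, rfl⟩)
  exact Metric.dist_le_diam_of_mem (isCompact_simplex _).isBounded (hm j) (hm i)

end Cell

/-! ### Parametrized simplices -/

section Param

variable {d m : ℕ}

/-- The unit simplex in `ℝ^m`. -/
def unitSimplex (m : ℕ) : Set (Fin m → ℝ) := {l | (∀ i, 0 ≤ l i) ∧ ∑ i, l i ≤ 1}

/-- The linear part of the parametrization of a simplex. -/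
def parL (x : Fin (m + 1) → E d) : E m →ₗ[ℝ] E d :=
  ∑ i, (LinearMap.toSpanSingleton ℝ (E d) (x i.succ - x 0)) ∘ₗ
    (EuclideanSpace.proj i : E m →L[ℝ] ℝ).toLinearMap

/-- The affine parametrization of a simplex by the unit simplex. -/
def par (x : Fin (m + 1) → E d) (l : Fin m → ℝ) : E d := x 0 + ∑ i, l i • (x i.succ - x 0)

lemma parL_apply (x : Fin (m + 1) → E d) (l : E m) :
    parL x l = ∑ i, l i • (x i.succ - x 0) := by
  simp [parL]

lemma par_eq (x : Fin (m + 1) → E d) (l : Fin m → ℝ) :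
    par x l = x 0 + parL x (WithLp.toLp 2 l) := by
  rw [parL_apply]
  rfl

lemma continuous_par (x : Fin (m + 1) → E d) : Continuous (par x) := by
  unfold par
  fun_prop

lemma measurable_par (x : Fin (m + 1) → E d) : Measurable (par x) := (continuous_par x).measurable

lemma par_eq_sum (x : Fin (m + 1) → E d) (l : Fin m → ℝ) :
    par x l = (1 - ∑ i, l i) • x 0 + ∑ i, l i • x i.succ := by
  simp only [par, smul_sub, Finset.sum_sub_distrib, sub_smul, one_smul, ← Finset.sum_smul]
  abel

lemma convexHull_range_eq (x : Fin (m + 1) → E d) :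
    convexHull ℝ (Set.range x) = par x '' unitSimplex m := by
  apply subset_antisymm
  · refine convexHull_min ?_ ?_
    · rintro _ ⟨i, rfl⟩
      refine Fin.cases ?_ (fun j => ?_) i
      · exact ⟨0, by simp [unitSimplex], by simp [par]⟩
      · refine ⟨Pi.single j 1, ⟨fun i => ?_, by simp⟩, ?_⟩
        · by_cases h : i = j
          · subst h; simp
          · simp [h]
        · rw [par_eq_sum]
          simp [Pi.single_apply, ite_smul]
    · rintro _ ⟨l, hl, rfl⟩ _ ⟨l', hl', rfl⟩ s t hs ht hst
      refine ⟨s • l + t • l', ⟨fun i => ?_, ?_⟩, ?_⟩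
      · have := hl.1 i
        have := hl'.1 i
        simp only [Pi.add_apply, Pi.smul_apply, smul_eq_mul]
        positivity
      · simp only [Pi.add_apply, Pi.smul_apply, smul_eq_mul, Finset.sum_add_distrib,
          ← Finset.mul_sum]
        nlinarith [hl.2, hl'.2]
      · simp only [par, Pi.add_apply, Pi.smul_apply, smul_eq_mul, add_smul, smul_add,
          Finset.sum_add_distrib, mul_smul, Finset.smul_sum]
        rw [add_add_add_comm, ← add_smul, hst, one_smul]
  · rintro _ ⟨l, hl, rfl⟩
    rw [par_eq_sum]
    have := (convex_convexHull ℝ (Set.range x)).sum_mem (t := Finset.univ)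
      (w := Fin.cons (1 - ∑ i, l i) l) (z := x) ?_ ?_ ?_
    · simpa [Fin.sum_univ_succ] using this
    · intro i _
      refine Fin.cases ?_ (fun j => ?_) i
      · simpa using hl.2
      · simpa using hl.1 j
    · simp [Fin.sum_univ_succ]
    · intro i _
      exact subset_convexHull ℝ _ ⟨i, rfl⟩

/-- The factor between Hausdorff measure on the simplex and Lebesgue measure on the unit simplex. -/
def volFactor (x : Fin (m + 1) → E d) : ℝ := (parL x).normDet

lemma volFactor_nonneg (x : Fin (m + 1) → E d) : 0 ≤ volFactor x := LinearMap.normDet_nonneg _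

lemma measurableSet_unitSimplex (m : ℕ) : MeasurableSet (unitSimplex m) := by
  have : unitSimplex m = (⋂ i, {l | 0 ≤ l i}) ∩ {l | ∑ i, l i ≤ 1} := by
    ext l
    simp [unitSimplex]
  rw [this]
  refine (MeasurableSet.iInter fun i => ?_).inter ?_
  · exact measurableSet_le measurable_const (measurable_pi_apply i)
  · exact measurableSet_le (by fun_prop) measurable_const

lemma hausdorff_image_par (x : Fin (m + 1) → E d) (s : Set (Fin m → ℝ)) :
    Measure.euclideanHausdorffMeasure m (par x '' s)
      = ENNReal.ofReal (volFactor x) * volume s := by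
  have h1 : par x '' s = (fun y => x 0 + y) '' (parL x '' (WithLp.toLp 2 '' s)) := by
    rw [Set.image_image, Set.image_image]
    exact Set.image_congr fun l _ => par_eq x l
  have h2 := (parL x).euclideanHausdorffMeasure_image_eq_normDet_mul_volume (WithLp.toLp 2 '' s)
  rw [finrank_euclideanSpace_fin] at h2
  rw [h1, (isometry_add_left (x 0)).euclideanHausdorffMeasure_image, h2]
  congr 1
  have h3 : (WithLp.toLp 2 '' s : Set (E m)) = (MeasurableEquiv.toLp 2 (Fin m → ℝ)).symm ⁻¹' s := by
    ext y
    constructor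
    · rintro ⟨l, hl, rfl⟩
      exact hl
    · intro hy
      exact ⟨_, hy, rfl⟩
  rw [h3]
  exact (EuclideanSpace.volume_preserving_symm_measurableEquiv_toLp (Fin m)).measure_preimage_equiv s

lemma hausdorff_restrict_simplex (x : Fin (m + 1) → E d) :
    (Measure.euclideanHausdorffMeasure m).restrict (convexHull ℝ (Set.range x))
      = ENNReal.ofReal (volFactor x) • (volume.restrict (unitSimplex m)).map (par x) := by
  ext t ht
  rw [Measure.restrict_apply ht, Measure.smul_apply, Measure.map_apply (measurable_par x) ht,
    Measure.restrict_apply (measurable_par x ht), convexHull_range_eq, smul_eq_mul,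
    ← hausdorff_image_par]
  congr 1
  ext y
  constructor
  · rintro ⟨hy, l, hl, rfl⟩
    exact ⟨l, ⟨hy, hl⟩, rfl⟩
  · rintro ⟨l, ⟨hy, hl⟩, rfl⟩
    exact ⟨hy, l, hl, rfl⟩

end Param

/-! ### The measures of a simplex and of its faces -/

section Volume

variable {n : ℕ}

lemma vol_unitSimplex_lt_top (m : ℕ) : volume (unitSimplex m) < ⊤ := by
  have : unitSimplex m ⊆ Set.Icc 0 1 := fun l hl => ⟨fun i => hl.1 i, fun i =>
    (Finset.single_le_sum (f := l) (fun j _ => hl.1 j) (Finset.mem_univ i)).trans hl.2⟩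
  exact (measure_mono this).trans_lt isCompact_Icc.measure_lt_top

lemma isCompact_unitSimplex (m : ℕ) : IsCompact (unitSimplex m) := by
  have h1 : unitSimplex m ⊆ Set.Icc 0 1 := fun l hl => ⟨fun i => hl.1 i, fun i =>
    (Finset.single_le_sum (f := l) (fun j _ => hl.1 j) (Finset.mem_univ i)).trans hl.2⟩
  refine isCompact_Icc.of_isClosed_subset ?_ h1
  have : unitSimplex m = (⋂ i, {l | 0 ≤ l i}) ∩ {l | ∑ i, l i ≤ 1} := by
    ext l
    simp [unitSimplex]
  rw [this]
  refine (isClosed_iInter fun i => ?_).inter ?_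
  · exact isClosed_le continuous_const (continuous_apply i)
  · exact isClosed_le (by fun_prop) continuous_const

lemma volume_eq_hausdorff (m : ℕ) :
    (volume : Measure (E m)) = Measure.euclideanHausdorffMeasure m :=
  (EuclideanSpace.euclideanHausdorffMeasure_eq_volume m).symm

lemma vol_unitSimplex_ne_zero (m : ℕ) : volume (unitSimplex m) ≠ 0 := by
  have : (interior (unitSimplex m)).Nonempty := by
    refine ⟨fun _ => ((m : ℝ) + 1)⁻¹, ?_⟩
    have hm : (0 : ℝ) < m + 1 := by positivity
    have h2 : {l : Fin m → ℝ | (∀ i, 0 < l i) ∧ ∑ i, l i < 1} ⊆ interior (unitSimplex m) := by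
      refine interior_maximal (fun l hl => ⟨fun i => (hl.1 i).le, hl.2.le⟩) ?_
      have : {l : Fin m → ℝ | (∀ i, 0 < l i) ∧ ∑ i, l i < 1}
          = (⋂ i, {l | 0 < l i}) ∩ {l | ∑ i, l i < 1} := by
        ext l
        simp
      rw [this]
      refine (isOpen_iInter_of_finite fun i => ?_).inter ?_
      · exact isOpen_lt continuous_const (continuous_apply i)
      · exact isOpen_lt (by fun_prop) continuous_const
    refine h2 ⟨fun i => by positivity, ?_⟩
    simp
    field_simp
    linarith
  exact (Measure.measure_pos_of_nonempty_interior _ this).ne'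

/-- Both parametrizations have the same image, whose Hausdorff measure determines the factor; the
order of the vertices is therefore irrelevant. -/
lemma volFactor_eq_of_range_eq {d m : ℕ} {x y : Fin (m + 1) → E d} (h : Set.range x = Set.range y) :
    volFactor x = volFactor y := by
  have hx := hausdorff_image_par x (unitSimplex m)
  have hy := hausdorff_image_par y (unitSimplex m)
  rw [← convexHull_range_eq] at hx hy
  rw [h, hy] at hx
  have := (ENNReal.mul_left_inj (vol_unitSimplex_ne_zero m) (vol_unitSimplex_lt_top m).ne).1 hx
  exact ((ENNReal.ofReal_eq_ofReal_iff (volFactor_nonneg _) (volFactor_nonneg _)).1 this).symm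

variable (b : AffineBasis (Fin (n + 2)) ℝ (E (n + 1)))

lemma cellMeasure_eq : cellMeasure (vs b)
    = ENNReal.ofReal (volFactor b) • (volume.restrict (unitSimplex (n + 1))).map (par b) := by
  rw [cellMeasure, simplex, coe_vs, volume_eq_hausdorff, hausdorff_restrict_simplex]

lemma faceMeasure_eq (i : Fin (n + 2)) : faceMeasure (fc b i)
    = ENNReal.ofReal (volFactor fun j => b (i.succAbove j)) •
      (volume.restrict (unitSimplex n)).map (par fun j => b (i.succAbove j)) := by
  rw [faceMeasure, simplex, coe_fc]
  exact hausdorff_restrict_simplex _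

lemma volFactor_pos : 0 < volFactor b := by
  refine lt_of_le_of_ne (volFactor_nonneg _) fun h => ?_
  have h1 := hausdorff_image_par b (unitSimplex (n + 1))
  rw [← h, ENNReal.ofReal_zero, zero_mul, ← convexHull_range_eq, ← coe_vs,
    ← volume_eq_hausdorff] at h1
  refine (Measure.measure_pos_of_nonempty_interior volume (s := simplex (vs b)) ?_).ne' h1
  rw [interior_simplex_vs]
  refine ⟨barycentre (vs b), fun i => ?_⟩
  rw [coord_barycentre_vs]
  positivity

/-- The volume of a prism is its height times the area of its base. -/
lemma volFactor_snoc (f : Fin (n + 1) → E (n + 1)) (a g : E (n + 1))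
    (hg : g ≠ 0) (hf : ∀ j, inner ℝ g (f j - f 0) = 0) (ha : inner ℝ g (a - f 0) = 1) :
    volFactor f = volFactor (Fin.snoc (α := fun _ => E (n + 1)) f a : Fin (n + 2) → E (n + 1))
      * ‖g‖ := by
  set c : Fin (n + 2) → E (n + 1) := Fin.snoc (α := fun _ => E (n + 1)) f a with hc
  have hpar : ∀ l : Fin (n + 1) → ℝ,
      par c l = l (Fin.last n) • (a - f 0) + par f (fun i : Fin n => l i.castSucc) := by
    intro l
    have h0 : c 0 = f 0 := by
      rw [hc, ← Fin.castSucc_zero, Fin.snoc_castSucc (α := fun _ => E (n + 1))]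
    have h1 : ∀ i : Fin n, c i.castSucc.succ = f i.succ := fun i => by
      rw [hc, Fin.succ_castSucc, Fin.snoc_castSucc (α := fun _ => E (n + 1))]
    have h2 : c (Fin.last n).succ = a := by
      rw [hc, Fin.succ_last, Fin.snoc_last (α := fun _ => E (n + 1))]
    rw [par, par, Fin.sum_univ_castSucc, h0, h2]
    simp only [h1]
    abel
  have hin : ∀ l : Fin (n + 1) → ℝ, inner ℝ g (par c l - f 0) = l (Fin.last n) := by
    intro l
    rw [hpar, par]
    have : l (Fin.last n) • (a - f 0) + (f 0 + ∑ i : Fin n, l i.castSucc • (f i.succ - f 0)) - f 0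
        = l (Fin.last n) • (a - f 0) + ∑ i : Fin n, l i.castSucc • (f i.succ - f 0) := by abel
    rw [this, inner_add_right, inner_smul_right, ha, inner_sum]
    simp [inner_smul_right, hf]
  have hng : 0 < ‖g‖ := norm_pos_iff.2 hg
  -- Scaled so that the hyperplane through f 0 + s v orthogonal to g is the set where ⟨g, y − f 0⟩ =
  -- s.
  set v : E (n + 1) := (‖g‖ ^ 2)⁻¹ • g with hv
  have hv0 : v ≠ 0 := smul_ne_zero (by positivity) hg
  have hnv : ‖v‖ = ‖g‖⁻¹ := by
    rw [hv, norm_smul, norm_inv, norm_pow, norm_norm]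
    field_simp
  -- Cavalieri's principle, applied to the image of the unit cube instead of the simplex: the slices
  -- at heights 0 ≤ s ≤ 1 are then all translates of the base parallelepiped, and the other slices
  -- are empty.
  have key := EuclideanGeometry.euclideanHausdorffMeasure_eq_lintegral (f 0) hv0
    (t := par c '' Set.Icc 0 1)
    ((isCompact_Icc.image (continuous_par c)).isClosed.measurableSet)
  rw [finrank_euclideanSpace_fin] at key
  simp only [Nat.add_sub_cancel] at key
  have hslice : ∀ s : ℝ, Measure.euclideanHausdorffMeasure n
      (par c '' Set.Icc 0 1 ∩ (AffineSubspace.mk' (s • v +ᵥ f 0) (ℝ ∙ v)ᗮ : Set (E (n + 1))))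
      = (Set.Icc (0 : ℝ) 1).indicator (fun _ => ENNReal.ofReal (volFactor f)) s := by
    intro s
    have hmem : ∀ y, y ∈ AffineSubspace.mk' (s • v +ᵥ f 0) (ℝ ∙ v)ᗮ ↔ inner ℝ g (y - f 0) = s := by
      intro y
      rw [AffineSubspace.mem_mk', Submodule.mem_orthogonal_singleton_iff_inner_right, hv,
        inner_smul_left, vsub_eq_sub, vadd_eq_add]
      have : y - (s • (‖g‖ ^ 2)⁻¹ • g + f 0) = (y - f 0) - (s * (‖g‖ ^ 2)⁻¹) • g := by
        rw [mul_smul]; abel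
      rw [this, inner_sub_right, inner_smul_right, real_inner_self_eq_norm_sq]
      simp only [map_inv₀, map_pow, conj_trivial, mul_eq_zero, inv_eq_zero]
      constructor
      · rintro (h | h)
        · exact absurd h (by positivity)
        · field_simp at h
          linarith
      · intro h
        right
        rw [h]
        field_simp
        ring
    by_cases hs : s ∈ Set.Icc (0 : ℝ) 1
    · rw [Set.indicator_of_mem hs]
      have : par c '' Set.Icc 0 1 ∩ (AffineSubspace.mk' (s • v +ᵥ f 0) (ℝ ∙ v)ᗮ : Set (E (n + 1)))
          = (fun y => s • (a - f 0) + y) '' (par f '' Set.Icc 0 1) := by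
        ext y
        constructor
        · rintro ⟨⟨l, hl, rfl⟩, hy⟩
          have := (hmem _).1 hy
          rw [hin] at this
          refine ⟨_, ⟨fun i : Fin n => l i.castSucc, ⟨fun i => hl.1 _, fun i => hl.2 _⟩, rfl⟩, ?_⟩
          rw [hpar, this]
        · rintro ⟨_, ⟨l, hl, rfl⟩, rfl⟩
          have he : s • (a - f 0) + par f l = par c (Fin.snoc (α := fun _ => ℝ) l s) := by
            rw [hpar]
            simp
          simp only
          rw [he]
          refine ⟨⟨_, ⟨fun i => ?_, fun i => ?_⟩, rfl⟩, (hmem _).2 ?_⟩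
          · refine Fin.lastCases ?_ (fun j => ?_) i
            · simpa using hs.1
            · simpa using hl.1 j
          · refine Fin.lastCases ?_ (fun j => ?_) i
            · simpa using hs.2
            · simpa using hl.2 j
          · rw [hin]
            simp
      rw [this, (isometry_add_left _).euclideanHausdorffMeasure_image, hausdorff_image_par,
        Real.volume_Icc_pi]
      simp
    · rw [Set.indicator_of_notMem hs]
      have : par c '' Set.Icc 0 1 ∩ (AffineSubspace.mk' (s • v +ᵥ f 0) (ℝ ∙ v)ᗮ : Set (E (n + 1)))
          = ∅ := by
        rw [Set.eq_empty_iff_forall_notMem]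
        rintro _ ⟨⟨l, hl, rfl⟩, hy⟩
        have := (hmem _).1 hy
        rw [hin] at this
        exact hs (this ▸ ⟨hl.1 _, hl.2 _⟩)
      rw [this, measure_empty]
  simp only [hslice] at key
  rw [hausdorff_image_par, Real.volume_Icc_pi, lintegral_indicator measurableSet_Icc] at key
  simp only [Pi.one_apply, Pi.zero_apply, sub_zero, ENNReal.ofReal_one, Finset.prod_const_one,
    mul_one, lintegral_const, Measure.restrict_apply MeasurableSet.univ, Set.univ_inter,
    Real.volume_Icc] at key
  rw [← ofReal_norm, ← ENNReal.ofReal_mul (norm_nonneg _), ENNReal.ofReal_eq_ofReal_iff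
    (volFactor_nonneg _) (mul_nonneg (norm_nonneg _) (volFactor_nonneg _)), hnv] at key
  rw [key]
  field_simp

/-- With the face as base and b i as apex the coordinate i rises from 0 to 1, so the height is
1/‖∇λ_i‖. -/
lemma volFactor_face (i : Fin (n + 2)) :
    volFactor (fun j => b (i.succAbove j)) = volFactor b * ‖cgrad b i‖ := by
  rw [volFactor_snoc (fun j => b (i.succAbove j)) (b i) (cgrad b i) (cgrad_ne_zero b i)]
  · congr 1
    apply volFactor_eq_of_range_eq
    rw [Fin.range_snoc]
    ext x
    simp only [Set.mem_insert_iff, Set.mem_range]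
    constructor
    · rintro (rfl | ⟨j, rfl⟩)
      exacts [⟨_, rfl⟩, ⟨_, rfl⟩]
    · rintro ⟨j, rfl⟩
      rcases eq_or_ne j i with rfl | hj
      · exact Or.inl rfl
      · obtain ⟨l, rfl⟩ := Fin.exists_succAbove_eq hj
        exact Or.inr ⟨l, rfl⟩
  · intro j
    rw [inner_cgrad_sub]
    simp [(Fin.succAbove_ne i _).symm]
  · rw [inner_cgrad_sub]
    simp [(Fin.succAbove_ne i _).symm]

lemma integral_cellMeasure {f : E (n + 1) → ℝ} (hf : Continuous f) :
    ∫ x, f x ∂cellMeasure (vs b) = volFactor b * ∫ l in unitSimplex (n + 1), f (par b l) := by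
  rw [cellMeasure_eq, integral_smul_measure, integral_map (measurable_par _).aemeasurable
    hf.aestronglyMeasurable, ENNReal.toReal_ofReal (volFactor_nonneg _), smul_eq_mul]

lemma integral_faceMeasure {f : E (n + 1) → ℝ} (hf : Continuous f) (i : Fin (n + 2)) :
    ∫ x, f x ∂faceMeasure (fc b i) = volFactor b * ‖cgrad b i‖ *
      ∫ l in unitSimplex n, f (par (fun j => b (i.succAbove j)) l) := by
  rw [faceMeasure_eq, integral_smul_measure, integral_map (measurable_par _).aemeasurable
    hf.aestronglyMeasurable, ENNReal.toReal_ofReal (volFactor_nonneg _), smul_eq_mul,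
    volFactor_face]

instance isFiniteMeasure_cellMeasure {d : ℕ} (K : Finset (E d)) :
    IsFiniteMeasure (cellMeasure K) :=
  ⟨by rw [cellMeasure, Measure.restrict_apply_univ]; exact (isCompact_simplex K).measure_lt_top⟩

lemma isFiniteMeasure_faceMeasure (i : Fin (n + 2)) : IsFiniteMeasure (faceMeasure (fc b i)) := by
  rw [faceMeasure_eq]
  have : IsFiniteMeasure (volume.restrict (unitSimplex n)) :=
    ⟨by rw [Measure.restrict_apply_univ]; exact vol_unitSimplex_lt_top n⟩
  exact Measure.smul_finite _ (by simp)

end Volume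

/-! ### The divergence theorem on a simplex -/

section Divergence

variable {n : ℕ}

lemma cons_mem_unitSimplex {l : Fin n → ℝ} {s : ℝ} :
    (Fin.cons s l : Fin (n + 1) → ℝ) ∈ unitSimplex (n + 1) ↔
      l ∈ unitSimplex n ∧ s ∈ Set.Icc 0 (1 - ∑ i, l i) := by
  simp only [unitSimplex, Set.mem_ofPred_eq, Fin.forall_fin_succ, Fin.cons_zero, Fin.cons_succ,
    Fin.sum_univ_succ, Set.mem_Icc]
  constructor
  · rintro ⟨⟨h1, h2⟩, h3⟩
    exact ⟨⟨h2, by linarith⟩, h1, by linarith⟩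
  · rintro ⟨⟨h2, h4⟩, h1, h3⟩
    exact ⟨⟨h1, h2⟩, by linarith⟩

/-- Fubini with the first coordinate innermost, ready for the fundamental theorem of calculus along
the edge from vertex 0 to vertex 1. -/
lemma integral_unitSimplex_succ {G : (Fin (n + 1) → ℝ) → ℝ} (hG : Continuous G) :
    ∫ l in unitSimplex (n + 1), G l
      = ∫ l in unitSimplex n, ∫ s in (0 : ℝ)..(1 - ∑ i, l i), G (Fin.cons s l) := by
  have hmp := (volume_preserving_piFinSuccAbove (fun _ : Fin (n + 1) => ℝ) 0).symm
  have hint : Integrable ((unitSimplex (n + 1)).indicator G) := by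
    rw [integrable_indicator_iff (measurableSet_unitSimplex _)]
    exact hG.continuousOn.integrableOn_compact (isCompact_unitSimplex _)
  rw [← integral_indicator (measurableSet_unitSimplex _),
    ← hmp.integral_comp' (g := (unitSimplex (n + 1)).indicator G)]
  have hint2 : Integrable (fun z => (unitSimplex (n + 1)).indicator G
      ((MeasurableEquiv.piFinSuccAbove (fun _ : Fin (n + 1) => ℝ) 0).symm z))
      (volume.prod volume) := hmp.integrable_comp_of_integrable hint
  rw [Measure.volume_eq_prod, integral_prod_symm _ hint2,
    ← integral_indicator (measurableSet_unitSimplex _)]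
  refine integral_congr_ae (Eventually.of_forall fun l => ?_)
  have he : ∀ s : ℝ, (MeasurableEquiv.piFinSuccAbove (fun _ : Fin (n + 1) => ℝ) 0).symm (s, l)
      = Fin.cons s l := fun s => by
    change Fin.insertNth (α := fun _ : Fin (n + 1) => ℝ) 0 s l = _
    rw [Fin.insertNth_zero]
    rfl
  simp only [he]
  by_cases hl : l ∈ unitSimplex n
  · rw [Set.indicator_of_mem hl, intervalIntegral.integral_of_le (by linarith [hl.2]),
      ← integral_Icc_eq_integral_Ioc, ← integral_indicator measurableSet_Icc]
    refine integral_congr_ae (Eventually.of_forall fun s => ?_)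
    by_cases hs : s ∈ Set.Icc 0 (1 - ∑ i, l i)
    · simp only
      rw [Set.indicator_of_mem hs, Set.indicator_of_mem (cons_mem_unitSimplex.2 ⟨hl, hs⟩)]
    · simp only
      rw [Set.indicator_of_notMem hs, Set.indicator_of_notMem fun h =>
        hs (cons_mem_unitSimplex.1 h).2]
  · rw [Set.indicator_of_notMem hl]
    refine integral_eq_zero_of_ae (Eventually.of_forall fun s => ?_)
    exact Set.indicator_of_notMem (fun h => hl (cons_mem_unitSimplex.1 h).1) _

lemma par_cons (x : Fin (n + 2) → E (n + 1)) (s : ℝ) (l : Fin n → ℝ) :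
    par x (Fin.cons s l : Fin (n + 1) → ℝ)
      = x 0 + s • (x 1 - x 0) + ∑ i : Fin n, l i • (x i.succ.succ - x 0) := by
  simp [par, Fin.sum_univ_succ, add_assoc]

/-- A line parallel to the edge from b 0 to b 1 enters through face 1, where the first parameter is
0, and leaves through face 0, where it is 1 − ∑ l. The fundamental theorem of calculus is integrated
over these lines; the inverse norms are the ratios between volume and surface factors. -/
lemma integral_fderiv_edge_zero (b : AffineBasis (Fin (n + 2)) ℝ (E (n + 1)))
    {f : E (n + 1) → ℝ} (hf : ContDiff ℝ 1 f) :
    ∫ x, fderiv ℝ f x (b 1 - b 0) ∂cellMeasure (vs b)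
      = ‖cgrad b 0‖⁻¹ * ∫ x, f x ∂faceMeasure (fc b 0)
        - ‖cgrad b 1‖⁻¹ * ∫ x, f x ∂faceMeasure (fc b 1) := by
  have hcont : Continuous fun x => fderiv ℝ f x (b 1 - b 0) :=
    (hf.continuous_fderiv (by norm_num)).clm_apply continuous_const
  rw [integral_cellMeasure b hcont, integral_faceMeasure b hf.continuous,
    integral_faceMeasure b hf.continuous,
    integral_unitSimplex_succ (G := fun l => fderiv ℝ f (par b l) (b 1 - b 0))
      (hcont.comp (continuous_par b))]
  have h0 := norm_cgrad_pos b 0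
  have h1 := norm_cgrad_pos b 1
  have e0 : ∀ A : ℝ, ‖cgrad b 0‖⁻¹ * (volFactor b * ‖cgrad b 0‖ * A) = volFactor b * A := by
    intro A; field_simp
  have e1 : ∀ A : ℝ, ‖cgrad b 1‖⁻¹ * (volFactor b * ‖cgrad b 1‖ * A) = volFactor b * A := by
    intro A; field_simp
  rw [e0, e1, ← mul_sub, ← integral_sub]
  · congr 1
    refine setIntegral_congr_fun (measurableSet_unitSimplex _) fun l _ => ?_
    have hp0 : par (fun j => b ((0 : Fin (n + 2)).succAbove j)) l
        = par b (Fin.cons (1 - ∑ i, l i) l : Fin (n + 1) → ℝ) := by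
      rw [par_cons, par]
      simp only [Fin.zero_succAbove, Fin.succ_zero_eq_one, smul_sub, Finset.sum_sub_distrib,
        ← Finset.sum_smul, sub_smul, one_smul]
      abel
    have hp1 : par (fun j => b ((1 : Fin (n + 2)).succAbove j)) l
        = par b (Fin.cons 0 l : Fin (n + 1) → ℝ) := by
      rw [par_cons, par]
      simp
    rw [hp0, hp1]
    have hd : ∀ s : ℝ, HasDerivAt (fun s => f (par b (Fin.cons s l : Fin (n + 1) → ℝ)))
        (fderiv ℝ f (par b (Fin.cons s l : Fin (n + 1) → ℝ)) (b 1 - b 0)) s := by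
      intro s
      have h2 : HasDerivAt (fun s => par b (Fin.cons s l : Fin (n + 1) → ℝ)) (b 1 - b 0) s := by
        simp only [par_cons]
        simpa using (((hasDerivAt_id s).smul_const (b 1 - b 0)).const_add (b 0)).add_const
          (∑ i : Fin n, l i • (b i.succ.succ - b 0))
      exact ((hf.differentiable (by norm_num)).differentiableAt.hasFDerivAt).comp_hasDerivAt s h2
    refine intervalIntegral.integral_eq_sub_of_hasDerivAt (fun s _ => hd s) ?_
    refine Continuous.intervalIntegrable ?_ _ _
    refine hcont.comp ((continuous_par b).comp ?_)
    exact Continuous.finCons continuous_id continuous_const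
  · exact (hf.continuous.comp (continuous_par _)).continuousOn.integrableOn_compact
      (isCompact_unitSimplex _)
  · exact (hf.continuous.comp (continuous_par _)).continuousOn.integrableOn_compact
      (isCompact_unitSimplex _)

variable (b : AffineBasis (Fin (n + 2)) ℝ (E (n + 1)))

lemma vs_reindex (e : Fin (n + 2) ≃ Fin (n + 2)) : vs (b.reindex e) = vs b := by
  apply Finset.coe_injective
  rw [coe_vs, coe_vs, AffineBasis.coe_reindex, e.symm.surjective.range_comp]

lemma fc_reindex (e : Fin (n + 2) ≃ Fin (n + 2)) (i : Fin (n + 2)) :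
    fc (b.reindex e) (e i) = fc b i := by
  obtain ⟨j, hj⟩ := (mem_facesOf_iff b).1 (vs_reindex b e ▸ fc_mem_facesOf (b.reindex e) (e i))
  rw [← hj]
  congr 1
  by_contra h
  have h1 : b i ∈ fc b j := (mem_fc b).2 (Ne.symm h)
  rw [hj, show b i = b.reindex e (e i) by simp, mem_fc] at h1
  exact h1 rfl

lemma cgrad_reindex (e : Fin (n + 2) ≃ Fin (n + 2)) (i : Fin (n + 2)) :
    cgrad (b.reindex e) (e i) = cgrad b i := by
  simp [cgrad]

lemma integral_fderiv_edge {f : E (n + 1) → ℝ} (hf : ContDiff ℝ 1 f) (i j : Fin (n + 2)) :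
    ∫ x, fderiv ℝ f x (b j - b i) ∂cellMeasure (vs b)
      = ‖cgrad b i‖⁻¹ * ∫ x, f x ∂faceMeasure (fc b i)
        - ‖cgrad b j‖⁻¹ * ∫ x, f x ∂faceMeasure (fc b j) := by
  rcases eq_or_ne i j with rfl | hij
  · simp
  · let e0 : Equiv.Perm (Fin (n + 2)) := Equiv.swap i 0
    -- The first transposition takes i to 0; the second takes the image of j to 1 and leaves 0
    -- fixed.
    let e : Equiv.Perm (Fin (n + 2)) := e0.trans (Equiv.swap (e0 j) 1)
    have hi : e i = 0 := by
      have h1 : e0 i = 0 := Equiv.swap_apply_left i 0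
      have h2 : e0 j ≠ 0 := fun h => hij (e0.injective (h1.trans h.symm))
      simp only [e, Equiv.trans_apply, h1]
      exact Equiv.swap_apply_of_ne_of_ne h2.symm (by simp)
    have hj : e j = 1 := by
      simp only [e, Equiv.trans_apply]
      exact Equiv.swap_apply_left _ _
    have := integral_fderiv_edge_zero (b.reindex e) hf
    rw [vs_reindex, ← hi, ← hj, fc_reindex, fc_reindex, cgrad_reindex, cgrad_reindex] at this
    simpa using this

/-- The divergence theorem on a simplex. -/
theorem integral_fderiv_cell {f : E (n + 1) → ℝ} (hf : ContDiff ℝ 1 f) (v : E (n + 1)) :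
    ∫ x, fderiv ℝ f x v ∂cellMeasure (vs b)
      = ∑ i, inner ℝ v (normal (vs b) (fc b i)) * ∫ x, f x ∂faceMeasure (fc b i) := by
  have h1 : ∀ x, fderiv ℝ f x v = ∑ j, inner ℝ (cgrad b j) v * fderiv ℝ f x (b j - b 0) := by
    intro x
    conv_lhs => rw [← sum_cgrad_smul_sub b v 0]
    simp [map_sum]
  have hcont : ∀ w, Continuous fun x => fderiv ℝ f x w := fun w =>
    (hf.continuous_fderiv (by norm_num)).clm_apply continuous_const
  simp only [h1]
  rw [integral_finsetSum]
  · simp only [integral_const_mul, integral_fderiv_edge b hf, mul_sub, Finset.sum_sub_distrib]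
    -- In the expansion of v in edges from vertex 0, the integral over face 0 is multiplied by the
    -- sum of all ⟨∇λ_j, v⟩, which is 0.
    simp only [← Finset.sum_mul, sum_inner_cgrad, zero_mul, zero_sub, ← Finset.sum_neg_distrib]
    refine Finset.sum_congr rfl fun i _ => ?_
    rw [inner_normal]
    ring
  · intro j _
    exact ((hcont _).continuousOn.integrableOn_compact (isCompact_simplex _)).const_mul _

end Divergence

/-! ### Mollification towards an interior ball -/

section Mollify

variable {d : ℕ} {c : E d}

/-- The mollifying kernel at scale `s`. -/
def molKernel (φ : ContDiffBump c) (s : ℝ) (w : E d) : ℝ :=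
  |(s ^ d)⁻¹| * φ.normed volume (-(s⁻¹ • w))

/-- The average of `F` over `(1 - s) x + s z` with `z` distributed as the bump function. -/
def mollify (φ : ContDiffBump c) (s : ℝ) (F : E d → ℝ) (x : E d) : ℝ :=
  convolution F (molKernel φ s) (ContinuousLinearMap.lsmul ℝ ℝ) volume ((1 - s) • x)

/-- The distribution given by a bump function. -/
def bumpMeasure (φ : ContDiffBump c) : Measure (E d) :=
  volume.withDensity fun z => ENNReal.ofReal (φ.normed volume z)

instance (φ : ContDiffBump c) : IsProbabilityMeasure (bumpMeasure φ) := by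
  refine ⟨?_⟩
  rw [bumpMeasure, withDensity_apply _ MeasurableSet.univ, Measure.restrict_univ,
    ← ofReal_integral_eq_lintegral_ofReal φ.integrable_normed
      (Eventually.of_forall fun z => φ.nonneg_normed z), φ.integral_normed, ENNReal.ofReal_one]

lemma contDiff_molKernel (φ : ContDiffBump c) (s : ℝ) : ContDiff ℝ ∞ (molKernel φ s) := by
  unfold molKernel
  refine contDiff_const.mul (φ.contDiff_normed.comp ?_)
  fun_prop

lemma molKernel_ne_zero {φ : ContDiffBump c} {s : ℝ} (hs : s ≠ 0) {w : E d}
    (h : molKernel φ s w ≠ 0) : ∃ z ∈ Metric.closedBall c φ.rOut, w = -(s • z) := by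
  have h1 : φ.normed volume (-(s⁻¹ • w)) ≠ 0 := right_ne_zero_of_mul h
  have h2 : -(s⁻¹ • w) ∈ Function.support (φ.normed volume) := h1
  rw [φ.support_normed_eq] at h2
  refine ⟨_, Metric.ball_subset_closedBall h2, ?_⟩
  rw [smul_neg, neg_neg, smul_smul, mul_inv_cancel₀ hs, one_smul]

lemma hasCompactSupport_molKernel (φ : ContDiffBump c) {s : ℝ} (hs : s ≠ 0) :
    HasCompactSupport (molKernel φ s) := by
  have hK : IsCompact ((fun z : E d => -(s • z)) '' Metric.closedBall c φ.rOut) :=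
    (isCompact_closedBall _ _).image (by fun_prop)
  refine HasCompactSupport.of_support_subset_isCompact hK fun w hw => ?_
  obtain ⟨z, hz, rfl⟩ := molKernel_ne_zero hs hw
  exact ⟨z, hz, rfl⟩

/-- A change of variables. The convolution form gives smoothness, the averaged form gives the L²
bound and the convergence. -/
lemma mollify_eq_integral (φ : ContDiffBump c) {s : ℝ} (hs : 0 < s) (F : E d → ℝ) (x : E d) :
    mollify φ s F x = ∫ z, F ((1 - s) • x + s • z) ∂bumpMeasure φ := by
  have hm : Measurable fun z => ENNReal.ofReal (φ.normed volume z) :=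
    (φ.contDiff_normed (n := 0)).continuous.measurable.ennreal_ofReal
  rw [mollify, convolution_lsmul, bumpMeasure, integral_withDensity_eq_integral_toReal_smul
    hm (by simp)]
  set X := (1 - s) • x
  rw [← integral_sub_left_eq_self _ _ X, ← integral_neg_eq_self]
  have h1 := Measure.integral_comp_smul (volume : Measure (E d))
    (fun z => φ.normed volume (s⁻¹ • z) * F (X + z)) s
  rw [finrank_euclideanSpace_fin] at h1
  have h2 : ∀ z, (ENNReal.ofReal (φ.normed volume z)).toReal • F (X + s • z)
      = φ.normed volume (s⁻¹ • s • z) * F (X + s • z) := fun z => by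
    rw [ENNReal.toReal_ofReal (φ.nonneg_normed z), smul_smul, inv_mul_cancel₀ hs.ne', one_smul,
      smul_eq_mul]
  simp only [h2]
  rw [h1, smul_eq_mul, ← integral_const_mul]
  refine integral_congr_ae (Eventually.of_forall fun z => ?_)
  simp only [smul_eq_mul, molKernel, sub_neg_eq_add, sub_add_cancel_left, smul_neg, neg_neg]
  ring

lemma contDiff_mollify (φ : ContDiffBump c) {s : ℝ} (hs : s ≠ 0) {F : E d → ℝ}
    (hF : LocallyIntegrable F volume) : ContDiff ℝ ∞ (mollify φ s F) := by
  have := (hasCompactSupport_molKernel φ hs).contDiff_convolution_right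
    (ContinuousLinearMap.lsmul ℝ ℝ) hF (contDiff_molKernel φ s)
  exact this.comp (contDiff_const_smul (1 - s))

lemma mollify_sub (φ : ContDiffBump c) {s : ℝ} (hs : s ≠ 0) {F F' : E d → ℝ}
    (hF : LocallyIntegrable F volume) (hF' : LocallyIntegrable F' volume) (x : E d) :
    mollify φ s (fun y => F y - F' y) x = mollify φ s F x - mollify φ s F' x := by
  have h1 := (hasCompactSupport_molKernel φ hs).convolutionExists_right
    (ContinuousLinearMap.lsmul ℝ ℝ) hF (contDiff_molKernel φ s).continuous ((1 - s) • x)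
  have h2 := (hasCompactSupport_molKernel φ hs).convolutionExists_right
    (ContinuousLinearMap.lsmul ℝ ℝ) hF' (contDiff_molKernel φ s).continuous ((1 - s) • x)
  simp only [mollify, convolution_def]
  rw [← integral_sub h1 h2]
  simp

lemma mollify_congr (φ : ContDiffBump c) (s : ℝ) {F F' : E d → ℝ} (h : F =ᵐ[volume] F') :
    mollify φ s F = mollify φ s F' := by
  funext x
  simp only [mollify, convolution_def]
  exact integral_congr_ae (h.mono fun t ht => by simp only [ht])

lemma eLpNorm_two_sq {α V : Type*} [MeasurableSpace α] [NormedAddCommGroup V] (μ : Measure α)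
    (f : α → V) : eLpNorm f 2 μ ^ 2 = ∫⁻ x, ‖f x‖ₑ ^ 2 ∂μ := by
  have := eLpNorm_nnreal_pow_eq_lintegral (f := f) (μ := μ) (p := 2) (by norm_num)
  norm_num at this
  exact_mod_cast this

lemma enorm_integral_sq_le {α : Type*} [MeasurableSpace α] (P : Measure α)
    [IsProbabilityMeasure P] {f : α → ℝ} (hf : AEStronglyMeasurable f P) :
    ‖∫ z, f z ∂P‖ₑ ^ 2 ≤ ∫⁻ z, ‖f z‖ₑ ^ 2 ∂P := by
  rw [← eLpNorm_two_sq]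
  gcongr
  refine (enorm_integral_le_lintegral_enorm f).trans ?_
  rw [← eLpNorm_one_eq_lintegral_enorm]
  exact eLpNorm_le_eLpNorm_of_exponent_le (by norm_num) hf

/-- Jensen's inequality for the average and Tonelli's theorem. For fixed z the map x ↦ (1 − s) x + s
z is a dilation by at least 1/2, which costs at most the factor 2^d. -/
lemma eLpNorm_mollify_le (φ : ContDiffBump c) {s : ℝ} (hs : 0 < s) (hs' : s ≤ 1 / 2)
    {F : E d → ℝ} (hF : AEStronglyMeasurable F volume) :
    eLpNorm (mollify φ s F) 2 volume ^ 2 ≤ ENNReal.ofReal (2 ^ d) * eLpNorm F 2 volume ^ 2 := by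
  -- Tonelli needs joint measurability in x and z, hence a strongly measurable representative.
  rw [mollify_congr φ s hF.ae_eq_mk, eLpNorm_congr_ae hF.ae_eq_mk]
  set F' := hF.mk F with hF'
  have hm : StronglyMeasurable F' := hF.stronglyMeasurable_mk
  rw [eLpNorm_two_sq, eLpNorm_two_sq]
  have hmeas : Measurable (fun p : E d × E d => F' ((1 - s) • p.1 + s • p.2)) :=
    hm.measurable.comp (by fun_prop)
  calc ∫⁻ x, ‖mollify φ s F' x‖ₑ ^ 2
      ≤ ∫⁻ x, (∫⁻ z, ‖F' ((1 - s) • x + s • z)‖ₑ ^ 2 ∂bumpMeasure φ) := by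
        refine lintegral_mono fun x => ?_
        simp only
        rw [mollify_eq_integral φ hs]
        exact enorm_integral_sq_le _ (hm.comp_measurable (by fun_prop)).aestronglyMeasurable
    _ = ∫⁻ z, (∫⁻ x, ‖F' ((1 - s) • x + s • z)‖ₑ ^ 2) ∂bumpMeasure φ := by
        refine lintegral_lintegral_swap ?_
        exact (hmeas.enorm.pow_const 2).aemeasurable
    _ = ∫⁻ _z, (ENNReal.ofReal |((1 - s) ^ d)⁻¹| * ∫⁻ x, ‖F' x‖ₑ ^ 2) ∂bumpMeasure φ := by
        refine lintegral_congr fun z => ?_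
        have h1 := lintegral_map (μ := volume) (f := fun x => ‖F' (x + s • z)‖ₑ ^ 2)
          (g := fun x : E d => (1 - s) • x) (by fun_prop) (by fun_prop)
        rw [← h1, Measure.map_addHaar_smul volume (by linarith), lintegral_smul_measure,
          lintegral_add_right_eq_self (fun x => ‖F' x‖ₑ ^ 2), finrank_euclideanSpace_fin,
          smul_eq_mul]
    _ ≤ ENNReal.ofReal (2 ^ d) * ∫⁻ x, ‖F' x‖ₑ ^ 2 := by
        rw [lintegral_const, measure_univ, mul_one]
        gcongr
        rw [abs_of_nonneg (inv_nonneg.2 (pow_nonneg (by linarith) d)), ← inv_pow]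
        refine pow_le_pow_left₀ (inv_nonneg.2 (by linarith)) ?_ d
        rw [inv_le_comm₀ (by linarith) (by norm_num)]
        linarith

/-- The factor 2^d in place of its square root is wasteful but keeps the inequality free of
fractional powers. -/
lemma eLpNorm_mollify_le' (φ : ContDiffBump c) {s : ℝ} (hs : 0 < s) (hs' : s ≤ 1 / 2)
    {F : E d → ℝ} (hF : AEStronglyMeasurable F volume) :
    eLpNorm (mollify φ s F) 2 volume ≤ ENNReal.ofReal (2 ^ d) * eLpNorm F 2 volume := by
  have h1 := eLpNorm_mollify_le φ hs hs' hF
  have h2 : (1 : ENNReal) ≤ ENNReal.ofReal (2 ^ d) := by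
    rw [← ENNReal.ofReal_one]
    exact ENNReal.ofReal_le_ofReal (one_le_pow₀ (by norm_num))
  have h3 : eLpNorm (mollify φ s F) 2 volume ^ 2
      ≤ (ENNReal.ofReal (2 ^ d) * eLpNorm F 2 volume) ^ 2 := by
    refine h1.trans ?_
    rw [mul_pow]
    gcongr
    exact le_self_pow₀ h2 (by norm_num)
  exact (ENNReal.pow_le_pow_left_iff (by norm_num)).1 h3

lemma ae_bumpMeasure_mem (φ : ContDiffBump c) :
    ∀ᵐ z ∂bumpMeasure φ, z ∈ Metric.closedBall c φ.rOut := by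
  have hm : Measurable fun z => ENNReal.ofReal (φ.normed volume z) :=
    (φ.contDiff_normed (n := 0)).continuous.measurable.ennreal_ofReal
  rw [bumpMeasure, ae_withDensity_iff hm]
  refine Eventually.of_forall fun z hz => ?_
  have h2 : z ∈ Function.support (φ.normed volume) := fun h => hz (by rw [h]; simp)
  rw [φ.support_normed_eq] at h2
  exact Metric.ball_subset_closedBall h2

lemma abs_mollify_sub_le (φ : ContDiffBump c) {s : ℝ} (hs : 0 < s) {w : E d → ℝ}
    (hw : Continuous w) (hwc : HasCompactSupport w) {x : E d} {η : ℝ}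
    (h : ∀ z ∈ Metric.closedBall c φ.rOut, |w ((1 - s) • x + s • z) - w x| ≤ η) :
    ‖mollify φ s w x - w x‖ ≤ η := by
  have hint : Integrable (fun z => w ((1 - s) • x + s • z)) (bumpMeasure φ) := by
    obtain ⟨C, hC⟩ := hwc.exists_bound_of_continuous hw
    refine Integrable.of_bound (Continuous.aestronglyMeasurable (by fun_prop)) C ?_
    exact Eventually.of_forall fun z => hC _
  have h1 : mollify φ s w x - w x
      = ∫ z, (w ((1 - s) • x + s • z) - w x) ∂bumpMeasure φ := by
    rw [mollify_eq_integral φ hs, integral_sub hint (integrable_const _)]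
    simp
  rw [h1]
  have := norm_integral_le_of_norm_le_const (μ := bumpMeasure φ) (C := η)
    (f := fun z => w ((1 - s) • x + s • z) - w x)
    ((ae_bumpMeasure_mem φ).mono fun z hz => h z hz)
  simpa using this

/-- The scales used for mollification. -/
def scale (n : ℕ) : ℝ := 1 / ((n : ℝ) + 2)

lemma scale_pos (n : ℕ) : 0 < scale n := by unfold scale; positivity

lemma scale_le (n : ℕ) : scale n ≤ 1 / 2 := by
  unfold scale
  gcongr
  have : (0 : ℝ) ≤ n := by positivity
  linarith

lemma tendsto_scale : Tendsto scale atTop (𝓝 0) := by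
  have := tendsto_one_div_add_atTop_nhds_zero_nat (𝕜 := ℝ)
  refine ((tendsto_add_atTop_iff_nat 1).2 this).congr fun n => ?_
  unfold scale
  push_cast
  ring

/-- F is replaced by a continuous w of compact support. The uniform L² bound handles the average of
F − w, and uniform continuity handles w on the bounded set S. -/
lemma tendsto_mollify (φ : ContDiffBump c) {F : E d → ℝ} (hF : MemLp F 2 volume) {S : Set (E d)}
    (hS : Bornology.IsBounded S) (hSm : MeasurableSet S) :
    Tendsto (fun n => eLpNorm (fun x => mollify φ (scale n) F x - F x) 2 (volume.restrict S))
      atTop (𝓝 0) := by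
  have hSv : volume S ≠ ⊤ := hS.measure_lt_top.ne
  set V : ℝ := ((volume S) ^ (2 : ENNReal).toReal⁻¹).toReal with hV
  have hVeq : (volume S) ^ (2 : ENNReal).toReal⁻¹ = ENNReal.ofReal V :=
    (ENNReal.ofReal_toReal (ENNReal.rpow_ne_top_of_nonneg (by norm_num) hSv)).symm
  set A : ℝ := 2 ^ d + 1 + V with hA
  have hA0 : 0 < A := by positivity
  have main : ∀ e : ℝ, 0 < e → ∀ᶠ n in atTop,
      eLpNorm (fun x => mollify φ (scale n) F x - F x) 2 (volume.restrict S)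
        ≤ ENNReal.ofReal (A * e) := by
    intro e he
    obtain ⟨w, hwc, hwF, hw, hwL⟩ := hF.exists_hasCompactSupport_eLpNorm_sub_le
      (by norm_num) (ε := ENNReal.ofReal e) (by simpa using he)
    have hu : UniformContinuous w := hwc.uniformContinuous_of_continuous hw
    obtain ⟨δ, hδ, hδw⟩ := Metric.uniformContinuous_iff.1 hu e he
    obtain ⟨R, hR⟩ := (Metric.isBounded_iff.1
      (hS.union (Metric.isBounded_closedBall (x := c) (r := φ.rOut))))
    -- The averaging moves x by s (z − x), and R bounds all distances between points of S and of the
    -- ball.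
    have hev : ∀ᶠ n in atTop, scale n * (|R| + 1) < δ := by
      have := tendsto_scale.mul_const (|R| + 1)
      rw [zero_mul] at this
      exact this.eventually_lt_const hδ
    filter_upwards [hev] with n hn
    have hs := scale_pos n
    have hLF := hF.locallyIntegrable (by norm_num)
    have hLw : LocallyIntegrable w volume := hw.locallyIntegrable
    have h1 : eLpNorm (fun x => mollify φ (scale n) w x - w x) 2 (volume.restrict S)
        ≤ ENNReal.ofReal (V * e) := by
      have hb : ∀ᵐ x ∂(volume.restrict S), ‖mollify φ (scale n) w x - w x‖ ≤ e := by
        refine (ae_restrict_iff' hSm).2 (Eventually.of_forall fun x hx => ?_)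
        refine abs_mollify_sub_le φ hs hw hwc fun z hz => ?_
        rw [← Real.dist_eq]
        refine (hδw ?_).le
        have he1 : (1 - scale n) • x + scale n • z - x = scale n • (z - x) := by
          rw [sub_smul, one_smul, smul_sub]; abel
        rw [dist_eq_norm, he1, norm_smul, Real.norm_of_nonneg hs.le, ← dist_eq_norm]
        refine lt_of_le_of_lt ?_ hn
        gcongr
        have := hR (Or.inr hz) (Or.inl hx)
        have := le_abs_self R
        linarith
      have := eLpNorm_le_of_ae_bound (p := 2) hb
      rw [Measure.restrict_apply_univ, hVeq, ← ENNReal.ofReal_mul (by positivity)] at this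
      exact this
    have h2 : eLpNorm (mollify φ (scale n) (fun y => F y - w y)) 2 (volume.restrict S)
        ≤ ENNReal.ofReal (2 ^ d * e) := by
      refine (eLpNorm_mono_measure _ Measure.restrict_le_self).trans ?_
      refine (eLpNorm_mollify_le' φ hs (scale_le n) (hF.1.sub hwL.1)).trans ?_
      rw [ENNReal.ofReal_mul (by positivity)]
      gcongr
    have h3 : eLpNorm (fun x => w x - F x) 2 (volume.restrict S) ≤ ENNReal.ofReal e := by
      refine (eLpNorm_mono_measure _ Measure.restrict_le_self).trans ?_
      refine le_trans (le_of_eq ?_) hwF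
      exact eLpNorm_sub_comm w F 2 volume
    have hms : ∀ G : E d → ℝ, LocallyIntegrable G volume →
        AEStronglyMeasurable (mollify φ (scale n) G) (volume.restrict S) := fun G hG =>
      (contDiff_mollify φ hs.ne' hG).continuous.aestronglyMeasurable
    have hsplit : (fun x => mollify φ (scale n) F x - F x)
        = (fun x => mollify φ (scale n) (fun y => F y - w y) x)
          + ((fun x => mollify φ (scale n) w x - w x) + fun x => w x - F x) := by
      funext x
      simp only [Pi.add_apply]
      rw [mollify_sub φ hs.ne' hLF hLw]
      ring
    rw [hsplit]
    refine (eLpNorm_add_le (hms _ (hLF.sub hLw)) (((hms _ hLw).sub hw.aestronglyMeasurable).add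
      (hw.aestronglyMeasurable.sub hF.1.restrict)) (by norm_num)).trans ?_
    refine (add_le_add le_rfl (eLpNorm_add_le ((hms _ hLw).sub hw.aestronglyMeasurable)
      (hw.aestronglyMeasurable.sub hF.1.restrict) (by norm_num))).trans ?_
    refine (add_le_add h2 (add_le_add h1 h3)).trans ?_
    rw [← ENNReal.ofReal_add (by positivity) (by positivity),
      ← ENNReal.ofReal_add (by positivity) (by positivity)]
    apply ENNReal.ofReal_le_ofReal
    rw [hA]
    linarith
  rw [ENNReal.tendsto_nhds_zero]
  intro ε hε
  by_cases ht : ε = ⊤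
  · simp [ht]
  · have he : 0 < ε.toReal / A := div_pos (ENNReal.toReal_pos hε.ne' ht) hA0
    filter_upwards [main _ he] with n hn
    rwa [mul_div_cancel₀ _ hA0.ne', ENNReal.ofReal_toReal ht] at hn

end Mollify

/-! ### Functions in `H¹` of a simplex -/

section CellH1

variable {d : ℕ}

/-- `v` is in `H¹` of the simplex `K`, with weak gradient `g`. -/
structure CellH1 (K : Finset (E d)) (v : E d → ℝ) (g : E d → E d) : Prop where
  memLp : MemLp v 2 (cellMeasure K)
  memLp_grad : MemLp g 2 (cellMeasure K)
  weak : HasWeakGrad (interior (simplex K)) v g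

/-- The frontier of a convex set is null. Weak derivatives live on the open interior, the integrals
of the theorem on the closed simplex. -/
lemma restrict_interior_simplex (K : Finset (E d)) :
    (volume : Measure (E d)).restrict (interior (simplex K)) = cellMeasure K :=
  Measure.restrict_congr_set
    (interior_ae_eq_of_null_frontier ((convex_simplex K).addHaar_frontier volume))

lemma pd_eq_gradient {ψ : E d → ℝ} (x : E d) (i : Fin d) : gradient ψ x i = pd i ψ x := by
  rw [pd]
  have h : inner ℝ (gradient ψ x) (EuclideanSpace.single i (1 : ℝ)) = gradient ψ x i := by
    rw [EuclideanSpace.inner_single_right, one_mul]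
    rfl
  rw [← h, gradient, InnerProductSpace.toDual_symm_apply]

lemma continuous_pd {ψ : E d → ℝ} (h : ContDiff ℝ 1 ψ) (i : Fin d) : Continuous (pd i ψ) :=
  (h.continuous_fderiv (by norm_num)).clm_apply continuous_const

lemma continuous_gradient {ψ : E d → ℝ} (h : ContDiff ℝ 1 ψ) : Continuous (gradient ψ) :=
  (InnerProductSpace.toDual ℝ (E d)).symm.continuous.comp (h.continuous_fderiv (by norm_num))

lemma inner_gradient {ψ : E d → ℝ} (x v : E d) : inner ℝ (gradient ψ x) v = fderiv ℝ ψ x v := by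
  rw [gradient, InnerProductSpace.toDual_symm_apply]

lemma eLpNorm_le_sum_coord {α : Type*} [MeasurableSpace α] {μ : Measure α} {f : α → E d}
    (hf : ∀ i, AEStronglyMeasurable (fun x => f x i) μ) :
    eLpNorm f 2 μ ≤ ∑ i, eLpNorm (fun x => f x i) 2 μ := by
  have h1 : f = ∑ i, fun x => f x i • EuclideanSpace.single i (1 : ℝ) := by
    funext x
    ext j
    simp [Finset.sum_apply, Pi.single_apply]
  conv_lhs => rw [h1]
  refine (eLpNorm_sum_le (fun i _ => (hf i).smul_const _) (by norm_num)).trans ?_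
  refine Finset.sum_le_sum fun i _ => le_of_eq ?_
  refine eLpNorm_congr_norm_ae (Eventually.of_forall fun x => ?_)
  simp [norm_smul]

lemma continuous_memLp_of_compact {V : Type*} [NormedAddCommGroup V] {μ : Measure (E d)}
    [IsFiniteMeasure μ] {S : Set (E d)}
    (hS : IsCompact S) (hμ : ∀ᵐ x ∂μ, x ∈ S) {f : E d → V} (hf : Continuous f) (p : ENNReal) :
    MemLp f p μ := by
  obtain ⟨C, hC⟩ := hS.exists_bound_of_continuousOn hf.continuousOn
  exact MemLp.of_bound hf.aestronglyMeasurable C (hμ.mono fun x hx => hC x hx)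

lemma ae_cellMeasure_mem (K : Finset (E d)) : ∀ᵐ x ∂cellMeasure K, x ∈ simplex K :=
  ae_restrict_mem (measurableSet_simplex K)

lemma ae_faceMeasure_mem (F : Finset (E d)) : ∀ᵐ x ∂faceMeasure F, x ∈ simplex F :=
  ae_restrict_mem (measurableSet_simplex F)

lemma memLp_cell {V : Type*} [NormedAddCommGroup V] (K : Finset (E d)) {f : E d → V}
    (hf : Continuous f) (p : ENNReal) : MemLp f p (cellMeasure K) :=
  continuous_memLp_of_compact (isCompact_simplex K) (ae_cellMeasure_mem K) hf p

lemma fderiv_mollify {c : E d} (φ : ContDiffBump c) {s : ℝ} (hs : s ≠ 0) {F : E d → ℝ}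
    (hF : LocallyIntegrable F volume) (x e : E d) :
    fderiv ℝ (mollify φ s F) x e
      = (1 - s) * ∫ t, F t * fderiv ℝ (molKernel φ s) ((1 - s) • x - t) e := by
  have hK := hasCompactSupport_molKernel φ hs
  have hK1 : ContDiff ℝ 1 (molKernel φ s) := (contDiff_molKernel φ s).of_le (by norm_cast)
  have h1 := hK.hasFDerivAt_convolution_right (ContinuousLinearMap.lsmul ℝ ℝ) hF hK1 ((1 - s) • x)
  have h2 : HasFDerivAt (fun y : E d => (1 - s) • y) ((1 - s) • ContinuousLinearMap.id ℝ (E d)) x :=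
    (hasFDerivAt_id x).const_smul (1 - s)
  have h3 := h1.comp x h2
  have h4 : fderiv ℝ (mollify φ s F) x = _ := h3.fderiv
  rw [h4, ContinuousLinearMap.comp_apply, smul_apply, map_smul,
    ContinuousLinearMap.id_apply, convolution_precompR_apply _ hF (hK.fderiv ℝ)
    (hK1.continuous_fderiv (by norm_num))]
  rfl

/-- For x in the closed simplex the kernel, as a function of the integration variable, is supported
in the points (1 − s) x + s z with z in the interior ball, so it is a test function in the open
simplex. Extending v by zero therefore creates no boundary term. -/
lemma pd_mollify {K : Finset (E d)} {v : E d → ℝ} {g : E d → E d} (h : CellH1 K v g)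
    {c : E d} (φ : ContDiffBump c) (hφ : Metric.closedBall c φ.rOut ⊆ interior (simplex K))
    {s : ℝ} (hs : 0 < s) (hs' : s ≤ 1 / 2) {x : E d} (hx : x ∈ simplex K) (i : Fin d) :
    pd i (mollify φ s ((simplex K).indicator v)) x
      = (1 - s) * mollify φ s ((simplex K).indicator fun y => g y i) x := by
  have hS := measurableSet_simplex K
  have hloc : LocallyIntegrable ((simplex K).indicator v) volume := by
    have : MemLp ((simplex K).indicator v) 2 volume := (memLp_indicator_iff_restrict hS).2 h.memLp
    exact this.locallyIntegrable (by norm_num)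
  have hK := hasCompactSupport_molKernel φ hs.ne'
  have hK1 : ContDiff ℝ 1 (molKernel φ s) := (contDiff_molKernel φ s).of_le (by norm_cast)
  rw [pd, fderiv_mollify φ hs.ne' hloc]
  congr 1
  set X := (1 - s) • x with hX
  let χ : E d → ℝ := fun y => molKernel φ s (X - y)
  have hsub : Function.support χ ⊆ (fun z : E d => X + s • z) '' Metric.closedBall c φ.rOut := by
    intro y hy
    obtain ⟨z, hz, hyz⟩ := molKernel_ne_zero hs.ne' hy
    refine ⟨z, hz, ?_⟩
    simp only
    rw [← neg_neg (s • z), ← hyz]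
    abel
  have hcpt : IsCompact ((fun z : E d => X + s • z) '' Metric.closedBall c φ.rOut) :=
    (isCompact_closedBall _ _).image (by fun_prop)
  have htest : IsTest (interior (simplex K)) χ := by
    refine ⟨?_, HasCompactSupport.of_support_subset_isCompact hcpt hsub, ?_⟩
    · exact (contDiff_molKernel φ s).comp (contDiff_const.sub contDiff_id)
    -- A proper convex combination of a point of a convex set with an interior point is interior.
    · refine (closure_minimal hsub hcpt.isClosed).trans ?_
      rintro _ ⟨z, hz, rfl⟩
      exact (convex_simplex K).combo_self_interior_mem_interior hx (hφ hz) (by linarith) hs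
        (by ring)
  have hw := h.weak χ htest i
  rw [restrict_interior_simplex] at hw
  have hpd : ∀ t, fderiv ℝ (molKernel φ s) (X - t) (EuclideanSpace.single i 1) = -pd i χ t := by
    intro t
    have h1 : HasFDerivAt χ (-(fderiv ℝ (molKernel φ s) (X - t))) t := by
      have h2 : HasFDerivAt (fun y : E d => X - y) (-ContinuousLinearMap.id ℝ (E d)) t :=
        (hasFDerivAt_id t).const_sub X
      refine (((hK1.differentiable (by norm_num) (X - t)).hasFDerivAt).comp t h2).congr_fderiv ?_
      ext
      simp
    rw [pd, h1.fderiv]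
    simp
  have e1 : ∀ (w k : E d → ℝ), ∫ t, (simplex K).indicator w t * k t
      = ∫ t, w t * k t ∂cellMeasure K := by
    intro w k
    rw [cellMeasure, ← integral_indicator hS]
    refine integral_congr_ae (Eventually.of_forall fun t => ?_)
    by_cases ht : t ∈ simplex K <;> simp [ht]
  rw [mollify, convolution_lsmul]
  simp only [smul_eq_mul]
  rw [e1, e1]
  simp only [hpd, mul_neg, integral_neg, hw, neg_neg]
  rfl

variable {n : ℕ} (b : AffineBasis (Fin (n + 2)) ℝ (E (n + 1)))

lemma interior_simplex_nonempty : (interior (simplex (vs b))).Nonempty := by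
  rw [interior_simplex_vs]
  refine ⟨barycentre (vs b), fun i => ?_⟩
  rw [coord_barycentre_vs]
  positivity

/-- Functions that are smooth up to the boundary are dense in `H¹` of a simplex. -/
theorem exists_smooth_approx {v : E (n + 1) → ℝ} {g : E (n + 1) → E (n + 1)}
    (h : CellH1 (vs b) v g) : ∃ ψ : ℕ → E (n + 1) → ℝ, (∀ m, ContDiff ℝ ∞ (ψ m)) ∧
      Tendsto (fun m => eLpNorm (fun x => ψ m x - v x) 2 (cellMeasure (vs b))) atTop (𝓝 0) ∧
      Tendsto (fun m => eLpNorm (fun x => gradient (ψ m) x - g x) 2 (cellMeasure (vs b)))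
        atTop (𝓝 0) := by
  obtain ⟨c, hc⟩ := interior_simplex_nonempty b
  obtain ⟨r, hr, hrS⟩ := Metric.nhds_basis_closedBall.mem_iff.1 (isOpen_interior.mem_nhds hc)
  let φ : ContDiffBump c := ⟨r / 2, r, by positivity, by linarith⟩
  set S := simplex (vs b) with hSdef
  have hS : MeasurableSet S := measurableSet_simplex _
  have hbd : Bornology.IsBounded S := (isCompact_simplex _).isBounded
  have hext : ∀ w : E (n + 1) → ℝ, MemLp w 2 (cellMeasure (vs b)) →
      MemLp (S.indicator w) 2 volume := fun w hw => (memLp_indicator_iff_restrict hS).2 hw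
  have hconv : ∀ w : E (n + 1) → ℝ, MemLp w 2 (cellMeasure (vs b)) →
      Tendsto (fun m => eLpNorm (fun x => mollify φ (scale m) (S.indicator w) x - w x) 2
        (cellMeasure (vs b))) atTop (𝓝 0) := by
    intro w hw
    refine (tendsto_mollify φ (hext w hw) hbd hS).congr fun m => ?_
    refine eLpNorm_congr_ae ((ae_restrict_iff' hS).2 (Eventually.of_forall fun x hx => ?_))
    simp only [Set.indicator_of_mem hx]
  have hsm : ∀ (w : E (n + 1) → ℝ), MemLp w 2 (cellMeasure (vs b)) → ∀ m,
      ContDiff ℝ ∞ (mollify φ (scale m) (S.indicator w)) := fun w hw m =>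
    contDiff_mollify φ (scale_pos m).ne' ((hext w hw).locallyIntegrable (by norm_num))
  refine ⟨fun m => mollify φ (scale m) (S.indicator v), hsm v h.memLp, hconv v h.memLp, ?_⟩
  have hgi := memLp_coord h.memLp_grad
  have hcoord : ∀ i, Tendsto (fun m => eLpNorm (fun x =>
      gradient (mollify φ (scale m) (S.indicator v)) x i - g x i) 2 (cellMeasure (vs b)))
      atTop (𝓝 0) := by
    intro i
    have hlim := (hconv _ (hgi i)).add (ENNReal.Tendsto.mul_const
      (ENNReal.tendsto_ofReal tendsto_scale)
      (Or.inr (hgi i).2.ne) (b := eLpNorm (fun x => g x i) 2 (cellMeasure (vs b))))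
    simp only [ENNReal.ofReal_zero, zero_mul, add_zero] at hlim
    refine tendsto_of_tendsto_of_tendsto_of_le_of_le tendsto_const_nhds hlim
      (fun _ => zero_le) fun m => ?_
    have hs := scale_pos m
    have hs' := scale_le m
    set A : E (n + 1) → ℝ := fun x =>
      mollify φ (scale m) (S.indicator fun y => g y i) x - g x i with hA
    set B : E (n + 1) → ℝ := fun x => g x i with hB
    -- The derivative of the average is (1 − s) times the average of g_i. Its distance from g_i is
    -- (1 − s) times the mollification error minus s g_i, and both tend to 0.
    have heq : (fun x => gradient (mollify φ (scale m) (S.indicator v)) x i - g x i)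
        =ᵐ[cellMeasure (vs b)] (1 - scale m) • A + (-scale m) • B := by
      refine (ae_restrict_iff' hS).2 (Eventually.of_forall fun x hx => ?_)
      simp only [Pi.add_apply, Pi.smul_apply, smul_eq_mul, hA, hB]
      rw [pd_eq_gradient, pd_mollify h φ hrS hs hs' hx]
      ring
    rw [eLpNorm_congr_ae heq]
    have hBm : AEStronglyMeasurable B (cellMeasure (vs b)) := (hgi i).1
    have hAm : AEStronglyMeasurable A (cellMeasure (vs b)) :=
      (hsm _ (hgi i) m).continuous.aestronglyMeasurable.sub hBm
    refine (eLpNorm_add_le (hAm.const_smul _) (hBm.const_smul _) (by norm_num)).trans ?_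
    refine add_le_add ?_ ?_
    · refine eLpNorm_const_smul_le.trans ?_
      refine mul_le_of_le_one_left zero_le ?_
      rw [Real.enorm_eq_ofReal (by linarith), ENNReal.ofReal_le_one]
      linarith
    · refine eLpNorm_const_smul_le.trans (le_of_eq ?_)
      rw [enorm_neg, Real.enorm_eq_ofReal hs.le]
  have hsum := tendsto_finsetSum (Finset.univ) fun i _ => hcoord i
  simp only [Finset.sum_const_zero] at hsum
  refine tendsto_of_tendsto_of_tendsto_of_le_of_le tendsto_const_nhds hsum
    (fun _ => zero_le) fun m => ?_
  refine eLpNorm_le_sum_coord (f := fun x => gradient _ x - g x) fun i => ?_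
  have hgc : Continuous (gradient (mollify φ (scale m) (S.indicator v))) :=
    continuous_gradient ((hsm v h.memLp m).of_le (by norm_cast))
  have : Continuous fun x => gradient (mollify φ (scale m) (S.indicator v)) x i := by fun_prop
  exact this.aestronglyMeasurable.sub (hgi i).1

end CellH1

/-! ### Traces of functions in `H¹` of a simplex -/

section Trace

variable {n : ℕ} (b : AffineBasis (Fin (n + 2)) ℝ (E (n + 1)))

lemma vertex_mem_simplex (i : Fin (n + 2)) : b i ∈ simplex (vs b) :=
  subset_convexHull ℝ _ (by rw [coe_vs]; exact ⟨i, rfl⟩)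

lemma dist_le_diam {x y : E (n + 1)} (hx : x ∈ simplex (vs b)) (hy : y ∈ simplex (vs b)) :
    dist x y ≤ Metric.diam (simplex (vs b)) :=
  Metric.dist_le_diam_of_mem (isCompact_simplex _).isBounded hx hy

instance (i : Fin (n + 2)) : IsFiniteMeasure (faceMeasure (fc b i)) :=
  isFiniteMeasure_faceMeasure b i

lemma memLp_face {V : Type*} [NormedAddCommGroup V] (i : Fin (n + 2)) {f : E (n + 1) → V}
    (hf : Continuous f) (p : ENNReal) : MemLp f p (faceMeasure (fc b i)) := by
  have := isFiniteMeasure_faceMeasure b i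
  exact continuous_memLp_of_compact (isCompact_simplex _) (ae_faceMeasure_mem _) hf p

/-- The divergence theorem for the field (x − b i) ψ². Its normal component vanishes on the faces
through b i; on the opposite face (x − b i)·n is the height 1/‖∇λ_i‖. -/
lemma integral_face_sq {ψ : E (n + 1) → ℝ} (hψ : ContDiff ℝ 1 ψ) (i : Fin (n + 2)) :
    ‖cgrad b i‖⁻¹ * ∫ x, ψ x ^ 2 ∂faceMeasure (fc b i)
      = ∫ x, ((n + 1 : ℝ) * ψ x ^ 2 + 2 * ψ x * fderiv ℝ ψ x (x - b i)) ∂cellMeasure (vs b) := by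
  let f : Fin (n + 1) → E (n + 1) → ℝ := fun m x => (x m - b i m) * ψ x ^ 2
  have hf : ∀ m, ContDiff ℝ 1 (f m) := fun m => by
    have : ContDiff ℝ 1 fun x : E (n + 1) => x m := by fun_prop
    exact (this.sub contDiff_const).mul (hψ.pow 2)
  have hder : ∀ m x, fderiv ℝ (f m) x (EuclideanSpace.single m 1)
      = ψ x ^ 2 + 2 * ψ x * ((x m - b i m) * fderiv ℝ ψ x (EuclideanSpace.single m 1)) := by
    intro m x
    have h1 : HasFDerivAt (fun y : E (n + 1) => y m - b i m)
        (EuclideanSpace.proj m : E (n + 1) →L[ℝ] ℝ) x :=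
      ((EuclideanSpace.proj m : E (n + 1) →L[ℝ] ℝ).hasFDerivAt).sub_const _
    have h2 := ((hψ.differentiable (by norm_num) x).hasFDerivAt).pow 2
    have h3 : fderiv ℝ (f m) x = _ := (h1.mul h2).fderiv
    rw [h3]
    simp
    ring
  have hcont : ∀ m, Continuous fun x => fderiv ℝ (f m) x (EuclideanSpace.single m 1) := fun m =>
    ((hf m).continuous_fderiv (by norm_num)).clm_apply continuous_const
  have hsum : ∀ x, ∑ m, fderiv ℝ (f m) x (EuclideanSpace.single m 1)
      = (n + 1 : ℝ) * ψ x ^ 2 + 2 * ψ x * fderiv ℝ ψ x (x - b i) := by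
    intro x
    have h1 : x - b i = ∑ m, (x m - b i m) • EuclideanSpace.single m (1 : ℝ) := by
      ext j
      simp [Finset.sum_apply, Pi.single_apply]
    simp only [hder, Finset.sum_add_distrib, ← Finset.mul_sum]
    conv_rhs => rw [h1]
    simp [map_sum]
  simp only [← hsum]
  rw [integral_finsetSum _ fun m _ => (memLp_cell (vs b) (hcont m) 1).integrable le_rfl]
  simp only [integral_fderiv_cell b (hf _)]
  rw [Finset.sum_comm]
  have hface : ∀ j, ∑ m, inner ℝ (EuclideanSpace.single m (1 : ℝ)) (normal (vs b) (fc b j)) *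
      ∫ x, f m x ∂faceMeasure (fc b j)
      = if i = j then ‖cgrad b i‖⁻¹ * ∫ x, ψ x ^ 2 ∂faceMeasure (fc b i) else 0 := by
    intro j
    simp only [← integral_const_mul]
    rw [← integral_finsetSum _ fun m _ =>
      ((memLp_face b j (hf m).continuous 1).integrable le_rfl).const_mul _]
    have h1 : ∀ x, ∑ m, inner ℝ (EuclideanSpace.single m (1 : ℝ)) (normal (vs b) (fc b j)) * f m x
        = inner ℝ (x - b i) (normal (vs b) (fc b j)) * ψ x ^ 2 := by
      intro x
      simp only [f, ← mul_assoc, ← Finset.sum_mul]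
      congr 1
      rw [PiLp.inner_apply]
      simp [EuclideanSpace.inner_single_left]
    simp only [h1]
    have h2 : ∀ᵐ x ∂faceMeasure (fc b j), inner ℝ (x - b i) (normal (vs b) (fc b j)) * ψ x ^ 2
        = (if i = j then ‖cgrad b i‖⁻¹ else 0) * ψ x ^ 2 := by
      filter_upwards [ae_faceMeasure_mem (fc b j)] with x hx
      congr 1
      rw [inner_normal]
      have h3 := coord_eq_add b j x (b i)
      rw [((mem_simplex_fc b).1 hx).1, b.coord_apply] at h3
      rcases eq_or_ne i j with rfl | hij
      · rw [if_pos rfl] at h3 ⊢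
        rw [show inner ℝ (cgrad b i) (x - b i) = -1 by linarith]
        ring
      · rw [if_neg hij.symm] at h3
        rw [if_neg hij, show inner ℝ (cgrad b j) (x - b i) = 0 by linarith]
        ring
    rw [integral_congr_ae h2, integral_const_mul]
    split_ifs with hij
    · rw [hij, integral_const_mul]
    · simp
  simp only [hface]
  simp

/-- In the identity above |x − b i| is at most the diameter, and the Cauchy-Schwarz inequality
bounds the term with the derivative. -/
lemma trace_inequality_smooth {ψ : E (n + 1) → ℝ} (hψ : ContDiff ℝ 1 ψ) (i : Fin (n + 2)) :
    ‖cgrad b i‖⁻¹ * l2 (faceMeasure (fc b i)) ψ ^ 2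
      ≤ (n + 1 : ℝ) * l2 (cellMeasure (vs b)) ψ ^ 2 + 2 * Metric.diam (simplex (vs b)) *
        (l2 (cellMeasure (vs b)) ψ * l2 (cellMeasure (vs b)) (gradient ψ)) := by
  rw [l2_sq_real, integral_face_sq b hψ i]
  have hgc := continuous_gradient hψ
  have hψ2 : MemLp ψ 2 (cellMeasure (vs b)) := memLp_cell _ hψ.continuous 2
  have hg2 : MemLp (gradient ψ) 2 (cellMeasure (vs b)) := memLp_cell _ hgc 2
  have hc2 : Continuous fun x => 2 * ψ x * fderiv ℝ ψ x (x - b i) :=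
    (continuous_const.mul hψ.continuous).mul
      ((hψ.continuous_fderiv (by norm_num)).clm_apply (continuous_id.sub continuous_const))
  have hc1 : Continuous fun x => (n + 1 : ℝ) * ψ x ^ 2 := by
    have := hψ.continuous
    fun_prop
  rw [integral_add ((memLp_cell _ hc1 1).integrable le_rfl)
    ((memLp_cell _ hc2 1).integrable le_rfl), integral_const_mul, ← l2_sq_real]
  gcongr
  have h1 : ∫ x, 2 * ψ x * fderiv ℝ ψ x (x - b i) ∂cellMeasure (vs b)
      ≤ ∫ x, 2 * Metric.diam (simplex (vs b)) * (‖ψ x‖ * ‖gradient ψ x‖) ∂cellMeasure (vs b) := by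
    refine integral_mono_ae ((memLp_cell _ hc2 1).integrable le_rfl)
      ((integrable_mul_of_memLp hψ2.norm hg2.norm).const_mul _) ?_
    filter_upwards [ae_cellMeasure_mem (vs b)] with x hx
    have h2 : |fderiv ℝ ψ x (x - b i)| ≤ ‖gradient ψ x‖ * Metric.diam (simplex (vs b)) := by
      rw [← inner_gradient]
      refine (abs_real_inner_le_norm _ _).trans ?_
      gcongr
      rw [← dist_eq_norm]
      exact dist_le_diam b hx (vertex_mem_simplex b i)
    calc 2 * ψ x * fderiv ℝ ψ x (x - b i) ≤ |2 * ψ x * fderiv ℝ ψ x (x - b i)| := le_abs_self _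
      _ = 2 * |ψ x| * |fderiv ℝ ψ x (x - b i)| := by rw [abs_mul, abs_mul]; norm_num
      _ ≤ 2 * |ψ x| * (‖gradient ψ x‖ * Metric.diam (simplex (vs b))) := by gcongr
      _ = _ := by rw [Real.norm_eq_abs]; ring
  refine h1.trans ?_
  rw [integral_const_mul]
  gcongr
  have h3 := abs_integral_mul_le hψ2.norm hg2.norm
  refine (le_abs_self _).trans (h3.trans_eq ?_)
  simp [l2]

/-- The sum of the surface measures of the faces. -/
def bdryMeasure : Measure (E (n + 1)) := ∑ i, faceMeasure (fc b i)

lemma faceMeasure_le_bdry (i : Fin (n + 2)) : faceMeasure (fc b i) ≤ bdryMeasure b := by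
  rw [bdryMeasure, ← Finset.add_sum_erase _ _ (Finset.mem_univ i)]
  exact Measure.le_add_right le_rfl

instance : IsFiniteMeasure (bdryMeasure b) := by
  have := isFiniteMeasure_faceMeasure b
  unfold bdryMeasure
  infer_instance

lemma memLp_bdry {f : E (n + 1) → ℝ} (hf : Continuous f) : MemLp f 2 (bdryMeasure b) := by
  obtain ⟨C, hC⟩ := (isCompact_simplex (vs b)).exists_bound_of_continuousOn hf.continuousOn
  refine MemLp.of_bound hf.aestronglyMeasurable C ?_
  rw [bdryMeasure, ae_finsetSum_measure_iff]
  intro i _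
  exact (ae_faceMeasure_mem _).mono fun x hx => hC x (simplex_mono (fc_subset b i) hx)

lemma l2_bdry_sq {f : E (n + 1) → ℝ} (hf : Continuous f) :
    l2 (bdryMeasure b) f ^ 2 = ∑ i, l2 (faceMeasure (fc b i)) f ^ 2 := by
  simp only [l2_sq, bdryMeasure]
  refine integral_finsetSum_measure fun i _ => ?_
  exact integrable_norm_sq (memLp_face b i hf 2)

lemma gradient_sub' {ψ χ : E (n + 1) → ℝ} (hψ : ContDiff ℝ 1 ψ) (hχ : ContDiff ℝ 1 χ)
    (x : E (n + 1)) : gradient (fun y => ψ y - χ y) x = gradient ψ x - gradient χ x := by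
  simp only [gradient]
  rw [fderiv_fun_sub (hψ.differentiable (by norm_num) x) (hχ.differentiable (by norm_num) x),
    map_sub]

/-- Functions in `H¹` of a simplex have a trace. -/
theorem exists_hasTrace {v : E (n + 1) → ℝ} {g : E (n + 1) → E (n + 1)}
    (h : CellH1 (vs b) v g) : ∃ t, HasTrace (vs b) v t := by
  obtain ⟨ψ, hψ, hv, hg⟩ := exists_smooth_approx b h
  have hψ1 : ∀ m, ContDiff ℝ 1 (ψ m) := fun m => (hψ m).of_le (by norm_cast)
  set κ := cellMeasure (vs b)
  have hψL : ∀ m, MemLp (ψ m) 2 κ := fun m => memLp_cell _ (hψ m).continuous 2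
  have hgL : ∀ m, MemLp (gradient (ψ m)) 2 κ := fun m =>
    memLp_cell _ (continuous_gradient (hψ1 m)) 2
  have hv' := tendsto_l2_of_eLpNorm hψL h.memLp hv
  have hg' := tendsto_l2_of_eLpNorm hgL h.memLp_grad hg
  let A : ℕ → ℝ := fun m => l2 κ (fun x => ψ m x - v x) + l2 κ (fun x => gradient (ψ m) x - g x)
  have hA : Tendsto A atTop (𝓝 0) := by simpa using hv'.add hg'
  have hA0 : ∀ m, 0 ≤ A m := fun m => add_nonneg (l2_nonneg _) (l2_nonneg _)
  set D := Metric.diam (simplex (vs b))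
  have hD : 0 ≤ D := Metric.diam_nonneg
  let M : ℝ := ∑ i, ‖cgrad b i‖ * (n + 1 + 2 * D)
  have hM : 0 ≤ M := Finset.sum_nonneg fun i _ => by positivity
  -- The boundary values are a Cauchy sequence, by the trace inequality for differences. One space
  -- for the whole boundary gives one limit function for all faces; M collects the constants of the
  -- faces.
  let T : ℕ → Lp ℝ 2 (bdryMeasure b) := fun m => (memLp_bdry b (hψ m).continuous).toLp (ψ m)
  have hdist : ∀ m l, dist (T m) (T l) ≤ Real.sqrt M * (A m + A l) := by
    intro m l
    have hsub : ContDiff ℝ 1 fun x => ψ m x - ψ l x := (hψ1 m).sub (hψ1 l)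
    have h0 : dist (T m) (T l) = l2 (bdryMeasure b) fun x => ψ m x - ψ l x := by
      rw [dist_eq_norm, ← MemLp.toLp_sub, Lp.norm_toLp, ← l2_eq_eLpNorm]
      · rfl
      · exact (memLp_bdry b (hψ m).continuous).sub (memLp_bdry b (hψ l).continuous)
    have h1 : l2 κ (fun x => ψ m x - ψ l x) ≤ A m + A l := by
      have h2 := l2_sub_le ((hψL m).sub h.memLp) ((hψL l).sub h.memLp)
      simp only [Pi.sub_apply, sub_sub_sub_cancel_right] at h2
      refine h2.trans (add_le_add ?_ ?_)
      · exact le_add_of_nonneg_right (l2_nonneg _)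
      · exact le_add_of_nonneg_right (l2_nonneg _)
    have h3 : l2 κ (gradient fun x => ψ m x - ψ l x) ≤ A m + A l := by
      have h2 := l2_sub_le ((hgL m).sub h.memLp_grad) ((hgL l).sub h.memLp_grad)
      simp only [Pi.sub_apply, sub_sub_sub_cancel_right] at h2
      rw [show (gradient fun x => ψ m x - ψ l x) = fun x => gradient (ψ m) x - gradient (ψ l) x from
        funext fun x => gradient_sub' (hψ1 m) (hψ1 l) x]
      refine h2.trans (add_le_add ?_ ?_)
      · exact le_add_of_nonneg_left (l2_nonneg _)
      · exact le_add_of_nonneg_left (l2_nonneg _)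
    have hs : 0 ≤ A m + A l := add_nonneg (hA0 m) (hA0 l)
    rw [h0]
    refine abs_le_of_sq_le_sq' ?_ (by positivity) |>.2
    rw [l2_bdry_sq b hsub.continuous, mul_pow, Real.sq_sqrt hM, Finset.sum_mul]
    refine Finset.sum_le_sum fun i _ => ?_
    have hpos := norm_cgrad_pos b i
    have h4 := trace_inequality_smooth b hsub i
    have h5 : (n + 1 : ℝ) * l2 κ (fun x => ψ m x - ψ l x) ^ 2 + 2 * D *
        (l2 κ (fun x => ψ m x - ψ l x) * l2 κ (gradient fun x => ψ m x - ψ l x))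
        ≤ (n + 1 + 2 * D) * (A m + A l) ^ 2 := by
      have e1 : l2 κ (fun x => ψ m x - ψ l x) ^ 2 ≤ (A m + A l) ^ 2 :=
        pow_le_pow_left₀ (l2_nonneg _) h1 2
      have e2 : l2 κ (fun x => ψ m x - ψ l x) * l2 κ (gradient fun x => ψ m x - ψ l x)
          ≤ (A m + A l) ^ 2 := by
        rw [sq]
        exact mul_le_mul h1 h3 (l2_nonneg _) hs
      have e3 : (n + 1 : ℝ) * l2 κ (fun x => ψ m x - ψ l x) ^ 2 ≤ (n + 1 : ℝ) * (A m + A l) ^ 2 :=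
        mul_le_mul_of_nonneg_left e1 (by positivity)
      have e4 := mul_le_mul_of_nonneg_left e2 (by positivity : 0 ≤ 2 * D)
      linarith
    have h6 := h4.trans h5
    rw [inv_mul_le_iff₀ hpos] at h6
    linarith
  have hcauchy : CauchySeq T := by
    rw [cauchySeq_iff_tendsto_dist_atTop_0]
    refine squeeze_zero (fun _ => dist_nonneg) (fun p => hdist p.1 p.2) ?_
    rw [← prod_atTop_atTop_eq]
    have e1 : Tendsto (fun p : ℕ × ℕ => A p.1) (atTop ×ˢ atTop) (𝓝 0) := hA.comp tendsto_fst
    have e2 : Tendsto (fun p : ℕ × ℕ => A p.2) (atTop ×ˢ atTop) (𝓝 0) := hA.comp tendsto_snd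
    simpa using (e1.add e2).const_mul (Real.sqrt M)
  obtain ⟨t, ht⟩ := cauchySeq_tendsto_of_complete hcauchy
  have hconv : Tendsto (fun m => eLpNorm (fun x => ψ m x - t x) 2 (bdryMeasure b)) atTop (𝓝 0) := by
    have := (Lp.tendsto_Lp_iff_tendsto_eLpNorm' T t).1 ht
    refine this.congr fun m => ?_
    refine eLpNorm_congr_ae ?_
    filter_upwards [(memLp_bdry b (hψ m).continuous).coeFn_toLp] with x hx
    simp only [Pi.sub_apply, T, hx]
  refine ⟨t, ?_, g, ψ, hψ, h.memLp, h.memLp_grad, hv, hg, ?_⟩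
  · intro F hF
    obtain ⟨i, rfl⟩ := (mem_facesOf_iff b).1 hF
    exact (Lp.memLp t).mono_measure (faceMeasure_le_bdry b i)
  · intro F hF
    obtain ⟨i, rfl⟩ := (mem_facesOf_iff b).1 hF
    exact tendsto_of_tendsto_of_tendsto_of_le_of_le tendsto_const_nhds hconv
      (fun _ => zero_le) fun m => eLpNorm_mono_measure _ (faceMeasure_le_bdry b i)

lemma hasTrace_trace {v : E (n + 1) → ℝ} {g : E (n + 1) → E (n + 1)}
    (h : CellH1 (vs b) v g) : HasTrace (vs b) v (trace (vs b) v) := by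
  have := exists_hasTrace b h
  rw [trace, dif_pos this]
  exact this.choose_spec

lemma memLp_trace {v : E (n + 1) → ℝ} {g : E (n + 1) → E (n + 1)} (h : CellH1 (vs b) v g)
    (i : Fin (n + 2)) : MemLp (trace (vs b) v) 2 (faceMeasure (fc b i)) :=
  (hasTrace_trace b h).1 _ (fc_mem_facesOf b i)

lemma integral_by_parts_smooth {ψ χ : E (n + 1) → ℝ} (hψ : ContDiff ℝ 1 ψ) (hχ : ContDiff ℝ 1 χ)
    (i : Fin (n + 1)) :
    (∫ x, gradient ψ x i * χ x ∂cellMeasure (vs b)) + ∫ x, ψ x * pd i χ x ∂cellMeasure (vs b)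
      = ∑ j, normal (vs b) (fc b j) i * ∫ x, ψ x * χ x ∂faceMeasure (fc b j) := by
  have h := integral_fderiv_cell b (f := fun x => ψ x * χ x) (hψ.mul hχ) (EuclideanSpace.single i 1)
  have h1 : ∀ x, fderiv ℝ (fun x => ψ x * χ x) x (EuclideanSpace.single i 1)
      = gradient ψ x i * χ x + ψ x * pd i χ x := by
    intro x
    rw [fderiv_fun_mul (hψ.differentiable (by norm_num) x) (hχ.differentiable (by norm_num) x),
      pd_eq_gradient, pd, pd]
    simp
    ring
  simp only [h1] at h
  have hc1 : Continuous fun x => gradient ψ x i * χ x := by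
    have := continuous_gradient hψ
    have := hχ.continuous
    fun_prop
  have hc2 : Continuous fun x => ψ x * pd i χ x := hψ.continuous.mul (continuous_pd hχ i)
  rw [integral_add ((memLp_cell _ hc1 1).integrable le_rfl)
    ((memLp_cell _ hc2 1).integrable le_rfl)] at h
  rw [h]
  refine Finset.sum_congr rfl fun j _ => ?_
  rw [EuclideanSpace.inner_single_left]
  simp

/-- Weak gradients are unique. -/
lemma ae_eq_of_weak {K : Finset (E (n + 1))} {v : E (n + 1) → ℝ} {g G : E (n + 1) → E (n + 1)}
    (hg : MemLp g 2 (cellMeasure K)) (hG : MemLp G 2 (cellMeasure K))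
    (h : HasWeakGrad (interior (simplex K)) v g) (h' : HasWeakGrad (interior (simplex K)) v G) :
    g =ᵐ[cellMeasure K] G := by
  have key : ∀ i, ∀ᵐ x ∂cellMeasure K, g x i - G x i = 0 := by
    intro i
    have hL : MemLp (fun x => g x i - G x i) 2 (cellMeasure K) :=
      (memLp_coord hg i).sub (memLp_coord hG i)
    have hint : IntegrableOn (fun x => g x i - G x i) (interior (simplex K)) := by
      rw [IntegrableOn, restrict_interior_simplex]
      exact hL.integrable (by norm_num)
    have := isOpen_interior.ae_eq_zero_of_integral_contDiff_smul_eq_zero (μ := volume)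
      (U := interior (simplex K)) (f := fun x => g x i - G x i) hint.locallyIntegrableOn ?_
    · rw [← restrict_interior_simplex]
      exact (ae_restrict_iff' isOpen_interior.measurableSet).2 this
    · intro χ hχ hχc hχs
      have e1 := h χ ⟨hχ, hχc, hχs⟩ i
      have e2 := h' χ ⟨hχ, hχc, hχs⟩ i
      rw [restrict_interior_simplex] at e1 e2
      have hχL : MemLp χ 2 (cellMeasure K) := memLp_cell K hχ.continuous 2
      have e3 : ∫ x, χ x • (g x i - G x i)
          = ∫ x in interior (simplex K), χ x • (g x i - G x i) := by
        refine (setIntegral_eq_integral_of_forall_compl_eq_zero fun x hx => ?_).symm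
        rw [image_eq_zero_of_notMem_tsupport fun h => hx (hχs h), zero_smul]
      rw [e3, restrict_interior_simplex]
      simp only [smul_eq_mul, mul_comm (χ _), sub_mul]
      rw [integral_sub (integrable_mul_of_memLp (memLp_coord hg i) hχL)
        (integrable_mul_of_memLp (memLp_coord hG i) hχL)]
      linarith
  filter_upwards [ae_all_iff.2 key] with x hx
  ext i
  exact sub_eq_zero.1 (hx i)

lemma notMem_face_of_interior {x : E (n + 1)} (hx : x ∈ interior (simplex (vs b)))
    (i : Fin (n + 2)) : x ∉ simplex (fc b i) := by
  intro h
  rw [interior_simplex_vs] at hx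
  exact (hx i).ne' ((mem_simplex_fc b).1 h).1

/-- Smooth functions that approximate a function of `H¹` together with its trace. -/
theorem exists_approx_trace {v : E (n + 1) → ℝ} {g : E (n + 1) → E (n + 1)}
    (h : CellH1 (vs b) v g) : ∃ ψ : ℕ → E (n + 1) → ℝ, (∀ m, ContDiff ℝ ∞ (ψ m)) ∧
      Tendsto (fun m => eLpNorm (fun x => ψ m x - v x) 2 (cellMeasure (vs b))) atTop (𝓝 0) ∧
      Tendsto (fun m => eLpNorm (fun x => gradient (ψ m) x - g x) 2 (cellMeasure (vs b)))
        atTop (𝓝 0) ∧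
      ∀ i, Tendsto (fun m => eLpNorm (fun x => ψ m x - trace (vs b) v x) 2
        (faceMeasure (fc b i))) atTop (𝓝 0) := by
  obtain ⟨-, G, ψ, hψ, -, hGL, hv, hG, hF⟩ := hasTrace_trace b h
  refine ⟨ψ, hψ, hv, ?_, fun i => hF _ (fc_mem_facesOf b i)⟩
  have hψ1 : ∀ m, ContDiff ℝ 1 (ψ m) := fun m => (hψ m).of_le (by norm_cast)
  -- The definition of a trace supplies only some limit G of the gradients. Integration by parts
  -- against test functions, in the limit, shows that G is a weak gradient of v, so it agrees with g
  -- almost everywhere.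
  have hweak : HasWeakGrad (interior (simplex (vs b))) v G := by
    intro χ hχ i
    rw [restrict_interior_simplex]
    have hχ1 : ContDiff ℝ 1 χ := hχ.1.of_le (by norm_cast)
    have hzero : ∀ m, (∫ x, gradient (ψ m) x i * χ x ∂cellMeasure (vs b))
        + ∫ x, ψ m x * pd i χ x ∂cellMeasure (vs b) = 0 := by
      intro m
      rw [integral_by_parts_smooth b (hψ1 m) hχ1]
      refine Finset.sum_eq_zero fun j _ => ?_
      rw [integral_eq_zero_of_ae, mul_zero]
      filter_upwards [ae_faceMeasure_mem (fc b j)] with x hx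
      have : χ x = 0 := image_eq_zero_of_notMem_tsupport fun hx' =>
        notMem_face_of_interior b (hχ.2.2 hx') j hx
      simp [this]
    have hψL : ∀ m, MemLp (ψ m) 2 (cellMeasure (vs b)) := fun m =>
      memLp_cell _ (hψ m).continuous 2
    have hgL : ∀ m, MemLp (gradient (ψ m)) 2 (cellMeasure (vs b)) := fun m =>
      memLp_cell _ (continuous_gradient (hψ1 m)) 2
    have t1 := tendsto_integral_mul hψL h.memLp (memLp_cell (vs b) (continuous_pd hχ1 i) 2) hv
    have t2 := tendsto_integral_mul (fun m => memLp_coord (hgL m) i) (memLp_coord hGL i)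
      (memLp_cell (vs b) hχ.1.continuous 2)
      (tendsto_of_tendsto_of_tendsto_of_le_of_le tendsto_const_nhds hG (fun _ => zero_le)
        fun m => eLpNorm_mono fun x => PiLp.norm_apply_le (gradient (ψ m) x - G x) i)
    have t3 := (t2.add t1).congr hzero
    have := tendsto_nhds_unique t3 tendsto_const_nhds
    linarith
  have hae := ae_eq_of_weak hGL h.memLp_grad hweak h.weak
  refine hG.congr fun m => eLpNorm_congr_ae (hae.mono fun x hx => ?_)
  simp only [hx]

/-- Integration by parts for functions in `H¹` of a simplex. -/
theorem integral_by_parts {v : E (n + 1) → ℝ} {g : E (n + 1) → E (n + 1)}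
    (h : CellH1 (vs b) v g) {χ : E (n + 1) → ℝ} (hχ : ContDiff ℝ 1 χ) (i : Fin (n + 1)) :
    (∫ x, g x i * χ x ∂cellMeasure (vs b)) + ∫ x, v x * pd i χ x ∂cellMeasure (vs b)
      = ∑ j, normal (vs b) (fc b j) i * ∫ x, trace (vs b) v x * χ x ∂faceMeasure (fc b j) := by
  obtain ⟨ψ, hψ, hv, hG, hF⟩ := exists_approx_trace b h
  have hψ1 : ∀ m, ContDiff ℝ 1 (ψ m) := fun m => (hψ m).of_le (by norm_cast)
  have hψL : ∀ m, MemLp (ψ m) 2 (cellMeasure (vs b)) := fun m =>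
    memLp_cell _ (hψ m).continuous 2
  have hgL : ∀ m, MemLp (gradient (ψ m)) 2 (cellMeasure (vs b)) := fun m =>
    memLp_cell _ (continuous_gradient (hψ1 m)) 2
  have t1 := tendsto_integral_mul hψL h.memLp (memLp_cell (vs b) (continuous_pd hχ i) 2) hv
  have t2 := tendsto_integral_mul (fun m => memLp_coord (hgL m) i) (memLp_coord h.memLp_grad i)
    (memLp_cell (vs b) hχ.continuous 2)
    (tendsto_of_tendsto_of_tendsto_of_le_of_le tendsto_const_nhds hG (fun _ => zero_le)
      fun m => eLpNorm_mono fun x => PiLp.norm_apply_le (gradient (ψ m) x - g x) i)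
  have t3 := tendsto_finsetSum Finset.univ fun j _ =>
    (tendsto_integral_mul (fun m => memLp_face b j (hψ m).continuous 2) (memLp_trace b h j)
      (memLp_face b j hχ.continuous 2) (hF j)).const_mul (normal (vs b) (fc b j) i)
  exact tendsto_nhds_unique (t2.add t1)
    (t3.congr fun m => (integral_by_parts_smooth b (hψ1 m) hχ i).symm)

/-- The trace inequality. -/
theorem trace_inequality {v : E (n + 1) → ℝ} {g : E (n + 1) → E (n + 1)}
    (h : CellH1 (vs b) v g) (c : ℝ) (i : Fin (n + 2)) :
    ‖cgrad b i‖⁻¹ * l2 (faceMeasure (fc b i)) (fun x => trace (vs b) v x - c) ^ 2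
      ≤ (n + 1 : ℝ) * l2 (cellMeasure (vs b)) (fun x => v x - c) ^ 2
        + 2 * Metric.diam (simplex (vs b)) *
          (l2 (cellMeasure (vs b)) (fun x => v x - c) * l2 (cellMeasure (vs b)) g) := by
  obtain ⟨ψ, hψ, hv, hG, hF⟩ := exists_approx_trace b h
  have hψ1 : ∀ m, ContDiff ℝ 1 (ψ m) := fun m => (hψ m).of_le (by norm_cast)
  have hfin := isFiniteMeasure_faceMeasure b
  have t1 : Tendsto (fun m => l2 (cellMeasure (vs b)) fun x => ψ m x - c) atTop
      (𝓝 (l2 (cellMeasure (vs b)) fun x => v x - c)) := by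
    refine tendsto_l2 (fun m => memLp_cell _ ((hψ m).continuous.sub continuous_const) 2)
      (h.memLp.sub (memLp_const c)) ?_
    simpa using hv
  have t2 := tendsto_l2 (fun m => memLp_cell (vs b) (continuous_gradient (hψ1 m)) 2)
    h.memLp_grad hG
  have t3 : Tendsto (fun m => l2 (faceMeasure (fc b i)) fun x => ψ m x - c) atTop
      (𝓝 (l2 (faceMeasure (fc b i)) fun x => trace (vs b) v x - c)) := by
    refine tendsto_l2 (fun m => memLp_face b i ((hψ m).continuous.sub continuous_const) 2)
      ((memLp_trace b h i).sub (memLp_const c)) ?_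
    simpa using hF i
  refine le_of_tendsto_of_tendsto' ((t3.pow 2).const_mul _)
    (((t1.pow 2).const_mul _).add ((t1.mul t2).const_mul _)) fun m => ?_
  have := trace_inequality_smooth b ((hψ1 m).sub (contDiff_const (c := c))) i
  have hgr : gradient (fun x => ψ m x - c) = gradient (ψ m) := by
    funext x
    simp only [gradient]
    rw [fderiv_sub_const]
  rw [hgr] at this
  exact this

end Trace

/-! ### The Poincaré inequality on a simplex -/

section Poincare

lemma lintegral_segment_le {d : ℕ} {h : E d → ENNReal} (hh : Measurable h) {t : ℝ} (ht : t ≤ 1 / 2)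
    (z : E d) : ∫⁻ x, h ((1 - t) • x + z) ≤ ENNReal.ofReal (2 ^ d) * ∫⁻ x, h x := by
  have h1 := lintegral_map (μ := volume) (f := fun x => h (x + z))
    (g := fun x : E d => (1 - t) • x) (by fun_prop) (by fun_prop)
  rw [← h1, Measure.map_addHaar_smul volume (by linarith), lintegral_smul_measure,
    lintegral_add_right_eq_self h, finrank_euclideanSpace_fin, smul_eq_mul]
  gcongr
  rw [abs_of_nonneg (by have : 0 ≤ 1 - t := by linarith
                        positivity), ← inv_pow]
  refine pow_le_pow_left₀ (by have : 0 ≤ 1 - t := by linarith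
                              positivity) ?_ d
  rw [inv_le_comm₀ (by linarith) (by norm_num)]
  linarith

/-- One of 1 − t and t is at least 1/2. The inner integral is taken in the variable with that
coefficient, where the substitution costs at most 2^d, and the other integral contributes the volume
of S. -/
lemma lintegral_lintegral_segment_le {d : ℕ} {S : Set (E d)} {h : E d → ENNReal}
    (hh : Measurable h) (t : ℝ) :
    ∫⁻ x in S, (∫⁻ y in S, h ((1 - t) • x + t • y))
      ≤ ENNReal.ofReal (2 ^ d) * volume S * ∫⁻ x, h x := by
  have hm : Measurable fun p : E d × E d => h ((1 - t) • p.1 + t • p.2) :=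
    hh.comp (by fun_prop)
  have fin : ∀ f : E d → E d → ENNReal, (∀ x, ∫⁻ y, f x y ≤ ENNReal.ofReal (2 ^ d) * ∫⁻ x, h x) →
      ∫⁻ x in S, (∫⁻ y in S, f x y) ≤ ENNReal.ofReal (2 ^ d) * volume S * ∫⁻ x, h x := by
    intro f hf
    calc ∫⁻ x in S, (∫⁻ y in S, f x y) ≤ ∫⁻ _x in S, ENNReal.ofReal (2 ^ d) * ∫⁻ x, h x :=
          lintegral_mono fun x => (setLIntegral_le_lintegral _ _).trans (hf x)
      _ = _ := by
          rw [setLIntegral_const]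
          ring
  rcases le_total t (1 / 2) with ht | ht
  · rw [lintegral_lintegral_swap hm.aemeasurable]
    exact fin _ fun y => lintegral_segment_le hh ht _
  · refine fin _ fun x => ?_
    have := lintegral_segment_le hh (t := 1 - t) (by linarith) ((1 - t) • x)
    simpa [sub_sub_cancel, add_comm] using this

/-- The fundamental theorem of calculus on the segment from x to y, followed by Jensen. Convexity
keeps the segment in S, so the indicator is harmless; it is what later permits integration over the
whole space. -/
lemma enorm_sub_sq_le {d : ℕ} {S : Set (E d)} (hS : Convex ℝ S) {D : ℝ}
    (hD : ∀ x ∈ S, ∀ y ∈ S, dist x y ≤ D) {ψ : E d → ℝ} (hψ : ContDiff ℝ 1 ψ)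
    {x y : E d} (hx : x ∈ S) (hy : y ∈ S) :
    ‖ψ x - ψ y‖ₑ ^ 2 ≤ ENNReal.ofReal (D ^ 2) * ∫⁻ t in Set.Icc (0 : ℝ) 1,
      S.indicator (fun z => ‖gradient ψ z‖ₑ ^ 2) ((1 - t) • x + t • y) := by
  have hder : ∀ t : ℝ, HasDerivAt (fun s : ℝ => ψ ((1 - s) • x + s • y))
      (fderiv ℝ ψ ((1 - t) • x + t • y) (y - x)) t := by
    intro t
    have h1 : HasDerivAt (fun s : ℝ => (1 - s) • x + s • y) (y - x) t := by
      have h2 := (((hasDerivAt_id t).const_sub 1).smul_const x).add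
        ((hasDerivAt_id t).smul_const y)
      have h3 : y - x = (-1 : ℝ) • x + (1 : ℝ) • y := by
        rw [neg_one_smul, one_smul, neg_add_eq_sub]
      rw [h3]
      exact h2
    exact ((hψ.differentiable (by norm_num) _).hasFDerivAt).comp_hasDerivAt t h1
  have hcont : Continuous fun t : ℝ => fderiv ℝ ψ ((1 - t) • x + t • y) (y - x) :=
    ((hψ.continuous_fderiv (by norm_num)).comp (by fun_prop)).clm_apply continuous_const
  have hftc := intervalIntegral.integral_eq_sub_of_hasDerivAt (a := 0) (b := 1)
    (fun t _ => hder t) (hcont.intervalIntegrable 0 1)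
  simp only [sub_zero, one_smul, zero_smul, add_zero, sub_self, zero_add] at hftc
  rw [← enorm_neg, neg_sub, ← hftc, intervalIntegral.integral_of_le zero_le_one,
    ← integral_Icc_eq_integral_Ioc]
  have : IsProbabilityMeasure ((volume : Measure ℝ).restrict (Set.Icc 0 1)) :=
    ⟨by simp⟩
  refine (enorm_integral_sq_le _ hcont.aestronglyMeasurable).trans ?_
  rw [← lintegral_const_mul' _ _ ENNReal.ofReal_ne_top]
  refine setLIntegral_mono' measurableSet_Icc fun t ht => ?_
  have hmem : (1 - t) • x + t • y ∈ S := hS hx hy (by linarith [ht.2]) ht.1 (by ring)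
  rw [Set.indicator_of_mem hmem, ← ofReal_norm, ← ofReal_norm,
    ← ENNReal.ofReal_pow (norm_nonneg _), ← ENNReal.ofReal_pow (norm_nonneg _),
    ← ENNReal.ofReal_mul (by positivity), ← mul_pow, ← inner_gradient]
  refine ENNReal.ofReal_le_ofReal (pow_le_pow_left₀ (norm_nonneg _) ?_ 2)
  refine (norm_inner_le_norm _ _).trans ?_
  rw [mul_comm]
  gcongr
  rw [← dist_eq_norm]
  exact hD y hy x hx

variable {n : ℕ} (b : AffineBasis (Fin (n + 2)) ℝ (E (n + 1)))

/-- ψ(x) minus the mean is the average of ψ(x) − ψ(y) over y. Jensen and the bound along segments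
reduce the claim to a triple integral in x, y, t. With t outermost the segment estimate applies, and
the volume of S cancels. -/
lemma poincare_smooth {ψ : E (n + 1) → ℝ} (hψ : ContDiff ℝ 1 ψ) :
    l2 (cellMeasure (vs b)) (fun x => ψ x
        - (∫ y, ψ y ∂cellMeasure (vs b)) * (volume.real (simplex (vs b)))⁻¹) ^ 2
      ≤ 2 ^ (n + 1) * Metric.diam (simplex (vs b)) ^ 2
        * l2 (cellMeasure (vs b)) (gradient ψ) ^ 2 := by
  set S := simplex (vs b) with hSdef
  set D := Metric.diam S
  have hSm : MeasurableSet S := measurableSet_simplex _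
  have hpos : volume S ≠ 0 :=
    (Measure.measure_pos_of_nonempty_interior _ (interior_simplex_nonempty b)).ne'
  have htop : volume S ≠ ⊤ := (isCompact_simplex _).measure_lt_top.ne
  set c := (∫ y, ψ y ∂cellMeasure (vs b)) * (volume.real S)⁻¹ with hc
  let P : Measure (E (n + 1)) := (volume S)⁻¹ • cellMeasure (vs b)
  have hP : IsProbabilityMeasure P := by
    refine ⟨?_⟩
    simp only [P, cellMeasure, Measure.smul_apply, Measure.restrict_apply MeasurableSet.univ,
      Set.univ_inter, smul_eq_mul]
    exact ENNReal.inv_mul_cancel hpos htop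
  have hcont := hψ.continuous
  have hint : Integrable ψ P :=
    ((memLp_cell (vs b) hcont 1).integrable le_rfl).smul_measure (ENNReal.inv_ne_top.2 hpos)
  have hcP : ∀ x, ψ x - c = ∫ y, (ψ x - ψ y) ∂P := by
    intro x
    rw [integral_sub (integrable_const _) hint, integral_const, probReal_univ, one_smul,
      integral_smul_measure, hc, ENNReal.toReal_inv, smul_eq_mul, mul_comm]
    rfl
  let h : E (n + 1) → ENNReal := S.indicator fun z => ‖gradient ψ z‖ₑ ^ 2
  have hgc := continuous_gradient hψ
  have hh : Measurable h := (hgc.measurable.enorm.pow_const 2).indicator hSm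
  have key : ∫⁻ x in S, ‖ψ x - c‖ₑ ^ 2
      ≤ ENNReal.ofReal (2 ^ (n + 1) * D ^ 2) * ∫⁻ x in S, ‖gradient ψ x‖ₑ ^ 2 := by
    have hm3 : Measurable fun p : (E (n + 1) × E (n + 1)) × ℝ =>
        h ((1 - p.2) • p.1.1 + p.2 • p.1.2) := hh.comp (by fun_prop)
    calc ∫⁻ x in S, ‖ψ x - c‖ₑ ^ 2
        ≤ ∫⁻ x in S, ((volume S)⁻¹ * ∫⁻ y in S, ‖ψ x - ψ y‖ₑ ^ 2) := by
          refine lintegral_mono fun x => ?_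
          simp only
          rw [hcP x]
          refine (enorm_integral_sq_le P ((continuous_const.sub hcont).aestronglyMeasurable)).trans ?_
          rw [lintegral_smul_measure]
          exact le_rfl
      _ ≤ ∫⁻ x in S, ((volume S)⁻¹ * ∫⁻ y in S, (ENNReal.ofReal (D ^ 2) *
            ∫⁻ t in Set.Icc (0 : ℝ) 1, h ((1 - t) • x + t • y))) := by
          refine setLIntegral_mono' hSm fun x hx => ?_
          gcongr (volume S)⁻¹ * ?_
          refine setLIntegral_mono' hSm fun y hy => ?_
          exact enorm_sub_sq_le (convex_simplex _)
            (fun _ h1 _ h2 => dist_le_diam b h1 h2) hψ hx hy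
      _ = (volume S)⁻¹ * ENNReal.ofReal (D ^ 2) * ∫⁻ t in Set.Icc (0 : ℝ) 1,
            (∫⁻ x in S, (∫⁻ y in S, h ((1 - t) • x + t • y))) := by
          simp only [lintegral_const_mul' _ _ ENNReal.ofReal_ne_top]
          rw [lintegral_const_mul' _ _ (ENNReal.inv_ne_top.2 hpos),
            lintegral_const_mul' _ _ ENNReal.ofReal_ne_top, mul_assoc]
          congr 2
          have i1 : ∀ x : E (n + 1), ∫⁻ y in S, (∫⁻ t in Set.Icc (0 : ℝ) 1,
              h ((1 - t) • x + t • y)) = ∫⁻ t in Set.Icc (0 : ℝ) 1,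
              (∫⁻ y in S, h ((1 - t) • x + t • y)) := fun x =>
            lintegral_lintegral_swap (hh.comp (by fun_prop)).aemeasurable
          simp only [i1]
          rw [lintegral_lintegral_swap]
          · refine Measurable.aemeasurable ?_
            refine Measurable.lintegral_prod_right'
              (f := fun q : (E (n + 1) × ℝ) × E (n + 1) =>
                h ((1 - q.1.2) • q.1.1 + q.1.2 • q.2)) ?_
            exact hh.comp (by fun_prop)
      _ ≤ (volume S)⁻¹ * ENNReal.ofReal (D ^ 2) * ∫⁻ _t in Set.Icc (0 : ℝ) 1,
            (ENNReal.ofReal (2 ^ (n + 1)) * volume S * ∫⁻ x, h x) := by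
          gcongr with t
          exact lintegral_lintegral_segment_le hh t
      _ = ENNReal.ofReal (2 ^ (n + 1) * D ^ 2) * ∫⁻ x in S, ‖gradient ψ x‖ₑ ^ 2 := by
          rw [setLIntegral_const, Real.volume_Icc, lintegral_indicator hSm,
            ENNReal.ofReal_mul (by positivity)]
          simp only [sub_zero, ENNReal.ofReal_one, mul_one]
          calc _ = ((volume S)⁻¹ * volume S) * (ENNReal.ofReal (2 ^ (n + 1)) *
              ENNReal.ofReal (D ^ 2) * ∫⁻ x in S, ‖gradient ψ x‖ₑ ^ 2) := by ring
            _ = _ := by rw [ENNReal.inv_mul_cancel hpos htop, one_mul]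
  have e1 : MemLp (fun x => ψ x - c) 2 (cellMeasure (vs b)) :=
    memLp_cell _ (hcont.sub continuous_const) 2
  have e2 : MemLp (gradient ψ) 2 (cellMeasure (vs b)) := memLp_cell _ hgc 2
  rw [l2_eq_eLpNorm e1, l2_eq_eLpNorm e2, ← ENNReal.toReal_pow, ← ENNReal.toReal_pow,
    eLpNorm_two_sq, eLpNorm_two_sq]
  refine (ENNReal.toReal_mono ?_ key).trans_eq ?_
  · refine ENNReal.mul_ne_top ENNReal.ofReal_ne_top ?_
    have := e2.2.ne
    rw [← eLpNorm_two_sq]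
    exact ENNReal.pow_ne_top this
  · rw [ENNReal.toReal_mul, ENNReal.toReal_ofReal (by positivity)]
    rfl

/-- The Poincaré inequality. -/
theorem exists_poincare {v : E (n + 1) → ℝ} {g : E (n + 1) → E (n + 1)}
    (h : CellH1 (vs b) v g) : ∃ c : ℝ,
      l2 (cellMeasure (vs b)) (fun x => v x - c) ^ 2
        ≤ 2 ^ (n + 1) * Metric.diam (simplex (vs b)) ^ 2 * l2 (cellMeasure (vs b)) g ^ 2 := by
  obtain ⟨ψ, hψ, hv, hG⟩ := exists_smooth_approx b h
  have hψ1 : ∀ m, ContDiff ℝ 1 (ψ m) := fun m => (hψ m).of_le (by norm_cast)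
  set κ := cellMeasure (vs b)
  set a := (volume.real (simplex (vs b)))⁻¹
  have hψL : ∀ m, MemLp (ψ m) 2 κ := fun m => memLp_cell _ (hψ m).continuous 2
  have hc : Tendsto (fun m => (∫ x, ψ m x * 1 ∂κ) * a) atTop (𝓝 ((∫ x, v x * 1 ∂κ) * a)) :=
    (tendsto_integral_mul hψL h.memLp (memLp_const 1) hv).mul_const a
  simp only [mul_one] at hc
  set c : ℝ := (∫ x, v x ∂κ) * a
  refine ⟨c, ?_⟩
  have hv' := tendsto_l2_of_eLpNorm hψL h.memLp hv
  have hg' := tendsto_l2 (fun m => memLp_cell (vs b) (continuous_gradient (hψ1 m)) 2)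
    h.memLp_grad hG
  have hc' : Tendsto (fun m => |(∫ x, ψ m x ∂κ) * a - c| * l2 κ fun _ => (1 : ℝ)) atTop (𝓝 0) := by
    have := ((hc.sub_const c).abs).mul_const (l2 κ fun _ => (1 : ℝ))
    simpa using this
  set M := 2 ^ (n + 1) * Metric.diam (simplex (vs b)) ^ 2
  -- Here v is compared with ψ m, then ψ m with its own mean, and that mean with the mean c of v.
  -- The first and the last distance vanish in the limit.
  have hbound : ∀ m, l2 κ (fun x => v x - c) ≤ l2 κ (fun x => ψ m x - v x) +
      Real.sqrt (M * l2 κ (gradient (ψ m)) ^ 2) +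
      |(∫ x, ψ m x ∂κ) * a - c| * l2 κ fun _ => (1 : ℝ) := by
    intro m
    set cm := (∫ x, ψ m x ∂κ) * a
    have e1 : l2 κ (fun x => ψ m x - cm) ≤ Real.sqrt (M * l2 κ (gradient (ψ m)) ^ 2) :=
      Real.le_sqrt_of_sq_le (poincare_smooth b (hψ1 m))
    have e2 := l2_add_le (h.memLp.sub (hψL m)) ((hψL m).sub (memLp_const c))
    have e3 := l2_add_le ((hψL m).sub (memLp_const cm)) (memLp_const (μ := κ) (cm - c))
    simp only [Pi.sub_apply, sub_add_sub_cancel] at e2 e3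
    have e4 : l2 κ (fun _ : E (n + 1) => cm - c) = |cm - c| * l2 κ fun _ => (1 : ℝ) := by
      rw [← l2_const_mul]
      simp
    have e5 : l2 κ (v - ψ m) = l2 κ (fun x => ψ m x - v x) := l2_sub_comm _ _
    have e6 : l2 κ (ψ m - fun _ => c) = l2 κ (fun x => ψ m x - c) := rfl
    have e7 : l2 κ (ψ m - fun _ => cm) = l2 κ (fun x => ψ m x - cm) := rfl
    linarith
  have hlim := (hv'.add ((Real.continuous_sqrt.tendsto _).comp ((hg'.pow 2).const_mul M))).add hc'
  have := ge_of_tendsto' hlim hbound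
  rw [zero_add, add_zero] at this
  calc _ ≤ Real.sqrt (M * l2 κ g ^ 2) ^ 2 := pow_le_pow_left₀ (l2_nonneg _) this 2
    _ = _ := Real.sq_sqrt (by positivity)

/-- An approximation by a constant, in the element and on its boundary. -/
theorem exists_poincare_trace {v : E (n + 1) → ℝ} {g : E (n + 1) → E (n + 1)}
    (h : CellH1 (vs b) v g) : ∃ c : ℝ,
      l2 (cellMeasure (vs b)) (fun x => v x - c) ^ 2
        ≤ 2 ^ (n + 1) * Metric.diam (simplex (vs b)) ^ 2 * l2 (cellMeasure (vs b)) g ^ 2 ∧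
      ∀ i, ‖cgrad b i‖⁻¹ * l2 (faceMeasure (fc b i)) (fun x => trace (vs b) v x - c) ^ 2
        ≤ (n + 3) * 2 ^ (n + 1) * Metric.diam (simplex (vs b)) ^ 2
          * l2 (cellMeasure (vs b)) g ^ 2 := by
  obtain ⟨c, hc⟩ := exists_poincare b h
  refine ⟨c, hc, fun i => (trace_inequality b h c i).trans ?_⟩
  set D := Metric.diam (simplex (vs b))
  have hD : 0 ≤ D := Metric.diam_nonneg
  set A := l2 (cellMeasure (vs b)) (fun x => v x - c)
  set B := l2 (cellMeasure (vs b)) g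
  have hA : 0 ≤ A := l2_nonneg _
  have hB : 0 ≤ B := l2_nonneg _
  have h1 : (1 : ℝ) ≤ 2 ^ (n + 1) := one_le_pow₀ (by norm_num)
  -- The trace inequality thus has the bound (n + 1) A² + A² + D² B², and each of A² and D² B² is at
  -- most 2^(n+1) D² B². This is the factor n + 3.
  have h2 : 2 * D * (A * B) ≤ A ^ 2 + D ^ 2 * B ^ 2 := by nlinarith [sq_nonneg (A - D * B)]
  have h3 : D ^ 2 * B ^ 2 ≤ 2 ^ (n + 1) * D ^ 2 * B ^ 2 := by
    rw [mul_assoc]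
    exact le_mul_of_one_le_left (by positivity) h1
  have h4 := mul_le_mul_of_nonneg_left hc (by positivity : (0 : ℝ) ≤ n + 1)
  linarith

end Poincare

/-! ### Polynomials of bounded degree -/

section Polynomial

variable {m : ℕ}

/-- Polynomials of degree at most `k`. -/
abbrev polyLe (m k : ℕ) : Submodule ℝ (Poly m) := MvPolynomial.restrictTotalDegree (Fin m) ℝ k

/-- Polynomials of degree less than `k`. -/
def polyLt (m : ℕ) : ℕ → Submodule ℝ (Poly m)
  | 0 => ⊥
  | k + 1 => polyLe m k

instance (k : ℕ) : FiniteDimensional ℝ (polyLt m k) := by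
  cases k
  · exact inferInstanceAs (FiniteDimensional ℝ (⊥ : Submodule ℝ (Poly m)))
  · exact inferInstanceAs (Module.Finite ℝ (polyLe m _))

lemma mem_polyLe {k : ℕ} {p : Poly m} : p ∈ polyLe m k ↔ p.totalDegree ≤ k :=
  MvPolynomial.mem_restrictTotalDegree _ _ _

/-- The zero polynomial has total degree 0, so for k = 0 the strict inequality would exclude it from
the trivial space. -/
lemma mem_polyLt {k : ℕ} {p : Poly m} : p ∈ polyLt m k ↔ p = 0 ∨ p.totalDegree < k := by
  cases k with
  | zero => simp [polyLt]
  | succ k =>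
    rw [polyLt, mem_polyLe, Nat.lt_succ_iff]
    refine ⟨Or.inr, fun h => h.elim (fun h => ?_) id⟩
    simp [h]

lemma polyLt_le {k : ℕ} : polyLt m k ≤ polyLe m k := by
  intro p hp
  rw [mem_polyLe]
  rcases mem_polyLt.1 hp with rfl | h
  · simp
  · exact h.le

lemma mul_mem_polyLe {k : ℕ} {a p : Poly m} (ha : a.totalDegree ≤ 1) (hp : p ∈ polyLt m k) :
    a * p ∈ polyLe m k := by
  rw [mem_polyLe]
  rcases mem_polyLt.1 hp with rfl | h
  · simp
  · have := MvPolynomial.totalDegree_mul a p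
    omega

lemma totalDegree_aeval_le {σ τ : Type*} {A : σ → MvPolynomial τ ℝ}
    (hA : ∀ i, (A i).totalDegree ≤ 1) (p : MvPolynomial σ ℝ) :
    (MvPolynomial.aeval A p).totalDegree ≤ p.totalDegree := by
  rw [MvPolynomial.aeval_def, MvPolynomial.eval₂_eq]
  refine MvPolynomial.totalDegree_finsetSum_le fun s hs => ?_
  refine (MvPolynomial.totalDegree_mul _ _).trans ?_
  rw [MvPolynomial.algebraMap_eq, MvPolynomial.totalDegree_C, zero_add]
  refine (MvPolynomial.totalDegree_finsetProd _ _).trans ?_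
  refine le_trans ?_ (MvPolynomial.le_totalDegree hs)
  refine Finset.sum_le_sum fun i _ => (MvPolynomial.totalDegree_pow _ _).trans ?_
  exact (Nat.mul_le_mul_left _ (hA i)).trans_eq (mul_one _)

lemma aeval_mem_polyLe {l k : ℕ} {A : Fin m → Poly l} (hA : ∀ i, (A i).totalDegree ≤ 1)
    {p : Poly m} (hp : p ∈ polyLe m k) : MvPolynomial.aeval A p ∈ polyLe l k :=
  mem_polyLe.2 ((totalDegree_aeval_le hA p).trans (mem_polyLe.1 hp))

lemma aeval_mem_polyLt {l k : ℕ} {A : Fin m → Poly l} (hA : ∀ i, (A i).totalDegree ≤ 1)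
    {p : Poly m} (hp : p ∈ polyLt m k) : MvPolynomial.aeval A p ∈ polyLt l k := by
  cases k with
  | zero =>
    have : p = 0 := hp
    rw [this, map_zero]
    exact zero_mem _
  | succ k => exact aeval_mem_polyLe hA hp

lemma eval_aeval {l : ℕ} (A : Fin m → Poly l) (p : Poly m) (x : Fin l → ℝ) :
    MvPolynomial.eval x (MvPolynomial.aeval A p)
      = MvPolynomial.eval (fun i => MvPolynomial.eval x (A i)) p := by
  rw [← MvPolynomial.coe_aeval_eq_eval, ← MvPolynomial.coe_aeval_eq_eval]
  have := MvPolynomial.comp_aeval A (MvPolynomial.aeval (R := ℝ) x)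
  exact congrArg (fun f => f p) this

/-- The polynomial `c + ∑ aᵢ xᵢ`. -/
def affPoly (c : ℝ) (a : Fin m → ℝ) : Poly m :=
  MvPolynomial.C c + ∑ i, MvPolynomial.C (a i) * MvPolynomial.X i

lemma totalDegree_affPoly (c : ℝ) (a : Fin m → ℝ) : (affPoly c a).totalDegree ≤ 1 := by
  refine (MvPolynomial.totalDegree_add _ _).trans (max_le ?_ ?_)
  · rw [MvPolynomial.totalDegree_C]; norm_num
  · refine MvPolynomial.totalDegree_finsetSum_le fun i _ => ?_
    refine (MvPolynomial.totalDegree_mul _ _).trans ?_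
    rw [MvPolynomial.totalDegree_C, MvPolynomial.totalDegree_X]

lemma eval_affPoly (c : ℝ) (a : Fin m → ℝ) (x : Fin m → ℝ) :
    MvPolynomial.eval x (affPoly c a) = c + ∑ i, a i * x i := by
  simp [affPoly]

lemma pderiv_mem_polyLt {k : ℕ} {p : Poly m} (hp : p ∈ polyLe m k) (i : Fin m) :
    MvPolynomial.pderiv i p ∈ polyLt m k := by
  rw [mem_polyLe] at hp
  have h : ∀ s ∈ p.support, MvPolynomial.pderiv i (MvPolynomial.monomial s (p.coeff s))
      ∈ polyLt m k := by
    intro s hs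
    rw [MvPolynomial.pderiv_monomial, mem_polyLt]
    -- A monomial without the variable i has derivative 0; otherwise its degree drops by one.
    by_cases h0 : s i = 0
    · left; simp [h0]
    · right
      have hdeg := MvPolynomial.le_totalDegree hs
      refine lt_of_lt_of_le (lt_of_le_of_lt (MvPolynomial.totalDegree_monomial_le _ _) ?_)
        (hdeg.trans hp)
      have hle : Finsupp.single i 1 ≤ s := by
        rw [Finsupp.single_le_iff]; omega
      have e : (s - Finsupp.single i 1) + Finsupp.single i 1 = s := tsub_add_cancel_of_le hle
      have e2 := congrArg Finsupp.degree e
      rw [map_add, Finsupp.degree_single] at e2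
      have e3 : (s.sum fun _ e => e) = s.degree := rfl
      have e4 : ((s - Finsupp.single i 1).sum fun _ => id) = (s - Finsupp.single i 1).degree := rfl
      rw [e3, e4]
      omega
  rw [MvPolynomial.as_sum p, map_sum]
  exact sum_mem h

/-! ### Polynomials as smooth functions -/

lemma contDiff_pval (p : Poly m) : ContDiff ℝ ∞ (pval p) := by
  have := AnalyticOnNhd.eval_continuousLinearMap' (𝕜 := ℝ)
    (fun i => (EuclideanSpace.proj i : E m →L[ℝ] ℝ)) p
  exact AnalyticOnNhd.contDiff this

lemma contDiff_one_pval (p : Poly m) : ContDiff ℝ 1 (pval p) := (contDiff_pval p).of_le (by norm_cast)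

lemma continuous_pval (p : Poly m) : Continuous (pval p) := (contDiff_pval p).continuous

lemma continuous_vval (r : Fin m → Poly m) : Continuous (vval r) := by
  have := fun i => continuous_pval (r i)
  unfold vval
  fun_prop

lemma pval_add (p q : Poly m) (x : E m) : pval (p + q) x = pval p x + pval q x := by simp [pval]
lemma pval_sub (p q : Poly m) (x : E m) : pval (p - q) x = pval p x - pval q x := by simp [pval]
lemma pval_mul (p q : Poly m) (x : E m) : pval (p * q) x = pval p x * pval q x := by simp [pval]
lemma pval_smul (c : ℝ) (p : Poly m) (x : E m) : pval (c • p) x = c * pval p x := by simp [pval]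
lemma pval_zero (x : E m) : pval (0 : Poly m) x = 0 := by simp [pval]
lemma pval_C (c : ℝ) (x : E m) : pval (MvPolynomial.C c : Poly m) x = c := by simp [pval]
lemma pval_sum {ι : Type*} (s : Finset ι) (p : ι → Poly m) (x : E m) :
    pval (∑ i ∈ s, p i) x = ∑ i ∈ s, pval (p i) x := by simp [pval]

lemma vval_apply (r : Fin m → Poly m) (x : E m) (i : Fin m) : vval r x i = pval (r i) x := rfl

lemma pd_pval (p : Poly m) (i : Fin m) (x : E m) :
    pd i (pval p) x = pval (MvPolynomial.pderiv i p) x := by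
  unfold pd
  induction p using MvPolynomial.induction_on with
  | C a =>
    have : pval (MvPolynomial.C a : Poly m) = fun _ => a := funext fun x => pval_C a x
    rw [this]
    simp [pval]
  | add p q hp hq =>
    have : pval (p + q) = fun x => pval p x + pval q x := funext fun x => pval_add p q x
    rw [this, fderiv_fun_add ((contDiff_one_pval p).differentiable (by norm_num) x)
      ((contDiff_one_pval q).differentiable (by norm_num) x), map_add, pval_add, add_apply, hp, hq]
  | mul_X p j hp =>
    have h1 : pval (MvPolynomial.X j : Poly m) = (EuclideanSpace.proj j : E m →L[ℝ] ℝ) :=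
      funext fun x => by simp [pval]
    have : pval (p * MvPolynomial.X j) = fun x => pval p x * (EuclideanSpace.proj j : E m →L[ℝ] ℝ) x :=
      funext fun x => by rw [pval_mul, h1]
    rw [this, fderiv_fun_mul ((contDiff_one_pval p).differentiable (by norm_num) x)
      (ContinuousLinearMap.differentiableAt _), Derivation.leibniz, pval_add]
    simp only [smul_eq_mul, pval_mul, add_apply, smul_apply, hp, h1,
      ContinuousLinearMap.fderiv, MvPolynomial.pderiv_X]
    by_cases hij : i = j
    · subst hij; simp [pval]
    · simp [pval, Ne.symm hij]

lemma pgrad_apply (p : Poly m) (x : E m) (i : Fin m) : pgrad p x i = pd i (pval p) x :=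
  (pd_pval p i x).symm

lemma pgrad_eq_gradient (p : Poly m) (x : E m) : pgrad p x = gradient (pval p) x := by
  ext i
  rw [pgrad_apply, pd_eq_gradient]

/-- The normal component of a polynomial field is a polynomial on each face. -/
def normalPoly (a : E m) (r : Fin m → Poly m) : Poly m := ∑ i, a i • r i

lemma pval_normalPoly (a : E m) (r : Fin m → Poly m) (x : E m) :
    pval (normalPoly a r) x = inner ℝ (vval r x) a := by
  rw [normalPoly, pval_sum, PiLp.inner_apply]
  refine Finset.sum_congr rfl fun i _ => ?_
  rw [pval_smul, vval_apply]
  simp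

lemma normalPoly_mem {S : Submodule ℝ (Poly m)} {r : Fin m → Poly m} (hr : ∀ i, r i ∈ S) (a : E m) :
    normalPoly a r ∈ S := sum_mem fun i _ => S.smul_mem _ (hr i)

end Polynomial

/-! ### Comparison of norms on the unit simplex -/

section Reference

/-- The map to `L²` given by a linear map to functions. -/
def toL2 {V α : Type*} [AddCommGroup V] [Module ℝ V] [MeasurableSpace α] {μ : Measure α}
    (S : V →ₗ[ℝ] α → ℝ) (hS : ∀ v, MemLp (S v) 2 μ) : V →ₗ[ℝ] Lp ℝ 2 μ where
  toFun v := (hS v).toLp (S v)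
  map_add' v w := by
    rw [← MemLp.toLp_add]
    exact MemLp.toLp_congr _ _ (by rw [map_add])
  map_smul' c v := by
    rw [RingHom.id_apply, ← MemLp.toLp_const_smul]
    exact MemLp.toLp_congr _ _ (by rw [map_smul])

lemma norm_toL2 {V α : Type*} [AddCommGroup V] [Module ℝ V] [MeasurableSpace α] {μ : Measure α}
    (S : V →ₗ[ℝ] α → ℝ) (hS : ∀ v, MemLp (S v) 2 μ) (v : V) : ‖toL2 S hS v‖ = l2 μ (S v) := by
  rw [l2_eq_eLpNorm (hS v)]
  exact Lp.norm_toLp _ (hS v)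

lemma toL2_eq_zero {V α : Type*} [AddCommGroup V] [Module ℝ V] [MeasurableSpace α] {μ : Measure α}
    (S : V →ₗ[ℝ] α → ℝ) (hS : ∀ v, MemLp (S v) 2 μ) (v : V) :
    toL2 S hS v = 0 ↔ S v =ᵐ[μ] 0 := by
  rw [Lp.eq_zero_iff_ae_eq_zero]
  have h := (hS v).coeFn_toLp
  exact ⟨fun h1 => h.symm.trans h1, fun h1 => EventuallyEq.trans h h1⟩

/-- Comparison of `L²` norms on a finite-dimensional space of functions. -/
lemma exists_l2_le {V α β : Type*} [AddCommGroup V] [Module ℝ V] [FiniteDimensional ℝ V]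
    [MeasurableSpace α] [MeasurableSpace β] {μ : Measure α} {ν : Measure β}
    (S : V →ₗ[ℝ] α → ℝ) (T : V →ₗ[ℝ] β → ℝ) (hS : ∀ v, MemLp (S v) 2 μ)
    (hT : ∀ v, MemLp (T v) 2 ν) (h : ∀ v, S v =ᵐ[μ] 0 → T v =ᵐ[ν] 0) :
    ∃ C, 0 < C ∧ ∀ v, l2 ν (T v) ≤ C * l2 μ (S v) := by
  obtain ⟨C, hC, hle⟩ := exists_norm_le_of_ker_le (toL2 S hS) (toL2 T hT) fun v hv =>
    (toL2_eq_zero T hT v).2 (h v ((toL2_eq_zero S hS v).1 hv))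
  refine ⟨C, hC, fun v => ?_⟩
  rw [← norm_toL2 T hT, ← norm_toL2 S hS]
  exact hle v

/-- The uniform measure on the unit simplex. -/
def unitMeasure (m : ℕ) : Measure (Fin m → ℝ) := volume.restrict (unitSimplex m)

instance (m : ℕ) : IsFiniteMeasure (unitMeasure m) :=
  ⟨by rw [unitMeasure, Measure.restrict_apply_univ]; exact vol_unitSimplex_lt_top m⟩

lemma memLp_unit {m : ℕ} {f : (Fin m → ℝ) → ℝ} (hf : Continuous f) (p : ENNReal) :
    MemLp f p (unitMeasure m) := by
  obtain ⟨C, hC⟩ := (isCompact_unitSimplex m).exists_bound_of_continuousOn hf.continuousOn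
  exact MemLp.of_bound hf.aestronglyMeasurable C
    ((ae_restrict_mem (measurableSet_unitSimplex m)).mono hC)

lemma convex_unitSimplex (m : ℕ) : Convex ℝ (unitSimplex m) := by
  intro x hx y hy s t hs ht hst
  refine ⟨fun i => ?_, ?_⟩
  · have := hx.1 i
    have := hy.1 i
    simp only [Pi.add_apply, Pi.smul_apply, smul_eq_mul]
    positivity
  · simp only [Pi.add_apply, Pi.smul_apply, smul_eq_mul, Finset.sum_add_distrib, ← Finset.mul_sum]
    have h1 := mul_le_mul_of_nonneg_left hx.2 hs
    have h2 := mul_le_mul_of_nonneg_left hy.2 ht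
    linarith

/-- A continuous function that vanishes almost everywhere on the simplex vanishes on it. -/
lemma eq_zero_of_ae_unit {m : ℕ} {f : (Fin m → ℝ) → ℝ} (hf : Continuous f)
    (h : f =ᵐ[unitMeasure m] 0) : ∀ l ∈ unitSimplex m, f l = 0 := by
  have hne : (interior (unitSimplex m)).Nonempty := by
    by_contra hcon
    rw [Set.not_nonempty_iff_eq_empty] at hcon
    have h1 := (convex_unitSimplex m).addHaar_frontier volume
    rw [frontier, hcon, Set.sdiff_empty, (isCompact_unitSimplex m).isClosed.closure_eq] at h1
    exact vol_unitSimplex_ne_zero m h1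
  have h1 : Set.EqOn f 0 (interior (unitSimplex m)) := by
    refine Measure.eqOn_open_of_ae_eq (μ := volume)
      (ae_restrict_of_ae_restrict_of_subset interior_subset h) isOpen_interior
      hf.continuousOn continuousOn_const
  have h2 := h1.of_subset_closure hf.continuousOn continuousOn_const interior_subset
    (t := unitSimplex m) ?_
  · exact fun l hl => h2 hl
  · rw [(convex_unitSimplex m).closure_interior_eq_closure_of_nonempty_interior hne]
    exact subset_closure

/-- Evaluation of polynomials as a linear map. -/
def evalL (m : ℕ) : Poly m →ₗ[ℝ] (Fin m → ℝ) → ℝ :=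
  { toFun := fun p l => MvPolynomial.eval l p
    map_add' := fun p q => by ext; simp
    map_smul' := fun c p => by ext; simp }

/-- Evaluation of polynomials on the face of the unit simplex where the first coordinate is `0`. -/
def evalFaceL (n : ℕ) : Poly (n + 1) →ₗ[ℝ] (Fin n → ℝ) → ℝ :=
  { toFun := fun p l => MvPolynomial.eval (Fin.cons 0 l) p
    map_add' := fun p q => by ext; simp
    map_smul' := fun c p => by ext; simp }

lemma continuous_evalL {m : ℕ} (p : Poly m) : Continuous (evalL m p) :=
  MvPolynomial.continuous_eval p

lemma continuous_evalFaceL {n : ℕ} (p : Poly (n + 1)) : Continuous (evalFaceL n p) := by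
  refine (MvPolynomial.continuous_eval p).comp ?_
  refine continuous_pi fun i => ?_
  refine Fin.cases ?_ (fun j => ?_) i
  · simp only [Fin.cons_zero]; fun_prop
  · simp only [Fin.cons_succ]; fun_prop

/-- A polynomial that vanishes on the unit simplex vanishes on its face, so comparability in finite
dimension applies. On the reference simplex the constant can depend only on n and k. -/
lemma exists_face_le_unit (n k : ℕ) : ∃ C, 0 < C ∧ ∀ p ∈ polyLe (n + 1) k,
    l2 (unitMeasure n) (evalFaceL n p) ≤ C * l2 (unitMeasure (n + 1)) (evalL (n + 1) p) := by
  obtain ⟨C, hC, h⟩ := exists_l2_le (μ := unitMeasure (n + 1)) (ν := unitMeasure n)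
    (evalL (n + 1) ∘ₗ (polyLe (n + 1) k).subtype) (evalFaceL n ∘ₗ (polyLe (n + 1) k).subtype)
    (fun v => memLp_unit (continuous_evalL _) 2) (fun v => memLp_unit (continuous_evalFaceL _) 2)
    (fun v hv => by
      have h1 := eq_zero_of_ae_unit (continuous_evalL _) hv
      filter_upwards [ae_restrict_mem (measurableSet_unitSimplex n)] with l hl
      refine h1 (Fin.cons 0 l) (cons_mem_unitSimplex.2 ⟨hl, le_rfl, ?_⟩)
      linarith [hl.2])
  exact ⟨C, hC, fun p hp => h ⟨p, hp⟩⟩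

/-- The part of a polynomial that does not involve the first variable. -/
def dropFirst {n : ℕ} (p : Poly (n + 1)) : Poly (n + 1) :=
  MvPolynomial.aeval (fun i => if i = 0 then 0 else MvPolynomial.X i) p

lemma eval_dropFirst {n : ℕ} (p : Poly (n + 1)) (s : ℝ) (l : Fin n → ℝ) :
    MvPolynomial.eval (Fin.cons s l) (dropFirst p) = MvPolynomial.eval (Fin.cons 0 l) p := by
  rw [dropFirst, eval_aeval]
  congr 1
  congr 1
  funext i
  refine Fin.cases ?_ (fun j => ?_) i
  · simp
  · simp [Fin.succ_ne_zero]

lemma X_dvd_sub_dropFirst {n : ℕ} (p : Poly (n + 1)) : MvPolynomial.X 0 ∣ p - dropFirst p := by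
  induction p using MvPolynomial.induction_on with
  | C a => simp [dropFirst, MvPolynomial.algebraMap_eq]
  | add p q hp hq =>
    have : p + q - dropFirst (p + q) = (p - dropFirst p) + (q - dropFirst q) := by
      simp only [dropFirst, map_add]
      ring
    rw [this]
    exact dvd_add hp hq
  | mul_X p j hp =>
    simp only [dropFirst, map_mul, MvPolynomial.aeval_X] at hp ⊢
    split_ifs with hj
    · rw [hj, mul_zero, sub_zero]
      exact dvd_mul_left _ _
    · rw [← sub_mul]
      exact hp.mul_right _

/-- Division by the first variable: what is left after the restriction to x_0 = 0 is a multiple of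
x_0, and the degree of the quotient is one lower. -/
lemma exists_eq_dropFirst_add {n k : ℕ} {p : Poly (n + 1)} (hp : p ∈ polyLe (n + 1) k) :
    ∃ q ∈ polyLt (n + 1) k, p = dropFirst p + MvPolynomial.X 0 * q := by
  obtain ⟨q, hq⟩ := X_dvd_sub_dropFirst p
  refine ⟨q, ?_, by rw [← hq]; ring⟩
  rw [mem_polyLt]
  by_cases h0 : q = 0
  · exact Or.inl h0
  · right
    have h1 : p - dropFirst p ∈ polyLe (n + 1) k := by
      refine sub_mem hp (aeval_mem_polyLe (fun i => ?_) hp)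
      split_ifs
      · simp
      · rw [MvPolynomial.totalDegree_X]
    rw [hq, mem_polyLe, MvPolynomial.totalDegree_mul_of_isDomain (MvPolynomial.X_ne_zero 0) h0,
      MvPolynomial.totalDegree_X] at h1
    omega

/-- If such a p vanishes on the face l_0 = 0, then p = l_0 q with q of degree below k. Orthogonality
to q gives ∫ l_0 q² = 0, and l_0 ≥ 0 forces p = 0 on the simplex. Hence the kernels are ordered as
comparability requires. -/
lemma exists_l2_le_face_unit (n k : ℕ) : ∃ C, 0 < C ∧ ∀ p ∈ polyLe (n + 1) k,
    (∀ q ∈ polyLt (n + 1) k, ∫ l, evalL (n + 1) p l * evalL (n + 1) q l ∂unitMeasure (n + 1) = 0) →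
    l2 (unitMeasure (n + 1)) (evalL (n + 1) p) ≤ C * l2 (unitMeasure n) (evalFaceL n p) := by
  let V : Submodule ℝ (Poly (n + 1)) :=
    { carrier := {p | p ∈ polyLe (n + 1) k ∧ ∀ q ∈ polyLt (n + 1) k,
        ∫ l, evalL (n + 1) p l * evalL (n + 1) q l ∂unitMeasure (n + 1) = 0}
      zero_mem' := ⟨zero_mem _, fun q _ => by simp⟩
      add_mem' := fun {p p'} hp hp' => ⟨add_mem hp.1 hp'.1, fun q hq => by
        simp only [map_add, Pi.add_apply, add_mul]
        rw [integral_add, hp.2 q hq, hp'.2 q hq, add_zero]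
        · exact integrable_mul_of_memLp (memLp_unit (continuous_evalL _) 2)
            (memLp_unit (continuous_evalL _) 2)
        · exact integrable_mul_of_memLp (memLp_unit (continuous_evalL _) 2)
            (memLp_unit (continuous_evalL _) 2)⟩
      smul_mem' := fun c p hp => ⟨Submodule.smul_mem _ c hp.1, fun q hq => by
        simp only [map_smul, Pi.smul_apply, smul_eq_mul, mul_assoc]
        rw [integral_const_mul, hp.2 q hq, mul_zero]⟩ }
  have hfin : FiniteDimensional ℝ V :=
    Submodule.finiteDimensional_of_le (S₂ := polyLe (n + 1) k) fun p hp => hp.1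
  obtain ⟨C, hC, h⟩ := exists_l2_le (μ := unitMeasure n) (ν := unitMeasure (n + 1))
    (evalFaceL n ∘ₗ V.subtype) (evalL (n + 1) ∘ₗ V.subtype)
    (fun v => memLp_unit (continuous_evalFaceL _) 2) (fun v => memLp_unit (continuous_evalL _) 2)
    (fun v hv => by
      obtain ⟨p, hp⟩ := v
      have h1 : ∀ l ∈ unitSimplex n, MvPolynomial.eval (Fin.cons 0 l) p = 0 :=
        eq_zero_of_ae_unit (continuous_evalFaceL p) hv
      obtain ⟨q, hq, hpq⟩ := exists_eq_dropFirst_add hp.1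
      have h2 : ∀ l ∈ unitSimplex (n + 1), evalL (n + 1) p l = l 0 * evalL (n + 1) q l := by
        intro l hl
        obtain ⟨s, l', rfl⟩ : ∃ s l', l = (Fin.cons s l' : Fin (n + 1) → ℝ) :=
          ⟨l 0, Fin.tail l, (Fin.cons_self_tail l).symm⟩
        have h3 : MvPolynomial.eval (Fin.cons s l' : Fin (n + 1) → ℝ) p
            = MvPolynomial.eval (Fin.cons s l' : Fin (n + 1) → ℝ)
              (dropFirst p + MvPolynomial.X 0 * q) := by rw [← hpq]
        rw [map_add, eval_dropFirst, h1 l' (cons_mem_unitSimplex.1 hl).1, zero_add, map_mul,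
          MvPolynomial.eval_X] at h3
        exact h3
      have hq0 : ∀ᵐ l ∂unitMeasure (n + 1), l 0 * evalL (n + 1) q l ^ 2 = 0 := by
        have hc : Continuous fun l : Fin (n + 1) → ℝ => l 0 * evalL (n + 1) q l ^ 2 := by
          have := continuous_evalL q
          fun_prop
        have h3 := hp.2 q hq
        have h4 : ∫ l, l 0 * evalL (n + 1) q l ^ 2 ∂unitMeasure (n + 1) = 0 := by
          rw [← h3]
          refine setIntegral_congr_fun (measurableSet_unitSimplex _) fun l hl => ?_
          simp only [h2 l hl]
          ring
        refine (integral_eq_zero_iff_of_nonneg_ae ?_ ((memLp_unit hc 1).integrable le_rfl)).1 h4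
        filter_upwards [ae_restrict_mem (measurableSet_unitSimplex (n + 1))] with l hl
        exact mul_nonneg (hl.1 0) (sq_nonneg _)
      filter_upwards [hq0, ae_restrict_mem (measurableSet_unitSimplex (n + 1))] with l hl hlm
      have h5 : evalL (n + 1) p l = 0 := by
        rw [h2 l hlm]
        rcases mul_eq_zero.1 hl with h | h
        · rw [h, zero_mul]
        · rw [pow_eq_zero_iff (by norm_num)] at h
          rw [h, mul_zero]
      exact h5)
  exact ⟨C, hC, fun p hp hq => h ⟨p, hp, hq⟩⟩

end Reference

/-! ### Polynomials on a simplex and on its faces -/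

section Cell

variable {n : ℕ} (b : AffineBasis (Fin (n + 2)) ℝ (E (n + 1)))

lemma memLp_pval {d : ℕ} (K : Finset (E d)) (p : Poly d) : MemLp (pval p) 2 (cellMeasure K) :=
  memLp_cell K (continuous_pval p) 2

lemma memLp_pval_face (i : Fin (n + 2)) (p : Poly (n + 1)) :
    MemLp (pval p) 2 (faceMeasure (fc b i)) := memLp_face b i (continuous_pval p) 2

/-- Polynomials of degree at most `k` that are orthogonal to the polynomials of degree less
than `k`. -/
def perp {d : ℕ} (K : Finset (E d)) (k : ℕ) : Submodule ℝ (Poly d) where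
  carrier := {p | p ∈ polyLe d k ∧ ∀ q ∈ polyLt d k, ∫ x, pval p x * pval q x ∂cellMeasure K = 0}
  zero_mem' := ⟨zero_mem _, fun q _ => by simp [pval_zero]⟩
  add_mem' {p p'} hp hp' := ⟨add_mem hp.1 hp'.1, fun q hq => by
    simp only [pval_add, add_mul]
    rw [integral_add (integrable_mul_of_memLp (memLp_pval K p) (memLp_pval K q))
      (integrable_mul_of_memLp (memLp_pval K p') (memLp_pval K q)), hp.2 q hq, hp'.2 q hq, add_zero]⟩
  smul_mem' c p hp := ⟨Submodule.smul_mem _ c hp.1, fun q hq => by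
    simp only [pval_smul, mul_assoc]
    rw [integral_const_mul, hp.2 q hq, mul_zero]⟩

instance {d : ℕ} (K : Finset (E d)) (k : ℕ) : FiniteDimensional ℝ (perp K k) :=
  Submodule.finiteDimensional_of_le (S₂ := polyLe d k) fun _ hp => hp.1

/-- The pullback of a polynomial to the unit simplex. -/
def pull (p : Poly (n + 1)) : Poly (n + 1) :=
  MvPolynomial.aeval (fun i => affPoly (b 0 i) fun j => (b j.succ - b 0) i) p

lemma evalL_pull (p : Poly (n + 1)) (l : Fin (n + 1) → ℝ) :
    evalL (n + 1) (pull b p) l = pval p (par b l) := by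
  change MvPolynomial.eval l (pull b p) = _
  rw [pull, eval_aeval, pval]
  congr 2
  funext i
  rw [eval_affPoly]
  simp [par, mul_comm]

lemma pull_mem {k : ℕ} {p : Poly (n + 1)} (hp : p ∈ polyLe (n + 1) k) :
    pull b p ∈ polyLe (n + 1) k :=
  aeval_mem_polyLe (fun _ => totalDegree_affPoly _ _) hp

/-- A barycentric coordinate as a polynomial. -/
def coordPoly (i : Fin (n + 2)) : Poly (n + 1) := affPoly (b.coord i 0) (cgrad b i)

lemma pval_coordPoly (i : Fin (n + 2)) (x : E (n + 1)) : pval (coordPoly b i) x = b.coord i x := by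
  rw [pval, coordPoly, eval_affPoly, coord_eq_add b i x 0, sub_zero, PiLp.inner_apply]
  simp [mul_comm]

lemma coord_par (l : Fin (n + 1) → ℝ) (j : Fin (n + 1)) : b.coord j.succ (par b l) = l j := by
  rw [par, coord_add, inner_sum, b.coord_apply]
  simp [inner_smul_right, inner_cgrad_sub, Fin.succ_ne_zero]

/-- Parameter 0 is the coordinate of vertex 1, since vertex 0 is the origin of the parametrization.
So the reference face l_0 = 0 corresponds to the face opposite to vertex 1. -/
lemma par_face_one (l : Fin n → ℝ) :
    par (fun j => b ((1 : Fin (n + 2)).succAbove j)) l = par b (Fin.cons 0 l) := by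
  rw [par_cons, par]
  have h0 : (1 : Fin (n + 2)).succAbove 0 = 0 := rfl
  have h1 : ∀ i : Fin n, (1 : Fin (n + 2)).succAbove i.succ = i.succ.succ := fun i =>
    Fin.succ_succAbove_succ 0 i
  simp [h0, h1]

lemma l2_cell_sq (p : Poly (n + 1)) : l2 (cellMeasure (vs b)) (pval p) ^ 2
    = volFactor b * l2 (unitMeasure (n + 1)) (evalL (n + 1) (pull b p)) ^ 2 := by
  rw [l2_sq_real, l2_sq_real, integral_cellMeasure b (f := fun x => pval p x ^ 2) ((continuous_pval p).pow 2)]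
  simp only [evalL_pull]
  rfl

lemma l2_face_one_sq (p : Poly (n + 1)) : l2 (faceMeasure (fc b 1)) (pval p) ^ 2
    = volFactor b * ‖cgrad b 1‖ * l2 (unitMeasure n) (evalFaceL n (pull b p)) ^ 2 := by
  rw [l2_sq_real, l2_sq_real, integral_faceMeasure b (f := fun x => pval p x ^ 2) ((continuous_pval p).pow 2)]
  simp only [par_face_one, ← evalL_pull]
  rfl

/-- A polynomial on the reference simplex becomes one on the element by inserting the barycentric
coordinates; this affine substitution does not raise the degree, and the Jacobian is constant. -/
lemma pull_perp {k : ℕ} {p : Poly (n + 1)} (hp : p ∈ perp (vs b) k) :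
    ∀ q ∈ polyLt (n + 1) k,
      ∫ l, evalL (n + 1) (pull b p) l * evalL (n + 1) q l ∂unitMeasure (n + 1) = 0 := by
  intro q hq
  have h1 := hp.2 (MvPolynomial.aeval (fun j : Fin (n + 1) => coordPoly b j.succ) q)
    (aeval_mem_polyLt (fun _ => totalDegree_affPoly _ _) hq)
  rw [integral_cellMeasure b (f := fun x => pval p x * pval _ x)
    ((continuous_pval p).mul (continuous_pval _))] at h1
  have h2 := (mul_eq_zero.1 h1).resolve_left (volFactor_pos b).ne'
  rw [← h2]
  refine integral_congr_ae (Eventually.of_forall fun l => ?_)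
  simp only [evalL_pull]
  congr 1
  rw [pval, eval_aeval]
  change MvPolynomial.eval l q = _
  congr 2
  funext j
  exact ((pval_coordPoly b j.succ (par b l)).trans (coord_par b l j)).symm

/-- Renumbering the vertices changes neither the element nor the face nor the gradient, so face 1
stands for every face. -/
lemma forall_of_one {P : Finset (E (n + 1)) → Finset (E (n + 1)) → E (n + 1) → Prop}
    (h : ∀ b : AffineBasis (Fin (n + 2)) ℝ (E (n + 1)), P (vs b) (fc b 1) (cgrad b 1))
    (i : Fin (n + 2)) : P (vs b) (fc b i) (cgrad b i) := by
  let e : Equiv.Perm (Fin (n + 2)) := Equiv.swap i 1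
  have he : e i = 1 := Equiv.swap_apply_left i 1
  have := h (b.reindex e)
  rw [vs_reindex, ← he, fc_reindex, cgrad_reindex] at this
  exact this

/-- The norm of a polynomial on a face is bounded by its norm in the element. -/
theorem exists_face_le_cell (n k : ℕ) : ∃ C, 0 < C ∧
    ∀ (b : AffineBasis (Fin (n + 2)) ℝ (E (n + 1))) (i : Fin (n + 2)), ∀ p ∈ polyLe (n + 1) k,
      l2 (faceMeasure (fc b i)) (pval p) ^ 2
        ≤ C * ‖cgrad b i‖ * l2 (cellMeasure (vs b)) (pval p) ^ 2 := by
  obtain ⟨C, hC, h⟩ := exists_face_le_unit n k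
  refine ⟨C ^ 2, by positivity, fun b i => ?_⟩
  refine (forall_of_one b (P := fun K F g => ∀ p ∈ polyLe (n + 1) k,
      l2 (faceMeasure F) (pval p) ^ 2 ≤ C ^ 2 * ‖g‖ * l2 (cellMeasure K) (pval p) ^ 2)
    (fun b p hp => ?_) i)
  rw [l2_cell_sq, l2_face_one_sq]
  have h1 := pow_le_pow_left₀ (l2_nonneg _) (h _ (pull_mem b hp)) 2
  have h2 : 0 ≤ volFactor b * ‖cgrad b 1‖ := mul_nonneg (volFactor_nonneg _) (norm_nonneg _)
  calc _ ≤ volFactor b * ‖cgrad b 1‖ *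
        (C * l2 (unitMeasure (n + 1)) (evalL (n + 1) (pull b p))) ^ 2 :=
        mul_le_mul_of_nonneg_left h1 h2
    _ = _ := by ring

/-- The norm of a polynomial that is orthogonal to those of lower degree is bounded by its norm on
any face. -/
theorem exists_cell_le_face (n k : ℕ) : ∃ C, 0 < C ∧
    ∀ (b : AffineBasis (Fin (n + 2)) ℝ (E (n + 1))) (i : Fin (n + 2)), ∀ p ∈ perp (vs b) k,
      ‖cgrad b i‖ * l2 (cellMeasure (vs b)) (pval p) ^ 2
        ≤ C * l2 (faceMeasure (fc b i)) (pval p) ^ 2 := by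
  obtain ⟨C, hC, h⟩ := exists_l2_le_face_unit n k
  refine ⟨C ^ 2, by positivity, fun b i => ?_⟩
  refine (forall_of_one b (P := fun K F g => ∀ p ∈ perp K k,
      ‖g‖ * l2 (cellMeasure K) (pval p) ^ 2 ≤ C ^ 2 * l2 (faceMeasure F) (pval p) ^ 2)
    (fun b p hp => ?_) i)
  rw [l2_cell_sq, l2_face_one_sq]
  have h1 := pow_le_pow_left₀ (l2_nonneg _) (h _ (pull_mem b hp.1) (pull_perp b hp)) 2
  have h2 : 0 ≤ volFactor b * ‖cgrad b 1‖ := mul_nonneg (volFactor_nonneg _) (norm_nonneg _)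
  calc _ = volFactor b * ‖cgrad b 1‖ *
        l2 (unitMeasure (n + 1)) (evalL (n + 1) (pull b p)) ^ 2 := by ring
    _ ≤ _ := mul_le_mul_of_nonneg_left h1 h2
    _ = _ := by ring

/-! ### Representation of functionals on polynomials -/

/-- Evaluation of the polynomials in a subspace. -/
def pvalL {d : ℕ} (S : Submodule ℝ (Poly d)) : S →ₗ[ℝ] E d → ℝ where
  toFun p := pval p.1
  map_add' _ _ := funext fun _ => pval_add _ _ _
  map_smul' _ _ := funext fun _ => pval_smul _ _ _

/-- The functional on polynomials given by integration against a function. -/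
def intL {d : ℕ} {μ : Measure (E d)} (S : Submodule ℝ (Poly d)) (hS : ∀ p : S, MemLp (pval p.1) 2 μ)
    {f : E d → ℝ} (hf : MemLp f 2 μ) : S →ₗ[ℝ] ℝ where
  toFun p := ∫ x, f x * pval p.1 x ∂μ
  map_add' p q := by
    rw [← integral_add (integrable_mul_of_memLp hf (hS p)) (integrable_mul_of_memLp hf (hS q))]
    refine integral_congr_ae (Eventually.of_forall fun x => ?_)
    simp only [Submodule.coe_add, pval_add]
    ring
  map_smul' c p := by
    rw [RingHom.id_apply, smul_eq_mul, ← integral_const_mul]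
    refine integral_congr_ae (Eventually.of_forall fun x => ?_)
    simp only [SetLike.val_smul, pval_smul]
    ring

/-- The form may be degenerate, as for polynomials restricted to a face; the functional only has to
vanish on what is zero almost everywhere. -/
lemma exists_rep {V α : Type*} [AddCommGroup V] [Module ℝ V] [FiniteDimensional ℝ V]
    [MeasurableSpace α] {μ : Measure α} (S : V →ₗ[ℝ] α → ℝ) (hS : ∀ v, MemLp (S v) 2 μ)
    (L : V →ₗ[ℝ] ℝ) (hL : ∀ v, S v =ᵐ[μ] 0 → L v = 0) :
    ∃ p, ∀ v, ∫ x, S p x * S v x ∂μ = L v := by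
  let B : V →ₗ[ℝ] V →ₗ[ℝ] ℝ := LinearMap.mk₂ ℝ (fun p v => ∫ x, S p x * S v x ∂μ)
    (fun p q v => by
      rw [← integral_add (integrable_mul_of_memLp (hS p) (hS v))
        (integrable_mul_of_memLp (hS q) (hS v))]
      simp only [map_add, Pi.add_apply, add_mul])
    (fun c p v => by
      simp only [map_smul, Pi.smul_apply, smul_eq_mul, mul_assoc]
      rw [integral_const_mul])
    (fun p v w => by
      rw [← integral_add (integrable_mul_of_memLp (hS p) (hS v))
        (integrable_mul_of_memLp (hS p) (hS w))]
      simp only [map_add, Pi.add_apply, mul_add])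
    (fun c p v => by
      simp only [map_smul, Pi.smul_apply, smul_eq_mul, mul_left_comm _ c]
      rw [integral_const_mul])
  refine exists_representer B (fun v w => ?_) L fun v hv => hL v ?_
  · simp only [B, LinearMap.mk₂_apply, mul_comm]
  · have h1 : ∫ x, S v x * S v x ∂μ = 0 := hv
    have h2 := (integral_eq_zero_iff_of_nonneg (fun x => mul_self_nonneg (S v x))
      (integrable_mul_of_memLp (hS v) (hS v))).1 h1
    exact h2.mono fun x hx => mul_self_eq_zero.1 hx

/-- The `L²` projection to polynomials. -/
lemma exists_l2_proj {d : ℕ} {μ : Measure (E d)} (S : Submodule ℝ (Poly d)) [FiniteDimensional ℝ S]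
    (hS : ∀ p : S, MemLp (pval p.1) 2 μ) {f : E d → ℝ} (hf : MemLp f 2 μ) :
    ∃ p ∈ S, ∀ s ∈ S, ∫ x, pval p x * pval s x ∂μ = ∫ x, f x * pval s x ∂μ := by
  obtain ⟨p, hp⟩ := exists_rep (pvalL S) hS (intL S hS hf) fun v hv => by
    refine integral_eq_zero_of_ae (hv.mono fun x hx => ?_)
    have : pval v.1 x = 0 := hx
    simp [this]
  exact ⟨p.1, p.2, fun s hs => hp ⟨s, hs⟩⟩

/-- The `L²` projection does not increase the norm. -/
lemma l2_proj_le {d : ℕ} {μ : Measure (E d)} {p : Poly d} (hp : MemLp (pval p) 2 μ)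
    {f : E d → ℝ} (hf : MemLp f 2 μ)
    (h : ∫ x, pval p x * pval p x ∂μ = ∫ x, f x * pval p x ∂μ) : l2 μ (pval p) ≤ l2 μ f := by
  have h1 := (le_abs_self _).trans (abs_integral_mul_le hf hp)
  rw [← h] at h1
  have h2 : ∫ x, pval p x * pval p x ∂μ = l2 μ (pval p) ^ 2 := by
    rw [l2_sq_real]
    simp only [sq]
  rw [h2, sq] at h1
  rcases (l2_nonneg (μ := μ) (pval p)).eq_or_lt with h3 | h3
  · rw [← h3]; exact l2_nonneg _
  · exact le_of_mul_le_mul_right h1 h3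

lemma coord_pos_ae (i : Fin (n + 2)) : ∀ᵐ x ∂cellMeasure (vs b), 0 < b.coord i x := by
  rw [← restrict_interior_simplex]
  filter_upwards [ae_restrict_mem isOpen_interior.measurableSet] with x hx
  rw [interior_simplex_vs] at hx
  exact hx i

/-- Every polynomial on a face is the restriction of a polynomial orthogonal to those of lower
degree. -/
lemma exists_lift {k : ℕ} (i : Fin (n + 2)) {p : Poly (n + 1)} (hp : p ∈ polyLe (n + 1) k) :
    ∃ w ∈ perp (vs b) k, ∀ x ∈ simplex (fc b i), pval w x = pval p x := by
  have hcont : Continuous (b.coord i) := by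
    have : (b.coord i : E (n + 1) → ℝ) = pval (coordPoly b i) :=
      funext fun x => (pval_coordPoly b i x).symm
    rw [this]
    exact continuous_pval _
  -- The lift is sought as p − λ_i q with q of lower degree, which leaves the values on the face
  -- unchanged. Orthogonality asks for ∫ λ_i q s = ∫ p s for all s of lower degree; the square root
  -- writes the weight λ_i as an L² product.
  let S : polyLt (n + 1) k →ₗ[ℝ] E (n + 1) → ℝ :=
    { toFun := fun q x => Real.sqrt (b.coord i x) * pval q.1 x
      map_add' := fun q q' => funext fun x => by
        simp only [Submodule.coe_add, pval_add, Pi.add_apply]; ring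
      map_smul' := fun c q => funext fun x => by
        simp only [SetLike.val_smul, pval_smul, Pi.smul_apply, smul_eq_mul, RingHom.id_apply]
        ring }
  have hS : ∀ q, MemLp (S q) 2 (cellMeasure (vs b)) := fun q =>
    memLp_cell _ ((Real.continuous_sqrt.comp hcont).mul (continuous_pval q.1)) 2
  obtain ⟨q, hq⟩ := exists_rep S hS (intL (polyLt (n + 1) k) (fun q => memLp_pval (vs b) q.1)
    (memLp_pval (vs b) p)) fun s hs => by
      refine integral_eq_zero_of_ae ?_
      filter_upwards [hs, coord_pos_ae b i] with x hx hpos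
      have h1 : Real.sqrt (b.coord i x) * pval s.1 x = 0 := hx
      rw [(mul_eq_zero.1 h1).resolve_left (Real.sqrt_pos.2 hpos).ne', mul_zero]
      rfl
  refine ⟨p - coordPoly b i * q.1, ⟨sub_mem hp (mul_mem_polyLe (totalDegree_affPoly _ _) q.2),
    fun s hs => ?_⟩, fun x hx => ?_⟩
  · have h1 := hq ⟨s, hs⟩
    have h2 : ∫ x, S q x * S ⟨s, hs⟩ x ∂cellMeasure (vs b)
        = ∫ x, pval (coordPoly b i * q.1) x * pval s x ∂cellMeasure (vs b) := by
      refine integral_congr_ae ((coord_pos_ae b i).mono fun x hx => ?_)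
      change Real.sqrt (b.coord i x) * pval q.1 x * (Real.sqrt (b.coord i x) * pval s x) = _
      simp only [pval_mul, pval_coordPoly]
      linear_combination (pval q.1 x * pval s x) * Real.mul_self_sqrt hx.le
    rw [h2] at h1
    simp only [pval_sub, sub_mul]
    rw [integral_sub (integrable_mul_of_memLp (memLp_pval _ _) (memLp_pval _ _))
      (integrable_mul_of_memLp (memLp_pval _ _) (memLp_pval _ _)), h1]
    exact sub_self _
  · rw [pval_sub, pval_mul, pval_coordPoly, ((mem_simplex_fc b).1 hx).1, zero_mul, sub_zero]

/-- The normal components of a field orthogonal to polynomials of lower degree are orthogonal on the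
boundary to such polynomials. -/
lemma sum_normal_perp {k : ℕ} {r : Fin (n + 1) → Poly (n + 1)} (hr : ∀ m, r m ∈ perp (vs b) k)
    {w : Poly (n + 1)} (hw : w ∈ perp (vs b) k) :
    ∑ i, ∫ x, normalVal (vs b) (fc b i) r x * pval w x ∂faceMeasure (fc b i) = 0 := by
  have h1 : ∀ m, ∑ i, normal (vs b) (fc b i) m *
      ∫ x, pval (r m) x * pval w x ∂faceMeasure (fc b i) = 0 := by
    intro m
    -- The boundary sum equals ∫ ∂_m(r_m w). A derivative lowers the degree, so each of the two
    -- product terms is orthogonal.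
    rw [← integral_by_parts_smooth b (contDiff_one_pval (r m)) (contDiff_one_pval w) m]
    simp only [pd_eq_gradient, pd_pval]
    rw [(hr m).2 _ (pderiv_mem_polyLt hw.1 m), add_zero]
    simp only [mul_comm _ (pval w _)]
    exact hw.2 _ (pderiv_mem_polyLt (hr m).1 m)
  have h2 : ∀ i, ∫ x, normalVal (vs b) (fc b i) r x * pval w x ∂faceMeasure (fc b i)
      = ∑ m, normal (vs b) (fc b i) m * ∫ x, pval (r m) x * pval w x ∂faceMeasure (fc b i) := by
    intro i
    simp only [← integral_const_mul]
    rw [← integral_finsetSum _ fun m _ => (integrable_mul_of_memLp (memLp_pval_face b i _)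
      (memLp_pval_face b i _)).const_mul _]
    refine integral_congr_ae (Eventually.of_forall fun x => ?_)
    simp only [normalVal, PiLp.inner_apply, Finset.sum_mul]
    refine Finset.sum_congr rfl fun m _ => ?_
    rw [vval_apply]
    simp [mul_assoc]
  simp only [h2]
  rw [Finset.sum_comm]
  exact Finset.sum_eq_zero fun m _ => h1 m

end Cell

/-! ### Existence of the HDG projection -/

section Existence

variable {n : ℕ} (b : AffineBasis (Fin (n + 2)) ℝ (E (n + 1)))

lemma normalVal_eq (K F : Finset (E (n + 1))) (r : Fin (n + 1) → Poly (n + 1)) (x : E (n + 1)) :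
    normalVal K F r x = pval (normalPoly (normal K F) r) x :=
  (pval_normalPoly _ _ _).symm

lemma memLp_normalVal (K : Finset (E (n + 1))) (i : Fin (n + 2)) (r : Fin (n + 1) → Poly (n + 1)) :
    MemLp (normalVal K (fc b i) r) 2 (faceMeasure (fc b i)) := by
  rw [show normalVal K (fc b i) r = _ from funext (normalVal_eq K (fc b i) r)]
  exact memLp_pval_face b i _

/-- The boundary measure with weights. -/
def weightMeasure (t : Fin (n + 2) → ℝ) : Measure (E (n + 1)) :=
  ∑ i, ENNReal.ofReal |t i| • faceMeasure (fc b i)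

instance (t : Fin (n + 2) → ℝ) : IsFiniteMeasure (weightMeasure b t) := by
  have : ∀ i, IsFiniteMeasure (ENNReal.ofReal |t i| • faceMeasure (fc b i)) := fun i =>
    Measure.smul_finite _ ENNReal.ofReal_ne_top
  unfold weightMeasure
  infer_instance

lemma memLp_weight (t : Fin (n + 2) → ℝ) (p : Poly (n + 1)) :
    MemLp (pval p) 2 (weightMeasure b t) := by
  refine continuous_memLp_of_compact (isCompact_simplex (vs b)) ?_ (continuous_pval p) 2
  rw [weightMeasure, ae_finsetSum_measure_iff]
  intro i _
  refine Measure.ae_smul_measure ?_ _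
  exact (ae_faceMeasure_mem _).mono fun x hx => simplex_mono (fc_subset b i) hx

lemma integral_weight (t : Fin (n + 2) → ℝ) (p q : Poly (n + 1)) :
    ∫ x, pval p x * pval q x ∂weightMeasure b t
      = ∑ i, |t i| * ∫ x, pval p x * pval q x ∂faceMeasure (fc b i) := by
  rw [weightMeasure, integral_finsetSum_measure]
  · refine Finset.sum_congr rfl fun i _ => ?_
    rw [integral_smul_measure, ENNReal.toReal_ofReal (abs_nonneg _), smul_eq_mul]
  · intro i _
    exact (integrable_mul_of_memLp (memLp_pval_face b i p) (memLp_pval_face b i q)).smul_measure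
      ENNReal.ofReal_ne_top

/-- A polynomial orthogonal to those of lower degree that vanishes on a face is zero. -/
lemma l2_face_eq_zero {k : ℕ} {w : Poly (n + 1)} (hw : w ∈ perp (vs b) k) {j : Fin (n + 2)}
    (h : pval w =ᵐ[faceMeasure (fc b j)] 0) (i : Fin (n + 2)) :
    l2 (faceMeasure (fc b i)) (pval w) = 0 := by
  obtain ⟨C₁, -, h₁⟩ := exists_face_le_cell n k
  obtain ⟨C₂, -, h₂⟩ := exists_cell_le_face n k
  have e0 : l2 (faceMeasure (fc b j)) (pval w) = 0 := by
    rw [l2_congr_ae h]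
    simp [l2]
  have e1 := h₂ b j w hw
  rw [e0] at e1
  have e2 : l2 (cellMeasure (vs b)) (pval w) ^ 2 ≤ 0 := by
    by_contra hcon
    have := mul_pos (norm_cgrad_pos b j) (not_le.1 hcon)
    linarith
  have e3 := h₁ b i w hw.1
  have e4 : l2 (cellMeasure (vs b)) (pval w) ^ 2 = 0 := le_antisymm e2 (sq_nonneg _)
  rw [e4, mul_zero] at e3
  exact pow_eq_zero_iff (two_ne_zero) |>.1 (le_antisymm e3 (sq_nonneg _))

/-- As the weights have one sign ε, the form is ε times an L² product with weights |t_i|. A member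
of `perp` that vanishes on a face with t_j ≠ 0 vanishes on every face, so the right-hand side
annihilates the radical and is represented. -/
lemma exists_scalar_correction {k : ℕ} {t : Fin (n + 2) → ℝ}
    (ht : (∀ i, 0 ≤ t i) ∨ ∀ i, t i ≤ 0) (hne : ∃ j, t j ≠ 0)
    {β : Fin (n + 2) → E (n + 1) → ℝ} (hβ : ∀ i, MemLp (β i) 2 (faceMeasure (fc b i))) :
    ∃ δ ∈ perp (vs b) k, ∀ w ∈ perp (vs b) k,
      ∑ i, t i * ∫ x, pval δ x * pval w x ∂faceMeasure (fc b i)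
        = ∑ i, ∫ x, β i x * pval w x ∂faceMeasure (fc b i) := by
  obtain ⟨ε, hε, hεt⟩ : ∃ ε : ℝ, ε * ε = 1 ∧ ∀ i, t i = ε * |t i| := by
    rcases ht with h | h
    · exact ⟨1, by norm_num, fun i => by rw [abs_of_nonneg (h i), one_mul]⟩
    · exact ⟨-1, by norm_num, fun i => by rw [abs_of_nonpos (h i)]; ring⟩
  obtain ⟨j, hj⟩ := hne
  let L : perp (vs b) k →ₗ[ℝ] ℝ :=
    ε • ∑ i, intL (perp (vs b) k) (fun p => memLp_pval_face b i p.1) (hβ i)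
  have hL : ∀ w : perp (vs b) k, L w = ε * ∑ i, ∫ x, β i x * pval w.1 x ∂faceMeasure (fc b i) := by
    intro w
    simp only [L, LinearMap.smul_apply, LinearMap.sum_apply, smul_eq_mul]
    rfl
  obtain ⟨δ, hδ⟩ := exists_rep (μ := weightMeasure b t) (pvalL (perp (vs b) k))
    (fun p => memLp_weight b t p.1) L fun w hw => by
      have h1 : pval w.1 =ᵐ[faceMeasure (fc b j)] 0 := by
        have h2 : ∀ᵐ x ∂weightMeasure b t, pval w.1 x = 0 := hw
        rw [weightMeasure, ae_finsetSum_measure_iff] at h2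
        have h3 := h2 j (Finset.mem_univ j)
        rwa [Measure.ae_ennreal_smul_measure_iff (by simpa using hj)] at h3
      rw [hL, Finset.sum_eq_zero fun i _ => ?_, mul_zero]
      have h4 := abs_integral_mul_le (hβ i) (memLp_pval_face b i w.1)
      rw [l2_face_eq_zero b w.2 h1 i, mul_zero] at h4
      exact abs_nonpos_iff.1 h4
  refine ⟨δ.1, δ.2, fun w hw => ?_⟩
  have h1 := hδ ⟨w, hw⟩
  rw [hL] at h1
  have h2 : ∫ x, pvalL (perp (vs b) k) δ x * pvalL (perp (vs b) k) ⟨w, hw⟩ x ∂weightMeasure b t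
      = ∑ i, |t i| * ∫ x, pval δ.1 x * pval w x ∂faceMeasure (fc b i) := integral_weight b t δ.1 w
  rw [h2] at h1
  calc _ = ε * ∑ i, |t i| * ∫ x, pval δ.1 x * pval w x ∂faceMeasure (fc b i) := by
        rw [Finset.mul_sum]
        refine Finset.sum_congr rfl fun i _ => ?_
        conv_lhs => rw [hεt i, mul_assoc]
    _ = _ := by rw [h1, ← mul_assoc, hε, one_mul]

/-- Normal components can be prescribed freely on all faces but face 0, by combining lifts with the
edges from vertex 0. On face 0 they are then right automatically, by the compatibility condition and
`sum_normal_perp`. -/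
lemma exists_vector_correction {k : ℕ} {γ : Fin (n + 2) → E (n + 1) → ℝ}
    (hγ : ∀ i, MemLp (γ i) 2 (faceMeasure (fc b i)))
    (h : ∀ w ∈ perp (vs b) k, ∑ i, ∫ x, γ i x * pval w x ∂faceMeasure (fc b i) = 0) :
    ∃ r : Fin (n + 1) → Poly (n + 1), (∀ m, r m ∈ perp (vs b) k) ∧
      ∀ i, ∀ l ∈ polyLe (n + 1) k, ∫ x, normalVal (vs b) (fc b i) r x * pval l x ∂faceMeasure (fc b i)
        = ∫ x, γ i x * pval l x ∂faceMeasure (fc b i) := by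
  have hm : ∀ i, ∃ w ∈ perp (vs b) k, ∀ l ∈ polyLe (n + 1) k,
      ∫ x, pval w x * pval l x ∂faceMeasure (fc b i)
        = ∫ x, γ i x * pval l x ∂faceMeasure (fc b i) := by
    intro i
    obtain ⟨q, hq, hql⟩ := exists_l2_proj (polyLe (n + 1) k) (fun p => memLp_pval_face b i p.1) (hγ i)
    obtain ⟨w, hw, hwq⟩ := exists_lift b i hq
    refine ⟨w, hw, fun l hl => ?_⟩
    rw [← hql l hl]
    exact integral_congr_ae ((ae_faceMeasure_mem _).mono fun x hx => by simp only [hwq x hx])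
  choose w hw hwl using hm
  -- The edge b j − b 0 is tangent to all faces except 0 and j, and its outward normal component on
  -- face j is −1/‖∇λ_j‖.
  let r : Fin (n + 1) → Poly (n + 1) := fun m =>
    ∑ j ∈ Finset.univ.erase 0, (-‖cgrad b j‖ * (b j - b 0) m) • w j
  have hr : ∀ m, r m ∈ perp (vs b) k := fun m =>
    sum_mem fun j _ => Submodule.smul_mem _ _ (hw j)
  have hrv : ∀ x, vval r x
      = ∑ j ∈ Finset.univ.erase 0, (-‖cgrad b j‖ * pval (w j) x) • (b j - b 0) := by
    intro x
    ext m
    rw [vval_apply, pval_sum]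
    simp only [pval_smul, WithLp.ofLp_sum, Finset.sum_apply, WithLp.ofLp_smul, Pi.smul_apply,
      smul_eq_mul]
    exact Finset.sum_congr rfl fun j _ => by ring
  have hrn : ∀ i, i ≠ 0 → ∀ x, normalVal (vs b) (fc b i) r x = pval (w i) x := by
    intro i hi x
    rw [normalVal, inner_normal, hrv, inner_sum, Finset.sum_eq_single i]
    · rw [inner_smul_right, inner_cgrad_sub, if_pos rfl, if_neg hi]
      have := (norm_cgrad_pos b i).ne'
      field_simp
      ring
    · intro j hj hji
      rw [inner_smul_right, inner_cgrad_sub, if_neg hji.symm, if_neg hi]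
      ring
    · intro hi'
      exact absurd (Finset.mem_erase.2 ⟨hi, Finset.mem_univ i⟩) hi'
  have hne : ∀ i, i ≠ 0 → ∀ l ∈ polyLe (n + 1) k,
      ∫ x, normalVal (vs b) (fc b i) r x * pval l x ∂faceMeasure (fc b i)
        = ∫ x, γ i x * pval l x ∂faceMeasure (fc b i) := by
    intro i hi l hl
    rw [← hwl i l hl]
    simp only [hrn i hi]
  refine ⟨r, hr, fun i l hl => ?_⟩
  rcases ne_or_eq i 0 with hi | rfl
  · exact hne i hi l hl
  -- Every polynomial on face 0 is the restriction of some v in `perp`. Tested with v, the sums over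
  -- all faces vanish for r·n and for γ, and they agree on the other faces.
  · obtain ⟨v, hv, hvl⟩ := exists_lift b 0 hl
    have h1 := sum_normal_perp b hr hv
    have h2 := h v hv
    rw [← Finset.add_sum_erase _ _ (Finset.mem_univ (0 : Fin (n + 2)))] at h1 h2
    have h3 : ∑ i ∈ Finset.univ.erase 0,
        ∫ x, normalVal (vs b) (fc b i) r x * pval v x ∂faceMeasure (fc b i)
        = ∑ i ∈ Finset.univ.erase 0, ∫ x, γ i x * pval v x ∂faceMeasure (fc b i) :=
      Finset.sum_congr rfl fun i hi => hne i (Finset.ne_of_mem_erase hi) v hv.1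
    have h4 : ∀ f : E (n + 1) → ℝ, ∫ x, f x * pval v x ∂faceMeasure (fc b 0)
        = ∫ x, f x * pval l x ∂faceMeasure (fc b 0) := fun f =>
      integral_congr_ae ((ae_faceMeasure_mem _).mono fun x hx => by simp only [hvl x hx])
    rw [h4] at h1 h2
    linarith

/-- The `L²` projections of a field and of a function to polynomials. -/
lemma exists_cell_proj {k : ℕ} {r : E (n + 1) → E (n + 1)} (hr : MemLp r 2 (cellMeasure (vs b))) :
    ∃ P : Fin (n + 1) → Poly (n + 1), ∀ m, P m ∈ polyLe (n + 1) k ∧ ∀ s ∈ polyLe (n + 1) k,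
      ∫ x, pval (P m) x * pval s x ∂cellMeasure (vs b) = ∫ x, r x m * pval s x ∂cellMeasure (vs b) := by
  have := fun m => exists_l2_proj (polyLe (n + 1) k) (fun p => memLp_pval (vs b) p.1)
    (memLp_coord hr m)
  choose P hP hP' using this
  exact ⟨P, fun m => ⟨hP m, hP' m⟩⟩

lemma integral_inner_vval {P s : Fin (n + 1) → Poly (n + 1)} (K : Finset (E (n + 1))) :
    ∫ x, inner ℝ (vval P x) (vval s x) ∂cellMeasure K
      = ∑ m, ∫ x, pval (P m) x * pval (s m) x ∂cellMeasure K := by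
  rw [← integral_finsetSum _ fun m _ => integrable_mul_of_memLp (memLp_pval K _) (memLp_pval K _)]
  refine integral_congr_ae (Eventually.of_forall fun x => ?_)
  simp only [PiLp.inner_apply, vval_apply]
  exact Finset.sum_congr rfl fun m _ => by simp [mul_comm]

lemma integral_inner_vval' {r : E (n + 1) → E (n + 1)} {s : Fin (n + 1) → Poly (n + 1)}
    {K : Finset (E (n + 1))} (hr : MemLp r 2 (cellMeasure K)) :
    ∫ x, inner ℝ (r x) (vval s x) ∂cellMeasure K
      = ∑ m, ∫ x, r x m * pval (s m) x ∂cellMeasure K := by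
  rw [← integral_finsetSum _ fun m _ =>
    integrable_mul_of_memLp (memLp_coord hr m) (memLp_pval K _)]
  refine integral_congr_ae (Eventually.of_forall fun x => ?_)
  simp only [PiLp.inner_apply, vval_apply]
  exact Finset.sum_congr rfl fun m _ => by simp [mul_comm]

lemma memLp_normalTrace {r : E (n + 1) → E (n + 1)}
    {g : Fin (n + 1) → E (n + 1) → E (n + 1)}
    (hr : ∀ m, CellH1 (vs b) (fun x => r x m) (g m)) (K : Finset (E (n + 1))) (i : Fin (n + 2)) :
    MemLp (fun x => ∑ m, trace (vs b) (fun y => r y m) x * normal K (fc b i) m) 2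
      (faceMeasure (fc b i)) :=
  memLp_finsetSum _ fun m _ => (memLp_trace b (hr m) i).mul_const _

/-- The HDG projection exists. -/
theorem exists_isProjection {k : ℕ} {τ : Finset (E (n + 1)) → ℝ}
    (ht : (∀ i, 0 ≤ τ (fc b i)) ∨ ∀ i, τ (fc b i) ≤ 0) (hne : ∃ j, τ (fc b j) ≠ 0)
    {r : E (n + 1) → E (n + 1)} {v : E (n + 1) → ℝ} {g : Fin (n + 1) → E (n + 1) → E (n + 1)}
    {g' : E (n + 1) → E (n + 1)} (hr : ∀ m, CellH1 (vs b) (fun x => r x m) (g m))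
    (hv : CellH1 (vs b) v g') : ∃ P p, IsProjection k τ (vs b) r v P p := by
  have hrL : MemLp r 2 (cellMeasure (vs b)) := memLp_of_coord fun m => (hr m).memLp
  obtain ⟨P₀, hP₀⟩ := exists_cell_proj (k := k) b hrL
  obtain ⟨p₀, hp₀, hp₀'⟩ := exists_l2_proj (polyLe (n + 1) k) (fun p => memLp_pval (vs b) p.1)
    hv.memLp
  -- The defect of the L² projections in the face equations. It is removed by corrections δ and ρ in
  -- `perp`, which do not disturb the moments of lower degree.
  let β : Fin (n + 2) → E (n + 1) → ℝ := fun i x =>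
    (normalTrace (vs b) (fc b i) r x + τ (fc b i) * trace (vs b) v x)
      - (normalVal (vs b) (fc b i) P₀ x + τ (fc b i) * pval p₀ x)
  have hβ1 : ∀ i, MemLp (fun x => normalTrace (vs b) (fc b i) r x + τ (fc b i) * trace (vs b) v x) 2
      (faceMeasure (fc b i)) := fun i =>
    (memLp_normalTrace b hr (vs b) i).add ((memLp_trace b hv i).const_mul _)
  have hβ2 : ∀ i (P : Fin (n + 1) → Poly (n + 1)) p,
      MemLp (fun x => normalVal (vs b) (fc b i) P x + τ (fc b i) * pval p x) 2
      (faceMeasure (fc b i)) := fun i P p =>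
    (memLp_normalVal b _ i P).add ((memLp_pval_face b i p).const_mul _)
  have hβ : ∀ i, MemLp (β i) 2 (faceMeasure (fc b i)) := fun i => (hβ1 i).sub (hβ2 i P₀ p₀)
  obtain ⟨δ, hδ, hδw⟩ := exists_scalar_correction (k := k) b ht hne hβ
  let γ : Fin (n + 2) → E (n + 1) → ℝ := fun i x => β i x - τ (fc b i) * pval δ x
  have hγ : ∀ i, MemLp (γ i) 2 (faceMeasure (fc b i)) := fun i =>
    (hβ i).sub ((memLp_pval_face b i δ).const_mul _)
  have hγint : ∀ i w, ∫ x, γ i x * pval w x ∂faceMeasure (fc b i)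
      = ∫ x, β i x * pval w x ∂faceMeasure (fc b i)
        - τ (fc b i) * ∫ x, pval δ x * pval w x ∂faceMeasure (fc b i) := by
    intro i w
    rw [← integral_const_mul, ← integral_sub (integrable_mul_of_memLp (hβ i) (memLp_pval_face b i w))
      ((integrable_mul_of_memLp (memLp_pval_face b i δ) (memLp_pval_face b i w)).const_mul _)]
    exact integral_congr_ae (Eventually.of_forall fun x => by simp only [γ]; ring)
  -- The compatibility condition for ρ is exactly the equation that determines δ.
  obtain ⟨ρ, hρ, hρl⟩ := exists_vector_correction (k := k) b hγ fun w hw => by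
    simp only [hγint, Finset.sum_sub_distrib]
    rw [hδw w hw, sub_self]
  refine ⟨fun m => P₀ m + ρ m, p₀ + δ, fun m => mem_polyLe.1 (add_mem (hP₀ m).1 (hρ m).1),
    mem_polyLe.1 (add_mem hp₀ hδ.1), fun s hs => ?_, fun s hs => ?_, fun F hF l hl => ?_⟩
  · rw [integral_inner_vval, integral_inner_vval' hrL]
    refine Finset.sum_congr rfl fun m _ => ?_
    have hsm : s m ∈ polyLt (n + 1) k := mem_polyLt.2 (Or.inr (hs m))
    simp only [pval_add, add_mul]
    rw [integral_add (integrable_mul_of_memLp (memLp_pval _ _) (memLp_pval _ _))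
      (integrable_mul_of_memLp (memLp_pval _ _) (memLp_pval _ _)), (hρ m).2 _ hsm, add_zero,
      (hP₀ m).2 _ (polyLt_le hsm)]
  · have hsm : s ∈ polyLt (n + 1) k := mem_polyLt.2 (Or.inr hs)
    simp only [pval_add, add_mul]
    rw [integral_add (integrable_mul_of_memLp (memLp_pval _ _) (memLp_pval _ _))
      (integrable_mul_of_memLp (memLp_pval _ _) (memLp_pval _ _)), hδ.2 _ hsm, add_zero,
      hp₀' _ (polyLt_le hsm)]
  · obtain ⟨i, rfl⟩ := (mem_facesOf_iff b).1 hF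
    have h1 := hρl i l (mem_polyLe.2 hl)
    rw [hγint] at h1
    have hl2 := memLp_pval_face b i l
    have h2 : ∫ x, β i x * pval l x ∂faceMeasure (fc b i)
        = ∫ x, (normalTrace (vs b) (fc b i) r x + τ (fc b i) * trace (vs b) v x) * pval l x
            ∂faceMeasure (fc b i)
          - ∫ x, (normalVal (vs b) (fc b i) P₀ x + τ (fc b i) * pval p₀ x) * pval l x
            ∂faceMeasure (fc b i) := by
      rw [← integral_sub (integrable_mul_of_memLp (hβ1 i) hl2)
        (integrable_mul_of_memLp (hβ2 i P₀ p₀) hl2)]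
      exact integral_congr_ae (Eventually.of_forall fun x => by simp only [β]; ring)
    have h3 : ∫ x, (normalVal (vs b) (fc b i) (fun m => P₀ m + ρ m) x
          + τ (fc b i) * pval (p₀ + δ) x) * pval l x ∂faceMeasure (fc b i)
        = ∫ x, (normalVal (vs b) (fc b i) P₀ x + τ (fc b i) * pval p₀ x) * pval l x
            ∂faceMeasure (fc b i)
          + (∫ x, normalVal (vs b) (fc b i) ρ x * pval l x ∂faceMeasure (fc b i)
          + τ (fc b i) * ∫ x, pval δ x * pval l x ∂faceMeasure (fc b i)) := by
      rw [← integral_const_mul, ← integral_add (integrable_mul_of_memLp (memLp_normalVal b _ i ρ) hl2)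
        ((integrable_mul_of_memLp (memLp_pval_face b i δ) hl2).const_mul _),
        ← integral_add (integrable_mul_of_memLp (hβ2 i P₀ p₀) hl2)]
      · refine integral_congr_ae (Eventually.of_forall fun x => ?_)
        have : vval (fun m => P₀ m + ρ m) x = vval P₀ x + vval ρ x := by
          ext m
          exact pval_add _ _ _
        simp only [normalVal, this, inner_add_left, pval_add]
        ring
      · exact (integrable_mul_of_memLp (memLp_normalVal b _ i ρ) hl2).add
          ((integrable_mul_of_memLp (memLp_pval_face b i δ) hl2).const_mul _)
    rw [h3, h1, h2]
    ring

end Existence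

/-! ### The error of the HDG projection -/

section Error

attribute [local irreducible] l2 faceMeasure cellMeasure

lemma l2_sum_le {ι α V : Type*} [MeasurableSpace α] {μ : Measure α}
    [NormedAddCommGroup V] (s : Finset ι) {f : ι → α → V} (hf : ∀ i, MemLp (f i) 2 μ) :
    l2 μ (fun x => ∑ i ∈ s, f i x) ≤ ∑ i ∈ s, l2 μ (f i) := by
  classical
  induction s using Finset.induction_on with
  | empty => simp [l2]
  | insert i s hi ih =>
    simp only [Finset.sum_insert hi]
    exact (l2_add_le (hf i) (memLp_finsetSum s fun j _ => hf j)).trans (by gcongr)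

lemma abs_inner_normal_le {n : ℕ} (b : AffineBasis (Fin (n + 2)) ℝ (E (n + 1))) (i : Fin (n + 2))
    (m : Fin (n + 1)) : |normal (vs b) (fc b i) m| ≤ 1 := by
  rw [← norm_normal b i, ← Real.norm_eq_abs]
  exact PiLp.norm_apply_le _ m

/-- The error of the `L²` projection in the element and on its faces. -/
lemma exists_l2_proj_error (n k : ℕ) : ∃ C, 0 < C ∧
    ∀ (b : AffineBasis (Fin (n + 2)) ℝ (E (n + 1))) (v : E (n + 1) → ℝ) (g : E (n + 1) → E (n + 1))
      (p : Poly (n + 1)), CellH1 (vs b) v g → p ∈ polyLe (n + 1) k →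
      (∀ s ∈ polyLe (n + 1) k,
        ∫ x, pval p x * pval s x ∂cellMeasure (vs b) = ∫ x, v x * pval s x ∂cellMeasure (vs b)) →
      l2 (cellMeasure (vs b)) (fun x => v x - pval p x)
        ≤ C * Metric.diam (simplex (vs b)) * l2 (cellMeasure (vs b)) g ∧
      ∀ i, l2 (faceMeasure (fc b i)) (fun x => trace (vs b) v x - pval p x)
        ≤ C * Real.sqrt ‖cgrad b i‖ * Metric.diam (simplex (vs b)) * l2 (cellMeasure (vs b)) g := by
  obtain ⟨C₁, hC₁, h₁⟩ := exists_face_le_cell n k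
  let A : ℝ := Real.sqrt (2 ^ (n + 1))
  let A' : ℝ := Real.sqrt ((n + 3) * 2 ^ (n + 1))
  have hA : 0 < A := Real.sqrt_pos.2 (by positivity)
  have hA' : 0 < A' := Real.sqrt_pos.2 (by positivity)
  -- 2 A serves the element, A' the trace of v − c, and √C₁ A the polynomial p − c on the faces.
  refine ⟨2 * A + A' + Real.sqrt C₁ * A, by positivity, fun b v g p h hp hproj => ?_⟩
  obtain ⟨c, hc, hcF⟩ := exists_poincare_trace b h
  have hfin := isFiniteMeasure_faceMeasure b
  set D := Metric.diam (simplex (vs b))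
  have hD : 0 ≤ D := Metric.diam_nonneg
  set B := l2 (cellMeasure (vs b)) g
  have hB : 0 ≤ B := l2_nonneg _
  -- Constants are reproduced, so p − c is the L² projection of v − c and has no larger norm.
  set p' : Poly (n + 1) := p - MvPolynomial.C c with hp'def
  have hp' : p' ∈ polyLe (n + 1) k := sub_mem hp (mem_polyLe.2 (by simp))
  have hp'v : ∀ x, pval p' x = pval p x - c := fun x => by rw [hp'def, pval_sub, pval_C]
  have hvc : MemLp (fun x => v x - c) 2 (cellMeasure (vs b)) := h.memLp.sub (memLp_const c)
  have e0 : l2 (cellMeasure (vs b)) (fun x => v x - c) ≤ A * D * B := by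
    refine abs_le_of_sq_le_sq' (hc.trans_eq ?_) (by positivity) |>.2
    rw [mul_pow, mul_pow, Real.sq_sqrt (by positivity)]
  have e1 : l2 (cellMeasure (vs b)) (pval p') ≤ l2 (cellMeasure (vs b)) (fun x => v x - c) := by
    refine l2_proj_le (memLp_pval _ _) hvc ?_
    have hone := memLp_pval (vs b) p'
    have h2 : ∀ x, pval p' x * pval p' x = pval p x * pval p' x - c * pval p' x := fun x => by
      rw [hp'v]; ring
    simp only [h2, sub_mul]
    rw [integral_sub (integrable_mul_of_memLp (memLp_pval _ _) hone)
      (integrable_mul_of_memLp (memLp_const c) hone),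
      integral_sub (integrable_mul_of_memLp h.memLp hone)
      (integrable_mul_of_memLp (memLp_const c) hone), hproj p' hp']
  refine ⟨?_, fun i => ?_⟩
  · have h2 := l2_sub_le hvc (memLp_pval (vs b) p')
    simp only [hp'v, sub_sub_sub_cancel_right] at h2
    have h3 : l2 (cellMeasure (vs b)) (fun x => pval p x - c) ≤ A * D * B := by
      refine le_trans (le_of_eq ?_) (e1.trans e0)
      exact congrArg _ (funext fun x => (hp'v x).symm)
    have h4 : l2 (cellMeasure (vs b)) (fun x => v x - pval p x) ≤ 2 * A * (D * B) := by
      have h5 : l2 (cellMeasure (vs b)) (pval p') ≤ A * D * B := e1.trans e0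
      linarith
    refine h4.trans ?_
    rw [mul_assoc _ D B]
    gcongr
    have : 0 ≤ Real.sqrt C₁ * A := by positivity
    linarith
  · have hg := norm_cgrad_pos b i
    have h2 := l2_sub_le ((memLp_trace b h i).sub (memLp_const c)) (memLp_pval_face b i p')
    simp only [Pi.sub_apply, hp'v, sub_sub_sub_cancel_right] at h2
    have h3 : l2 (faceMeasure (fc b i)) (fun x => trace (vs b) v x - c)
        ≤ A' * Real.sqrt ‖cgrad b i‖ * D * B := by
      have h4 := hcF i
      rw [inv_mul_le_iff₀ hg] at h4
      refine abs_le_of_sq_le_sq' (h4.trans_eq ?_) (by positivity) |>.2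
      rw [mul_pow, mul_pow, mul_pow, Real.sq_sqrt (by positivity), Real.sq_sqrt (by positivity)]
      ring
    have h4 : l2 (faceMeasure (fc b i)) (pval p')
        ≤ Real.sqrt C₁ * A * Real.sqrt ‖cgrad b i‖ * D * B := by
      have h5 := h₁ b i p' hp'
      have h6 : l2 (cellMeasure (vs b)) (pval p') ^ 2 ≤ (A * D * B) ^ 2 :=
        pow_le_pow_left₀ (l2_nonneg _) (e1.trans e0) 2
      refine abs_le_of_sq_le_sq' (h5.trans ((mul_le_mul_of_nonneg_left h6
        (by positivity)).trans_eq ?_)) (by positivity) |>.2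
      have e1 := Real.sq_sqrt hC₁.le
      have e2 := Real.sq_sqrt hg.le
      calc C₁ * ‖cgrad b i‖ * (A * D * B) ^ 2
          = Real.sqrt C₁ ^ 2 * Real.sqrt ‖cgrad b i‖ ^ 2 * (A * D * B) ^ 2 := by rw [e1, e2]
        _ = _ := by ring
    have h5 : l2 (faceMeasure (fc b i)) ((trace (vs b) v) - fun _ => c)
        = l2 (faceMeasure (fc b i)) (fun x => trace (vs b) v x - c) := rfl
    have h6 : l2 (faceMeasure (fc b i)) (pval p')
        = l2 (faceMeasure (fc b i)) (fun x => pval p x - c) := congrArg _ (funext hp'v)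
    have h7 : 0 ≤ 2 * A * (Real.sqrt ‖cgrad b i‖ * D * B) := by positivity
    linarith

variable {n : ℕ} (b : AffineBasis (Fin (n + 2)) ℝ (E (n + 1)))

lemma norm_vval_le (r : Fin (n + 1) → Poly (n + 1)) (x : E (n + 1)) :
    ‖vval r x‖ ≤ ∑ i, (Metric.diam (simplex (vs b)) * ‖cgrad b i‖) *
      |pval (normalPoly (normal (vs b) (fc b i)) r) x| := by
  have h0 : ∀ i, |inner ℝ (cgrad b i) (vval r x)|
      = ‖cgrad b i‖ * |pval (normalPoly (normal (vs b) (fc b i)) r) x| := by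
    intro i
    have := norm_cgrad_pos b i
    rw [pval_normalPoly, inner_normal, abs_neg, abs_mul, abs_inv, abs_norm]
    field_simp
  have h1 : ∑ i, (Metric.diam (simplex (vs b)) * ‖cgrad b i‖)
        * |pval (normalPoly (normal (vs b) (fc b i)) r) x|
      = Metric.diam (simplex (vs b)) * ∑ i, |inner ℝ (cgrad b i) (vval r x)| := by
    rw [Finset.mul_sum]
    exact Finset.sum_congr rfl fun i _ => by rw [h0, mul_assoc]
  rw [h1]
  refine (norm_le_sum_cgrad b (vval r x) 0).trans
    (mul_le_mul_of_nonneg_left ?_ Metric.diam_nonneg)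
  exact Finset.sum_le_sum_of_subset_of_nonneg (Finset.subset_univ _)
    fun i _ _ => abs_nonneg (inner ℝ (cgrad b i) (vval r x))

lemma l2_abs {α : Type*} [MeasurableSpace α] (μ : Measure α) (f : α → ℝ) :
    l2 μ (fun x => |f x|) = l2 μ f := by
  unfold l2
  simp only [Real.norm_eq_abs, abs_abs]

/-- The normal components are again polynomials, and they inherit membership in `perp`, so this
reduces a bound of the field to bounds on single faces. -/
lemma l2_le_sum_normal (r : Fin (n + 1) → Poly (n + 1)) :
    l2 (cellMeasure (vs b)) (vval r) ≤ ∑ i, Metric.diam (simplex (vs b)) * (‖cgrad b i‖ *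
        l2 (cellMeasure (vs b)) (pval (normalPoly (normal (vs b) (fc b i)) r))) := by
  have hL : ∀ i : Fin (n + 2), MemLp (fun x => (Metric.diam (simplex (vs b)) * ‖cgrad b i‖) *
      |pval (normalPoly (normal (vs b) (fc b i)) r) x|) 2 (cellMeasure (vs b)) := fun i =>
    (memLp_pval (vs b) _).abs.const_mul _
  have hS : MemLp (fun x => ∑ i, (Metric.diam (simplex (vs b)) * ‖cgrad b i‖) *
      |pval (normalPoly (normal (vs b) (fc b i)) r) x|) 2 (cellMeasure (vs b)) :=
    memLp_finsetSum _ fun i _ => hL i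
  have h1 := l2_mono (f := vval r) hS (Eventually.of_forall fun x =>
    (norm_vval_le b r x).trans (Real.le_norm_self _))
  have h2 := h1.trans (l2_sum_le Finset.univ hL)
  simp only [l2_const_mul, l2_abs] at h2
  refine h2.trans_eq (Finset.sum_congr rfl fun i _ => ?_)
  rw [abs_of_nonneg (mul_nonneg Metric.diam_nonneg (norm_nonneg _)), mul_assoc]

set_option maxHeartbeats 1000000 in
/-- Stability of the corrections that turn the `L²` projection into the HDG projection. -/
lemma exists_correction_le (n k : ℕ) (ρ : ℝ) : ∃ C, 0 < C ∧
    ∀ (b : AffineBasis (Fin (n + 2)) ℝ (E (n + 1))) (t : Fin (n + 2) → ℝ)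
      (δ : Poly (n + 1)) (r : Fin (n + 1) → Poly (n + 1)) (β : Fin (n + 2) → E (n + 1) → ℝ),
      (∀ i, ‖cgrad b i‖ * Metric.diam (simplex (vs b)) ≤ ρ) →
      ((∀ i, 0 ≤ t i) ∨ ∀ i, t i ≤ 0) → δ ∈ perp (vs b) k → (∀ m, r m ∈ perp (vs b) k) →
      (∀ i, MemLp (β i) 2 (faceMeasure (fc b i))) →
      (∀ i, ∀ l ∈ polyLe (n + 1) k,
        ∫ x, (normalVal (vs b) (fc b i) r x + t i * pval δ x) * pval l x ∂faceMeasure (fc b i)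
          = ∫ x, β i x * pval l x ∂faceMeasure (fc b i)) →
      l2 (cellMeasure (vs b)) (vval r) ≤ C * Real.sqrt (Metric.diam (simplex (vs b))) *
        ∑ i, l2 (faceMeasure (fc b i)) (β i) := by
  obtain ⟨C₁, hC₁, h₁⟩ := exists_face_le_cell n k
  obtain ⟨C₂, hC₂, h₂⟩ := exists_cell_le_face n k
  let C₃ : ℝ := Real.sqrt (C₁ * C₂ * |ρ|)
  have hC₃ : 0 ≤ C₃ := Real.sqrt_nonneg _
  -- The additional 1 keeps the constant positive when ρ = 0.
  refine ⟨(n + 2) * (Real.sqrt C₂ * Real.sqrt |ρ| * (1 + C₃ ^ 2)) + 1, by positivity,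
    fun b t δ r β hρ ht hδ hr hβ h => ?_⟩
  set D := Metric.diam (simplex (vs b))
  have hD : 0 ≤ D := Metric.diam_nonneg
  set B := ∑ i, l2 (faceMeasure (fc b i)) (β i) with hBdef
  have hB : 0 ≤ B := Finset.sum_nonneg fun i _ => l2_nonneg _
  have hβB : ∀ i, l2 (faceMeasure (fc b i)) (β i) ≤ B := fun i =>
    Finset.single_le_sum (f := fun i => l2 (faceMeasure (fc b i)) (β i)) (fun i _ => l2_nonneg _)
      (Finset.mem_univ i)
  -- The face with the largest |t|. The product |t j| ‖δ‖ on it is bounded below by means of the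
  -- data and dominates the same product on every other face, so small weights do no harm.
  obtain ⟨j, -, hj⟩ := Finset.exists_max_image Finset.univ (fun i => |t i|) Finset.univ_nonempty
  replace hj : ∀ i, |t i| ≤ |t j| := fun i => hj i (Finset.mem_univ i)
  set a := l2 (faceMeasure (fc b j)) (pval δ) with ha
  have ha0 : 0 ≤ a := l2_nonneg _
  -- From face i to the element and back to face j. The quotient of the two heights is at most ρ,
  -- because the height over face j does not exceed the diameter.
  have hcomp : ∀ i, l2 (faceMeasure (fc b i)) (pval δ) ≤ C₃ * a := by
    intro i
    have e1 := h₁ b i δ hδ.1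
    have e2 := h₂ b j δ hδ
    have e3 := one_le_norm_cgrad_mul_diam b j
    set X := l2 (cellMeasure (vs b)) (pval δ) ^ 2
    have hX : 0 ≤ X := sq_nonneg _
    refine abs_le_of_sq_le_sq' ?_ (by positivity) |>.2
    have e4 : (C₃ * a) ^ 2 = C₁ * |ρ| * (C₂ * a ^ 2) := by
      rw [mul_pow, Real.sq_sqrt (by positivity)]
      ring
    rw [e4]
    calc _ ≤ C₁ * ‖cgrad b i‖ * X := e1
      _ ≤ C₁ * ‖cgrad b i‖ * X * (‖cgrad b j‖ * D) := le_mul_of_one_le_right (by positivity) e3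
      _ = C₁ * (‖cgrad b i‖ * D) * (‖cgrad b j‖ * X) := by ring
      _ ≤ C₁ * |ρ| * (C₂ * a ^ 2) := by
          gcongr
          exact (hρ i).trans (le_abs_self _)
  have hsplit : ∀ i, ∀ l ∈ polyLe (n + 1) k,
      ∫ x, normalVal (vs b) (fc b i) r x * pval l x ∂faceMeasure (fc b i)
        + t i * ∫ x, pval δ x * pval l x ∂faceMeasure (fc b i)
        = ∫ x, β i x * pval l x ∂faceMeasure (fc b i) := by
    intro i l hl
    rw [← h i l hl, ← integral_const_mul, ← integral_add
      (integrable_mul_of_memLp (memLp_normalVal b _ i r) (memLp_pval_face b i l))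
      ((integrable_mul_of_memLp (memLp_pval_face b i δ) (memLp_pval_face b i l)).const_mul _)]
    exact integral_congr_ae (Eventually.of_forall fun x => by ring)
  -- The face equations are tested with δ. The terms with r sum to zero, and with one sign of t no
  -- cancellation occurs in the rest; one factor a is then divided out.
  have hτa : |t j| * a ≤ C₃ * B := by
    have e1 : ∑ i, t i * l2 (faceMeasure (fc b i)) (pval δ) ^ 2
        = ∑ i, ∫ x, β i x * pval δ x ∂faceMeasure (fc b i) := by
      rw [← Finset.sum_congr rfl fun i _ => hsplit i δ hδ.1, Finset.sum_add_distrib,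
        sum_normal_perp b hr hδ, zero_add]
      refine Finset.sum_congr rfl fun i _ => ?_
      rw [l2_sq_real]
      simp only [sq]
    have e2 : ∑ i, |t i| * l2 (faceMeasure (fc b i)) (pval δ) ^ 2
        ≤ |∑ i, t i * l2 (faceMeasure (fc b i)) (pval δ) ^ 2| := by
      rcases ht with ht | ht
      · refine le_trans (le_of_eq ?_) (le_abs_self _)
        exact Finset.sum_congr rfl fun i _ => by rw [abs_of_nonneg (ht i)]
      · refine le_trans (le_of_eq ?_) (neg_le_abs _)
        rw [← Finset.sum_neg_distrib]
        exact Finset.sum_congr rfl fun i _ => by rw [abs_of_nonpos (ht i), neg_mul]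
    have e3 : |t j| * a ^ 2 ≤ ∑ i, |t i| * l2 (faceMeasure (fc b i)) (pval δ) ^ 2 :=
      Finset.single_le_sum (f := fun i => |t i| * l2 (faceMeasure (fc b i)) (pval δ) ^ 2)
        (fun i _ => by positivity) (Finset.mem_univ j)
    have e4 : |∑ i, ∫ x, β i x * pval δ x ∂faceMeasure (fc b i)| ≤ B * (C₃ * a) := by
      refine (Finset.abs_sum_le_sum_abs _ _).trans ?_
      rw [hBdef, Finset.sum_mul]
      refine Finset.sum_le_sum fun i _ => ?_
      refine (abs_integral_mul_le (hβ i) (memLp_pval_face b i δ)).trans ?_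
      exact mul_le_mul_of_nonneg_left (hcomp i) (l2_nonneg _)
    rw [e1] at e2
    have e5 : (|t j| * a) * a ≤ (C₃ * B) * a := by
      calc (|t j| * a) * a = |t j| * a ^ 2 := by ring
        _ ≤ B * (C₃ * a) := e3.trans (e2.trans e4)
        _ = _ := by ring
    rcases ha0.eq_or_lt with h0 | h0
    · rw [← h0, mul_zero]; positivity
    · exact le_of_mul_le_mul_right e5 h0
  -- Each face equation is now tested with the normal component of r itself, as t δ is under
  -- control.
  have hnormal : ∀ i, l2 (faceMeasure (fc b i)) (pval (normalPoly (normal (vs b) (fc b i)) r))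
      ≤ (1 + C₃ ^ 2) * B := by
    intro i
    set w := normalPoly (normal (vs b) (fc b i)) r with hw
    have hwmem : w ∈ perp (vs b) k := normalPoly_mem hr _
    set y := l2 (faceMeasure (fc b i)) (pval w)
    have e1 := hsplit i w hwmem.1
    simp only [normalVal_eq] at e1
    have e2 : ∫ x, pval w x * pval w x ∂faceMeasure (fc b i) = y ^ 2 := by
      rw [l2_sq_real]
      simp only [sq]
    rw [← hw, e2] at e1
    have e3 := abs_integral_mul_le (hβ i) (memLp_pval_face b i w)
    have e4 := abs_integral_mul_le (memLp_pval_face b i δ) (memLp_pval_face b i w)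
    have hy : 0 ≤ y := l2_nonneg _
    have e5 : |t i| * l2 (faceMeasure (fc b i)) (pval δ) ≤ C₃ ^ 2 * B := by
      calc _ ≤ |t j| * (C₃ * a) := mul_le_mul (hj i) (hcomp i) (l2_nonneg _) (abs_nonneg _)
        _ = C₃ * (|t j| * a) := by ring
        _ ≤ C₃ * (C₃ * B) := mul_le_mul_of_nonneg_left hτa hC₃
        _ = _ := by ring
    have e6 : y * y ≤ ((1 + C₃ ^ 2) * B) * y := by
      have e7 : |t i * ∫ x, pval δ x * pval w x ∂faceMeasure (fc b i)| ≤ C₃ ^ 2 * B * y := by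
        rw [abs_mul]
        calc _ ≤ |t i| * (l2 (faceMeasure (fc b i)) (pval δ) * y) :=
              mul_le_mul_of_nonneg_left e4 (abs_nonneg _)
          _ = (|t i| * l2 (faceMeasure (fc b i)) (pval δ)) * y := by ring
          _ ≤ _ := mul_le_mul_of_nonneg_right e5 hy
      have e8 : |∫ x, β i x * pval w x ∂faceMeasure (fc b i)| ≤ B * y :=
        e3.trans (mul_le_mul_of_nonneg_right (hβB i) hy)
      have e9 := (abs_le.1 e7).1
      have e10 := (abs_le.1 e8).2
      linarith
    rcases hy.eq_or_lt with h0 | h0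
    · rw [← h0]; positivity
    · exact le_of_mul_le_mul_right e6 h0
  refine (l2_le_sum_normal b r).trans ?_
  -- Passing from the face to the element costs the inverse root of ‖∇λ_i‖; with ‖∇λ_i‖ D ≤ ρ the
  -- factor √D survives.
  have hterm : ∀ i, D * (‖cgrad b i‖ *
      l2 (cellMeasure (vs b)) (pval (normalPoly (normal (vs b) (fc b i)) r)))
      ≤ Real.sqrt C₂ * Real.sqrt |ρ| * (1 + C₃ ^ 2) * Real.sqrt D * B := by
    intro i
    set w := normalPoly (normal (vs b) (fc b i)) r
    have e1 := h₂ b i w (normalPoly_mem hr _)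
    have hy : 0 ≤ l2 (faceMeasure (fc b i)) (pval w) := l2_nonneg _
    have e2 : l2 (faceMeasure (fc b i)) (pval w) ^ 2 ≤ ((1 + C₃ ^ 2) * B) ^ 2 :=
      pow_le_pow_left₀ hy (hnormal i) 2
    have hz : 0 ≤ l2 (cellMeasure (vs b)) (pval w) := l2_nonneg _
    refine abs_le_of_sq_le_sq' ?_ (by positivity) |>.2
    calc _ = (‖cgrad b i‖ * D) * D * (‖cgrad b i‖ * l2 (cellMeasure (vs b)) (pval w) ^ 2) := by ring
      _ ≤ |ρ| * D * (C₂ * ((1 + C₃ ^ 2) * B) ^ 2) :=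
          mul_le_mul (mul_le_mul_of_nonneg_right ((hρ i).trans (le_abs_self _)) hD)
            (e1.trans (mul_le_mul_of_nonneg_left e2 hC₂.le)) (by positivity) (by positivity)
      _ = Real.sqrt C₂ ^ 2 * Real.sqrt |ρ| ^ 2 * Real.sqrt D ^ 2 * ((1 + C₃ ^ 2) * B) ^ 2 := by
          rw [Real.sq_sqrt hC₂.le, Real.sq_sqrt (abs_nonneg ρ), Real.sq_sqrt hD]
          ring
      _ = _ := by ring
  refine (Finset.sum_le_sum fun i _ => hterm i).trans ?_
  rw [Finset.sum_const, Finset.card_univ, Fintype.card_fin, nsmul_eq_mul]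
  push_cast
  have : 0 ≤ Real.sqrt D * B := by positivity
  linarith

set_option maxHeartbeats 1000000 in
/-- The error of the HDG projection. -/
theorem exists_projection_error (n k : ℕ) (γ ρ : ℝ) : ∃ C, 0 < C ∧
    ∀ (b : AffineBasis (Fin (n + 2)) ℝ (E (n + 1))) (τ : Finset (E (n + 1)) → ℝ)
      (r : E (n + 1) → E (n + 1)) (v : E (n + 1) → ℝ) (g : Fin (n + 1) → E (n + 1) → E (n + 1))
      (g' : E (n + 1) → E (n + 1)) (P : Fin (n + 1) → Poly (n + 1)) (p : Poly (n + 1)),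
      (∀ i, ‖cgrad b i‖ * Metric.diam (simplex (vs b)) ≤ ρ) →
      ((∀ i, 0 ≤ τ (fc b i)) ∨ ∀ i, τ (fc b i) ≤ 0) → (∀ i, |τ (fc b i)| ≤ γ) →
      (∀ m, CellH1 (vs b) (fun x => r x m) (g m)) → CellH1 (vs b) v g' →
      IsProjection k τ (vs b) r v P p →
      l2 (cellMeasure (vs b)) (fun x => vval P x - r x) ≤ C * Metric.diam (simplex (vs b)) *
        (∑ m, l2 (cellMeasure (vs b)) (g m) + l2 (cellMeasure (vs b)) g') := by
  obtain ⟨C₁, hC₁, h₁⟩ := exists_l2_proj_error n k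
  obtain ⟨C₂, hC₂, h₂⟩ := exists_correction_le n k ρ
  refine ⟨C₁ + C₂ * ((n + 2) * (C₁ * Real.sqrt |ρ| * (1 + |γ|))), by positivity,
    fun b τ r v g g' P p hρ ht hγ hr hv hP => ?_⟩
  set D := Metric.diam (simplex (vs b))
  have hD : 0 ≤ D := Metric.diam_nonneg
  set X := ∑ m, l2 (cellMeasure (vs b)) (g m) with hX
  set Y := l2 (cellMeasure (vs b)) g'
  have hX0 : 0 ≤ X := Finset.sum_nonneg fun _ _ => l2_nonneg _
  have hY0 : 0 ≤ Y := l2_nonneg _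
  have hrL : MemLp r 2 (cellMeasure (vs b)) := memLp_of_coord fun m => (hr m).memLp
  obtain ⟨P₀, hP₀⟩ := exists_cell_proj (k := k) b hrL
  obtain ⟨p₀, hp₀, hp₀'⟩ := exists_l2_proj (polyLe (n + 1) k) (fun p => memLp_pval (vs b) p.1)
    hv.memLp
  have err := fun m => h₁ b _ _ _ (hr m) (hP₀ m).1 (hP₀ m).2
  have err' := h₁ b _ _ _ hv hp₀ hp₀'
  -- HDG and L² projections have the same moments of lower degree, so the differences δ and R are in
  -- `perp`.
  let δ := p - p₀
  let R : Fin (n + 1) → Poly (n + 1) := fun m => P m - P₀ m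
  have hδ : δ ∈ perp (vs b) k := by
    refine ⟨sub_mem (mem_polyLe.2 hP.degree_p) hp₀, fun s hs => ?_⟩
    simp only [δ, pval_sub, sub_mul]
    rw [integral_sub (integrable_mul_of_memLp (memLp_pval _ _) (memLp_pval _ _))
      (integrable_mul_of_memLp (memLp_pval _ _) (memLp_pval _ _)), hp₀' _ (polyLt_le hs)]
    rcases mem_polyLt.1 hs with rfl | h
    · simp [pval_zero]
    · rw [hP.moment_p s h, sub_self]
  have hR : ∀ m, R m ∈ perp (vs b) k := by
    intro m
    refine ⟨sub_mem (mem_polyLe.2 (hP.degree_P m)) (hP₀ m).1, fun s hs => ?_⟩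
    simp only [R, pval_sub, sub_mul]
    rw [integral_sub (integrable_mul_of_memLp (memLp_pval _ _) (memLp_pval _ _))
      (integrable_mul_of_memLp (memLp_pval _ _) (memLp_pval _ _)), (hP₀ m).2 _ (polyLt_le hs)]
    cases k with
    | zero =>
      have : s = 0 := hs
      simp [this, pval_zero]
    | succ k =>
      have hsdeg : s.totalDegree < k + 1 := Nat.lt_succ_of_le (mem_polyLe.1 hs)
      -- A field with a single nonzero component isolates the moments of P m.
      have h3 := hP.moment_P (Pi.single m s) fun i => by
        rcases eq_or_ne i m with rfl | h
        · rw [Pi.single_eq_same]; exact hsdeg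
        · rw [Pi.single_eq_of_ne h]; simp
      rw [integral_inner_vval, integral_inner_vval' hrL, Finset.sum_eq_single m,
        Finset.sum_eq_single m, Pi.single_eq_same] at h3
      · rw [h3, sub_self]
      · intro i _ hi
        simp [Pi.single_eq_of_ne hi, pval_zero]
      · simp
      · intro i _ hi
        simp [Pi.single_eq_of_ne hi, pval_zero]
      · simp
  -- The data of the correction are the errors of the L² projections on the faces.
  let β : Fin (n + 2) → E (n + 1) → ℝ := fun i x =>
    ∑ m, (trace (vs b) (fun y => r y m) x - pval (P₀ m) x) * normal (vs b) (fc b i) m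
      + τ (fc b i) * (trace (vs b) v x - pval p₀ x)
  have hβm : ∀ i m, MemLp (fun x => trace (vs b) (fun y => r y m) x - pval (P₀ m) x) 2
      (faceMeasure (fc b i)) := fun i m => (memLp_trace b (hr m) i).sub (memLp_pval_face b i _)
  have hβv : ∀ i, MemLp (fun x => trace (vs b) v x - pval p₀ x) 2 (faceMeasure (fc b i)) :=
    fun i => (memLp_trace b hv i).sub (memLp_pval_face b i _)
  have hβs : ∀ i, MemLp (fun x => ∑ m, (trace (vs b) (fun y => r y m) x - pval (P₀ m) x)
      * normal (vs b) (fc b i) m) 2 (faceMeasure (fc b i)) := fun i =>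
    memLp_finsetSum _ fun m _ => (hβm i m).mul_const _
  have hβ : ∀ i, MemLp (β i) 2 (faceMeasure (fc b i)) := fun i =>
    (hβs i).add ((hβv i).const_mul _)
  have hkey := h₂ b (fun i => τ (fc b i)) δ R β hρ ht hδ hR hβ fun i l hl => by
    have hl2 := memLp_pval_face b i l
    have hT : MemLp (fun x => normalTrace (vs b) (fc b i) r x + τ (fc b i) * trace (vs b) v x) 2
      (faceMeasure (fc b i)) :=
      (memLp_normalTrace b hr (vs b) i).add ((memLp_trace b hv i).const_mul _)
    have hV : ∀ (Q : Fin (n + 1) → Poly (n + 1)) q,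
        MemLp (fun x => normalVal (vs b) (fc b i) Q x + τ (fc b i) * pval q x) 2
        (faceMeasure (fc b i)) := fun Q q =>
      (memLp_normalVal b _ i Q).add ((memLp_pval_face b i q).const_mul _)
    have h3 := hP.face _ (fc_mem_facesOf b i) l (mem_polyLe.1 hl)
    have h4 : ∫ x, (normalVal (vs b) (fc b i) R x + τ (fc b i) * pval δ x) * pval l x
          ∂faceMeasure (fc b i)
        = ∫ x, (normalVal (vs b) (fc b i) P x + τ (fc b i) * pval p x) * pval l x
          ∂faceMeasure (fc b i)
        - ∫ x, (normalVal (vs b) (fc b i) P₀ x + τ (fc b i) * pval p₀ x) * pval l x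
          ∂faceMeasure (fc b i) := by
      rw [← integral_sub (integrable_mul_of_memLp (hV P p) hl2)
        (integrable_mul_of_memLp (hV P₀ p₀) hl2)]
      refine integral_congr_ae (Eventually.of_forall fun x => ?_)
      have : vval R x = vval P x - vval P₀ x := by
        ext m
        exact pval_sub _ _ _
      simp only [normalVal, this, inner_sub_left, δ, pval_sub]
      ring
    have h5 : ∫ x, β i x * pval l x ∂faceMeasure (fc b i)
        = ∫ x, (normalTrace (vs b) (fc b i) r x + τ (fc b i) * trace (vs b) v x) * pval l x
          ∂faceMeasure (fc b i)
        - ∫ x, (normalVal (vs b) (fc b i) P₀ x + τ (fc b i) * pval p₀ x) * pval l x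
          ∂faceMeasure (fc b i) := by
      rw [← integral_sub (integrable_mul_of_memLp hT hl2)
        (integrable_mul_of_memLp (hV P₀ p₀) hl2)]
      refine integral_congr_ae (Eventually.of_forall fun x => ?_)
      have : normalVal (vs b) (fc b i) P₀ x
          = ∑ m, pval (P₀ m) x * normal (vs b) (fc b i) m := by
        rw [normalVal, PiLp.inner_apply]
        exact Finset.sum_congr rfl fun m _ => by rw [vval_apply]; simp [mul_comm]
      simp only [β, normalTrace, this, sub_mul, Finset.sum_sub_distrib]
      ring
    rw [h4, h5, h3]
  -- The face errors of the L² projections are thus of order √D; the stability of the corrections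
  -- supplies the other factor √D.
  have hsqrt : ∀ i, Real.sqrt ‖cgrad b i‖ * D ≤ Real.sqrt |ρ| * Real.sqrt D := by
    intro i
    calc Real.sqrt ‖cgrad b i‖ * D = Real.sqrt ‖cgrad b i‖ * Real.sqrt D * Real.sqrt D := by
          rw [mul_assoc, Real.mul_self_sqrt hD]
      _ = Real.sqrt (‖cgrad b i‖ * D) * Real.sqrt D := by rw [Real.sqrt_mul (norm_nonneg _)]
      _ ≤ _ := by
          gcongr
          exact (hρ i).trans (le_abs_self _)
  have hβle : ∀ i, l2 (faceMeasure (fc b i)) (β i)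
      ≤ C₁ * Real.sqrt |ρ| * (1 + |γ|) * Real.sqrt D * (X + Y) := by
    intro i
    have hc : ∀ z, 0 ≤ z → C₁ * Real.sqrt ‖cgrad b i‖ * D * z
        ≤ C₁ * Real.sqrt |ρ| * Real.sqrt D * z := by
      intro z hz
      have := mul_le_mul_of_nonneg_left (hsqrt i) (mul_nonneg hC₁.le hz)
      linarith
    have e1 : l2 (faceMeasure (fc b i)) (fun x => ∑ m, (trace (vs b) (fun y => r y m) x
        - pval (P₀ m) x) * normal (vs b) (fc b i) m) ≤ C₁ * Real.sqrt |ρ| * Real.sqrt D * X := by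
      refine (l2_sum_le _ fun m => (hβm i m).mul_const _).trans ?_
      rw [hX, Finset.mul_sum]
      refine Finset.sum_le_sum fun m _ => ?_
      have e2 : l2 (faceMeasure (fc b i)) (fun x => (trace (vs b) (fun y => r y m) x
          - pval (P₀ m) x) * normal (vs b) (fc b i) m)
          = |normal (vs b) (fc b i) m| * l2 (faceMeasure (fc b i)) (fun x =>
            trace (vs b) (fun y => r y m) x - pval (P₀ m) x) := by
        rw [← l2_const_mul]
        simp only [mul_comm]
      rw [e2]
      refine (mul_le_of_le_one_left (l2_nonneg _) (abs_inner_normal_le b i m)).trans ?_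
      exact ((err m).2 i).trans (hc _ (l2_nonneg _))
    have e2 : l2 (faceMeasure (fc b i)) (fun x => τ (fc b i) * (trace (vs b) v x - pval p₀ x))
        ≤ |γ| * (C₁ * Real.sqrt |ρ| * Real.sqrt D * Y) := by
      rw [l2_const_mul]
      refine mul_le_mul ((hγ i).trans (le_abs_self _)) ((err'.2 i).trans (hc _ hY0)) (l2_nonneg _)
        (abs_nonneg _)
    refine (l2_add_le (hβs i) ((hβv i).const_mul _)).trans ((add_le_add e1 e2).trans ?_)
    have e3 : 0 ≤ C₁ * Real.sqrt |ρ| * Real.sqrt D := by positivity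
    have e4 : 0 ≤ C₁ * Real.sqrt |ρ| * Real.sqrt D * Y := by positivity
    have e5 : 0 ≤ |γ| * (C₁ * Real.sqrt |ρ| * Real.sqrt D * X) := by positivity
    linarith
  have hsum : l2 (cellMeasure (vs b)) (vval R)
      ≤ C₂ * ((n + 2) * (C₁ * Real.sqrt |ρ| * (1 + |γ|))) * D * (X + Y) := by
    refine hkey.trans ?_
    have e1 := Finset.sum_le_sum fun i (_ : i ∈ (Finset.univ : Finset (Fin (n + 2)))) => hβle i
    rw [Finset.sum_const, Finset.card_univ, Fintype.card_fin, nsmul_eq_mul] at e1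
    push_cast at e1
    refine (mul_le_mul_of_nonneg_left e1 (by positivity)).trans_eq ?_
    linear_combination (C₂ * ((n + 2) * (C₁ * Real.sqrt |ρ| * (1 + |γ|))) * (X + Y)) *
      Real.mul_self_sqrt hD
  have hP₀err : l2 (cellMeasure (vs b)) (fun x => vval P₀ x - r x) ≤ C₁ * D * X := by
    have hm : ∀ m, MemLp (fun x => pval (P₀ m) x - r x m) 2 (cellMeasure (vs b)) := fun m =>
      (memLp_pval _ _).sub (hr m).memLp
    have e0 : MemLp (fun x => vval P₀ x - r x) 2 (cellMeasure (vs b)) := memLp_of_coord hm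
    have e1 := l2_sq_eq_sum e0
    have e2 : ∀ m, l2 (cellMeasure (vs b)) (fun x => pval (P₀ m) x - r x m)
        ≤ C₁ * D * l2 (cellMeasure (vs b)) (g m) := fun m => by
      rw [l2_sub_comm]
      exact (err m).1
    refine abs_le_of_sq_le_sq' (e1.trans_le ?_) (by positivity) |>.2
    have e3 : ∑ m, l2 (cellMeasure (vs b)) (fun x => pval (P₀ m) x - r x m) ≤ C₁ * D * X := by
      rw [hX, Finset.mul_sum]
      exact Finset.sum_le_sum fun m _ => e2 m
    have e4 := Finset.sum_sq_le_sq_sum_of_nonneg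
      (fun m (_ : m ∈ (Finset.univ : Finset (Fin (n + 1)))) =>
        l2_nonneg (μ := cellMeasure (vs b)) (fun x => pval (P₀ m) x - r x m))
    exact e4.trans (pow_le_pow_left₀ (Finset.sum_nonneg fun _ _ => l2_nonneg _) e3 2)
  have hfinal : l2 (cellMeasure (vs b)) (fun x => vval P x - r x)
      ≤ l2 (cellMeasure (vs b)) (vval R) + l2 (cellMeasure (vs b)) (fun x => vval P₀ x - r x) := by
    have e1 : MemLp (vval R) 2 (cellMeasure (vs b)) := memLp_cell _ (continuous_vval R) 2
    have e2 : MemLp (fun x => vval P₀ x - r x) 2 (cellMeasure (vs b)) :=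
      (memLp_cell _ (continuous_vval P₀) 2).sub hrL
    refine le_trans (le_of_eq ?_) (l2_add_le e1 e2)
    congr 1
    funext x
    have : vval R x = vval P x - vval P₀ x := by
      ext m
      exact pval_sub _ _ _
    rw [this]
    abel
  have e6 : 0 ≤ C₁ * D * Y := by positivity
  linarith

end Error

/-! ### Relative interiors of faces -/

/-- The points of a simplex that are in no simplex spanned by fewer vertices. -/
def relint {d : ℕ} (F : Finset (E d)) : Set (E d) := {x | x ∈ simplex F ∧ ∀ S ⊂ F, x ∉ simplex S}

section Relint

variable {n : ℕ} (b : AffineBasis (Fin (n + 2)) ℝ (E (n + 1)))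

lemma continuous_coord (i : Fin (n + 2)) : Continuous (b.coord i) := by
  have : (b.coord i : E (n + 1) → ℝ) = pval (coordPoly b i) :=
    funext fun x => (pval_coordPoly b i x).symm
  rw [this]
  exact continuous_pval _

/-- If a further coordinate vanished, the point would be a convex combination of fewer vertices;
conversely a missing vertex forces its coordinate to be 0. -/
lemma mem_relint_fc {i : Fin (n + 2)} {x : E (n + 1)} :
    x ∈ relint (fc b i) ↔ b.coord i x = 0 ∧ ∀ j, j ≠ i → 0 < b.coord j x := by
  constructor
  · rintro ⟨h1, h2⟩
    obtain ⟨h3, h4⟩ := (mem_simplex_fc b).1 h1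
    refine ⟨h3, fun j hj => lt_of_le_of_ne (h4 j) fun h0 => ?_⟩
    have hbj : b j ∈ fc b i := (mem_fc b).2 hj
    refine h2 _ (Finset.erase_ssubset hbj) ?_
    have e1 : ∑ l ∈ (Finset.univ.erase i).erase j, b.coord l x = 1 := by
      rw [← b.sum_coord_apply_eq_one x, ← Finset.add_sum_erase _ _ (Finset.mem_univ i), h3, zero_add,
        ← Finset.add_sum_erase _ _ (Finset.mem_erase.2 ⟨hj, Finset.mem_univ j⟩), ← h0, zero_add]
    have e2 : ∑ l ∈ (Finset.univ.erase i).erase j, b.coord l x • b l = x := by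
      conv_rhs => rw [← b.linear_combination_coord_eq_self x]
      rw [← Finset.add_sum_erase _ _ (Finset.mem_univ i), h3, zero_smul, zero_add,
        ← Finset.add_sum_erase _ _ (Finset.mem_erase.2 ⟨hj, Finset.mem_univ j⟩), ← h0, zero_smul,
        zero_add]
    rw [← e2]
    refine (convex_simplex _).sum_mem (fun l _ => h4 l) e1 fun l hl => subset_convexHull ℝ _ ?_
    have hl1 := Finset.ne_of_mem_erase hl
    have hl2 := Finset.ne_of_mem_erase (Finset.mem_of_mem_erase hl)
    exact Finset.mem_coe.2 (Finset.mem_erase.2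
      ⟨fun h => hl1 (basis_injective b h), (mem_fc b).2 hl2⟩)
  · rintro ⟨h1, h2⟩
    refine ⟨(mem_simplex_fc b).2 ⟨h1, fun j => ?_⟩, fun S hS hx => ?_⟩
    · rcases eq_or_ne j i with rfl | hj
      · exact h1.ge
      · exact (h2 j hj).le
    · obtain ⟨y, hyF, hyS⟩ := Finset.exists_of_ssubset hS
      have hyK := fc_subset b i hyF
      obtain ⟨j, rfl⟩ : ∃ j, b j = y := by simpa [vs] using hyK
      have hj : j ≠ i := (mem_fc b).1 hyF
      have := simplex_subset_of_subset b (hS.1.trans (fc_subset b i)) hx hyS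
      exact (h2 j hj).ne' this

lemma barycentre_mem_relint (i : Fin (n + 2)) : ∃ x, x ∈ relint (fc b i) := by
  let w : Fin (n + 2) → ℝ := fun j => if j = i then 0 else ((n : ℝ) + 1)⁻¹
  have hw : ∑ j, w j = 1 := by
    rw [← Finset.add_sum_erase _ _ (Finset.mem_univ i)]
    have : ∑ j ∈ Finset.univ.erase i, w j = ∑ j ∈ Finset.univ.erase i, ((n : ℝ) + 1)⁻¹ :=
      Finset.sum_congr rfl fun j hj => if_neg (Finset.ne_of_mem_erase hj)
    rw [this, Finset.sum_const, Finset.card_erase_of_mem (Finset.mem_univ i), Finset.card_univ,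
      Fintype.card_fin]
    simp only [w, if_pos, nsmul_eq_mul]
    push_cast
    field_simp
    simp
  refine ⟨Finset.univ.affineCombination ℝ b w, (mem_relint_fc b).2 ?_⟩
  have hc : ∀ j, b.coord j (Finset.univ.affineCombination ℝ b w) = w j := fun j =>
    b.coord_apply_combination_of_mem (Finset.mem_univ j) hw
  refine ⟨by rw [hc]; simp [w], fun j hj => ?_⟩
  rw [hc]
  simp only [w, if_neg hj]
  positivity

lemma volume_affine_eq_zero {m : ℕ} (f : (Fin m → ℝ) →ᵃ[ℝ] ℝ) {l₀ : Fin m → ℝ} (h : f l₀ ≠ 0) :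
    volume {l | f l = 0} = 0 := by
  let s : AffineSubspace ℝ (Fin m → ℝ) := (AffineSubspace.mk' (0 : ℝ) ⊥).comap f
  have hs : (s : Set (Fin m → ℝ)) = {l | f l = 0} := by
    ext l
    simp [s, AffineSubspace.mem_mk']
  rw [← hs]
  refine Measure.addHaar_affineSubspace volume s fun htop => h ?_
  have : l₀ ∈ (s : Set (Fin m → ℝ)) := by rw [htop]; trivial
  rw [hs] at this
  exact this

/-- Almost every point of a face is in its relative interior. -/
lemma ae_mem_relint (i : Fin (n + 2)) : ∀ᵐ x ∂faceMeasure (fc b i), x ∈ relint (fc b i) := by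
  -- In the parameters of the face the coordinate j is an affine function with value 1 at vertex j,
  -- so its zero set is null.
  have key : ∀ j, j ≠ i → ∀ᵐ x ∂faceMeasure (fc b i), b.coord j x ≠ 0 := by
    intro j hj
    let x := fun l => b (i.succAbove l)
    let g : (Fin n → ℝ) →ᵃ[ℝ] E (n + 1) :=
      AffineMap.mk' (par x) ((parL x) ∘ₗ (WithLp.linearEquiv 2 ℝ (Fin n → ℝ)).symm.toLinearMap) 0
        (fun l => by
          rw [par_eq, par_eq]
          simp [add_comm])
    obtain ⟨j', rfl⟩ := Fin.exists_succAbove_eq hj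
    have hmem : b (i.succAbove j') ∈ par x '' unitSimplex n := by
      rw [← convexHull_range_eq]
      exact subset_convexHull ℝ _ ⟨j', rfl⟩
    obtain ⟨l₀, -, hl₀⟩ := hmem
    have h1 : ((b.coord (i.succAbove j')).comp g) l₀ ≠ 0 := by
      have h2 : g l₀ = b (i.succAbove j') := hl₀
      rw [AffineMap.comp_apply, h2, b.coord_apply, if_pos rfl]
      exact one_ne_zero
    have h3 := volume_affine_eq_zero _ h1
    have hset : MeasurableSet {y : E (n + 1) | b.coord (i.succAbove j') y ≠ 0} :=
      (measurableSet_singleton (0 : ℝ)).compl.preimage (continuous_coord b _).measurable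
    rw [faceMeasure_eq]
    refine Measure.ae_smul_measure ?_ _
    rw [ae_map_iff (measurable_par _).aemeasurable hset]
    refine ae_restrict_of_ae ?_
    rw [ae_iff]
    simp only [ne_eq, not_not]
    exact h3
  filter_upwards [ae_all_iff.2 fun j => ae_all_iff.2 (key j), ae_faceMeasure_mem (fc b i)] with x h1 h2
  obtain ⟨h3, h4⟩ := (mem_simplex_fc b).1 h2
  exact (mem_relint_fc b).2 ⟨h3, fun j hj => lt_of_le_of_ne (h4 j) (h1 j hj).symm⟩

end Relint

/-! ### Two elements with a common face -/

section Neighbours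

variable {n : ℕ} (b b' : AffineBasis (Fin (n + 2)) ℝ (E (n + 1))) {i i' : Fin (n + 2)}

/-- Both coordinates are affine and vanish on the common face, hence they are proportional. It
suffices to compare them at the vertices of b'. -/
lemma coord_neighbour (hF : fc b i = fc b' i') (x : E (n + 1)) :
    b.coord i x = b.coord i (b' i') * b'.coord i' x := by
  have h1 : ∀ j, b.coord i (b' j) = b.coord i (b' i') * b'.coord i' (b' j) := by
    intro j
    rw [b'.coord_apply]
    rcases eq_or_ne i' j with rfl | hj
    · simp
    · rw [if_neg hj, mul_zero]
      refine ((mem_simplex_fc b).1 ?_).1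
      rw [hF]
      exact subset_convexHull ℝ _ (Finset.mem_coe.2 ((mem_fc b').2 hj.symm))
  have h2 : x = Finset.univ.affineCombination ℝ b' (fun j => b'.coord j x) :=
    (b'.affineCombination_coord_eq_self x).symm
  have hw : ∑ j, b'.coord j x = 1 := b'.sum_coord_apply_eq_one x
  have h3 := Finset.univ.map_affineCombination b' (fun j => b'.coord j x) hw (b.coord i)
  rw [← h2, Finset.univ.affineCombination_eq_linear_combination _ _ hw] at h3
  rw [h3, Finset.sum_eq_single i']
  · simp only [Function.comp_apply, smul_eq_mul]
    ring
  · intro j _ hj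
    simp only [Function.comp_apply, smul_eq_mul]
    rw [h1 j, b'.coord_apply, if_neg hj.symm]
    ring
  · simp

variable (hF : fc b i = fc b' i')
  (hint : simplex (vs b) ∩ simplex (vs b') ⊆ simplex (fc b i))

include hF in
lemma coord_neighbour_ne : b.coord i (b' i') ≠ 0 := by
  intro h
  have := coord_neighbour b b' hF (b i)
  rw [h, zero_mul, b.coord_apply, if_pos rfl] at this
  exact one_ne_zero this

-- If the opposite vertex of b' lay on the same side as b, a short step towards it from the relative
-- interior of the face would stay in both simplices and leave the face.
include hF hint in
lemma coord_neighbour_neg : b.coord i (b' i') < 0 := by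
  refine lt_of_le_of_ne (not_lt.1 fun hpos => ?_) (coord_neighbour_ne b b' hF)
  obtain ⟨y, hy⟩ := barycentre_mem_relint b i
  have hyF := hy.1
  rw [hF] at hyF
  obtain ⟨hy0, hyj⟩ := (mem_relint_fc b).1 hy
  have hlim : ∀ j, Tendsto (fun t : ℝ => b.coord j (y + t • (b' i' - y))) (𝓝[>] 0)
      (𝓝 (b.coord j y)) := by
    intro j
    have h1 : Continuous fun t : ℝ => b.coord j (y + t • (b' i' - y)) :=
      (continuous_coord b j).comp (by fun_prop)
    have h2 := h1.tendsto 0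
    simp only [zero_smul, add_zero] at h2
    exact h2.mono_left nhdsWithin_le_nhds
  have hev : ∀ᶠ t in 𝓝[>] (0 : ℝ), ∀ j, j ≠ i → 0 < b.coord j (y + t • (b' i' - y)) := by
    rw [eventually_all]
    intro j
    by_cases hj : j = i
    · exact Eventually.of_forall fun t h => absurd hj h
    · exact ((hlim j).eventually (lt_mem_nhds (hyj j hj))).mono fun t ht _ => ht
  have hIoc : ∀ᶠ t in 𝓝[>] (0 : ℝ), t ∈ Set.Ioc (0 : ℝ) 1 := Ioc_mem_nhdsGT one_pos
  obtain ⟨t, ht, ht1⟩ := (hev.and hIoc).exists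
  set z := y + t • (b' i' - y) with hz
  have hci : b.coord i z = t * b.coord i (b' i') := by
    have e1 := coord_add b i y (t • (b' i' - y))
    have e2 := coord_eq_add b i (b' i') y
    rw [inner_smul_right] at e1
    rw [hz, e1, hy0]
    rw [hy0] at e2
    rw [e2]
    ring
  have hzpos : 0 < b.coord i z := by rw [hci]; exact mul_pos ht1.1 hpos
  have hzK : z ∈ simplex (vs b) := by
    rw [simplex_vs]
    intro j
    rcases eq_or_ne j i with rfl | hj
    · exact hzpos.le
    · exact (ht j hj).le
  have hzK' : z ∈ simplex (vs b') := by
    have := (convex_simplex (vs b')).add_smul_sub_mem (simplex_mono (fc_subset b' i') hyF)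
      (vertex_mem_simplex b' i') ⟨ht1.1.le, ht1.2⟩
    exact this
  exact hzpos.ne' ((mem_simplex_fc b).1 (hint ⟨hzK, hzK'⟩)).1

include hF in
lemma cgrad_neighbour : cgrad b i = b.coord i (b' i') • cgrad b' i' := by
  refine ext_inner_right ℝ fun v => ?_
  have h1 := coord_add b i 0 v
  have h2 := coord_add b' i' 0 v
  have h3 := coord_neighbour b b' hF (0 + v)
  have h4 := coord_neighbour b b' hF 0
  rw [inner_smul_left]
  simp only [conj_trivial]
  rw [h1, h2, h4] at h3
  linarith

-- The gradients of the two coordinates are proportional with a negative factor, and normalizing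
-- removes its size.
include hF hint in
lemma normal_neighbour : normal (vs b') (fc b i) = -normal (vs b) (fc b i) := by
  have hneg := coord_neighbour_neg b b' hF hint
  have h1 : normal (vs b') (fc b i) = normal (vs b') (fc b' i') := by rw [hF]
  rw [h1, normal_eq, normal_eq, cgrad_neighbour b b' hF, norm_smul, Real.norm_eq_abs,
    abs_of_neg hneg, smul_smul, neg_neg, ← neg_smul]
  congr 1
  have := (norm_cgrad_pos b' i').ne'
  have := hneg.ne
  field_simp

/-- A neighbourhood of the relative interior of the common face of two elements. -/
def nearFace (b b' : AffineBasis (Fin (n + 2)) ℝ (E (n + 1))) (i i' : Fin (n + 2)) :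
    Set (E (n + 1)) :=
  {z | (∀ j, j ≠ i → 0 < b.coord j z) ∧ ∀ j, j ≠ i' → 0 < b'.coord j z}

lemma isOpen_nearFace (i i' : Fin (n + 2)) : IsOpen (nearFace b b' i i') := by
  have : nearFace b b' i i' = (⋂ j, {z | j ≠ i → 0 < b.coord j z}) ∩
      ⋂ j, {z | j ≠ i' → 0 < b'.coord j z} := by
    ext z
    simp [nearFace]
  rw [this]
  refine (isOpen_iInter_of_finite fun j => ?_).inter (isOpen_iInter_of_finite fun j => ?_)
  · by_cases h : j = i
    · simp [h]
    · simpa [h] using isOpen_lt continuous_const (continuous_coord b j)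
  · by_cases h : j = i'
    · simp [h]
    · simpa [h] using isOpen_lt continuous_const (continuous_coord b' j)

include hF in
lemma relint_subset_nearFace : relint (fc b i) ⊆ nearFace b b' i i' := by
  intro x hx
  refine ⟨((mem_relint_fc b).1 hx).2, ?_⟩
  rw [hF] at hx
  exact ((mem_relint_fc b').1 hx).2

-- The coordinates of the two opposite vertices have opposite signs. The sign of either decides in
-- which element the point lies, since all others are positive.
include hF hint in
lemma nearFace_subset : nearFace b b' i i' ⊆ simplex (vs b) ∪ simplex (vs b') := by
  intro z hz
  rcases le_total 0 (b.coord i z) with h | h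
  · left
    rw [simplex_vs]
    intro j
    rcases eq_or_ne j i with rfl | hj
    · exact h
    · exact (hz.1 j hj).le
  · right
    rw [simplex_vs]
    intro j
    rcases eq_or_ne j i' with rfl | hj
    · rw [coord_neighbour b b' hF] at h
      by_contra hcon
      have := mul_pos_of_neg_of_neg (coord_neighbour_neg b b' hF hint) (not_le.1 hcon)
      linarith
    · exact (hz.2 j hj).le

lemma nearFace_face {z : E (n + 1)} {j : Fin (n + 2)} (hj : j ≠ i) (hz : z ∈ simplex (fc b j)) :
    z ∉ nearFace b b' i i' := fun h => (h.1 j hj).ne' ((mem_simplex_fc b).1 hz).1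

/-- Integration by parts with a test function that vanishes on all faces but one. -/
lemma integral_by_parts_face {v : E (n + 1) → ℝ} {g : E (n + 1) → E (n + 1)}
    (h : CellH1 (vs b) v g) {χ : E (n + 1) → ℝ} (hχ : ContDiff ℝ 1 χ)
    (h0 : ∀ j, j ≠ i → ∀ x ∈ simplex (fc b j), χ x = 0) (m : Fin (n + 1)) :
    (∫ x, g x m * χ x ∂cellMeasure (vs b)) + ∫ x, v x * pd m χ x ∂cellMeasure (vs b)
      = normal (vs b) (fc b i) m * ∫ x, trace (vs b) v x * χ x ∂faceMeasure (fc b i) := by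
  rw [integral_by_parts b h hχ, Finset.sum_eq_single i]
  · intro j _ hj
    rw [integral_eq_zero_of_ae, mul_zero]
    filter_upwards [ae_faceMeasure_mem (fc b j)] with x hx
    simp [h0 j hj x hx]
  · simp

include hF in
/-- A function on the common face that is orthogonal to all test functions vanishes. -/
lemma ae_eq_zero_of_forall_test {f : E (n + 1) → ℝ} (hf : MemLp f 2 (faceMeasure (fc b i)))
    (h : ∀ χ, IsTest (nearFace b b' i i') χ → ∫ x, χ x * f x ∂faceMeasure (fc b i) = 0) :
    f =ᵐ[faceMeasure (fc b i)] 0 := by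
  have hfin := isFiniteMeasure_faceMeasure b i
  have h1 := (isOpen_nearFace b b' i i').ae_eq_zero_of_integral_contDiff_smul_eq_zero
    (μ := faceMeasure (fc b i)) (f := f)
    ((hf.locallyIntegrable (by norm_num)).locallyIntegrableOn _)
    fun χ h2 h3 h4 => h χ ⟨h2, h3, h4⟩
  filter_upwards [h1, ae_mem_relint b i] with x hx hx'
  exact hx (relint_subset_nearFace b b' hF hx')

end Neighbours

/-! ### Restriction of Sobolev functions -/

section Restriction

variable {d : ℕ}

lemma IsTest.mono {U V : Set (E d)} {ψ : E d → ℝ} (h : IsTest V ψ) (hVU : V ⊆ U) : IsTest U ψ :=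
  ⟨h.1, h.2.1, h.2.2.trans hVU⟩

lemma IsTest.eq_zero {U : Set (E d)} {ψ : E d → ℝ} (h : IsTest U ψ) {x : E d} (hx : x ∉ U) :
    ψ x = 0 := image_eq_zero_of_notMem_tsupport fun h' => hx (h.2.2 h')

lemma IsTest.pd_eq_zero {U : Set (E d)} {ψ : E d → ℝ} (h : IsTest U ψ) {x : E d} (hx : x ∉ U)
    (i : Fin d) : pd i ψ x = 0 := by
  have : fderiv ℝ ψ x = 0 :=
    image_eq_zero_of_notMem_tsupport fun h' => hx (h.2.2 (tsupport_fderiv_subset ℝ h'))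
  rw [pd, this]
  rfl

lemma setIntegral_eq_of_zero {U V : Set (E d)} (hVU : V ⊆ U) {f : E d → ℝ}
    (h : ∀ x ∉ V, f x = 0) : ∫ x in U, f x = ∫ x in V, f x := by
  rw [setIntegral_eq_integral_of_forall_compl_eq_zero h,
    setIntegral_eq_integral_of_forall_compl_eq_zero fun x hx => h x fun h' => hx (hVU h')]

lemma HasWeakGrad.mono {U V : Set (E d)} {v : E d → ℝ} {g : E d → E d} (h : HasWeakGrad U v g)
    (hVU : V ⊆ U) : HasWeakGrad V v g := by
  intro ψ hψ i
  rw [← setIntegral_eq_of_zero hVU fun x hx => by rw [hψ.pd_eq_zero hx, mul_zero],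
    ← setIntegral_eq_of_zero hVU fun x hx => by rw [hψ.eq_zero hx, mul_zero]]
  exact h ψ (hψ.mono hVU) i

lemma memLp_weakGrad {U : Set (E d)} {v : E d → ℝ} (h : MemH1 U v) :
    MemLp (weakGrad U v) 2 (volume.restrict U) := by
  rw [weakGrad, dif_pos h]
  exact h.2.choose_spec.1

lemma hasWeakGrad_weakGrad {U : Set (E d)} {v : E d → ℝ} (h : MemH1 U v) :
    HasWeakGrad U v (weakGrad U v) := by
  rw [weakGrad, dif_pos h]
  exact h.2.choose_spec.2

lemma memLp_cell_of_subset {V : Type*} [NormedAddCommGroup V] {U : Set (E d)} {f : E d → V}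
    (hf : MemLp f 2 (volume.restrict U)) {K : Finset (E d)} (hK : interior (simplex K) ⊆ U) :
    MemLp f 2 (cellMeasure K) := by
  rw [← restrict_interior_simplex]
  exact hf.mono_measure (Measure.restrict_mono hK le_rfl)

lemma cellH1_of_memH1 {U : Set (E d)} {v : E d → ℝ} (h : MemH1 U v) {K : Finset (E d)}
    (hK : interior (simplex K) ⊆ U) : CellH1 K v (weakGrad U v) :=
  ⟨memLp_cell_of_subset h.1 hK, memLp_cell_of_subset (memLp_weakGrad h) hK,
    (hasWeakGrad_weakGrad h).mono hK⟩

end Restriction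

/-! ### Geometry of the triangulation -/

namespace Triangulation

variable {n : ℕ} {G : Config (n + 1)} (T : Triangulation G)

lemma mem_cells {K : Finset (E (n + 1))} : K ∈ T.cells ↔ K ∈ T.cx.faces ∧ K.card = n + 2 := by
  simp [cells]

lemma mem_faces {F : Finset (E (n + 1))} : F ∈ T.faces ↔ F ∈ T.cx.faces ∧ F.card = n + 1 := by
  simp [faces]

lemma exists_basis {K : Finset (E (n + 1))} (hK : K ∈ T.cells) :
    ∃ b : AffineBasis (Fin (n + 2)) ℝ (E (n + 1)), vs b = K :=
  exists_vs_eq (T.cx.indep (T.mem_cells.1 hK).1) (T.mem_cells.1 hK).2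

lemma facesOf_subset {K F : Finset (E (n + 1))} (hK : K ∈ T.cells) (hF : F ∈ facesOf K) :
    F ∈ T.faces := by
  obtain ⟨h1, h2⟩ := Finset.mem_powersetCard.1 hF
  refine T.mem_faces.2 ⟨T.cx.down_closed (T.mem_cells.1 hK).1 h1 ?_, h2⟩
  exact Finset.card_pos.1 (by omega)

lemma simplex_subset_closure {s : Finset (E (n + 1))} (hs : s ∈ T.cx.faces) :
    simplex s ⊆ closure G.Ω := by
  rw [← T.space_eq]
  exact Geometry.SimplicialComplex.convexHull_subset_space hs

/-- The mesh covers the closure of Ω; the condition Ω = int(cl Ω) brings the open elements back into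
Ω. -/
lemma interior_subset {K : Finset (E (n + 1))} (hK : K ∈ T.cells) :
    interior (simplex K) ⊆ G.Ω := by
  rw [← G.interior_closure]
  exact interior_mono (T.simplex_subset_closure (T.mem_cells.1 hK).1)

lemma simplex_inter_subset {s t : Finset (E (n + 1))} (hs : s ∈ T.cx.faces) (ht : t ∈ T.cx.faces)
    {x : E (n + 1)} (hxs : x ∈ simplex s) (hxt : x ∈ simplex t) : x ∈ simplex (s ∩ t) := by
  have := T.cx.inter_subset_convexHull hs ht ⟨hxs, hxt⟩
  rwa [← Finset.coe_inter] at this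

/-- The intersection of two elements with a common face. -/
lemma inter_subset_face {K K' F : Finset (E (n + 1))} (hK : K ∈ T.cells) (hK' : K' ∈ T.cells)
    (hne : K ≠ K') (hF : F ∈ facesOf K) (hF' : F ∈ facesOf K') :
    simplex K ∩ simplex K' ⊆ simplex F := by
  rintro x ⟨hx, hx'⟩
  have h1 := T.simplex_inter_subset (T.mem_cells.1 hK).1 (T.mem_cells.1 hK').1 hx hx'
  obtain ⟨h2, h3⟩ := Finset.mem_powersetCard.1 hF
  obtain ⟨h4, -⟩ := Finset.mem_powersetCard.1 hF'
  have h5 : F ⊆ K ∩ K' := Finset.subset_inter h2 h4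
  have h6 : (K ∩ K').card < n + 2 := by
    rw [← (T.mem_cells.1 hK).2]
    refine Finset.card_lt_card ⟨Finset.inter_subset_left, fun h => hne ?_⟩
    refine Finset.eq_of_subset_of_card_le (h.trans Finset.inter_subset_right) ?_
    rw [(T.mem_cells.1 hK).2, (T.mem_cells.1 hK').2]
  rwa [Finset.eq_of_subset_of_card_le h5 (by omega)]

/-- A common point lies in the hull of the common vertices, so the coordinate of a vertex of K not
in K' is 0, while interior points have positive coordinates. -/
lemma disjoint_interior {K K' : Finset (E (n + 1))} (hK : K ∈ T.cells) (hK' : K' ∈ T.cells)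
    (hne : K ≠ K') : Disjoint (interior (simplex K)) (interior (simplex K')) := by
  rw [Set.disjoint_left]
  intro x hx hx'
  have h1 := T.simplex_inter_subset (T.mem_cells.1 hK).1 (T.mem_cells.1 hK').1
    (_root_.interior_subset hx) (_root_.interior_subset hx')
  obtain ⟨b, rfl⟩ := T.exists_basis hK
  obtain ⟨y, hy, hy'⟩ : ∃ y ∈ vs b, y ∉ K' := by
    by_contra! h
    refine hne (Finset.eq_of_subset_of_card_le h ?_)
    rw [(T.mem_cells.1 hK).2, (T.mem_cells.1 hK').2]
  obtain ⟨j, rfl⟩ : ∃ j, b j = y := by simpa [vs] using hy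
  rw [interior_simplex_vs] at hx
  refine (hx j).ne' (simplex_subset_of_subset b Finset.inter_subset_left h1 fun h => hy' ?_)
  exact (Finset.mem_inter.1 h).2

lemma restrict_biUnion_interior {S : Finset (Finset (E (n + 1)))} (hS : S ⊆ T.cells) :
    (volume : Measure (E (n + 1))).restrict (⋃ K ∈ S, interior (simplex K))
      = ∑ K ∈ S, cellMeasure K := by
  rw [Measure.restrict_biUnion_finset (fun K hK K' hK' hne => T.disjoint_interior (hS hK) (hS hK') hne)
    fun K => isOpen_interior.measurableSet, Measure.sum_fintype, Finset.univ_eq_attach,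
    Finset.sum_attach S fun K => (volume : Measure (E (n + 1))).restrict (interior (simplex K))]
  exact Finset.sum_congr rfl fun K _ => restrict_interior_simplex K

/-- A simplex with an interior point spans the whole space, and affine independence then fixes the
number of its vertices. -/
lemma card_of_interior {s : Finset (E (n + 1))} (hs : s ∈ T.cx.faces) {x : E (n + 1)}
    (hx : x ∈ interior (simplex s)) : s ∈ T.cells := by
  refine T.mem_cells.2 ⟨hs, ?_⟩
  have h1 : affineSpan ℝ (s : Set (E (n + 1))) = ⊤ :=
    interior_convexHull_nonempty_iff_affineSpan_eq_top.1 ⟨x, hx⟩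
  have h2 := T.cx.indep hs
  have h3 : affineSpan ℝ (Set.range ((↑) : s → E (n + 1))) = ⊤ := by
    rw [← h1]
    congr 1
    exact Subtype.range_coe
  have h4 := h2.affineSpan_eq_top_iff_card_eq_finrank_add_one.1 h3
  rw [finrank_euclideanSpace_fin, Fintype.card_coe] at h4
  omega

/-- The elements cover `Ω` up to a null set. -/
lemma restrict_Ω : (volume : Measure (E (n + 1))).restrict G.Ω = ∑ K ∈ T.cells, cellMeasure K := by
  rw [← T.restrict_biUnion_interior subset_rfl]
  refine Measure.restrict_congr_set (Filter.EventuallyLE.antisymm ?_ ?_)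
  · rw [ae_le_set]
    -- A point of Ω outside all open elements is on the frontier of some simplex of the complex;
    -- those of lower dimension consist of frontier only.
    have hnull : volume (⋃ s ∈ T.cx.faces, frontier (simplex s)) = 0 :=
      (measure_biUnion_null_iff T.finite_faces.countable).2 fun s _ =>
        (convex_simplex s).addHaar_frontier volume
    refine measure_mono_null ?_ hnull
    rintro x ⟨hxΩ, hx⟩
    have hxs : x ∈ T.cx.space := by
      rw [T.space_eq]
      exact subset_closure hxΩ
    obtain ⟨s, hs, hxs⟩ := Geometry.SimplicialComplex.mem_space_iff.1 hxs
    refine Set.mem_biUnion hs ⟨subset_closure hxs, fun hxi => hx ?_⟩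
    exact Set.mem_biUnion (T.card_of_interior hs hxi) hxi
  · exact Filter.Eventually.of_forall fun x hx => by
      obtain ⟨K, hK, hx⟩ := Set.mem_iUnion₂.1 hx
      exact T.interior_subset hK hx

lemma integral_Ω {f : E (n + 1) → ℝ} (hf : ∀ K ∈ T.cells, Integrable f (cellMeasure K)) :
    ∫ x in G.Ω, f x = ∑ K ∈ T.cells, ∫ x, f x ∂cellMeasure K := by
  rw [T.restrict_Ω, integral_finsetSum_measure hf]

lemma memLp_cell_of_Ω {V : Type*} [NormedAddCommGroup V] {f : E (n + 1) → V}
    (hf : MemLp f 2 (volume.restrict G.Ω)) {K : Finset (E (n + 1))} (hK : K ∈ T.cells) :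
    MemLp f 2 (cellMeasure K) := memLp_cell_of_subset hf (T.interior_subset hK)

/-! ### The two subdomains -/

lemma mem_cellsp {K : Finset (E (n + 1))} :
    K ∈ T.cellsp ↔ K ∈ T.cells ∧ interior (simplex K) ⊆ G.Ωp := by
  classical
  simp [cellsp]

lemma mem_cellsm {K : Finset (E (n + 1))} :
    K ∈ T.cellsm ↔ K ∈ T.cells ∧ interior (simplex K) ⊆ G.Ωm := by
  classical
  simp [cellsm]

lemma cellsp_or_cellsm {K : Finset (E (n + 1))} (hK : K ∈ T.cells) :
    K ∈ T.cellsp ∨ K ∈ T.cellsm :=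
  (T.side K (T.mem_cells.1 hK).1 (T.mem_cells.1 hK).2).imp
    (fun h => T.mem_cellsp.2 ⟨hK, h⟩) fun h => T.mem_cellsm.2 ⟨hK, h⟩

lemma interior_nonempty {K : Finset (E (n + 1))} (hK : K ∈ T.cells) :
    (interior (simplex K)).Nonempty := by
  obtain ⟨b, rfl⟩ := T.exists_basis hK
  exact interior_simplex_nonempty b

lemma disjoint_cellsp_cellsm : Disjoint T.cellsp T.cellsm := by
  rw [Finset.disjoint_left]
  intro K hp hm
  obtain ⟨x, hx⟩ := T.interior_nonempty (T.mem_cellsp.1 hp).1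
  have : x ∈ G.Ωp ∩ G.Ωm := ⟨(T.mem_cellsp.1 hp).2 hx, (T.mem_cellsm.1 hm).2 hx⟩
  rw [G.disjoint_Ω] at this
  exact this

lemma sum_cells {M : Type*} [AddCommMonoid M] (f : Finset (E (n + 1)) → M) :
    ∑ K ∈ T.cells, f K = ∑ K ∈ T.cellsp, f K + ∑ K ∈ T.cellsm, f K := by
  classical
  rw [← Finset.sum_union T.disjoint_cellsp_cellsm]
  refine Finset.sum_congr ?_ fun _ _ => rfl
  ext K
  rw [Finset.mem_union]
  exact ⟨T.cellsp_or_cellsm, fun h => h.elim (fun h => (T.mem_cellsp.1 h).1)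
    fun h => (T.mem_cellsm.1 h).1⟩

lemma σ_cellsp {K : Finset (E (n + 1))} (hK : K ∈ T.cellsp) (σp σm : ℝ) :
    ∀ᵐ x ∂cellMeasure K, G.σ σp σm x = σp := by
  rw [← restrict_interior_simplex]
  filter_upwards [ae_restrict_mem isOpen_interior.measurableSet] with x hx
  rw [Config.σ, if_pos ((T.mem_cellsp.1 hK).2 hx)]

lemma σ_cellsm {K : Finset (E (n + 1))} (hK : K ∈ T.cellsm) (σp σm : ℝ) :
    ∀ᵐ x ∂cellMeasure K, G.σ σp σm x = σm := by
  rw [← restrict_interior_simplex]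
  filter_upwards [ae_restrict_mem isOpen_interior.measurableSet] with x hx
  rw [Config.σ, if_neg]
  intro h
  have : x ∈ G.Ωp ∩ G.Ωm := ⟨h, (T.mem_cellsm.1 hK).2 hx⟩
  rw [G.disjoint_Ω] at this
  exact this

lemma exists_σ {K : Finset (E (n + 1))} (hK : K ∈ T.cells) (σp σm : ℝ) :
    ∃ s, ∀ᵐ x ∂cellMeasure K, G.σ σp σm x = s :=
  (T.cellsp_or_cellsm hK).elim (fun h => ⟨σp, T.σ_cellsp h σp σm⟩)
    fun h => ⟨σm, T.σ_cellsm h σp σm⟩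

/-- For nonnegative f it is enough that the open elements are disjoint and contained in the
subdomain; that they fill it is not needed. -/
lemma sum_cellsp_le {f : E (n + 1) → ℝ} (hf : Integrable f (volume.restrict G.Ωp))
    (h0 : ∀ x, 0 ≤ f x) : ∑ K ∈ T.cellsp, ∫ x, f x ∂cellMeasure K ≤ ∫ x in G.Ωp, f x := by
  have hsub : T.cellsp ⊆ T.cells := fun K hK => (T.mem_cellsp.1 hK).1
  have hle : ∑ K ∈ T.cellsp, cellMeasure K ≤ volume.restrict G.Ωp := by
    rw [← T.restrict_biUnion_interior hsub]
    exact Measure.restrict_mono (Set.iUnion₂_subset fun K hK => (T.mem_cellsp.1 hK).2) le_rfl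
  have hK : ∀ K ∈ T.cellsp, Integrable f (cellMeasure K) := fun K hK => by
    rw [← restrict_interior_simplex]
    exact hf.mono_measure (Measure.restrict_mono (T.mem_cellsp.1 hK).2 le_rfl)
  rw [← integral_finsetSum_measure hK]
  exact integral_mono_measure hle (Eventually.of_forall h0) hf

lemma sum_cellsm_le {f : E (n + 1) → ℝ} (hf : Integrable f (volume.restrict G.Ωm))
    (h0 : ∀ x, 0 ≤ f x) : ∑ K ∈ T.cellsm, ∫ x, f x ∂cellMeasure K ≤ ∫ x in G.Ωm, f x := by
  have hsub : T.cellsm ⊆ T.cells := fun K hK => (T.mem_cellsm.1 hK).1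
  have hle : ∑ K ∈ T.cellsm, cellMeasure K ≤ volume.restrict G.Ωm := by
    rw [← T.restrict_biUnion_interior hsub]
    exact Measure.restrict_mono (Set.iUnion₂_subset fun K hK => (T.mem_cellsm.1 hK).2) le_rfl
  have hK : ∀ K ∈ T.cellsm, Integrable f (cellMeasure K) := fun K hK => by
    rw [← restrict_interior_simplex]
    exact hf.mono_measure (Measure.restrict_mono (T.mem_cellsm.1 hK).2 le_rfl)
  rw [← integral_finsetSum_measure hK]
  exact integral_mono_measure hle (Eventually.of_forall h0) hf

/-- The stabilization parameter has one sign on the boundary of an element, and does not vanish on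
all of it. -/
lemma tau_sign {τ : Finset (E (n + 1)) → ℝ} (hτ : T.TauCondition τ) {K : Finset (E (n + 1))}
    (hK : K ∈ T.cells) : ((∀ F ∈ facesOf K, 0 ≤ τ F) ∨ ∀ F ∈ facesOf K, τ F ≤ 0) ∧
      ∃ F ∈ facesOf K, τ F ≠ 0 := by
  obtain ⟨h0, hp, hm⟩ := hτ
  obtain ⟨F₀, hF₀, hF₀I⟩ := T.not_enclosed K (T.mem_cells.1 hK).1 (T.mem_cells.1 hK).2
  rcases T.cellsp_or_cellsm hK with h | h
  · refine ⟨Or.inl fun F hF => ?_, F₀, hF₀, (hp K h F₀ hF₀ hF₀I).ne'⟩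
    by_cases hI : simplex F ⊆ G.ΓI
    · exact (h0 F (T.facesOf_subset hK hF) hI).ge
    · exact (hp K h F hF hI).le
  · refine ⟨Or.inr fun F hF => ?_, F₀, hF₀, (hm K h F₀ hF₀ hF₀I).ne⟩
    by_cases hI : simplex F ⊆ G.ΓI
    · exact (h0 F (T.facesOf_subset hK hF) hI).le
    · exact (hm K h F hF hI).le

/-- Shape regularity bounds the diameter by the heights. -/
lemma norm_cgrad_mul_diam_le {ρ : ℝ} (hρ : 0 < ρ) (hT : T.ShapeRegular ρ)
    {b : AffineBasis (Fin (n + 2)) ℝ (E (n + 1))} (hK : vs b ∈ T.cells) (i : Fin (n + 2)) :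
    ‖cgrad b i‖ * Metric.diam (simplex (vs b)) ≤ ρ := by
  obtain ⟨x, hx⟩ := hT _ hK
  have := norm_cgrad_mul_le b (by have := Metric.diam_nonneg (s := simplex (vs b)); positivity) hx i
  rw [mul_div_assoc', div_le_one hρ] at this
  exact this

lemma diam_le_h {K : Finset (E (n + 1))} (hK : K ∈ T.cells) : Metric.diam (simplex K) ≤ T.h :=
  le_ciSup (f := fun K : {K // K ∈ T.cells} => Metric.diam (simplex K.1))
    (Set.finite_range _).bddAbove ⟨K, hK⟩

/-! ### Faces and the elements that contain them -/

/-- A face of only one element is on the boundary. -/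
lemma face_subset_frontier {K F : Finset (E (n + 1))} (hK : K ∈ T.cells) (hF : F ∈ facesOf K)
    (h : ∀ K' ∈ T.cells, F ∈ facesOf K' → K' = K) : simplex F ⊆ frontier G.Ω := by
  obtain ⟨b, rfl⟩ := T.exists_basis hK
  obtain ⟨i, rfl⟩ := (mem_facesOf_iff b).1 hF
  intro x hx
  have hxc : x ∈ closure G.Ω :=
    T.simplex_subset_closure (T.mem_faces.1 (T.facesOf_subset hK hF)).1 hx
  rw [frontier, G.isOpen_Ω.interior_eq]
  refine ⟨hxc, fun hxΩ => ?_⟩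
  obtain ⟨y₀, hy₀⟩ := barycentre_mem_relint b i
  obtain ⟨hy₀i, hy₀j⟩ := (mem_relint_fc b).1 hy₀
  obtain ⟨hxi, hxj⟩ := (mem_simplex_fc b).1 hx
  have hc : Continuous fun t : ℝ => x + t • (y₀ - x) := by fun_prop
  have h1 : ∀ᶠ t in 𝓝[>] (0 : ℝ), x + t • (y₀ - x) ∈ G.Ω := by
    have h2 := hc.tendsto 0
    simp only [zero_smul, add_zero] at h2
    exact (h2.mono_left nhdsWithin_le_nhds).eventually (G.isOpen_Ω.mem_nhds hxΩ)
  have h2 : ∀ᶠ t in 𝓝[>] (0 : ℝ), t ∈ Set.Ioc (0 : ℝ) 1 := Ioc_mem_nhdsGT one_pos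
  -- If x were in Ω, a short step towards the relative interior would give a point y of Ω in the
  -- relative interior of the face.
  obtain ⟨t, hyΩ, ht0, ht1⟩ := (h1.and h2).exists
  set y := x + t • (y₀ - x) with hy
  have hcoord : ∀ j, b.coord j y = (1 - t) * b.coord j x + t * b.coord j y₀ := by
    intro j
    rw [hy, coord_add, inner_smul_right, coord_eq_add b j y₀ x]
    ring
  have hyF : y ∈ relint (fc b i) := by
    refine (mem_relint_fc b).2 ⟨by rw [hcoord, hxi, hy₀i]; ring, fun j hj => ?_⟩
    rw [hcoord]
    have := mul_nonneg (sub_nonneg.2 ht1) (hxj j)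
    have := mul_pos ht0 (hy₀j j hj)
    linarith
  have hFf : fc b i ∈ T.cx.faces := (T.mem_faces.1 (T.facesOf_subset hK hF)).1
  -- A simplex of the complex that contains y contains all vertices of the face. It is the face, or
  -- an element with this face, that is, K.
  have hsub : ∀ s ∈ T.cx.faces, y ∈ simplex s → s ⊆ vs b := by
    intro s hs hys
    have h3 := T.simplex_inter_subset hFf hs hyF.1 hys
    have h4 : fc b i ⊆ s := by
      by_contra hcon
      refine hyF.2 _ ⟨Finset.inter_subset_left, fun h5 => hcon ?_⟩ h3
      exact h5.trans Finset.inter_subset_right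
    have h5 : s.card ≤ n + 2 := by
      have := (T.cx.indep hs).card_le_finrank_succ
      rw [Fintype.card_coe] at this
      refine this.trans ?_
      have := Submodule.finrank_le (vectorSpan ℝ (Set.range ((↑) : s → E (n + 1))))
      rw [finrank_euclideanSpace_fin] at this
      omega
    have h6 := Finset.card_le_card h4
    rw [card_fc] at h6
    rcases h6.eq_or_lt with h7 | h7
    · rw [← Finset.eq_of_subset_of_card_le h4 (by rw [card_fc]; omega)]
      exact fc_subset b i
    · rw [h s (T.mem_cells.2 ⟨hs, by omega⟩)
        (Finset.mem_powersetCard.2 ⟨h4, card_fc b i⟩)]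
  have hclosed : IsClosed (⋃ s ∈ {s ∈ T.cx.faces | y ∉ simplex s}, simplex s) :=
    (T.finite_faces.subset (Set.sep_subset _ _)).isClosed_biUnion
      fun s _ => (isCompact_simplex s).isClosed
  have hopen : IsOpen (G.Ω ∩ (⋃ s ∈ {s ∈ T.cx.faces | y ∉ simplex s}, simplex s)ᶜ) :=
    G.isOpen_Ω.inter hclosed.isOpen_compl
  -- Near y only simplices through y occur, and all of them lie in K. So y is interior to K,
  -- although it is on a face.
  have hyint : y ∈ interior (simplex (vs b)) := by
    refine mem_interior.2 ⟨_, ?_, hopen, hyΩ, ?_⟩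
    · rintro z ⟨hzΩ, hz⟩
      have hzs : z ∈ T.cx.space := by
        rw [T.space_eq]
        exact subset_closure hzΩ
      obtain ⟨s, hs, hzs⟩ := Geometry.SimplicialComplex.mem_space_iff.1 hzs
      have hys : y ∈ simplex s := by
        by_contra hcon
        exact hz (Set.mem_biUnion ⟨hs, hcon⟩ hzs)
      exact simplex_mono (hsub s hs hys) hzs
    · simp only [Set.mem_compl_iff, Set.mem_iUnion, not_exists]
      rintro s ⟨-, hs⟩ hys
      exact hs hys
  exact notMem_face_of_interior b hyint i hyF.1

/-- At most two elements contain a face. -/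
lemma eq_or_eq_of_face {K K' K'' F : Finset (E (n + 1))} (hK : K ∈ T.cells) (hK' : K' ∈ T.cells)
    (hK'' : K'' ∈ T.cells) (hF : F ∈ facesOf K) (hF' : F ∈ facesOf K') (hF'' : F ∈ facesOf K'')
    (hne : K ≠ K') : K'' = K ∨ K'' = K' := by
  by_contra! hcon
  have i1 := T.inter_subset_face hK hK' hne hF hF'
  have i2 := T.inter_subset_face hK hK'' hcon.1.symm hF hF''
  have i3 := T.inter_subset_face hK' hK'' hcon.2.symm hF' hF''
  obtain ⟨b, rfl⟩ := T.exists_basis hK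
  obtain ⟨b', rfl⟩ := T.exists_basis hK'
  obtain ⟨b'', rfl⟩ := T.exists_basis hK''
  obtain ⟨i, rfl⟩ := (mem_facesOf_iff b).1 hF
  obtain ⟨i', hi'⟩ := (mem_facesOf_iff b').1 hF'
  obtain ⟨i'', hi''⟩ := (mem_facesOf_iff b'').1 hF''
  -- The normals of three elements on the face would be pairwise opposite, hence zero.
  have e1 := normal_neighbour b b' hi'.symm i1
  have e2 := normal_neighbour b b'' hi''.symm i2
  have e3 := normal_neighbour b' b'' (hi'.trans hi''.symm) (by rw [hi']; exact i3)
  rw [hi', e1, e2, neg_neg] at e3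
  have e4 := norm_normal b i
  have e5 : normal (vs b) (fc b i) = 0 := by
    have h2 : (2 : ℝ) • normal (vs b) (fc b i) = 0 := by
      rw [two_smul]
      nth_rewrite 1 [← e3]
      exact neg_add_cancel _
    exact (smul_eq_zero.1 h2).resolve_left two_ne_zero
  rw [e5, norm_zero] at e4
  exact zero_ne_one e4

end Triangulation

lemma continuous_pd_of_isTest {d : ℕ} {U : Set (E d)} {χ : E d → ℝ} (hχ : IsTest U χ) (i : Fin d) :
    Continuous (pd i χ) := continuous_pd (hχ.1.of_le (by norm_cast)) i

/-- A function on an element that has the same moments with all test functions vanishes. -/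
lemma ae_eq_zero_of_forall_isTest {d : ℕ} {K : Finset (E d)} {f : E d → ℝ}
    (hf : MemLp f 2 (cellMeasure K))
    (h : ∀ χ, IsTest (interior (simplex K)) χ → ∫ x, f x * χ x ∂cellMeasure K = 0) :
    f =ᵐ[cellMeasure K] 0 := by
  have hint : IntegrableOn f (interior (simplex K)) := by
    rw [IntegrableOn, restrict_interior_simplex]
    exact hf.integrable (by norm_num)
  have := isOpen_interior.ae_eq_zero_of_integral_contDiff_smul_eq_zero (μ := volume)
    (U := interior (simplex K)) (f := f) hint.locallyIntegrableOn ?_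
  · rw [← restrict_interior_simplex]
    exact (ae_restrict_iff' isOpen_interior.measurableSet).2 this
  · intro χ hχ hχc hχs
    rw [← h χ ⟨hχ, hχc, hχs⟩, ← restrict_interior_simplex,
      setIntegral_eq_integral_of_forall_compl_eq_zero fun x hx => ?_]
    · simp only [smul_eq_mul, mul_comm]
    · rw [image_eq_zero_of_notMem_tsupport fun h => hx (hχs h), mul_zero]

namespace Triangulation

variable {n : ℕ} {G : Config (n + 1)} (T : Triangulation G)

/-! ### Elementwise facts -/

section Element

variable {K F : Finset (E (n + 1))} (hK : K ∈ T.cells)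

include hK in
lemma memLp_pval_face (hF : F ∈ facesOf K) (p : Poly (n + 1)) :
    MemLp (pval p) 2 (faceMeasure F) := by
  obtain ⟨b, rfl⟩ := T.exists_basis hK
  obtain ⟨i, rfl⟩ := (mem_facesOf_iff b).1 hF
  exact SignHDG.memLp_pval_face b i p

include hK in
lemma memLp_normalVal (hF : F ∈ facesOf K) (r : Fin (n + 1) → Poly (n + 1)) :
    MemLp (normalVal K F r) 2 (faceMeasure F) := by
  obtain ⟨b, rfl⟩ := T.exists_basis hK
  obtain ⟨i, rfl⟩ := (mem_facesOf_iff b).1 hF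
  exact SignHDG.memLp_normalVal b _ i r

include hK in
lemma memLp_trace (hF : F ∈ facesOf K) {v : E (n + 1) → ℝ} {g : E (n + 1) → E (n + 1)}
    (h : CellH1 K v g) : MemLp (trace K v) 2 (faceMeasure F) := by
  obtain ⟨b, rfl⟩ := T.exists_basis hK
  obtain ⟨i, rfl⟩ := (mem_facesOf_iff b).1 hF
  exact SignHDG.memLp_trace b h i

include hK in
lemma memLp_normalTrace (hF : F ∈ facesOf K) {r : E (n + 1) → E (n + 1)}
    {g : Fin (n + 1) → E (n + 1) → E (n + 1)} (hr : ∀ m, CellH1 K (fun x => r x m) (g m)) :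
    MemLp (normalTrace K F r) 2 (faceMeasure F) := by
  obtain ⟨b, rfl⟩ := T.exists_basis hK
  obtain ⟨i, rfl⟩ := (mem_facesOf_iff b).1 hF
  exact SignHDG.memLp_normalTrace b hr (vs b) i

include hK in
lemma integral_by_parts {v : E (n + 1) → ℝ} {g : E (n + 1) → E (n + 1)} (h : CellH1 K v g)
    {χ : E (n + 1) → ℝ} (hχ : ContDiff ℝ 1 χ) (m : Fin (n + 1)) :
    (∫ x, g x m * χ x ∂cellMeasure K) + ∫ x, v x * pd m χ x ∂cellMeasure K
      = ∑ F ∈ facesOf K, normal K F m * ∫ x, trace K v x * χ x ∂faceMeasure F := by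
  obtain ⟨b, rfl⟩ := T.exists_basis hK
  rw [sum_facesOf]
  exact SignHDG.integral_by_parts b h hχ m

include hK in
lemma integral_by_parts_vec {w : E (n + 1) → E (n + 1)} {g : Fin (n + 1) → E (n + 1) → E (n + 1)}
    (h : ∀ m, CellH1 K (fun x => w x m) (g m)) {χ : E (n + 1) → ℝ} (hχ : ContDiff ℝ 1 χ) :
    (∫ x, (∑ m, g m x m) * χ x ∂cellMeasure K) + ∫ x, ∑ m, w x m * pd m χ x ∂cellMeasure K
      = ∑ F ∈ facesOf K, ∫ x, normalTrace K F w x * χ x ∂faceMeasure F := by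
  have hχL : MemLp χ 2 (cellMeasure K) := memLp_cell K hχ.continuous 2
  have e1 : ∫ x, (∑ m, g m x m) * χ x ∂cellMeasure K
      = ∑ m, ∫ x, g m x m * χ x ∂cellMeasure K := by
    simp only [Finset.sum_mul]
    exact integral_finsetSum _ fun m _ =>
      integrable_mul_of_memLp (memLp_coord (h m).memLp_grad m) hχL
  have e2 : ∫ x, ∑ m, w x m * pd m χ x ∂cellMeasure K
      = ∑ m, ∫ x, w x m * pd m χ x ∂cellMeasure K :=
    integral_finsetSum _ fun m _ =>
      integrable_mul_of_memLp (h m).memLp (memLp_cell K (continuous_pd hχ m) 2)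
  rw [e1, e2, ← Finset.sum_add_distrib,
    Finset.sum_congr rfl fun m _ => T.integral_by_parts hK (h m) hχ m, Finset.sum_comm]
  refine Finset.sum_congr rfl fun F hF => ?_
  have hχF : MemLp χ 2 (faceMeasure F) := by
    obtain ⟨b, rfl⟩ := T.exists_basis hK
    obtain ⟨i, rfl⟩ := (mem_facesOf_iff b).1 hF
    exact memLp_face b i hχ.continuous 2
  simp only [normalTrace, Finset.sum_mul, mul_right_comm]
  rw [integral_finsetSum _ fun m _ =>
    (integrable_mul_of_memLp (T.memLp_trace hK hF (h m)) hχF).mul_const _]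
  refine Finset.sum_congr rfl fun m _ => ?_
  rw [integral_mul_const, mul_comm]

include hK in
/-- A weak divergence is elementwise the divergence. -/
lemma div_eq {w : E (n + 1) → E (n + 1)} {θ : E (n + 1) → ℝ}
    {g : Fin (n + 1) → E (n + 1) → E (n + 1)} (hg : ∀ m, CellH1 K (fun x => w x m) (g m))
    (hθ : MemLp θ 2 (volume.restrict G.Ω)) (hw : HasWeakDiv G.Ω w θ) :
    (fun x => ∑ m, g m x m) =ᵐ[cellMeasure K] θ := by
  have hθK := T.memLp_cell_of_Ω hθ hK
  have hgL : MemLp (fun x => ∑ m, g m x m) 2 (cellMeasure K) :=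
    memLp_finsetSum _ fun m _ => memLp_coord (hg m).memLp_grad m
  have h1 := ae_eq_zero_of_forall_isTest (hgL.sub hθK) fun χ hχ => by
    have hχL : MemLp χ 2 (cellMeasure K) := memLp_cell K hχ.1.continuous 2
    have e1 := hw χ (hχ.mono (T.interior_subset hK))
    rw [setIntegral_eq_of_zero (T.interior_subset hK) fun x hx =>
        Finset.sum_eq_zero fun m _ => by rw [hχ.pd_eq_zero hx, mul_zero],
      setIntegral_eq_of_zero (T.interior_subset hK) fun x hx => by rw [hχ.eq_zero hx, mul_zero],
      restrict_interior_simplex] at e1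
    have e2 := T.integral_by_parts_vec hK hg (hχ.1.of_le (by norm_cast))
    rw [Finset.sum_eq_zero, e1] at e2
    · simp only [Pi.sub_apply, sub_mul]
      rw [integral_sub (integrable_mul_of_memLp hgL hχL) (integrable_mul_of_memLp hθK hχL)]
      linarith
    · intro F hF
      refine integral_eq_zero_of_ae ?_
      filter_upwards [ae_faceMeasure_mem F] with x hx
      rw [Pi.zero_apply, hχ.eq_zero, mul_zero]
      obtain ⟨b, rfl⟩ := T.exists_basis hK
      obtain ⟨i, rfl⟩ := (mem_facesOf_iff b).1 hF
      exact fun hxi => notMem_face_of_interior b hxi i hx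
  filter_upwards [h1] with x hx
  exact sub_eq_zero.1 hx

end Element

/-! ### Jumps over a face -/

section Jumps

variable {b b' : AffineBasis (Fin (n + 2)) ℝ (E (n + 1))} {i i' : Fin (n + 2)}
  (hK : vs b ∈ T.cells) (hK' : vs b' ∈ T.cells) (hne : vs b ≠ vs b') (hF : fc b i = fc b' i')

include hK hK' hne hF

lemma nearFace_subset_union : nearFace b b' i i' ⊆ simplex (vs b) ∪ simplex (vs b') :=
  nearFace_subset b b' hF
    (T.inter_subset_face hK hK' hne (fc_mem_facesOf b i) (hF ▸ fc_mem_facesOf b' i'))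

lemma nearFace_subset_Ω : nearFace b b' i i' ⊆ G.Ω := by
  rw [← G.interior_closure]
  refine interior_maximal ((T.nearFace_subset_union hK hK' hne hF).trans ?_)
    (isOpen_nearFace b b' i i')
  exact Set.union_subset (T.simplex_subset_closure (T.mem_cells.1 hK).1)
    (T.simplex_subset_closure (T.mem_cells.1 hK').1)

/-- The support lies in two elements, and the interiors of all the others are disjoint from these
two. -/
lemma integral_Ω_nearFace {f : E (n + 1) → ℝ} (hf : ∀ K ∈ T.cells, Integrable f (cellMeasure K))
    (h0 : ∀ x ∉ nearFace b b' i i', f x = 0) :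
    ∫ x in G.Ω, f x = ∫ x, f x ∂cellMeasure (vs b) + ∫ x, f x ∂cellMeasure (vs b') := by
  classical
  have hdisj : ∀ K ∈ T.cells, ∀ K' ∈ T.cells, K ≠ K' →
      Disjoint (interior (simplex K)) (simplex K') := by
    intro K h1 K' h2 h3
    have h4 := (T.disjoint_interior h1 h2 h3).closure_right isOpen_interior
    rw [(convex_simplex K').closure_interior_eq_closure_of_nonempty_interior
      (T.interior_nonempty h2)] at h4
    exact h4.mono_right subset_closure
  rw [T.integral_Ω hf, ← Finset.sum_pair (f := fun K => ∫ x, f x ∂cellMeasure K) hne]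
  symm
  refine Finset.sum_subset ?_ fun K h1 h2 => ?_
  · intro K h
    rcases Finset.mem_insert.1 h with rfl | h
    · exact hK
    · rw [Finset.mem_singleton.1 h]
      exact hK'
  · simp only [Finset.mem_insert, Finset.mem_singleton, not_or] at h2
    refine integral_eq_zero_of_ae ?_
    rw [← restrict_interior_simplex]
    filter_upwards [ae_restrict_mem isOpen_interior.measurableSet] with x hx
    refine h0 x fun hx' => ?_
    rcases T.nearFace_subset_union hK hK' hne hF hx' with h | h
    · exact Set.disjoint_left.1 (hdisj K h1 _ hK h2.1) hx h
    · exact Set.disjoint_left.1 (hdisj K h1 _ hK' h2.2) hx h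

lemma normal_eq_neg : normal (vs b') (fc b i) = -normal (vs b) (fc b i) :=
  normal_neighbour b b' hF
    (T.inter_subset_face hK hK' hne (fc_mem_facesOf b i) (hF ▸ fc_mem_facesOf b' i'))

/-- For test functions supported near the face, integration by parts on the two elements leaves the
jump times a component of the normal, whereas the weak gradient on Ω leaves nothing. A nonzero
component m of the normal is used. -/
lemma trace_eq_of_basis {φ : E (n + 1) → ℝ} (hφ : MemH1 G.Ω φ) :
    trace (vs b) φ =ᵐ[faceMeasure (fc b i)] trace (vs b') φ := by
  have hc := cellH1_of_memH1 hφ (T.interior_subset hK)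
  have hc' := cellH1_of_memH1 hφ (T.interior_subset hK')
  have hL := SignHDG.memLp_trace b hc i
  have hL' : MemLp (trace (vs b') φ) 2 (faceMeasure (fc b i)) := by
    rw [hF]
    exact SignHDG.memLp_trace b' hc' i'
  obtain ⟨m, hm⟩ : ∃ m, normal (vs b) (fc b i) m ≠ 0 := by
    by_contra! h
    have h1 : normal (vs b) (fc b i) = 0 := by
      ext m
      exact h m
    have h2 := norm_normal b i
    rw [h1, norm_zero] at h2
    exact zero_ne_one h2
  have key := ae_eq_zero_of_forall_test b b' hF (hL.sub hL') fun χ hχ => by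
    have hχ1 : ContDiff ℝ 1 χ := hχ.1.of_le (by norm_cast)
    have hχF := memLp_face b i hχ.1.continuous 2
    have e1 := integral_by_parts_face (i := i) b hc hχ1
      (fun j hj x hx => hχ.eq_zero (nearFace_face b b' hj hx)) m
    have e2 := integral_by_parts_face (i := i') b' hc' hχ1
      (fun j hj x hx => hχ.eq_zero fun h => nearFace_face b' b hj hx ⟨h.2, h.1⟩) m
    rw [← hF, T.normal_eq_neg hK hK' hne hF, PiLp.neg_apply] at e2
    have hg : ∀ K ∈ T.cells, Integrable (fun x => weakGrad G.Ω φ x m * χ x) (cellMeasure K) :=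
      fun K hK => integrable_mul_of_memLp (memLp_coord (T.memLp_cell_of_Ω (memLp_weakGrad hφ) hK) m)
        (memLp_cell K hχ.1.continuous 2)
    have hv : ∀ K ∈ T.cells, Integrable (fun x => φ x * pd m χ x) (cellMeasure K) :=
      fun K hK => integrable_mul_of_memLp (T.memLp_cell_of_Ω hφ.1 hK)
        (memLp_cell K (continuous_pd_of_isTest hχ m) 2)
    have e3 := hasWeakGrad_weakGrad hφ χ (hχ.mono (T.nearFace_subset_Ω hK hK' hne hF)) m
    rw [T.integral_Ω_nearFace hK hK' hne hF hg fun x hx => by rw [hχ.eq_zero hx, mul_zero],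
      T.integral_Ω_nearFace hK hK' hne hF hv fun x hx => by rw [hχ.pd_eq_zero hx, mul_zero]] at e3
    have e4 : ∫ x, χ x * (trace (vs b) φ x - trace (vs b') φ x) ∂faceMeasure (fc b i)
        = (∫ x, trace (vs b) φ x * χ x ∂faceMeasure (fc b i))
          - ∫ x, trace (vs b') φ x * χ x ∂faceMeasure (fc b i) := by
      rw [← integral_sub (integrable_mul_of_memLp hL hχF) (integrable_mul_of_memLp hL' hχF)]
      congr 1
      ext x
      ring
    simp only [Pi.sub_apply]
    rw [e4]
    refine (mul_eq_zero.1 (?_ : normal (vs b) (fc b i) m * _ = 0)).resolve_left hm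
    rw [mul_sub]
    linarith
  filter_upwards [key] with x hx
  exact sub_eq_zero.1 hx

/-- The argument for traces with the weak divergence in place of the weak gradient: on each element
the divergence is θ, so only the face terms remain. -/
lemma jump_flux_of_basis {w : E (n + 1) → E (n + 1)} {θ : E (n + 1) → ℝ}
    {g : Finset (E (n + 1)) → Fin (n + 1) → E (n + 1) → E (n + 1)}
    (hg : ∀ K ∈ T.cells, ∀ m, CellH1 K (fun x => w x m) (g K m))
    (hθ : MemLp θ 2 (volume.restrict G.Ω)) (hw : HasWeakDiv G.Ω w θ) :
    ∀ᵐ x ∂faceMeasure (fc b i),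
      normalTrace (vs b) (fc b i) w x + normalTrace (vs b') (fc b i) w x = 0 := by
  have hFK := fc_mem_facesOf b i
  have hFK' : fc b i ∈ facesOf (vs b') := hF ▸ fc_mem_facesOf b' i'
  have hL := T.memLp_normalTrace hK hFK (hg _ hK)
  have hL' := T.memLp_normalTrace hK' hFK' (hg _ hK')
  refine ae_eq_zero_of_forall_test b b' hF (hL.add hL') fun χ hχ => ?_
  have hχ1 : ContDiff ℝ 1 χ := hχ.1.of_le (by norm_cast)
  have hχF := memLp_face b i hχ.1.continuous 2
  have e1 := T.integral_by_parts_vec hK (hg _ hK) hχ1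
  have e2 := T.integral_by_parts_vec hK' (hg _ hK') hχ1
  have d1 : ∫ x, (∑ m, g (vs b) m x m) * χ x ∂cellMeasure (vs b)
      = ∫ x, θ x * χ x ∂cellMeasure (vs b) :=
    integral_congr_ae ((T.div_eq hK (hg _ hK) hθ hw).mono fun x hx => by
      simp only at hx ⊢
      rw [hx])
  have d2 : ∫ x, (∑ m, g (vs b') m x m) * χ x ∂cellMeasure (vs b')
      = ∫ x, θ x * χ x ∂cellMeasure (vs b') :=
    integral_congr_ae ((T.div_eq hK' (hg _ hK') hθ hw).mono fun x hx => by
      simp only at hx ⊢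
      rw [hx])
  rw [sum_facesOf, Finset.sum_eq_single i, d1] at e1
  rotate_left
  · intro j _ hj
    refine integral_eq_zero_of_ae ?_
    filter_upwards [ae_faceMeasure_mem (fc b j)] with x hx
    rw [Pi.zero_apply, hχ.eq_zero (nearFace_face b b' hj hx), mul_zero]
  · simp
  rw [sum_facesOf, Finset.sum_eq_single i', d2, ← hF] at e2
  rotate_left
  · intro j _ hj
    refine integral_eq_zero_of_ae ?_
    filter_upwards [ae_faceMeasure_mem (fc b' j)] with x hx
    rw [Pi.zero_apply, hχ.eq_zero (fun h => nearFace_face b' b hj hx ⟨h.2, h.1⟩), mul_zero]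
  · simp
  have hθK : ∀ K ∈ T.cells, Integrable (fun x => θ x * χ x) (cellMeasure K) :=
    fun K hK => integrable_mul_of_memLp (T.memLp_cell_of_Ω hθ hK) (memLp_cell K hχ.1.continuous 2)
  have hwK : ∀ K ∈ T.cells, Integrable (fun x => ∑ m, w x m * pd m χ x) (cellMeasure K) :=
    fun K hK => integrable_finsetSum _ fun m _ => integrable_mul_of_memLp (hg K hK m).memLp
      (memLp_cell K (continuous_pd_of_isTest hχ m) 2)
  have e3 := hw χ (hχ.mono (T.nearFace_subset_Ω hK hK' hne hF))
  rw [T.integral_Ω_nearFace hK hK' hne hF hθK fun x hx => by rw [hχ.eq_zero hx, mul_zero],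
    T.integral_Ω_nearFace hK hK' hne hF hwK fun x hx =>
      Finset.sum_eq_zero fun m _ => by rw [hχ.pd_eq_zero hx, mul_zero]] at e3
  simp only [mul_add]
  simp only [mul_comm (χ _)]
  rw [integral_add (integrable_mul_of_memLp hL hχF) (integrable_mul_of_memLp hL' hχF)]
  linarith

end Jumps

/-- The trace of a function in `H¹(Ω)` is the same from both sides of a face. -/
lemma trace_eq {K K' F : Finset (E (n + 1))} (hK : K ∈ T.cells) (hK' : K' ∈ T.cells)
    (hF : F ∈ facesOf K) (hF' : F ∈ facesOf K') {φ : E (n + 1) → ℝ} (hφ : MemH1 G.Ω φ) :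
    trace K φ =ᵐ[faceMeasure F] trace K' φ := by
  rcases eq_or_ne K K' with rfl | hne
  · rfl
  obtain ⟨b, rfl⟩ := T.exists_basis hK
  obtain ⟨b', rfl⟩ := T.exists_basis hK'
  obtain ⟨i, rfl⟩ := (mem_facesOf_iff b).1 hF
  obtain ⟨i', hi'⟩ := (mem_facesOf_iff b').1 hF'
  exact T.trace_eq_of_basis hK hK' hne hi'.symm hφ

/-- The normal component of a field with a weak divergence does not jump. -/
lemma jump_flux {K K' F : Finset (E (n + 1))} (hK : K ∈ T.cells) (hK' : K' ∈ T.cells)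
    (hne : K ≠ K') (hF : F ∈ facesOf K) (hF' : F ∈ facesOf K')
    {w : E (n + 1) → E (n + 1)} {θ : E (n + 1) → ℝ}
    {g : Finset (E (n + 1)) → Fin (n + 1) → E (n + 1) → E (n + 1)}
    (hg : ∀ K ∈ T.cells, ∀ m, CellH1 K (fun x => w x m) (g K m))
    (hθ : MemLp θ 2 (volume.restrict G.Ω)) (hw : HasWeakDiv G.Ω w θ) :
    ∀ᵐ x ∂faceMeasure F, normalTrace K F w x + normalTrace K' F w x = 0 := by
  obtain ⟨b, rfl⟩ := T.exists_basis hK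
  obtain ⟨b', rfl⟩ := T.exists_basis hK'
  obtain ⟨i, rfl⟩ := (mem_facesOf_iff b).1 hF
  obtain ⟨i', hi'⟩ := (mem_facesOf_iff b').1 hF'
  exact T.jump_flux_of_basis hK hK' hne hi'.symm hg hθ hw

/-- A flux that vanishes on the Neumann faces is orthogonal to `M_h`. -/
lemma sum_flux_eq_zero {w : E (n + 1) → E (n + 1)} {θ : E (n + 1) → ℝ}
    {g : Finset (E (n + 1)) → Fin (n + 1) → E (n + 1) → E (n + 1)}
    (hg : ∀ K ∈ T.cells, ∀ m, CellH1 K (fun x => w x m) (g K m))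
    (hθ : MemLp θ 2 (volume.restrict G.Ω)) (hw : HasWeakDiv G.Ω w θ)
    (hN : ∀ K ∈ T.cells, ∀ F ∈ facesOf K, F ∈ T.facesN → normalTrace K F w =ᵐ[faceMeasure F] 0)
    {m : Finset (E (n + 1)) → Poly (n + 1)} (hm : ∀ F ∈ T.facesD, m F = 0) :
    ∑ K ∈ T.cells, ∑ F ∈ facesOf K, ∫ x, normalTrace K F w x * pval (m F) x ∂faceMeasure F = 0 := by
  classical
  -- The sum is reordered by faces; each face then belongs to no, one or two elements.
  have e1 : ∑ K ∈ T.cells, ∑ F ∈ facesOf K,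
      ∫ x, normalTrace K F w x * pval (m F) x ∂faceMeasure F
      = ∑ F ∈ T.faces, ∑ K ∈ T.cells with F ∈ facesOf K,
        ∫ x, normalTrace K F w x * pval (m F) x ∂faceMeasure F := by
    refine Finset.sum_comm' fun K F => ⟨fun h => ?_, fun h => ?_⟩
    · exact ⟨Finset.mem_filter.2 h, T.facesOf_subset h.1 h.2⟩
    · exact Finset.mem_filter.1 h.1
  rw [e1]
  refine Finset.sum_eq_zero fun F hF => ?_
  by_cases hD : F ∈ T.facesD
  · refine Finset.sum_eq_zero fun K _ => ?_
    rw [hm F hD]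
    simp [pval_zero]
  have hz : ∀ K, normalTrace K F w =ᵐ[faceMeasure F] 0 →
      ∫ x, normalTrace K F w x * pval (m F) x ∂faceMeasure F = 0 := fun K h =>
    integral_eq_zero_of_ae (h.mono fun x hx => by simp [hx])
  rcases ({K ∈ T.cells | F ∈ facesOf K} : Finset _).eq_empty_or_nonempty with h0 | ⟨K, hK⟩
  · rw [h0, Finset.sum_empty]
  obtain ⟨hK, hFK⟩ := Finset.mem_filter.1 hK
  by_cases h1 : ∃ K' ∈ T.cells, F ∈ facesOf K' ∧ K' ≠ K
  -- Between two elements the normal traces cancel against the single-valued polynomial.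
  · obtain ⟨K', hK', hFK', hne⟩ := h1
    have h2 : ({K ∈ T.cells | F ∈ facesOf K} : Finset _) = {K, K'} := by
      ext K''
      simp only [Finset.mem_filter, Finset.mem_insert, Finset.mem_singleton]
      constructor
      · exact fun h => T.eq_or_eq_of_face hK hK' h.1 hFK hFK' h.2 hne.symm
      · rintro (rfl | rfl)
        · exact ⟨hK, hFK⟩
        · exact ⟨hK', hFK'⟩
    rw [h2, Finset.sum_pair hne.symm, ← integral_add
      (integrable_mul_of_memLp (T.memLp_normalTrace hK hFK (hg K hK)) (T.memLp_pval_face hK hFK _))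
      (integrable_mul_of_memLp (T.memLp_normalTrace hK' hFK' (hg K' hK'))
        (T.memLp_pval_face hK hFK _))]
    refine integral_eq_zero_of_ae ?_
    filter_upwards [T.jump_flux hK hK' hne.symm hFK hFK' hg hθ hw] with x hx
    rw [← add_mul, hx, zero_mul, Pi.zero_apply]
  -- A face of one element is on the boundary, and as it is not a Dirichlet face it is a Neumann
  -- face.
  · push Not at h1
    have h2 := T.face_subset_frontier hK hFK h1
    have hDn : ¬ simplex F ⊆ closure G.ΓD := fun h => hD (by
      rw [facesD]
      exact Finset.mem_filter.2 ⟨hF, h⟩)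
    have hFN : F ∈ T.facesN := by
      rw [facesN]
      exact Finset.mem_filter.2 ⟨hF, h2, hDn⟩
    refine Finset.sum_eq_zero fun K' hK' => hz K' ?_
    obtain ⟨hK', hFK'⟩ := Finset.mem_filter.1 hK'
    exact hN K' hK' F hFK' hFN

end Triangulation

/-! ### Linearity of integrals of products. -/

section Bilinear

variable {α V : Type*} [MeasurableSpace α] {μ : Measure α} {f g l : α → ℝ}

lemma integral_sub_mul (hf : MemLp f 2 μ) (hg : MemLp g 2 μ) (hl : MemLp l 2 μ) :
    ∫ x, (f x - g x) * l x ∂μ = (∫ x, f x * l x ∂μ) - ∫ x, g x * l x ∂μ := by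
  simp only [sub_mul]
  exact integral_sub (integrable_mul_of_memLp hf hl) (integrable_mul_of_memLp hg hl)

lemma integral_add_mul (hf : MemLp f 2 μ) (hg : MemLp g 2 μ) (hl : MemLp l 2 μ) :
    ∫ x, (f x + g x) * l x ∂μ = (∫ x, f x * l x ∂μ) + ∫ x, g x * l x ∂μ := by
  simp only [add_mul]
  exact integral_add (integrable_mul_of_memLp hf hl) (integrable_mul_of_memLp hg hl)

lemma integral_mul_mul (c : ℝ) (f l : α → ℝ) :
    ∫ x, c * f x * l x ∂μ = c * ∫ x, f x * l x ∂μ := by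
  simp only [mul_assoc]
  exact integral_const_mul _ _

lemma integral_mul_swap (f l : α → ℝ) : ∫ x, f x * l x ∂μ = ∫ x, l x * f x ∂μ := by
  simp only [mul_comm]

variable [NormedAddCommGroup V] [InnerProductSpace ℝ V] {a b c : α → V}

lemma integral_inner_sub_left (ha : MemLp a 2 μ) (hb : MemLp b 2 μ) (hc : MemLp c 2 μ) :
    ∫ x, inner ℝ (a x - b x) (c x) ∂μ
      = (∫ x, inner ℝ (a x) (c x) ∂μ) - ∫ x, inner ℝ (b x) (c x) ∂μ := by
  simp only [inner_sub_left]
  exact integral_sub (integrable_inner_of_memLp ha hc) (integrable_inner_of_memLp hb hc)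

lemma integral_inner_sub_right (ha : MemLp a 2 μ) (hb : MemLp b 2 μ) (hc : MemLp c 2 μ) :
    ∫ x, inner ℝ (c x) (a x - b x) ∂μ
      = (∫ x, inner ℝ (c x) (a x) ∂μ) - ∫ x, inner ℝ (c x) (b x) ∂μ := by
  simp only [inner_sub_right]
  exact integral_sub (integrable_inner_of_memLp hc ha) (integrable_inner_of_memLp hc hb)

lemma integral_inner_swap (a b : α → V) :
    ∫ x, inner ℝ (a x) (b x) ∂μ = ∫ x, inner ℝ (b x) (a x) ∂μ := by
  simp only [real_inner_comm]

end Bilinear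

/-! ### Divergence of polynomial fields -/

section PolyDiv

variable {d : ℕ}

/-- The divergence of a polynomial field. -/
def pdiv (r : Fin d → Poly d) : Poly d := ∑ i, MvPolynomial.pderiv i (r i)

lemma pdiv_mem_polyLt {k : ℕ} {r : Fin d → Poly d} (hr : ∀ i, (r i).totalDegree ≤ k) :
    pdiv r ∈ polyLt d k :=
  sum_mem fun i _ => pderiv_mem_polyLt (mem_polyLe.2 (hr i)) i

lemma memLp_vval (K : Finset (E d)) (r : Fin d → Poly d) : MemLp (vval r) 2 (cellMeasure K) :=
  memLp_cell K (continuous_vval r) 2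

lemma memLp_pgrad (K : Finset (E d)) (p : Poly d) : MemLp (pgrad p) 2 (cellMeasure K) :=
  memLp_vval K _

lemma vval_sub (r s : Fin d → Poly d) (x : E d) :
    vval (fun i => r i - s i) x = vval r x - vval s x := by
  ext i
  rw [vval_apply, PiLp.sub_apply, pval_sub, vval_apply, vval_apply]

lemma normalVal_sub (K F : Finset (E d)) (r s : Fin d → Poly d) (x : E d) :
    normalVal K F (fun i => r i - s i) x = normalVal K F r x - normalVal K F s x := by
  rw [normalVal, vval_sub, inner_sub_left]
  rfl

end PolyDiv

/-! ### Moments of lower degree of the HDG projection. -/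

section Projection

variable {d k : ℕ} {τ : Finset (E d) → ℝ} {K : Finset (E d)} {r : E d → E d} {v : E d → ℝ}
  {P : Fin d → Poly d} {p : Poly d}

/-- For k = 0 the strict degree condition admits no test field at all, not even zero, so the trivial
case is treated apart. -/
lemma IsProjection.integral_inner (h : IsProjection k τ K r v P p) {s : Fin d → Poly d}
    (hs : ∀ i, s i ∈ polyLt d k) :
    ∫ x, inner ℝ (vval P x) (vval s x) ∂cellMeasure K
      = ∫ x, inner ℝ (r x) (vval s x) ∂cellMeasure K := by
  rcases Nat.eq_zero_or_pos k with rfl | hk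
  · have : ∀ x, vval s x = 0 := fun x => by
      ext i
      rw [vval_apply, show s i = 0 from hs i, pval_zero]
      rfl
    simp [this]
  · refine h.moment_P s fun i => ?_
    rcases mem_polyLt.1 (hs i) with h0 | h0
    · rw [h0, MvPolynomial.totalDegree_zero]
      exact hk
    · exact h0

lemma IsProjection.integral_mul (h : IsProjection k τ K r v P p) {s : Poly d}
    (hs : s ∈ polyLt d k) :
    ∫ x, pval p x * pval s x ∂cellMeasure K = ∫ x, v x * pval s x ∂cellMeasure K := by
  rcases Nat.eq_zero_or_pos k with rfl | hk
  · rw [show s = 0 from hs]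
    simp [pval_zero]
  · refine h.moment_p s ?_
    rcases mem_polyLt.1 hs with h0 | h0
    · rw [h0, MvPolynomial.totalDegree_zero]
      exact hk
    · exact h0

end Projection

lemma integral_σ_inv_mul {d : ℕ} {G : Config d} {K : Finset (E d)} {σp σm s : ℝ} (hs : ∀ᵐ x ∂cellMeasure K, G.σ σp σm x = s)
    (f : E d → ℝ) :
    ∫ x, (G.σ σp σm x)⁻¹ * f x ∂cellMeasure K = s⁻¹ * ∫ x, f x ∂cellMeasure K := by
  rw [← integral_const_mul]
  exact integral_congr_ae (hs.mono fun x hx => by simp only [hx])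

/-! ### Integration by parts against polynomials on an element. -/

namespace Triangulation

variable {n : ℕ} {G : Config (n + 1)} (T : Triangulation G)

section Element

variable {K F : Finset (E (n + 1))} (hK : K ∈ T.cells)

include hK

/-- The scalar formula is a hypothesis, so that one proof serves functions in H¹ with their traces
and polynomials with their boundary values. -/
lemma integral_inner_vval_of_parts {v t : E (n + 1) → ℝ} {g : E (n + 1) → E (n + 1)}
    (hv : MemLp v 2 (cellMeasure K)) (hg : MemLp g 2 (cellMeasure K))
    (ht : ∀ F ∈ facesOf K, MemLp t 2 (faceMeasure F))
    (h : ∀ (p : Poly (n + 1)) (m : Fin (n + 1)),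
      (∫ x, g x m * pval p x ∂cellMeasure K) + ∫ x, v x * pd m (pval p) x ∂cellMeasure K
        = ∑ F ∈ facesOf K, normal K F m * ∫ x, t x * pval p x ∂faceMeasure F)
    (r : Fin (n + 1) → Poly (n + 1)) :
    ∫ x, inner ℝ (g x) (vval r x) ∂cellMeasure K
      = -(∫ x, v x * pval (pdiv r) x ∂cellMeasure K)
        + ∑ F ∈ facesOf K, ∫ x, t x * normalVal K F r x ∂faceMeasure F := by
  have e1 := integral_inner_vval' (s := r) hg
  have e2 : ∫ x, v x * pval (pdiv r) x ∂cellMeasure K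
      = ∑ m, ∫ x, v x * pd m (pval (r m)) x ∂cellMeasure K := by
    rw [← integral_finsetSum _ fun m _ =>
      integrable_mul_of_memLp hv (memLp_cell K (continuous_pd (contDiff_one_pval _) m) 2)]
    simp only [pdiv, pval_sum, Finset.mul_sum, pd_pval]
  have e3 : ∀ F ∈ facesOf K, ∫ x, t x * normalVal K F r x ∂faceMeasure F
      = ∑ m, normal K F m * ∫ x, t x * pval (r m) x ∂faceMeasure F := by
    intro F hF
    simp only [← integral_const_mul]
    rw [← integral_finsetSum _ fun m _ =>
      (integrable_mul_of_memLp (ht F hF) (T.memLp_pval_face hK hF (r m))).const_mul _]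
    simp only [normalVal_eq, normalPoly, pval_sum, pval_smul, Finset.mul_sum]
    simp only [mul_left_comm]
  rw [e1, e2, Finset.sum_congr rfl e3, Finset.sum_comm, ← Finset.sum_neg_distrib,
    ← Finset.sum_add_distrib]
  refine Finset.sum_congr rfl fun m _ => ?_
  have := h (r m) m
  linarith

lemma integral_inner_vval_cellH1 {v : E (n + 1) → ℝ} {g : E (n + 1) → E (n + 1)}
    (h : CellH1 K v g) (r : Fin (n + 1) → Poly (n + 1)) :
    ∫ x, inner ℝ (g x) (vval r x) ∂cellMeasure K
      = -(∫ x, v x * pval (pdiv r) x ∂cellMeasure K)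
        + ∑ F ∈ facesOf K, ∫ x, trace K v x * normalVal K F r x ∂faceMeasure F :=
  T.integral_inner_vval_of_parts hK h.memLp h.memLp_grad (fun _ hF => T.memLp_trace hK hF h)
    (fun p m => T.integral_by_parts hK h (contDiff_one_pval p) m) r

lemma integral_inner_pgrad_vval (w : Poly (n + 1)) (r : Fin (n + 1) → Poly (n + 1)) :
    ∫ x, inner ℝ (pgrad w x) (vval r x) ∂cellMeasure K
      = -(∫ x, pval w x * pval (pdiv r) x ∂cellMeasure K)
        + ∑ F ∈ facesOf K, ∫ x, pval w x * normalVal K F r x ∂faceMeasure F := by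
  refine T.integral_inner_vval_of_parts hK (memLp_pval K w) (memLp_pgrad K w)
    (fun _ hF => T.memLp_pval_face hK hF w) (fun p m => ?_) r
  obtain ⟨b, rfl⟩ := T.exists_basis hK
  rw [sum_facesOf]
  simp only [pgrad_eq_gradient]
  exact integral_by_parts_smooth b (contDiff_one_pval w) (contDiff_one_pval p) m

/-- Integration by parts of a field against a polynomial. -/
lemma integral_div_mul_pval {w : E (n + 1) → E (n + 1)} {θ : E (n + 1) → ℝ}
    {g : Fin (n + 1) → E (n + 1) → E (n + 1)} (hg : ∀ m, CellH1 K (fun x => w x m) (g m))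
    (hθ : MemLp θ 2 (volume.restrict G.Ω)) (hw : HasWeakDiv G.Ω w θ) (p : Poly (n + 1)) :
    ∫ x, pval p x * θ x ∂cellMeasure K = -(∫ x, inner ℝ (w x) (pgrad p x) ∂cellMeasure K)
      + ∑ F ∈ facesOf K, ∫ x, normalTrace K F w x * pval p x ∂faceMeasure F := by
  rw [← T.integral_by_parts_vec hK hg (contDiff_one_pval p)]
  have e1 : ∫ x, (∑ m, g m x m) * pval p x ∂cellMeasure K
      = ∫ x, pval p x * θ x ∂cellMeasure K :=
    integral_congr_ae ((T.div_eq hK hg hθ hw).mono fun x hx => by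
      simp only at hx ⊢
      rw [hx, mul_comm])
  have e2 : ∀ x, inner ℝ (w x) (pgrad p x) = ∑ m, w x m * pd m (pval p) x := fun x => by
    rw [PiLp.inner_apply]
    refine Finset.sum_congr rfl fun m _ => ?_
    rw [pgrad_apply]
    simp [mul_comm]
  simp only [e1, e2]
  ring

/-- `proj` is zero if no projection exists. Existence holds since τ has one sign on the element and
does not vanish on its whole boundary. -/
lemma isProjection_proj {k : ℕ} {τ : Finset (E (n + 1)) → ℝ} (hτ : T.TauCondition τ)
    {r : E (n + 1) → E (n + 1)} {v : E (n + 1) → ℝ} {g : Fin (n + 1) → E (n + 1) → E (n + 1)}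
    {g' : E (n + 1) → E (n + 1)} (hr : ∀ m, CellH1 K (fun x => r x m) (g m)) (hv : CellH1 K v g') :
    IsProjection k τ K r v (projV k τ r v K) (projW k τ r v K) := by
  have h : ∃ P : (Fin (n + 1) → Poly (n + 1)) × Poly (n + 1), IsProjection k τ K r v P.1 P.2 := by
    obtain ⟨h1, F, hF, h2⟩ := T.tau_sign hτ hK
    obtain ⟨b, rfl⟩ := T.exists_basis hK
    obtain ⟨i, rfl⟩ := (mem_facesOf_iff b).1 hF
    obtain ⟨P, p, hP⟩ := exists_isProjection (k := k) b
      (h1.imp (fun h i => h _ (fc_mem_facesOf b i)) fun h i => h _ (fc_mem_facesOf b i))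
      ⟨i, h2⟩ hr hv
    exact ⟨(P, p), hP⟩
  rw [projV, projW, proj, dif_pos h]
  exact h.choose_spec

end Element

/-- The components of a flux are in `H¹` of each element. -/
lemma exists_cellH1 {w : E (n + 1) → E (n + 1)} (hp : MemH1Vec G.Ωp w) (hm : MemH1Vec G.Ωm w) :
    ∃ g : Finset (E (n + 1)) → Fin (n + 1) → E (n + 1) → E (n + 1),
      ∀ K ∈ T.cells, ∀ m, CellH1 K (fun x => w x m) (g K m) := by
  have h : ∀ K, ∀ m, ∃ g, K ∈ T.cells → CellH1 K (fun x => w x m) g := by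
    intro K m
    by_cases hK : K ∈ T.cells
    · rcases T.cellsp_or_cellsm hK with h | h
      · exact ⟨_, fun _ => cellH1_of_memH1 (hp m) (T.mem_cellsp.1 h).2⟩
      · exact ⟨_, fun _ => cellH1_of_memH1 (hm m) (T.mem_cellsm.1 h).2⟩
    · exact ⟨0, fun h => absurd h hK⟩
  choose g hg using h
  exact ⟨g, fun K hK m => hg K m hK⟩

end Triangulation

/-! ### Error equations and the duality identity. -/

namespace Triangulation

variable {n : ℕ} {G : Config (n + 1)} (T : Triangulation G)

/-- Facewise moments of degree at most `k` of functions on the faces. -/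
lemma exists_face_proj (k : ℕ) {e : Finset (E (n + 1)) → E (n + 1) → ℝ}
    (he : ∀ K ∈ T.cells, ∀ F ∈ facesOf K, MemLp (e F) 2 (faceMeasure F))
    (hD : ∀ F ∈ T.facesD, e F =ᵐ[faceMeasure F] 0) :
    ∃ m : Finset (E (n + 1)) → Poly (n + 1), (∀ F, (m F).totalDegree ≤ k) ∧
      (∀ F ∈ T.facesD, m F = 0) ∧ ∀ K ∈ T.cells, ∀ F ∈ facesOf K, ∀ s : Poly (n + 1),
        s.totalDegree ≤ k →
        ∫ x, pval (m F) x * pval s x ∂faceMeasure F = ∫ x, e F x * pval s x ∂faceMeasure F := by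
  have h : ∀ F, ∃ p : Poly (n + 1), p.totalDegree ≤ k ∧ (F ∈ T.facesD → p = 0) ∧
      ∀ K ∈ T.cells, F ∈ facesOf K → ∀ s : Poly (n + 1), s.totalDegree ≤ k →
        ∫ x, pval p x * pval s x ∂faceMeasure F = ∫ x, e F x * pval s x ∂faceMeasure F := by
    intro F
    by_cases hF : F ∈ T.facesD
    -- On Dirichlet faces the polynomial is 0 identically and not only on the face, as the later
    -- sums over faces require.
    · refine ⟨0, by simp, fun _ => rfl, fun K hK hFK s hs => ?_⟩
      rw [integral_eq_zero_of_ae (f := fun x => e F x * pval s x)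
        ((hD F hF).mono fun x hx => by simp [hx])]
      simp [pval_zero]
    by_cases hc : ∃ K ∈ T.cells, F ∈ facesOf K
    · obtain ⟨K, hK, hFK⟩ := hc
      obtain ⟨p, hp, h⟩ := exists_l2_proj (polyLe (n + 1) k)
        (fun p => T.memLp_pval_face hK hFK p.1) (he K hK F hFK)
      exact ⟨p, mem_polyLe.1 hp, fun h => absurd h hF, fun _ _ _ s hs => h s (mem_polyLe.2 hs)⟩
    · exact ⟨0, by simp, fun _ => rfl, fun K hK hFK => absurd ⟨K, hK, hFK⟩ hc⟩
  choose m h1 h2 h3 using h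
  exact ⟨m, h1, h2, fun K hK F hF => h3 F K hK hF⟩

/-- The third equation omits the Dirichlet faces for the exact solution and includes them for the
discrete one; for test functions that are zero there both read the same. -/
lemma sumBdryNotD_eq (g : Finset (E (n + 1)) → Finset (E (n + 1)) → E (n + 1) → ℝ)
    (h : ∀ K, ∀ F ∈ T.facesD, ∀ x, g K F x = 0) : T.sumBdryNotD g = T.sumBdry g := by
  classical
  refine Finset.sum_congr rfl fun K _ => Finset.sum_subset Finset.sdiff_subset fun F h1 h2 => ?_
  have : F ∈ T.facesD := by
    by_contra hF
    exact h2 (Finset.mem_sdiff.2 ⟨h1, hF⟩)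
  simp [h K F this]

section Identity

variable {k : ℕ} {σp σm : ℝ} {τ : Finset (E (n + 1)) → ℝ} {f : E (n + 1) → ℝ}
  {q : E (n + 1) → E (n + 1)} {u : E (n + 1) → ℝ} {ubar : Finset (E (n + 1)) → E (n + 1) → ℝ}
  {qh : Finset (E (n + 1)) → Fin (n + 1) → Poly (n + 1)} {uh ubarh : Finset (E (n + 1)) → Poly (n + 1)}
  {P : Finset (E (n + 1)) → Fin (n + 1) → Poly (n + 1)} {p : Finset (E (n + 1)) → Poly (n + 1)}
  (hex : T.IsExactSolution k σp σm τ f q u ubar) (hhd : T.IsHDGSolution k σp σm τ f qh uh ubarh)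
  (hP : ∀ K ∈ T.cells, IsProjection k τ K q u (P K) (p K))

include hex in
lemma cellH1_u {K : Finset (E (n + 1))} (hK : K ∈ T.cells) : CellH1 K u (weakGrad G.Ω u) :=
  cellH1_of_memH1 hex.memH1_u (T.interior_subset hK)

include hex in
lemma cellH1_q {K : Finset (E (n + 1))} (hK : K ∈ T.cells) (m : Fin (n + 1)) :
    CellH1 K (fun x => q x m) (weakGrad G.Ω fun x => q x m) :=
  cellH1_of_memH1 (hex.memH1_q m) (T.interior_subset hK)

include hex in
lemma memLp_q {K : Finset (E (n + 1))} (hK : K ∈ T.cells) : MemLp q 2 (cellMeasure K) :=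
  memLp_of_coord fun m => (T.cellH1_q hex hK m).memLp

include hex in
lemma memLp_ubar {K F : Finset (E (n + 1))} (hK : K ∈ T.cells) (hF : F ∈ facesOf K) :
    MemLp (ubar F) 2 (faceMeasure F) := by
  by_cases hD : F ∈ T.facesD
  · exact (memLp_congr_ae (hex.ubar_D F hD)).2 MemLp.zero
  · exact (memLp_congr_ae (hex.ubar_eq K hK F hF hD)).2 (T.memLp_trace hK hF (T.cellH1_u hex hK))

include hex in
lemma memLp_err {K F : Finset (E (n + 1))} (hK : K ∈ T.cells) (hF : F ∈ facesOf K) :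
    MemLp (fun x => ubar F x - pval (ubarh F) x) 2 (faceMeasure F) :=
  (T.memLp_ubar hex hK hF).sub (T.memLp_pval_face hK hF _)

include hex hhd hP in
/-- The first error equation. -/
lemma error_eq1 {s : Finset (E (n + 1)) → ℝ}
    (hs : ∀ K ∈ T.cells, ∀ᵐ x ∂cellMeasure K, G.σ σp σm x = s K)
    {r : Finset (E (n + 1)) → Fin (n + 1) → Poly (n + 1)} (hr : T.MemV k r) :
    ∑ K ∈ T.cells, ((s K)⁻¹ * (∫ x, inner ℝ (q x - vval (qh K) x) (vval (r K) x) ∂cellMeasure K)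
      - (∫ x, (pval (p K) x - pval (uh K) x) * pval (pdiv (r K)) x ∂cellMeasure K)
      + ∑ F ∈ facesOf K,
        ∫ x, (ubar F x - pval (ubarh F) x) * normalVal K F (r K) x ∂faceMeasure F) = 0 := by
  have e1 := hex.eq1 r hr
  have e2 := hhd.eq1 r hr
  unfold sumCells sumBdry at e1 e2
  rw [← Finset.sum_add_distrib, ← Finset.sum_sub_distrib] at e1 e2
  have e3 := congrArg₂ (· - ·) e1 e2
  simp only [sub_zero, ← Finset.sum_sub_distrib] at e3
  rw [← e3]
  refine Finset.sum_congr rfl fun K hK => ?_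
  -- After integration by parts the traces of u and u_h cancel, so only the face unknowns stay on
  -- ∂K. The divergence of r has degree below k, which allows Π_W u in place of u.
  rw [integral_σ_inv_mul (hs K hK), integral_σ_inv_mul (hs K hK),
    integral_inner_sub_left (T.memLp_q hex hK) (memLp_vval K _) (memLp_vval K _),
    T.integral_inner_vval_cellH1 hK (T.cellH1_u hex hK), T.integral_inner_pgrad_vval hK,
    integral_sub_mul (memLp_pval K _) (memLp_pval K _) (memLp_pval K _),
    (hP K hK).integral_mul (pdiv_mem_polyLt (hr K hK))]
  have f1 : ∀ F ∈ facesOf K,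
      ∫ x, (trace K u x - ubar F x) * normalVal K F (r K) x ∂faceMeasure F
      = (∫ x, trace K u x * normalVal K F (r K) x ∂faceMeasure F)
        - ∫ x, ubar F x * normalVal K F (r K) x ∂faceMeasure F := fun F hF =>
    integral_sub_mul (T.memLp_trace hK hF (T.cellH1_u hex hK)) (T.memLp_ubar hex hK hF)
      (T.memLp_normalVal hK hF _)
  have f2 : ∀ F ∈ facesOf K,
      ∫ x, (pval (uh K) x - pval (ubarh F) x) * normalVal K F (r K) x ∂faceMeasure F
      = (∫ x, pval (uh K) x * normalVal K F (r K) x ∂faceMeasure F)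
        - ∫ x, pval (ubarh F) x * normalVal K F (r K) x ∂faceMeasure F := fun F hF =>
    integral_sub_mul (T.memLp_pval_face hK hF _) (T.memLp_pval_face hK hF _)
      (T.memLp_normalVal hK hF _)
  have f3 : ∀ F ∈ facesOf K,
      ∫ x, (ubar F x - pval (ubarh F) x) * normalVal K F (r K) x ∂faceMeasure F
      = (∫ x, ubar F x * normalVal K F (r K) x ∂faceMeasure F)
        - ∫ x, pval (ubarh F) x * normalVal K F (r K) x ∂faceMeasure F := fun F hF =>
    integral_sub_mul (T.memLp_ubar hex hK hF) (T.memLp_pval_face hK hF _)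
      (T.memLp_normalVal hK hF _)
  rw [Finset.sum_congr rfl f1, Finset.sum_congr rfl f2, Finset.sum_congr rfl f3,
    Finset.sum_sub_distrib, Finset.sum_sub_distrib, Finset.sum_sub_distrib]
  ring

/-- The moment of the error of the numerical flux on a face. -/
lemma flux_error {K F : Finset (E (n + 1))} (hK : K ∈ T.cells) (hF : F ∈ facesOf K)
    (hq : ∀ m, CellH1 K (fun x => q x m) (weakGrad G.Ω fun x => q x m))
    (hu : CellH1 K u (weakGrad G.Ω u)) (hub : MemLp (ubar F) 2 (faceMeasure F))
    {Q Q' : Fin (n + 1) → Poly (n + 1)} {w w' m' : Poly (n + 1)} (hQ : IsProjection k τ K q u Q w)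
    {l : Poly (n + 1)} (hl : l.totalDegree ≤ k) :
    (∫ x, (normalTrace K F q x + τ F * (trace K u x - ubar F x)) * pval l x ∂faceMeasure F)
      - ∫ x, (normalVal K F Q' x + τ F * (pval w' x - pval m' x)) * pval l x ∂faceMeasure F
    = (∫ x, normalVal K F (fun i => Q i - Q' i) x * pval l x ∂faceMeasure F)
      + τ F * (∫ x, pval (w - w') x * pval l x ∂faceMeasure F)
      - τ F * ∫ x, (ubar F x - pval m' x) * pval l x ∂faceMeasure F := by
  have hL := T.memLp_pval_face hK hF l
  have hN := fun r => T.memLp_normalVal hK hF r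
  have hpv := fun w => T.memLp_pval_face hK hF w
  have htu := T.memLp_trace hK hF hu
  have htq := T.memLp_normalTrace hK hF hq
  -- The face condition exchanges q·n + τ u for its projection; everything else is linearity.
  have h1 := hQ.face F hF l hl
  rw [integral_add_mul (hN Q) ((hpv w).const_mul _) hL,
    integral_add_mul htq (htu.const_mul _) hL, integral_mul_mul, integral_mul_mul] at h1
  have hs1 : MemLp (fun x => trace K u x - ubar F x) 2 (faceMeasure F) := htu.sub hub
  have hs2 : MemLp (fun x => pval w' x - pval m' x) 2 (faceMeasure F) := (hpv w').sub (hpv m')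
  rw [integral_add_mul htq (hs1.const_mul _) hL, integral_add_mul (hN Q') (hs2.const_mul _) hL,
    integral_mul_mul, integral_mul_mul, integral_sub_mul hub (hpv m') hL]
  simp only [normalVal_sub, pval_sub]
  rw [integral_sub_mul htu hub hL, integral_sub_mul (hpv w') (hpv m') hL,
    integral_sub_mul (hN Q) (hN Q') hL, integral_sub_mul (hpv w) (hpv w') hL]
  linear_combination -h1

include hex hhd hP in
/-- The second error equation. -/
lemma error_eq2 {v : Finset (E (n + 1)) → Poly (n + 1)} (hv : T.MemW k v) :
    ∑ K ∈ T.cells,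
      ((∫ x, inner ℝ (vval (fun i => P K i - qh K i) x) (pgrad (v K) x) ∂cellMeasure K)
      - ∑ F ∈ facesOf K,
        ((∫ x, normalVal K F (fun i => P K i - qh K i) x * pval (v K) x ∂faceMeasure F)
          + τ F * (∫ x, pval (p K - uh K) x * pval (v K) x ∂faceMeasure F)
          - τ F * ∫ x, (ubar F x - pval (ubarh F) x) * pval (v K) x ∂faceMeasure F)) = 0 := by
  have e1 := hex.eq2 v hv
  have e2 := hhd.eq2 v hv
  rw [← e2] at e1
  have e3 := sub_eq_zero.2 e1
  unfold sumCells sumBdry at e3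
  simp only [← Finset.sum_sub_distrib] at e3
  rw [← e3]
  refine Finset.sum_congr rfl fun K hK => ?_
  rw [Finset.sum_congr rfl fun F hF => (T.flux_error hK hF (T.cellH1_q hex hK) (T.cellH1_u hex hK)
    (T.memLp_ubar hex hK hF) (hP K hK) (hv K hK)).symm, Finset.sum_sub_distrib]
  simp only [vval_sub]
  rw [integral_inner_sub_left (memLp_vval K _) (memLp_vval K _) (memLp_pgrad K _)]
  -- The gradient of the test function has degree below k, so Π_V q has the same moments as q.
  have h1 := (hP K hK).integral_inner (s := fun i => MvPolynomial.pderiv i (v K))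
    fun i => pderiv_mem_polyLt (mem_polyLe.2 (hv K hK)) i
  have h2 : ∫ x, inner ℝ (vval (P K) x) (pgrad (v K) x) ∂cellMeasure K
      = ∫ x, inner ℝ (q x) (pgrad (v K) x) ∂cellMeasure K := h1
  rw [h2]
  ring

include hex hhd hP in
/-- The third error equation. -/
lemma error_eq3 {l : Finset (E (n + 1)) → Poly (n + 1)} (hl : ∀ F, (l F).totalDegree ≤ k)
    (hD : ∀ F ∈ T.facesD, l F = 0) :
    ∑ K ∈ T.cells, ∑ F ∈ facesOf K,
      ((∫ x, normalVal K F (fun i => P K i - qh K i) x * pval (l F) x ∂faceMeasure F)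
        + τ F * (∫ x, pval (p K - uh K) x * pval (l F) x ∂faceMeasure F)
        - τ F * ∫ x, (ubar F x - pval (ubarh F) x) * pval (l F) x ∂faceMeasure F) = 0 := by
  have hM : T.MemM k l := ⟨fun F _ => hl F, fun F hF x _ => by rw [hD F hF, pval_zero]⟩
  have e1 := hex.eq3 l hM
  have e2 := hhd.eq3 l hM
  rw [T.sumBdryNotD_eq _ fun K F hF x => by rw [hD F hF, pval_zero, mul_zero]] at e1
  have e3 := congrArg₂ (· - ·) e1 e2
  unfold sumBdry at e3
  simp only [← Finset.sum_sub_distrib, sub_zero] at e3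
  rw [← e3]
  exact Finset.sum_congr rfl fun K hK => Finset.sum_congr rfl fun F hF =>
    (T.flux_error hK hF (T.cellH1_q hex hK) (T.cellH1_u hex hK)
      (T.memLp_ubar hex hK hF) (hP K hK) (hl F)).symm

include hex hhd hP in
/-- The error representation by duality, for given projections. -/
lemma dual_identity_of_proj {θ : E (n + 1) → ℝ} {Φ : E (n + 1) → E (n + 1)} {φ : E (n + 1) → ℝ}
    (hθ : MemLp θ 2 (volume.restrict G.Ω)) (hd : T.IsDualSolution σp σm θ Φ φ)
    {Q : Finset (E (n + 1)) → Fin (n + 1) → Poly (n + 1)} {w : Finset (E (n + 1)) → Poly (n + 1)}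
    (hQ : ∀ K ∈ T.cells, IsProjection k τ K Φ φ (Q K) (w K))
    {φh : Finset (E (n + 1)) → Poly (n + 1)} (hφh : T.MemW k φh) :
    T.sumCells (fun K x => (pval (p K) x - pval (uh K) x) * θ x)
      = T.sumCells (fun K x => (G.σ σp σm x)⁻¹ *
          inner ℝ (q x - vval (qh K) x) (vval (Q K) x - Φ x))
        + T.sumCells (fun K x =>
          inner ℝ (vval (P K) x - q x) (weakGrad G.Ω φ x - pgrad (φh K) x)) := by
  obtain ⟨g, hg⟩ := T.exists_cellH1 hd.memH1_Φp hd.memH1_Φm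
  have hφ := fun K hK => cellH1_of_memH1 hd.memH1_φ (K := K) (T.interior_subset hK)
  have hs : ∃ s : Finset (E (n + 1)) → ℝ,
      ∀ K ∈ T.cells, ∀ᵐ x ∂cellMeasure K, G.σ σp σm x = s K := by
    have : ∀ K, ∃ s, K ∈ T.cells → ∀ᵐ x ∂cellMeasure K, G.σ σp σm x = s := fun K => by
      by_cases hK : K ∈ T.cells
      · exact (T.exists_σ hK σp σm).imp fun s h _ => h
      · exact ⟨0, fun h => absurd h hK⟩
    choose s hs using this
    exact ⟨s, hs⟩
  obtain ⟨s, hs⟩ := hs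
  -- facewise projections of the error of the traces and of the trace of the dual solution
  have herr := fun K hK F hF => T.memLp_err hex (ubarh := ubarh) (K := K) (F := F) hK hF
  obtain ⟨m, hmk, hmD, hm⟩ := T.exists_face_proj k herr fun F hF => by
    filter_upwards [hex.ubar_D F hF, ae_faceMeasure_mem F] with x h1 h2
    rw [h1, hhd.mem_ubarh.2 F hF x h2, Pi.zero_apply, sub_zero]
  obtain ⟨l, hlk, hlD, hl⟩ : ∃ l : Finset (E (n + 1)) → Poly (n + 1),
      (∀ F, (l F).totalDegree ≤ k) ∧ (∀ F ∈ T.facesD, l F = 0) ∧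
      ∀ K ∈ T.cells, ∀ F ∈ facesOf K, ∀ s : Poly (n + 1), s.totalDegree ≤ k →
        ∫ x, pval (l F) x * pval s x ∂faceMeasure F
          = ∫ x, trace K φ x * pval s x ∂faceMeasure F := by
    classical
    -- The trace of φ is taken from any one element at the face; by `trace_eq` the choice does not
    -- matter.
    let t : Finset (E (n + 1)) → E (n + 1) → ℝ := fun F =>
      if h : ∃ K ∈ T.cells, F ∈ facesOf K then trace h.choose φ else 0
    have ht : ∀ K ∈ T.cells, ∀ F ∈ facesOf K, t F =ᵐ[faceMeasure F] trace K φ := by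
      intro K hK F hF
      have h : ∃ K ∈ T.cells, F ∈ facesOf K := ⟨K, hK, hF⟩
      simp only [t, dif_pos h]
      exact T.trace_eq h.choose_spec.1 hK h.choose_spec.2 hF hd.memH1_φ
    obtain ⟨l, h1, h2, h3⟩ := T.exists_face_proj k (e := t)
      (fun K hK F hF => (memLp_congr_ae (ht K hK F hF)).2 (T.memLp_trace hK hF (hφ K hK)))
      fun F hF => by
        by_cases h : ∃ K ∈ T.cells, F ∈ facesOf K
        · obtain ⟨K, hK, hFK⟩ := h
          exact (ht K hK F hFK).trans (hd.dirichlet K hK F hFK hF)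
        · simp only [t, dif_neg h]
          rfl
    refine ⟨l, h1, h2, fun K hK F hF s hs => (h3 K hK F hF s hs).trans ?_⟩
    exact integral_congr_ae ((ht K hK F hF).mono fun x hx => by simp only [hx])
  -- The four vanishing sums: the error equations tested with Π_V Φ, Π_W φ and l, and the flux of Φ
  -- against m.
  have hE1 := T.error_eq1 hex hhd hP hs (r := Q) fun K hK => (hQ K hK).degree_P
  have hE2 := T.error_eq2 hex hhd hP (v := w) fun K hK => (hQ K hK).degree_p
  have hE3 := T.error_eq3 hex hhd hP hlk hlD
  have hE4 := T.sum_flux_eq_zero hg hθ hd.div hd.neumann hmD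
  rw [← sub_eq_zero]
  unfold sumCells
  rw [← Finset.sum_add_distrib, ← Finset.sum_sub_distrib]
  -- The identity already holds on each element: the difference of the two sides is a combination of
  -- the summands of the four sums.
  have key : ∀ K ∈ T.cells,
      (∫ x, (pval (p K) x - pval (uh K) x) * θ x ∂cellMeasure K)
      - ((∫ x, (G.σ σp σm x)⁻¹ * inner ℝ (q x - vval (qh K) x) (vval (Q K) x - Φ x) ∂cellMeasure K)
        + ∫ x, inner ℝ (vval (P K) x - q x) (weakGrad G.Ω φ x - pgrad (φh K) x) ∂cellMeasure K)
      = -((s K)⁻¹ * (∫ x, inner ℝ (q x - vval (qh K) x) (vval (Q K) x) ∂cellMeasure K)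
        - (∫ x, (pval (p K) x - pval (uh K) x) * pval (pdiv (Q K)) x ∂cellMeasure K)
        + ∑ F ∈ facesOf K,
          ∫ x, (ubar F x - pval (ubarh F) x) * normalVal K F (Q K) x ∂faceMeasure F)
      - ((∫ x, inner ℝ (vval (fun i => P K i - qh K i) x) (pgrad (w K) x) ∂cellMeasure K)
        - ∑ F ∈ facesOf K,
          ((∫ x, normalVal K F (fun i => P K i - qh K i) x * pval (w K) x ∂faceMeasure F)
            + τ F * (∫ x, pval (p K - uh K) x * pval (w K) x ∂faceMeasure F)
            - τ F * ∫ x, (ubar F x - pval (ubarh F) x) * pval (w K) x ∂faceMeasure F))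
      - (∑ F ∈ facesOf K,
        ((∫ x, normalVal K F (fun i => P K i - qh K i) x * pval (l F) x ∂faceMeasure F)
          + τ F * (∫ x, pval (p K - uh K) x * pval (l F) x ∂faceMeasure F)
          - τ F * ∫ x, (ubar F x - pval (ubarh F) x) * pval (l F) x ∂faceMeasure F))
      + ∑ F ∈ facesOf K, ∫ x, normalTrace K F Φ x * pval (m F) x ∂faceMeasure F := by
    intro K hK
    have hqK := T.memLp_q hex hK
    have hΦK : MemLp Φ 2 (cellMeasure K) := T.memLp_cell_of_Ω hd.memL2_Φ hK
    have hdφ := (hφ K hK).memLp_grad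
    -- the degree of the error polynomials
    have hdeg_e : ∀ i, (P K i - qh K i).totalDegree ≤ k := fun i => mem_polyLe.1
      (sub_mem (mem_polyLe.2 ((hP K hK).degree_P i)) (mem_polyLe.2 (hhd.mem_qh K hK i)))
    have hdeg_u : (p K - uh K).totalDegree ≤ k := mem_polyLe.1
      (sub_mem (mem_polyLe.2 (hP K hK).degree_p) (mem_polyLe.2 (hhd.mem_uh K hK)))
    -- the term with the datum of the dual problem
    have a1 := T.integral_div_mul_pval hK (hg K hK) hθ hd.div (p K - uh K)
    have a2 := (hQ K hK).integral_inner (s := fun i => MvPolynomial.pderiv i (p K - uh K))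
      fun i => pderiv_mem_polyLt (mem_polyLe.2 hdeg_u) i
    have a2' : ∫ x, inner ℝ (pgrad (p K - uh K) x) (vval (Q K) x) ∂cellMeasure K
        = ∫ x, inner ℝ (Φ x) (pgrad (p K - uh K) x) ∂cellMeasure K := by
      rw [integral_inner_swap]
      exact a2
    have a3 := T.integral_inner_pgrad_vval hK (p K - uh K) (Q K)
    -- the gradient of the dual solution against the error of the flux
    have b1 := T.integral_inner_vval_cellH1 hK (hφ K hK) fun i => P K i - qh K i
    have b2 := T.integral_inner_pgrad_vval hK (w K) fun i => P K i - qh K i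
    have b3 := (hQ K hK).integral_mul (pdiv_mem_polyLt hdeg_e)
    -- the constitutive equation
    have hfl : ∀ᵐ x ∂cellMeasure K, (s K)⁻¹ • Φ x = -weakGrad G.Ω φ x := by
      have h1 : ∀ᵐ x ∂cellMeasure K, (G.σ σp σm x)⁻¹ • Φ x + weakGrad G.Ω φ x = 0 := by
        rw [← restrict_interior_simplex]
        exact ae_mono (Measure.restrict_mono (T.interior_subset hK) le_rfl) hd.flux
      filter_upwards [h1, hs K hK] with x h2 h3
      rw [h3] at h2
      exact eq_neg_of_add_eq_zero_left h2
    have c1 : (s K)⁻¹ * (∫ x, inner ℝ (q x - vval (qh K) x) (Φ x) ∂cellMeasure K)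
        = -∫ x, inner ℝ (q x - vval (qh K) x) (weakGrad G.Ω φ x) ∂cellMeasure K := by
      rw [← integral_const_mul, ← integral_neg]
      refine integral_congr_ae (hfl.mono fun x hx => ?_)
      simp only
      rw [← inner_smul_right, hx, inner_neg_right]
    have d1 : ∫ x, inner ℝ (vval (P K) x) (pgrad (φh K) x) ∂cellMeasure K
        = ∫ x, inner ℝ (q x) (pgrad (φh K) x) ∂cellMeasure K :=
      (hP K hK).integral_inner (s := fun i => MvPolynomial.pderiv i (φh K))
        fun i => pderiv_mem_polyLt (mem_polyLe.2 (hφh K hK)) i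
    -- facewise identity
    have face : ∀ F ∈ facesOf K,
        τ F * (∫ x, (ubar F x - pval (ubarh F) x) * pval (w K) x ∂faceMeasure F)
          + (∫ x, (ubar F x - pval (ubarh F) x) * normalVal K F (Q K) x ∂faceMeasure F)
          - (∫ x, trace K φ x * normalVal K F (fun i => P K i - qh K i) x ∂faceMeasure F)
          - (∫ x, normalVal K F (fun i => Q K i) x * pval (p K - uh K) x ∂faceMeasure F)
          + (∫ x, normalTrace K F Φ x * pval (p K - uh K) x ∂faceMeasure F)
          - τ F * (∫ x, pval (w K) x * pval (p K - uh K) x ∂faceMeasure F)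
        = (∫ x, normalTrace K F Φ x * pval (m F) x ∂faceMeasure F)
          - ((∫ x, normalVal K F (fun i => P K i - qh K i) x * pval (l F) x ∂faceMeasure F)
          + τ F * (∫ x, pval (p K - uh K) x * pval (l F) x ∂faceMeasure F)
          - τ F * ∫ x, (ubar F x - pval (ubarh F) x) * pval (l F) x ∂faceMeasure F) := by
      intro F hF
      have hN := fun r => T.memLp_normalVal hK hF r
      have hpv := fun w => T.memLp_pval_face hK hF w
      have htφ := T.memLp_trace hK hF (hφ K hK)
      have htΦ := T.memLp_normalTrace hK hF (hg K hK)
      have hface : ∀ s : Poly (n + 1), s.totalDegree ≤ k →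
          (∫ x, normalVal K F (Q K) x * pval s x ∂faceMeasure F)
            + τ F * (∫ x, pval (w K) x * pval s x ∂faceMeasure F)
          = (∫ x, normalTrace K F Φ x * pval s x ∂faceMeasure F)
            + τ F * ∫ x, trace K φ x * pval s x ∂faceMeasure F := by
        intro s hs
        have h1 := (hQ K hK).face F hF s hs
        rwa [integral_add_mul (hN _) ((hpv _).const_mul _) (hpv s),
          integral_add_mul htΦ (htφ.const_mul _) (hpv s), integral_mul_mul, integral_mul_mul] at h1
      -- `f1` and `f2` test the face condition of the dual projection with m and with Π_W u − u_h.
      -- `f3` to `f5` exchange the face error for m, and `f6` to `f8` exchange the trace of φ for l,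
      -- against polynomials of degree k.
      have f1 := hface _ (hmk F)
      have f2 := hface _ hdeg_u
      have f3 := hm K hK F hF _ (hQ K hK).degree_p
      have f4 := hm K hK F hF (normalPoly (normal K F) (Q K)) (mem_polyLe.1
        (normalPoly_mem (fun i => mem_polyLe.2 ((hQ K hK).degree_P i)) _))
      have f5 := hm K hK F hF _ (hlk F)
      have f6 := hl K hK F hF _ (hmk F)
      have f7 := hl K hK F hF (normalPoly (normal K F) fun i => P K i - qh K i) (mem_polyLe.1
        (normalPoly_mem (fun i => mem_polyLe.2 (hdeg_e i)) _))
      have f8 := hl K hK F hF _ hdeg_u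
      simp only [← normalVal_eq] at f4 f7
      rw [integral_mul_swap] at f3 f4 f6 f7 f8
      linear_combination τ F * f3.symm + f4.symm + f1 + τ F * f6.symm + τ F * f5 - f2 + f7 + τ F * f8
    have facesum := Finset.sum_congr rfl face
    have hq1 : MemLp (fun x => q x - vval (qh K) x) 2 (cellMeasure K) := hqK.sub (memLp_vval K _)
    have hq2 : MemLp (fun x => vval (P K) x - q x) 2 (cellMeasure K) := (memLp_vval K _).sub hqK
    have sw1 := Finset.sum_congr rfl fun F (_ : F ∈ facesOf K) =>
      integral_mul_swap (μ := faceMeasure F) (pval (p K - uh K)) (normalVal K F (Q K))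
    have sw2 := Finset.sum_congr rfl fun F (_ : F ∈ facesOf K) =>
      integral_mul_swap (μ := faceMeasure F) (pval (w K)) (normalVal K F fun i => P K i - qh K i)
    have sw3 := Finset.sum_congr rfl fun F (_ : F ∈ facesOf K) => congrArg (τ F * ·)
      (integral_mul_swap (μ := faceMeasure F) (pval (w K)) (pval (p K - uh K)))
    simp only [← pval_sub]
    rw [integral_σ_inv_mul (hs K hK), integral_inner_sub_right (memLp_vval K _) hΦK hq1,
      integral_inner_sub_right hdφ (memLp_pgrad K _) hq2,
      integral_inner_sub_left (memLp_vval K _) hqK hdφ,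
      integral_inner_sub_left (memLp_vval K _) hqK (memLp_pgrad K _), d1, a1, mul_sub, c1,
      integral_inner_sub_left hqK (memLp_vval K _) hdφ]
    rw [integral_inner_swap] at b1 b2
    simp only [vval_sub] at b1
    rw [integral_inner_sub_left (memLp_vval K _) (memLp_vval K _) hdφ] at b1
    simp only [Finset.sum_sub_distrib, Finset.sum_add_distrib] at facesum ⊢
    linarith
  rw [Finset.sum_congr rfl key]
  simp only [Finset.sum_sub_distrib, Finset.sum_add_distrib, Finset.sum_neg_distrib] at hE1 hE2 hE3 hE4 ⊢
  linarith

include hex hhd in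
/-- The error representation by duality. -/
theorem dual_identity (hτ : T.TauCondition τ) {θ : E (n + 1) → ℝ} {Φ : E (n + 1) → E (n + 1)}
    {φ : E (n + 1) → ℝ} (hθ : MemLp θ 2 (volume.restrict G.Ω))
    (hd : T.IsDualSolution σp σm θ Φ φ) {φh : Finset (E (n + 1)) → Poly (n + 1)}
    (hφh : T.MemW k φh) :
    T.sumCells (fun K x => (pval (projW k τ q u K) x - pval (uh K) x) * θ x)
      = T.sumCells (fun K x => (G.σ σp σm x)⁻¹ *
          inner ℝ (q x - vval (qh K) x) (vval (projV k τ Φ φ K) x - Φ x))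
        + T.sumCells (fun K x =>
          inner ℝ (vval (projV k τ q u K) x - q x) (weakGrad G.Ω φ x - pgrad (φh K) x)) := by
  obtain ⟨g, hg⟩ := T.exists_cellH1 hd.memH1_Φp hd.memH1_Φm
  exact T.dual_identity_of_proj hex hhd
    (fun K hK => T.isProjection_proj hK hτ (T.cellH1_q hex hK) (T.cellH1_u hex hK)) hθ hd
    (fun K hK => T.isProjection_proj hK hτ (hg K hK)
      (cellH1_of_memH1 hd.memH1_φ (T.interior_subset hK))) hφh

end Identity

end Triangulation

attribute [local irreducible] l2 faceMeasure cellMeasure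

/-! ### Local seminorms and affine approximation of the dual potential. -/

section ElementReg

variable {n : ℕ}

/-- The square of the `H¹ × H²` seminorm of a flux and a potential on an element. -/
def elementReg (U : Set (E (n + 1))) (Φ : E (n + 1) → E (n + 1)) (φ : E (n + 1) → ℝ)
    (K : Finset (E (n + 1))) : ℝ :=
  ∑ m, l2 (cellMeasure K) (weakGrad U fun x => Φ x m) ^ 2
    + l2 (cellMeasure K) (weakGrad U φ) ^ 2
    + ∑ m, l2 (cellMeasure K) (weakGrad U fun x => weakGrad U φ x m) ^ 2

variable {U : Set (E (n + 1))} {Φ : E (n + 1) → E (n + 1)} {φ : E (n + 1) → ℝ}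
  {K : Finset (E (n + 1))}

lemma elementReg_nonneg : 0 ≤ elementReg U Φ φ K := by
  unfold elementReg
  positivity

lemma l2_grad_flux_le (m : Fin (n + 1)) :
    l2 (cellMeasure K) (weakGrad U fun x => Φ x m) ≤ Real.sqrt (elementReg U Φ φ K) := by
  refine Real.le_sqrt_of_sq_le ?_
  have h1 := Finset.single_le_sum
    (f := fun m => l2 (cellMeasure K) (weakGrad U fun x => Φ x m) ^ 2)
    (fun m _ => sq_nonneg _) (Finset.mem_univ m)
  have h2 : 0 ≤ ∑ m, l2 (cellMeasure K) (weakGrad U fun x => weakGrad U φ x m) ^ 2 := by positivity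
  have h3 := sq_nonneg (l2 (cellMeasure K) (weakGrad U φ))
  simp only at h1
  unfold elementReg
  linarith

lemma l2_grad_le : l2 (cellMeasure K) (weakGrad U φ) ≤ Real.sqrt (elementReg U Φ φ K) := by
  refine Real.le_sqrt_of_sq_le ?_
  have h1 : 0 ≤ ∑ m, l2 (cellMeasure K) (weakGrad U fun x => Φ x m) ^ 2 := by positivity
  have h2 : 0 ≤ ∑ m, l2 (cellMeasure K) (weakGrad U fun x => weakGrad U φ x m) ^ 2 := by positivity
  unfold elementReg
  linarith

lemma l2_hessian_le (m : Fin (n + 1)) :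
    l2 (cellMeasure K) (weakGrad U fun x => weakGrad U φ x m)
      ≤ Real.sqrt (elementReg U Φ φ K) := by
  refine Real.le_sqrt_of_sq_le ?_
  have h1 := Finset.single_le_sum
    (f := fun m => l2 (cellMeasure K) (weakGrad U fun x => weakGrad U φ x m) ^ 2)
    (fun m _ => sq_nonneg _) (Finset.mem_univ m)
  have h2 : 0 ≤ ∑ m, l2 (cellMeasure K) (weakGrad U fun x => Φ x m) ^ 2 := by positivity
  have h3 := sq_nonneg (l2 (cellMeasure K) (weakGrad U φ))
  simp only at h1
  unfold elementReg
  linarith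

lemma pgrad_affPoly (c : Fin (n + 1) → ℝ) (x : E (n + 1)) (i : Fin (n + 1)) :
    pgrad (affPoly 0 c) x i = c i := by
  rw [pgrad_apply, pd_pval, affPoly]
  simp [pval, MvPolynomial.pderiv_X, Pi.single_apply]

/-- Approximation of a gradient by constants. -/
lemma exists_affine_approx (b : AffineBasis (Fin (n + 2)) ℝ (E (n + 1)))
    (hU : interior (simplex (vs b)) ⊆ U) (hφ : MemH2 U φ) (Φ : E (n + 1) → E (n + 1)) :
    ∃ p : Poly (n + 1), p.totalDegree ≤ 1 ∧
      l2 (cellMeasure (vs b)) (fun x => weakGrad U φ x - pgrad p x)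
        ≤ (n + 1) * 2 ^ (n + 1) * Metric.diam (simplex (vs b))
          * Real.sqrt (elementReg U Φ φ (vs b)) := by
  -- The slopes are the Poincaré constants of the partial derivatives.
  choose c hc using fun m => exists_poincare b (cellH1_of_memH1 (hφ.2 m) hU)
  refine ⟨affPoly 0 c, totalDegree_affPoly 0 c, ?_⟩
  set D := Metric.diam (simplex (vs b))
  have hD : 0 ≤ D := Metric.diam_nonneg
  set R := Real.sqrt (elementReg U Φ φ (vs b))
  have hR0 : 0 ≤ R := Real.sqrt_nonneg _
  have hL : MemLp (weakGrad U φ) 2 (cellMeasure (vs b)) :=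
    memLp_cell_of_subset (memLp_weakGrad hφ.1) hU
  refine (sq_le_sq₀ (l2_nonneg _) (by positivity)).1 ?_
  have hL2 : MemLp (fun x => weakGrad U φ x - pgrad (affPoly 0 c) x) 2 (cellMeasure (vs b)) :=
    hL.sub (memLp_pgrad (vs b) _)
  rw [l2_sq_eq_sum hL2]
  have h1 : ∀ m ∈ (Finset.univ : Finset (Fin (n + 1))),
      l2 (cellMeasure (vs b)) (fun x => (weakGrad U φ x - pgrad (affPoly 0 c) x) m) ^ 2
        ≤ 2 ^ (n + 1) * D ^ 2 * R ^ 2 := by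
    intro m _
    simp only [PiLp.sub_apply, pgrad_affPoly]
    refine (hc m).trans ?_
    have h2 := pow_le_pow_left₀ (l2_nonneg _) (l2_hessian_le (U := U) (Φ := Φ) (φ := φ)
      (K := vs b) m) 2
    exact mul_le_mul_of_nonneg_left h2 (by positivity)
  refine (Finset.sum_le_sum h1).trans ?_
  rw [Finset.sum_const, Finset.card_univ, Fintype.card_fin, nsmul_eq_mul]
  push_cast
  have h3 : (1 : ℝ) ≤ 2 ^ (n + 1) := one_le_pow₀ (by norm_num)
  have h4 : (1 : ℝ) ≤ (n : ℝ) + 1 := by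
    have : (0 : ℝ) ≤ n := n.cast_nonneg
    linarith
  -- The constant is at least 1, so its square bounds it and no root is needed in the statement.
  have h5 : ((n : ℝ) + 1) * 2 ^ (n + 1) ≤ (((n : ℝ) + 1) * 2 ^ (n + 1)) ^ 2 := by
    have h6 : (1 : ℝ) ≤ ((n : ℝ) + 1) * 2 ^ (n + 1) := by
      have := mul_le_mul h4 h3 zero_le_one (by positivity)
      linarith
    rw [sq]
    exact le_mul_of_one_le_left (by positivity) h6
  calc ((n : ℝ) + 1) * (2 ^ (n + 1) * D ^ 2 * R ^ 2)
      = (((n : ℝ) + 1) * 2 ^ (n + 1)) * (D ^ 2 * R ^ 2) := by ring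
    _ ≤ (((n : ℝ) + 1) * 2 ^ (n + 1)) ^ 2 * (D ^ 2 * R ^ 2) :=
        mul_le_mul_of_nonneg_right h5 (by positivity)
    _ = _ := by ring

/-- The elementwise seminorms add up to at most the norms on a subdomain. -/
lemma sum_elementReg_le {S : Finset (Finset (E (n + 1)))}
    (hS : ∀ f : E (n + 1) → ℝ, Integrable f (volume.restrict U) → (∀ x, 0 ≤ f x) →
      ∑ K ∈ S, ∫ x, f x ∂cellMeasure K ≤ ∫ x in U, f x)
    (hΦ : MemH1Vec U Φ) (hφ : MemH2 U φ) :
    ∑ K ∈ S, elementReg U Φ φ K ≤ normH1Vec U Φ ^ 2 + normH2 U φ ^ 2 := by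
  have hsq : ∀ g : E (n + 1) → E (n + 1), MemLp g 2 (volume.restrict U) →
      ∑ K ∈ S, l2 (cellMeasure K) g ^ 2 ≤ ∫ x in U, ‖g x‖ ^ 2 := by
    intro g hg
    simp only [l2_sq]
    exact hS _ (integrable_norm_sq hg) fun x => by positivity
  have h1 : ∀ m ∈ (Finset.univ : Finset (Fin (n + 1))),
      ∑ K ∈ S, l2 (cellMeasure K) (weakGrad U fun x => Φ x m) ^ 2
        ≤ normH1Sq U fun x => Φ x m := by
    intro m _
    refine (hsq _ (memLp_weakGrad (hΦ m))).trans (le_add_of_nonneg_left ?_)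
    exact integral_nonneg fun x => sq_nonneg _
  have hg := memLp_weakGrad hφ.1
  have h2 := hsq _ hg
  have h3 : ∀ m ∈ (Finset.univ : Finset (Fin (n + 1))),
      (∫ x in U, weakGrad U φ x m ^ 2)
        + ∑ K ∈ S, l2 (cellMeasure K) (weakGrad U fun x => weakGrad U φ x m) ^ 2
        ≤ normH1Sq U fun x => weakGrad U φ x m := by
    intro m _
    have := hsq _ (memLp_weakGrad (hφ.2 m))
    unfold normH1Sq
    linarith
  -- `normH2` contains the first derivatives through the H¹ norms of the partial derivatives.
  have h4 : ∫ x in U, ‖weakGrad U φ x‖ ^ 2 = ∑ m, ∫ x in U, weakGrad U φ x m ^ 2 := by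
    rw [← l2_sq, l2_sq_eq_sum hg]
    simp only [l2_sq_real]
  have h5 := Finset.sum_le_sum h1
  have h6 := Finset.sum_le_sum h3
  rw [Finset.sum_add_distrib, ← h4] at h6
  have hnn : ∀ v : E (n + 1) → ℝ, 0 ≤ normH1Sq U v := fun v =>
    add_nonneg (integral_nonneg fun x => sq_nonneg _) (integral_nonneg fun x => sq_nonneg _)
  have hφ0 : 0 ≤ ∫ x in U, φ x ^ 2 := integral_nonneg fun x => sq_nonneg _
  rw [normH1Vec, normH2, Real.sq_sqrt (Finset.sum_nonneg fun m _ => hnn _),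
    Real.sq_sqrt (add_nonneg hφ0 (Finset.sum_nonneg fun m _ => hnn _))]
  unfold elementReg
  rw [Finset.sum_add_distrib, Finset.sum_add_distrib, Finset.sum_comm,
    Finset.sum_comm (s := S) (t := Finset.univ)
      (f := fun K m => l2 (cellMeasure K) (weakGrad U fun x => weakGrad U φ x m) ^ 2)]
  linarith

end ElementReg

/-! ### Approximation of the dual solution on the mesh. -/

namespace Triangulation

variable {n : ℕ} {G : Config (n + 1)} (T : Triangulation G)

/-- The elementwise seminorm of the dual solution. -/
def dualReg (Φ : E (n + 1) → E (n + 1)) (φ : E (n + 1) → ℝ) (K : Finset (E (n + 1))) : ℝ := by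
  classical exact
  if K ∈ T.cellsp then Real.sqrt (elementReg G.Ωp Φ φ K) else Real.sqrt (elementReg G.Ωm Φ φ K)

lemma dualReg_cellsp {Φ : E (n + 1) → E (n + 1)} {φ : E (n + 1) → ℝ} {K : Finset (E (n + 1))}
    (hK : K ∈ T.cellsp) : T.dualReg Φ φ K = Real.sqrt (elementReg G.Ωp Φ φ K) := if_pos hK

lemma dualReg_cellsm {Φ : E (n + 1) → E (n + 1)} {φ : E (n + 1) → ℝ} {K : Finset (E (n + 1))}
    (hK : K ∈ T.cellsm) : T.dualReg Φ φ K = Real.sqrt (elementReg G.Ωm Φ φ K) :=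
  if_neg (Finset.disjoint_right.1 T.disjoint_cellsp_cellsm hK)

/-- The sum of the squares of the four norms in (R) is at most the square of their sum. -/
lemma sum_dualReg_le {Creg : ℝ} {θ : E (n + 1) → ℝ} {Φ : E (n + 1) → E (n + 1)}
    {φ : E (n + 1) → ℝ} (hreg : HasRegularity G Creg θ Φ φ) :
    Real.sqrt (∑ K ∈ T.cells, T.dualReg Φ φ K ^ 2) ≤ Creg * normL2 G.Ω θ := by
  obtain ⟨h1, h2, h3, h4, h5⟩ := hreg
  have e1 := sum_elementReg_le (S := T.cellsp) (fun f hf h0 => T.sum_cellsp_le hf h0) h1 h3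
  have e2 := sum_elementReg_le (S := T.cellsm) (fun f hf h0 => T.sum_cellsm_le hf h0) h2 h4
  rw [T.sum_cells, Finset.sum_congr rfl fun K hK => by
      rw [T.dualReg_cellsp hK, Real.sq_sqrt elementReg_nonneg],
    Finset.sum_congr (s₁ := T.cellsm) rfl fun K hK => by
      rw [T.dualReg_cellsm hK, Real.sq_sqrt elementReg_nonneg]]
  have p1 : 0 ≤ normH1Vec G.Ωp Φ := Real.sqrt_nonneg _
  have p2 : 0 ≤ normH1Vec G.Ωm Φ := Real.sqrt_nonneg _
  have p3 : 0 ≤ normH2 G.Ωp φ := Real.sqrt_nonneg _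
  have p4 : 0 ≤ normH2 G.Ωm φ := Real.sqrt_nonneg _
  refine le_trans (Real.sqrt_le_iff.2 ⟨by positivity, ?_⟩) h5
  nlinarith [mul_nonneg p1 p2, mul_nonneg p1 p3, mul_nonneg p1 p4, mul_nonneg p2 p3,
    mul_nonneg p2 p4, mul_nonneg p3 p4]

/-- Both approximation errors of a dual solution on an element. -/
theorem exists_dual_error (n k : ℕ) (γ : ℝ) {ρ : ℝ} (hρ : 0 < ρ) (hk : 1 ≤ k) : ∃ C, 0 < C ∧
    ∀ (G : Config (n + 1)) (T : Triangulation G), T.ShapeRegular ρ →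
    ∀ τ : Finset (E (n + 1)) → ℝ, T.TauCondition τ → (∀ F ∈ T.faces, |τ F| ≤ γ) →
    ∀ (Creg : ℝ) (θ : E (n + 1) → ℝ) (Φ : E (n + 1) → E (n + 1)) (φ : E (n + 1) → ℝ),
    HasRegularity G Creg θ Φ φ → MemH1 G.Ω φ →
    ∃ φh : Finset (E (n + 1)) → Poly (n + 1), T.MemW k φh ∧ ∀ K ∈ T.cells,
      (∀ Q w, IsProjection k τ K Φ φ Q w →
        l2 (cellMeasure K) (fun x => vval Q x - Φ x) ≤ C * T.h * T.dualReg Φ φ K) ∧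
      l2 (cellMeasure K) (fun x => weakGrad G.Ω φ x - pgrad (φh K) x)
        ≤ C * T.h * T.dualReg Φ φ K := by
  obtain ⟨C₁, hC₁, hproj⟩ := exists_projection_error n k γ ρ
  refine ⟨C₁ * (n + 2) + (n + 1) * 2 ^ (n + 1), by positivity,
    fun G T hT τ hτ hγ Creg θ Φ φ hreg hφ => ?_⟩
  -- U is either subdomain. On K the weak gradients of φ taken in U and in Ω agree, since weak
  -- gradients are unique.
  have key : ∀ K ∈ T.cells, ∀ U : Set (E (n + 1)), interior (simplex K) ⊆ U → MemH1Vec U Φ →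
      MemH2 U φ → ∃ p : Poly (n + 1), p.totalDegree ≤ k ∧ (∀ Q w, IsProjection k τ K Φ φ Q w →
        l2 (cellMeasure K) (fun x => vval Q x - Φ x)
          ≤ (C₁ * (n + 2) + (n + 1) * 2 ^ (n + 1)) * T.h * Real.sqrt (elementReg U Φ φ K)) ∧
      l2 (cellMeasure K) (fun x => weakGrad G.Ω φ x - pgrad p x)
        ≤ (C₁ * (n + 2) + (n + 1) * 2 ^ (n + 1)) * T.h * Real.sqrt (elementReg U Φ φ K) := by
    intro K hK U hU hΦU hφU
    have hsign := (T.tau_sign hτ hK).1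
    obtain ⟨b, rfl⟩ := T.exists_basis hK
    obtain ⟨p, hp, hpe⟩ := exists_affine_approx b hU hφU Φ
    have hDh := T.diam_le_h hK
    set D := Metric.diam (simplex (vs b))
    have hD : 0 ≤ D := Metric.diam_nonneg
    set R := Real.sqrt (elementReg U Φ φ (vs b))
    have hR0 : 0 ≤ R := Real.sqrt_nonneg _
    have hDR : D * R ≤ T.h * R := mul_le_mul_of_nonneg_right hDh hR0
    have hhR : 0 ≤ T.h * R := mul_nonneg (hD.trans hDh) hR0
    have hA : 0 ≤ C₁ * ((n : ℝ) + 2) := by positivity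
    have hB : 0 ≤ ((n : ℝ) + 1) * 2 ^ (n + 1) := by positivity
    -- The affine approximation belongs to W_h because k ≥ 1.
    refine ⟨p, hp.trans hk, fun Q w hQ => ?_, ?_⟩
    · have h1 := hproj b τ Φ φ _ _ Q w (T.norm_cgrad_mul_diam_le hρ hT hK)
        (hsign.imp (fun h i => h _ (fc_mem_facesOf b i)) fun h i => h _ (fc_mem_facesOf b i))
        (fun i => hγ _ (T.facesOf_subset hK (fc_mem_facesOf b i)))
        (fun m => cellH1_of_memH1 (hΦU m) hU) (cellH1_of_memH1 hφU.1 hU) hQ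
      have h2 : ∑ m, l2 (cellMeasure (vs b)) (weakGrad U fun x => Φ x m) ≤ (n + 1) * R := by
        refine (Finset.sum_le_sum fun m _ => l2_grad_flux_le (φ := φ) m).trans ?_
        rw [Finset.sum_const, Finset.card_univ, Fintype.card_fin, nsmul_eq_mul]
        push_cast
        exact le_rfl
      have h3 : l2 (cellMeasure (vs b)) (weakGrad U φ) ≤ R := l2_grad_le
      refine h1.trans ?_
      calc C₁ * D * (∑ m, l2 (cellMeasure (vs b)) (weakGrad U fun x => Φ x m)
            + l2 (cellMeasure (vs b)) (weakGrad U φ))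
          ≤ C₁ * D * ((n + 2) * R) :=
            mul_le_mul_of_nonneg_left (by linarith) (by positivity)
        _ = C₁ * (n + 2) * (D * R) := by ring
        _ ≤ C₁ * (n + 2) * (T.h * R) := mul_le_mul_of_nonneg_left hDR hA
        _ ≤ _ := by
            have := mul_nonneg hB hhR
            linarith
    · have h1 : weakGrad G.Ω φ =ᵐ[cellMeasure (vs b)] weakGrad U φ := by
        have c1 := cellH1_of_memH1 hφ (T.interior_subset hK)
        have c2 := cellH1_of_memH1 hφU.1 hU
        exact ae_eq_of_weak c1.memLp_grad c2.memLp_grad c1.weak c2.weak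
      rw [l2_congr_ae (g := fun x => weakGrad U φ x - pgrad p x)
        (h1.mono fun x hx => by simp only [hx])]
      refine hpe.trans ?_
      calc (n + 1) * 2 ^ (n + 1) * D * R = (n + 1) * 2 ^ (n + 1) * (D * R) := by ring
        _ ≤ (n + 1) * 2 ^ (n + 1) * (T.h * R) := mul_le_mul_of_nonneg_left hDR hB
        _ ≤ _ := by
            have := mul_nonneg hA hhR
            linarith
  obtain ⟨r1, r2, r3, r4, -⟩ := hreg
  have hex : ∀ K, ∃ p : Poly (n + 1), K ∈ T.cells → p.totalDegree ≤ k ∧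
      (∀ Q w, IsProjection k τ K Φ φ Q w → l2 (cellMeasure K) (fun x => vval Q x - Φ x)
        ≤ (C₁ * (n + 2) + (n + 1) * 2 ^ (n + 1)) * T.h * T.dualReg Φ φ K) ∧
      l2 (cellMeasure K) (fun x => weakGrad G.Ω φ x - pgrad p x)
        ≤ (C₁ * (n + 2) + (n + 1) * 2 ^ (n + 1)) * T.h * T.dualReg Φ φ K := by
    intro K
    by_cases hK : K ∈ T.cells
    · rcases T.cellsp_or_cellsm hK with h | h
      · obtain ⟨p, hp⟩ := key K hK G.Ωp (T.mem_cellsp.1 h).2 r1 r3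
        rw [← T.dualReg_cellsp h] at hp
        exact ⟨p, fun _ => hp⟩
      · obtain ⟨p, hp⟩ := key K hK G.Ωm (T.mem_cellsm.1 h).2 r2 r4
        rw [← T.dualReg_cellsm h] at hp
        exact ⟨p, fun _ => hp⟩
    · exact ⟨0, fun h => absurd h hK⟩
  choose φh hφh using hex
  exact ⟨φh, fun K hK => (hφh K hK).1, fun K hK => (hφh K hK).2⟩

end Triangulation

/-! ### The duality argument. -/

namespace Triangulation

variable {n : ℕ} {G : Config (n + 1)} (T : Triangulation G)

lemma h_nonneg : 0 ≤ T.h := Real.iSup_nonneg fun _ => Metric.diam_nonneg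

/-- A piecewise polynomial as a function on `Ω`. -/
def glue (e : Finset (E (n + 1)) → Poly (n + 1)) (x : E (n + 1)) : ℝ :=
  ∑ K ∈ T.cells, (interior (simplex K)).indicator (pval (e K)) x

lemma glue_ae (e : Finset (E (n + 1)) → Poly (n + 1)) {K : Finset (E (n + 1))} (hK : K ∈ T.cells) :
    T.glue e =ᵐ[cellMeasure K] pval (e K) := by
  rw [← restrict_interior_simplex]
  filter_upwards [ae_restrict_mem isOpen_interior.measurableSet] with x hx
  rw [glue, Finset.sum_eq_single K, Set.indicator_of_mem hx]
  · intro K' hK' hne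
    exact Set.indicator_of_notMem
      (fun h => Set.disjoint_left.1 (T.disjoint_interior hK' hK hne) h hx) _
  · exact fun h => absurd hK h

lemma memLp_glue (e : Finset (E (n + 1)) → Poly (n + 1)) :
    MemLp (T.glue e) 2 (volume.restrict G.Ω) := by
  refine memLp_finsetSum _ fun K hK => ?_
  refine MemLp.restrict _ ((memLp_indicator_iff_restrict isOpen_interior.measurableSet).2 ?_)
  rw [restrict_interior_simplex]
  exact memLp_pval K _

lemma normL2_glue (e : Finset (E (n + 1)) → Poly (n + 1)) :
    normL2 G.Ω (T.glue e) = T.normCells fun K => pval (e K) := by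
  rw [normL2, normCells, sumCells, T.integral_Ω fun K hK =>
    (T.memLp_cell_of_Ω (T.memLp_glue e) hK).integrable_sq]
  congr 1
  exact Finset.sum_congr rfl fun K hK =>
    integral_congr_ae ((T.glue_ae e hK).mono fun x hx => by simp only [hx])

-- With θ = 1 in (R) this shows that the regularity constant is nonnegative.
include T in
lemma normL2_one_pos : 0 < normL2 G.Ω fun _ => 1 := by
  have hlt : volume G.Ω ≠ ⊤ := by
    rw [← Measure.restrict_apply_univ, T.restrict_Ω, Measure.finsetSum_apply]
    exact (ENNReal.sum_lt_top.2 fun K _ => measure_lt_top _ _).ne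
  have hpos := G.isOpen_Ω.measure_pos volume G.nonempty_Ω
  refine Real.sqrt_pos.2 ?_
  simp only [one_pow, integral_const, smul_eq_mul, mul_one, measureReal_restrict_apply_univ]
  exact ENNReal.toReal_pos hpos.ne' hlt

include T in
lemma memLp_one : MemLp (fun _ => (1 : ℝ)) 2 ((volume : Measure (E (n + 1))).restrict G.Ω) := by
  have : IsFiniteMeasure ((volume : Measure (E (n + 1))).restrict G.Ω) := by
    rw [T.restrict_Ω]
    infer_instance
  exact memLp_const 1

/-- On Ω₋ the negative sign of σ cancels the minus sign in the definition, so the integrand is at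
least |r|²/σmax on both sides. -/
lemma sq_le_normV {σmax σp σm : ℝ} (hp0 : 0 < σp) (hp : σp ≤ σmax) (hm0 : 0 < -σm)
    (hm : -σm ≤ σmax) (r : Finset (E (n + 1)) → E (n + 1) → E (n + 1)) :
    Real.sqrt (∑ K ∈ T.cells, l2 (cellMeasure K) (r K) ^ 2)
      ≤ Real.sqrt σmax * T.normV σp σm r := by
  have hσ : 0 < σmax := hp0.trans_le hp
  rw [normV, ← Real.sqrt_mul hσ.le]
  refine Real.sqrt_le_sqrt ?_
  have hl : ∀ K, ∫ x, inner ℝ (r K x) (r K x) ∂cellMeasure K = l2 (cellMeasure K) (r K) ^ 2 := by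
    intro K
    simp only [l2_sq, real_inner_self_eq_norm_sq]
  have h1 : ∀ K ∈ T.cellsp, l2 (cellMeasure K) (r K) ^ 2
      ≤ σmax * ∫ x, (G.σ σp σm x)⁻¹ * inner ℝ (r K x) (r K x) ∂cellMeasure K := by
    intro K hK
    rw [integral_σ_inv_mul (T.σ_cellsp hK σp σm), hl, ← mul_assoc, ← div_eq_mul_inv]
    exact le_mul_of_one_le_left (sq_nonneg _) ((one_le_div hp0).2 hp)
  have h2 : ∀ K ∈ T.cellsm, l2 (cellMeasure K) (r K) ^ 2
      ≤ -(σmax * ∫ x, (G.σ σp σm x)⁻¹ * inner ℝ (r K x) (r K x) ∂cellMeasure K) := by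
    intro K hK
    rw [integral_σ_inv_mul (T.σ_cellsm hK σp σm), hl, ← mul_assoc, ← neg_mul, ← div_eq_mul_inv,
      ← div_neg]
    exact le_mul_of_one_le_left (sq_nonneg _) ((one_le_div hm0).2 hm)
  rw [T.sum_cells, mul_sub, Finset.mul_sum, Finset.mul_sum, sub_eq_add_neg,
    ← Finset.sum_neg_distrib]
  exact add_le_add (Finset.sum_le_sum h1) (Finset.sum_le_sum h2)

lemma normCellsVec_eq (r : Finset (E (n + 1)) → E (n + 1) → E (n + 1)) :
    T.normCellsVec r = Real.sqrt (∑ K ∈ T.cells, l2 (cellMeasure K) (r K) ^ 2) := by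
  simp only [normCellsVec, sumCells, l2_sq]

/-- The error estimate from the duality identity. -/
theorem exists_error_estimate (n k : ℕ) (γ : ℝ) {ρ σmin σmax : ℝ} (hρ : 0 < ρ) (hσ : 0 < σmin)
    (hk : 1 ≤ k) : ∃ C, 0 < C ∧
    ∀ (σp σm : ℝ), σmin ≤ σp → σp ≤ σmax → σmin ≤ -σm → -σm ≤ σmax →
    ∀ (G : Config (n + 1)) (T : Triangulation G), T.ShapeRegular ρ →
    ∀ τ : Finset (E (n + 1)) → ℝ, T.TauCondition τ → (∀ F ∈ T.faces, |τ F| ≤ γ) →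
    ∀ (Creg : ℝ) (q : E (n + 1) → E (n + 1)) (qh P : Finset (E (n + 1)) → Fin (n + 1) → Poly (n + 1))
      (e : Finset (E (n + 1)) → Poly (n + 1)), MemLp q 2 (volume.restrict G.Ω) →
    (∀ (θ : E (n + 1) → ℝ) (Φ : E (n + 1) → E (n + 1)) (φ : E (n + 1) → ℝ),
      MemLp θ 2 (volume.restrict G.Ω) → T.IsDualSolution σp σm θ Φ φ →
      HasRegularity G Creg θ Φ φ →
      ∀ φh : Finset (E (n + 1)) → Poly (n + 1), T.MemW k φh →
        T.sumCells (fun K x => pval (e K) x * θ x)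
          = T.sumCells (fun K x => (G.σ σp σm x)⁻¹ *
              inner ℝ (q x - vval (qh K) x) (vval (projV k τ Φ φ K) x - Φ x))
            + T.sumCells (fun K x =>
              inner ℝ (vval (P K) x - q x) (weakGrad G.Ω φ x - pgrad (φh K) x))) →
    (∀ θ : E (n + 1) → ℝ, MemLp θ 2 (volume.restrict G.Ω) →
      ∃ (Φ : E (n + 1) → E (n + 1)) (φ : E (n + 1) → ℝ),
        T.IsDualSolution σp σm θ Φ φ ∧ HasRegularity G Creg θ Φ φ) →
    T.normCells (fun K => pval (e K)) ≤ C * Creg * T.h *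
      (T.normV σp σm (fun K x => q x - vval (qh K) x)
        + T.normCellsVec (fun K x => q x - vval (P K) x)) := by
  obtain ⟨C, hC, hdual⟩ := exists_dual_error n k γ hρ hk
  refine ⟨C * (σmin⁻¹ * Real.sqrt σmax + 1), by positivity,
    fun σp σm hp hp' hm hm' G T hT τ hτ hγ Creg q qh P e hq hid hsol => ?_⟩
  set N := T.normCells (fun K => pval (e K)) with hN
  have hN0 : 0 ≤ N := Real.sqrt_nonneg _
  have hh := T.h_nonneg
  have hregnn : ∀ (θ : E (n + 1) → ℝ) Φ φ, HasRegularity G Creg θ Φ φ →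
      0 ≤ Creg * normL2 G.Ω θ := fun θ Φ φ h => (Real.sqrt_nonneg _).trans (T.sum_dualReg_le h)
  have hCreg : 0 ≤ Creg := by
    obtain ⟨Φ, φ, -, h⟩ := hsol _ T.memLp_one
    exact nonneg_of_mul_nonneg_left (hregnn _ _ _ h) T.normL2_one_pos
  -- The datum of the dual problem is the error itself, so the left side of the identity becomes N².
  obtain ⟨Φ, φ, hd, hreg⟩ := hsol _ (T.memLp_glue e)
  obtain ⟨φh, hφh, hest⟩ := hdual G T hT τ hτ hγ Creg _ Φ φ hreg hd.memH1_φ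
  have hmain := hid _ Φ φ (T.memLp_glue e) hd hreg φh hφh
  obtain ⟨g, hg⟩ := T.exists_cellH1 hd.memH1_Φp hd.memH1_Φm
  have hD := T.sum_dualReg_le hreg
  rw [T.normL2_glue, ← hN] at hD
  have hNsq : T.sumCells (fun K x => pval (e K) x * T.glue e x) = N ^ 2 := by
    have h0 : 0 ≤ T.sumCells fun K x => pval (e K) x ^ 2 :=
      Finset.sum_nonneg fun K _ => integral_nonneg fun x => sq_nonneg _
    rw [hN, normCells, Real.sq_sqrt h0]
    refine Finset.sum_congr rfl fun K hK => integral_congr_ae ((T.glue_ae e hK).mono fun x hx => ?_)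
    simp only [hx, sq]
  rw [hNsq] at hmain
  set D := T.dualReg Φ φ
  set a : Finset (E (n + 1)) → ℝ := fun K => l2 (cellMeasure K) fun x => q x - vval (qh K) x
    with ha
  set c : Finset (E (n + 1)) → ℝ := fun K => l2 (cellMeasure K) fun x => q x - vval (P K) x
    with hc
  have hqK := fun K hK => T.memLp_cell_of_Ω hq (K := K) hK
  -- Cauchy-Schwarz on each element, with σ constant there and |σ⁻¹| ≤ σmin⁻¹.
  have e1 : T.sumCells (fun K x => (G.σ σp σm x)⁻¹ *
      inner ℝ (q x - vval (qh K) x) (vval (projV k τ Φ φ K) x - Φ x))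
      ≤ σmin⁻¹ * (C * T.h) * ∑ K ∈ T.cells, a K * D K := by
    rw [Finset.mul_sum]
    refine Finset.sum_le_sum fun K hK => ?_
    obtain ⟨s, hs, hsσ⟩ : ∃ s, |s⁻¹| ≤ σmin⁻¹ ∧ ∀ᵐ x ∂cellMeasure K, G.σ σp σm x = s := by
      rcases T.cellsp_or_cellsm hK with h | h
      · refine ⟨σp, ?_, T.σ_cellsp h σp σm⟩
        rw [abs_inv, abs_of_pos (hσ.trans_le hp)]
        exact inv_anti₀ hσ hp
      · refine ⟨σm, ?_, T.σ_cellsm h σp σm⟩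
        rw [abs_inv, ← abs_neg, abs_of_pos (hσ.trans_le hm)]
        exact inv_anti₀ hσ hm
    rw [integral_σ_inv_mul hsσ]
    have hΦK : MemLp Φ 2 (cellMeasure K) := T.memLp_cell_of_Ω hd.memL2_Φ hK
    have i1 := abs_integral_inner_le ((hqK K hK).sub (memLp_vval K (qh K)))
      ((memLp_vval K (projV k τ Φ φ K)).sub hΦK)
    have i2 := (hest K hK).1 _ _ (T.isProjection_proj hK hτ (hg K hK)
      (cellH1_of_memH1 hd.memH1_φ (T.interior_subset hK)))
    have i3 := mul_le_mul_of_nonneg_left i2 (l2_nonneg (μ := cellMeasure K)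
      (fun x => q x - vval (qh K) x))
    refine (le_abs_self _).trans ?_
    rw [abs_mul]
    refine (mul_le_mul hs (i1.trans i3) (abs_nonneg _) (by positivity)).trans (le_of_eq ?_)
    simp only [ha]
    ring
  have e2 : T.sumCells (fun K x =>
      inner ℝ (vval (P K) x - q x) (weakGrad G.Ω φ x - pgrad (φh K) x))
      ≤ C * T.h * ∑ K ∈ T.cells, c K * D K := by
    rw [Finset.mul_sum]
    refine Finset.sum_le_sum fun K hK => ?_
    have hφK := (cellH1_of_memH1 hd.memH1_φ (T.interior_subset hK)).memLp_grad
    have i1 := abs_integral_inner_le ((memLp_vval K (P K)).sub (hqK K hK))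
      (hφK.sub (memLp_pgrad K (φh K)))
    have i3 := mul_le_mul_of_nonneg_left (hest K hK).2 (l2_nonneg (μ := cellMeasure K)
      (fun x => vval (P K) x - q x))
    refine (le_abs_self _).trans ((i1.trans i3).trans (le_of_eq ?_))
    simp only [hc]
    rw [l2_sub_comm]
    ring
  have hA := T.sq_le_normV (hσ.trans_le hp) hp' (hσ.trans_le hm) hm'
    fun K x => q x - vval (qh K) x
  rw [T.normCellsVec_eq]
  set V := T.normV σp σm fun K x => q x - vval (qh K) x
  set W := Real.sqrt (∑ K ∈ T.cells, l2 (cellMeasure K) (fun x => q x - vval (P K) x) ^ 2)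
  have hV : 0 ≤ V := Real.sqrt_nonneg _
  have hW : 0 ≤ W := Real.sqrt_nonneg _
  -- Cauchy-Schwarz over the elements; the regularity norms add up to at most Creg N.
  have s1 : ∑ K ∈ T.cells, a K * D K ≤ Real.sqrt σmax * V * (Creg * N) :=
    (Real.sum_mul_le_sqrt_mul_sqrt _ _ _).trans (mul_le_mul hA hD (Real.sqrt_nonneg _) (by positivity))
  have s2 : ∑ K ∈ T.cells, c K * D K ≤ W * (Creg * N) :=
    (Real.sum_mul_le_sqrt_mul_sqrt _ _ _).trans (mul_le_mul le_rfl hD (Real.sqrt_nonneg _) hW)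
  have t1 := mul_le_mul_of_nonneg_left s1 (show 0 ≤ σmin⁻¹ * (C * T.h) by positivity)
  have t2 := mul_le_mul_of_nonneg_left s2 (show 0 ≤ C * T.h by positivity)
  -- One factor N comes from the datum and is divided out; for N = 0 the estimate holds because its
  -- right side is nonnegative.
  have hfin : N * N ≤ N * (C * (σmin⁻¹ * Real.sqrt σmax + 1) * Creg * T.h * (V + W)) := by
    have x1 : 0 ≤ C * T.h * (Creg * N) * V := by positivity
    have x2 : 0 ≤ C * T.h * (Creg * N) * W * (σmin⁻¹ * Real.sqrt σmax) := by positivity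
    linarith
  rcases hN0.eq_or_lt with h0 | h0
  · rw [← h0]
    positivity
  · exact le_of_mul_le_mul_left hfin h0

end Triangulation

end SignHDG

end

/-! ### The theorem. -/

open SignHDG in
theorem mainTheorem4 (d k : ℕ) (hd : 2 ≤ d) (σmin σmax γ ρ : ℝ) (hσmin : 0 < σmin) (hρ : 0 < ρ) :
    ∃ C : ℝ, 0 < C ∧
      ∀ (σp σm : ℝ), σmin ≤ σp → σp ≤ σmax → σmin ≤ -σm → -σm ≤ σmax →
      ∀ (G : Config d) (T : Triangulation G), T.ShapeRegular ρ →
      ∀ τ : Finset (E d) → ℝ, T.TauCondition τ → (∀ F ∈ T.faces, |τ F| ≤ γ) →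
      ∀ (f : E d → ℝ), MemLp f 2 (volume.restrict G.Ω) →
      ∀ (q : E d → E d) (u : E d → ℝ) (ubar : Finset (E d) → E d → ℝ)
        (qh : Finset (E d) → Fin d → Poly d) (uh ubarh : Finset (E d) → Poly d),
      T.IsExactSolution k σp σm τ f q u ubar → T.IsHDGSolution k σp σm τ f qh uh ubarh →
      ∀ Creg : ℝ,
        (∀ (θ : E d → ℝ) (Φ : E d → E d) (φ : E d → ℝ),
          MemLp θ 2 (volume.restrict G.Ω) → T.IsDualSolution σp σm θ Φ φ →
          HasRegularity G Creg θ Φ φ →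
          ∀ φh : Finset (E d) → Poly d, T.MemW k φh →
            T.sumCells (fun K x => (pval (projW k τ q u K) x - pval (uh K) x) * θ x)
              = T.sumCells (fun K x => (G.σ σp σm x)⁻¹ *
                  inner ℝ (q x - vval (qh K) x) (vval (projV k τ Φ φ K) x - Φ x))
                + T.sumCells (fun K x =>
                  inner ℝ (vval (projV k τ q u K) x - q x)
                    (weakGrad G.Ω φ x - pgrad (φh K) x))) ∧
        (1 ≤ k →
          (∀ θ : E d → ℝ, MemLp θ 2 (volume.restrict G.Ω) →
            ∃ (Φ : E d → E d) (φ : E d → ℝ),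
              T.IsDualSolution σp σm θ Φ φ ∧ HasRegularity G Creg θ Φ φ) →
          T.normCells (fun K x => pval (projW k τ q u K) x - pval (uh K) x)
            ≤ C * Creg * T.h *
              (T.normV σp σm (fun K x => q x - vval (qh K) x)
                + T.normCellsVec (fun K x => q x - vval (projV k τ q u K) x))) := by
  obtain ⟨n, rfl⟩ : ∃ n, d = n + 1 := ⟨d - 1, by omega⟩
  -- For k = 0 part (b) is empty and any positive constant will do; part (a) holds for every k.
  by_cases hk : 1 ≤ k
  · obtain ⟨C, hC, hest⟩ := Triangulation.exists_error_estimate n k γ (σmax := σmax) hρ hσmin hk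
    refine ⟨C, hC, fun σp σm hp hp' hm hm' G T hT τ hτ hγ f _ q u ubar qh uh ubarh hex hhd Creg =>
      ⟨fun θ Φ φ hθ hd _ φh hφh => T.dual_identity hex hhd hτ hθ hd hφh, fun _ hsol => ?_⟩⟩
    have := hest σp σm hp hp' hm hm' G T hT τ hτ hγ Creg q qh (fun K => projV k τ q u K)
      (fun K => projW k τ q u K - uh K) (memLp_of_coord fun m => (hex.memH1_q m).1)
      (fun θ Φ φ hθ hd _ φh hφh => by
        simpa only [pval_sub] using T.dual_identity hex hhd hτ hθ hd hφh) hsol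
    have he : (fun K => pval (projW k τ q u K - uh K))
        = fun K x => pval (projW k τ q u K) x - pval (uh K) x := funext₂ fun K x => pval_sub _ _ x
    rwa [he] at this
  · exact ⟨1, one_pos, fun σp σm _ _ _ _ G T _ τ hτ _ f _ q u ubar qh uh ubarh hex hhd Creg =>
      ⟨fun θ Φ φ hθ hd _ φh hφh => T.dual_identity hex hhd hτ hθ hd hφh, fun h => absurd h hk⟩⟩
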